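/- **Setting.** Let $(\mathcal M,g)$ be a smooth $D$-dimensional Lorentzian manifold with a smooth isometric action of $\mathbb R\times U(1)^{p-1}$ ($p\ge 1$), generated by the commuting Killing vector fields $V_{(0)}$ (generating $\mathbb R$) and $V_{(1)},\dots,V_{(p-1)}$ (generating the $U(1)$ factors, with flows of period $2\pi$). Put $G_{ij}=g(V_{(i)},V_{(j)})$. Let the exterior region $\mathcal E$ be a connected component of the set of points at which some linear combination of the $V_{(i)}$ is time-like; the space-time under consideration is the closure $\overline{\mathcal E}$, that is, the exterior with its horizons. Assume: 1. the group acts effectively on $\mathcal E$ and properly on $\overline{\mathcal E}$; $\overline{\mathcal E}$ is a smooth manifold with (possibly empty) boundary $\partial\mathcal E$; no linear combination of $V_{(1)},\dots,V_{(p-1)}$ is time-like anywhere on $\mathcal E$; 2. $\overline{\mathcal E}$ is asymptotic to Minkowski space or to Kaluza-Klein space $\mathbb R^{1,d}\times T^{k}$ with a flat torus: $\mathcal E$ contains an open region with coordinates $(t,y,\theta)$, $|y|>R$, in which $g$ tends to the flat metric as $|y|\to\infty$, $V_{(0)}=\partial_t$, and the flows of $V_{(1)},\dots,V_{(p-1)}$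 are linear isometries of $y$ combined with translations of $T^k$; the rest of $\overline{\mathcal E}$ is contained in the union of the translates of a compact set under the group; 3. (regularity for $r\to0$, where $r=\sqrt{|\det G|}$) write $g=G_{ij}(dx^i+A^i)(dx^j+A^j)+\tilde g$ with $V_{(i)}=\partial/\partial x^i$, where $\tilde g$ is the metric on the space of orbits. Near every point of $\partial\mathcal E$ with $\dim\ker G\le1$, for a suitable choice of the $x^i$, the $A^i$ are bounded in the norm of $\tilde g$, and $g_{rr}=1/\tilde g^{ab}\partial_a r\,\partial_b r$ is bounded and bounded away from zero. Let $\mathcal N$ be the orbit space of $\overline{\mathcal E}$ with the quotient topology, on which $G$ is a well-defined function; let $B=\{q\in\mathcal N:\det G(q)=0\}$ and $Q_2=\{q\in\mathcal N:\dim\ker G(q)\ge2\}$. Constant linear combinations of the $V_{(i)}$ are identified with vectors in $\mathbb R^p$, on which $G(q)$ acts. A *domain* is a set $D\subset B$ for which there are a point $q\in B\setminus Q_2$ and a nonzero $W\in\ker G(q)$ such that $D$ is the maximal connected subset of $B$ that contains $q$ and satisfies $W\in\ker G(q')$ for all $q'\in D$. A vector $W$ is *space-like* (*time-like*) *near* $q$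 if $g(W,W)>0$ ($<0$) on $\mathcal O\setminus B$ for some neighborhood $\mathcal O$ of $q$ in $\mathcal N$; it is space-like (time-like) for $r\to 0$ on $D$ if this holds near every $q\in D\setminus Q_2$. **Theorem.** There are only finitely many domains $D_1,\dots,D_N$, and $B=D_1\cup\dots\cup D_N$. For each domain $D_m$ there is a nonzero constant linear combination $W_m$ of the Killing vector fields, the direction of $D_m$, with $W_m\in\ker G(q)$ for all $q\in D_m$. It is either space-like or time-like for $r\to0$ on $D_m$, and it can be normalized as follows. * If $W_m$ is space-like for $r\to0$, then $W_m=\sum_{i=1}^{p-1}q_iV_{(i)}$ with relatively prime integers $q_i$, and $W_m$ generates a $U(1)$ isometry of $\overline{\mathcal E}$ whose flow has (minimal) period $2\pi$. * If $W_m$ is time-like for $r\to0$, then $W_m=V_{(0)}+\sum_{i=1}^{p-1}\Omega_iV_{(i)}$ with real constants $\Omega_i$, and $D_m$ is a Killing horizon of $W_m$: the set of points of $\overline{\mathcal E}$ over $D_m$ is a smooth hypersurface on which $W_m$ is nonzero, null and normal to the hypersurface. -/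

import Mathlib

open Set Filter Topology
open scoped Manifold ContDiff Matrix

namespace DomainStructure

/-- A smooth metric of Lorentzian signature `(-,+,…,+)` on a `D`-dimensional manifold. -/
structure LorentzMetric (D : ℕ) (M : Type*) [TopologicalSpace M]
    [ChartedSpace (EuclideanSpace ℝ (Fin D)) M] [IsManifold (𝓡 D) ∞ M] where
  /-- the bilinear form on each tangent space -/
  val (x : M) : TangentSpace (𝓡 D) x →L[ℝ] TangentSpace (𝓡 D) x →L[ℝ] ℝ
  symm (x : M) (v w : TangentSpace (𝓡 D) x) : val x v w = val x w v
  signature (x : M) : ∃ v : TangentSpace (𝓡 D) x, val x v v < 0 ∧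
    ∀ w : TangentSpace (𝓡 D) x, val x v w = 0 → w ≠ 0 → 0 < val x w w
  smooth : ContMDiff (𝓡 D)
    ((𝓡 D).prod 𝓘(ℝ, EuclideanSpace ℝ (Fin D) →L[ℝ] EuclideanSpace ℝ (Fin D) →L[ℝ] ℝ)) ∞
    (fun x => Bundle.TotalSpace.mk'
      (EuclideanSpace ℝ (Fin D) →L[ℝ] EuclideanSpace ℝ (Fin D) →L[ℝ] ℝ)
      (E := fun x : M => TangentSpace (𝓡 D) x →L[ℝ] TangentSpace (𝓡 D) x →L[ℝ] ℝ) x (val x))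

/-- A smooth isometric action of `ℝ × U(1)^m`, written as an action of `ℝ^(1+m)` whose directions
`1, …, m` are `2π`-periodic. The generators of the `p = m + 1` directions are the commuting
Killing vector fields `V_(0), V_(1), …, V_(m)`. -/
structure IsometricAction {D : ℕ} {M : Type*} [TopologicalSpace M]
    [ChartedSpace (EuclideanSpace ℝ (Fin D)) M] [IsManifold (𝓡 D) ∞ M]
    (g : LorentzMetric D M) (m : ℕ) where
  /-- the joint flow: `flow s` is the composition of the flows of `V_(i)` for the times `s i` -/
  flow : (Fin (m + 1) → ℝ) → M → M
  flow_zero (x : M) : flow 0 x = x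
  flow_add (s t : Fin (m + 1) → ℝ) (x : M) : flow (s + t) x = flow s (flow t x)
  smooth : ContMDiff (𝓘(ℝ, Fin (m + 1) → ℝ).prod (𝓡 D)) (𝓡 D) ∞
    (fun z : (Fin (m + 1) → ℝ) × M => flow z.1 z.2)
  isometry (s : Fin (m + 1) → ℝ) (x : M) (v w : TangentSpace (𝓡 D) x) :
    g.val (flow s x) (mfderiv (𝓡 D) (𝓡 D) (flow s) x v) (mfderiv (𝓡 D) (𝓡 D) (flow s) x w)
      = g.val x v w
  periodic (i : Fin m) (x : M) : flow (Pi.single i.succ (2 * Real.pi)) x = x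

namespace IsometricAction

variable {D m : ℕ} {M : Type*} [TopologicalSpace M]
  [ChartedSpace (EuclideanSpace ℝ (Fin D)) M] [IsManifold (𝓡 D) ∞ M]
  {g : LorentzMetric D M} (Φ : IsometricAction g m)

/-- The Killing vector field `∑ i, a i • V_(i)`: the velocity of the flow in the direction `a`. -/
noncomputable def killing (a : Fin (m + 1) → ℝ) (x : M) : TangentSpace (𝓡 D) x :=
  (mfderiv 𝓘(ℝ, Fin (m + 1) → ℝ) (𝓡 D) (fun s => Φ.flow s x) 0 a :)

/-- The basis Killing vector field `V_(i)`. -/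
noncomputable def V (i : Fin (m + 1)) (x : M) : TangentSpace (𝓡 D) x :=
  Φ.killing (Pi.single i 1) x

/-- The matrix `G_ij = g(V_(i), V_(j))` at a point of the space-time. -/
noncomputable def G (x : M) : Matrix (Fin (m + 1)) (Fin (m + 1)) ℝ :=
  Matrix.of fun i j => g.val x (Φ.V i x) (Φ.V j x)

theorem killing_flow (s a : Fin (m + 1) → ℝ) (x : M) :
    Φ.killing a (Φ.flow s x) = mfderiv (𝓡 D) (𝓡 D) (Φ.flow s) x (Φ.killing a x) := by
  have h1 : (fun t => Φ.flow t (Φ.flow s x)) = Φ.flow s ∘ (fun t => Φ.flow t x) := by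
    funext t
    simp only [Function.comp]
    rw [← Φ.flow_add, ← Φ.flow_add, add_comm]
  have hA : MDifferentiableAt (𝓡 D) (𝓡 D) (Φ.flow s) x :=
    ((Φ.smooth.comp (contMDiff_const.prodMk contMDiff_id :
      ContMDiff (𝓡 D) (𝓘(ℝ, Fin (m + 1) → ℝ).prod (𝓡 D)) ∞ fun y : M => (s, y))).mdifferentiable
        (by simp)) x
  have hB : MDifferentiableAt 𝓘(ℝ, Fin (m + 1) → ℝ) (𝓡 D) (fun t => Φ.flow t x) 0 :=
    ((Φ.smooth.comp (contMDiff_id.prodMk contMDiff_const :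
      ContMDiff 𝓘(ℝ, Fin (m + 1) → ℝ) (𝓘(ℝ, Fin (m + 1) → ℝ).prod (𝓡 D)) ∞
        fun t : Fin (m + 1) → ℝ => (t, x))).mdifferentiable (by simp)) 0
  unfold killing
  rw [h1]
  exact mfderiv_comp_apply_of_eq 0 hA hB (Φ.flow_zero x) a

theorem G_flow (s : Fin (m + 1) → ℝ) (x : M) : Φ.G (Φ.flow s x) = Φ.G x := by
  ext i j
  simp only [G, V, Matrix.of_apply, killing_flow]
  exact Φ.isometry s x _ _

/-! ### The exterior region and its orbit space -/

/-- The points at which some linear combination of the Killing vector fields is time-like. -/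
def timelikeOrbits : Set M := {x | ∃ a : Fin (m + 1) → ℝ, a ⬝ᵥ (Φ.G x *ᵥ a) < 0}

/-- `E` is a connected component of the region in which the orbits are time-like. -/
def IsExterior (E : Set M) : Prop :=
  ∃ x ∈ Φ.timelikeOrbits, E = connectedComponentIn Φ.timelikeOrbits x

/-- Two points of the space-time `closure E` are equivalent if they lie on one orbit. -/
def orbitSetoid (E : Set M) : Setoid (closure E) where
  r x y := ∃ s, Φ.flow s x = y
  iseqv :=
    { refl := fun x => ⟨0, Φ.flow_zero x⟩
      symm := by
        rintro x y ⟨s, hs⟩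
        exact ⟨-s, by rw [← hs, ← Φ.flow_add, neg_add_cancel, Φ.flow_zero]⟩
      trans := by
        rintro x y z ⟨s, hs⟩ ⟨t, ht⟩
        exact ⟨t + s, by rw [Φ.flow_add, hs, ht]⟩ }

/-- The orbit space `N` of the space-time `closure E`, with the quotient topology. -/
abbrev OrbitSpace (E : Set M) : Type _ := Quotient (Φ.orbitSetoid E)

variable {E : Set M}

/-- The matrix `G_ij` as a function on the orbit space. -/
noncomputable def orbitG (q : Φ.OrbitSpace E) : Matrix (Fin (m + 1)) (Fin (m + 1)) ℝ :=
  Quotient.lift (s := Φ.orbitSetoid E) (fun x => Φ.G x.1)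
    (by rintro x y ⟨s, hs⟩; rw [← hs, Φ.G_flow]) q

/-- The Killing vector field `∑ i, a i • V_(i)` lies in `ker G(q)`. -/
def InKer (a : Fin (m + 1) → ℝ) (q : Φ.OrbitSpace E) : Prop := Φ.orbitG q *ᵥ a = 0

variable (E) in
/-- The set `B` of the orbits with `det G = 0`. -/
def B : Set (Φ.OrbitSpace E) := {q | (Φ.orbitG q).det = 0}

variable (E) in
/-- The set `Q_k` of the orbits with `dim ker G ≥ k`. -/
def Q (k : ℕ) : Set (Φ.OrbitSpace E) :=
  {q | k ≤ Module.finrank ℝ (LinearMap.ker (Φ.orbitG q).mulVecLin)}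

/-- `W = ∑ i, a i • V_(i)` is space-like near `q`. -/
def SpacelikeNear (a : Fin (m + 1) → ℝ) (q : Φ.OrbitSpace E) : Prop :=
  ∃ O ∈ 𝓝 q, ∀ q' ∈ O \ Φ.B E, 0 < a ⬝ᵥ (Φ.orbitG q' *ᵥ a)

/-- `W = ∑ i, a i • V_(i)` is time-like near `q`. -/
def TimelikeNear (a : Fin (m + 1) → ℝ) (q : Φ.OrbitSpace E) : Prop :=
  ∃ O ∈ 𝓝 q, ∀ q' ∈ O \ Φ.B E, a ⬝ᵥ (Φ.orbitG q' *ᵥ a) < 0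

/-- A domain of `B`: for some `q ∈ B ∖ Q_2` and some nonzero `W ∈ ker G(q)`, the maximal connected
subset of `B` that contains `q` and on which `W ∈ ker G`. -/
def IsDomain (S : Set (Φ.OrbitSpace E)) : Prop :=
  ∃ q ∈ Φ.B E \ Φ.Q E 2, ∃ a : Fin (m + 1) → ℝ, a ≠ 0 ∧ Φ.InKer a q ∧
    Maximal (fun T : Set (Φ.OrbitSpace E) =>
      IsConnected T ∧ q ∈ T ∧ T ⊆ Φ.B E ∧ ∀ q' ∈ T, Φ.InKer a q') S

/-- `W` is space-like for `r → 0` on `S` (away from the intersections with other domains). -/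
def IsSpacelikeDirection (S : Set (Φ.OrbitSpace E)) (a : Fin (m + 1) → ℝ) : Prop :=
  ∀ q ∈ S \ Φ.Q E 2, Φ.SpacelikeNear a q

/-- `W` is time-like for `r → 0` on `S` (away from the intersections with other domains). -/
def IsTimelikeDirection (S : Set (Φ.OrbitSpace E)) (a : Fin (m + 1) → ℝ) : Prop :=
  ∀ q ∈ S \ Φ.Q E 2, Φ.TimelikeNear a q

/-- The points of the space-time whose orbits belong to `S`. -/
def preimage (S : Set (Φ.OrbitSpace E)) : Set M :=
  {x | ∃ h : x ∈ closure E, Quotient.mk (Φ.orbitSetoid E) ⟨x, h⟩ ∈ S}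

/-- `H` is a Killing horizon of `W = ∑ i, a i • V_(i)`: a smooth hypersurface on which `W` is
nonzero, null, and normal to `H` (so `H` is a null hypersurface). -/
def IsKillingHorizon (H : Set M) (a : Fin (m + 1) → ℝ) : Prop :=
  ∀ x ∈ H, ∃ U : Set M, IsOpen U ∧ x ∈ U ∧ ∃ u : M → ℝ,
    ContMDiffOn (𝓡 D) 𝓘(ℝ, ℝ) ∞ u U ∧ H ∩ U = {y ∈ U | u y = 0} ∧
    mfderiv (𝓡 D) 𝓘(ℝ, ℝ) u x ≠ 0 ∧
    Φ.killing a x ≠ 0 ∧ g.val x (Φ.killing a x) (Φ.killing a x) = 0 ∧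
    ∀ v : TangentSpace (𝓡 D) x,
      mfderiv (𝓡 D) 𝓘(ℝ, ℝ) u x v = 0 → g.val x (Φ.killing a x) v = 0

/-! ### Standing assumptions -/

/-- No linear combination of the rotational Killing vector fields is time-like on `E`. -/
def RotationsNotTimelike (E : Set M) : Prop :=
  ∀ x ∈ E, ∀ a : Fin (m + 1) → ℝ, a 0 = 0 → 0 ≤ a ⬝ᵥ (Φ.G x *ᵥ a)

/-- The group that acts on `E` is `ℝ × U(1)^m` (with the `U(1)` flows of period `2π`), and not
a quotient of it. -/
def IsEffective (E : Set M) : Prop :=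
  ∀ s : Fin (m + 1) → ℝ, (∀ x ∈ E, Φ.flow s x = x) →
    s 0 = 0 ∧ ∀ i : Fin m, ∃ k : ℤ, s i.succ = 2 * Real.pi * k

/-- `ℝ × U(1)^m` acts properly on `closure E`; as `U(1)^m` is compact, this concerns
the time parameter only. -/
def IsProper (E : Set M) : Prop :=
  ∀ K ⊆ closure E, IsCompact K →
    ∃ T : ℝ, ∀ s : Fin (m + 1) → ℝ, ∀ x ∈ K, Φ.flow s x ∈ K → |s 0| ≤ T

/-- The one-form `θ^i = dx^i + A^i`: it is zero on vectors orthogonal to the orbits and has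
`θ^i(V_(j)) = δ^i_j`. -/
noncomputable def theta (i : Fin (m + 1)) (x : M) (v : TangentSpace (𝓡 D) x) : ℝ :=
  ∑ j, (Φ.G x)⁻¹ i j * g.val x (Φ.V j x) v

/-- The quadratic form `g̃(v, v)` in `g = G_ij (dx^i + A^i) (dx^j + A^j) + g̃`. -/
noncomputable def gTilde (x : M) (v : TangentSpace (𝓡 D) x) : ℝ :=
  g.val x v v - ∑ i, ∑ j, Φ.G x i j * Φ.theta i x v * Φ.theta j x v

/-- The function `r = √|det G|`. -/
noncomputable def r (x : M) : ℝ := Real.sqrt |(Φ.G x).det|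

/-- The component `g_rr` of `g̃` in any coordinates `(r, z)` of the orbit space with `g_rz = 0`:
the least value of `g̃(v, v)` over the vectors with `dr(v) = 1`. -/
noncomputable def g_rr (x : M) : ℝ :=
  sInf {c | ∃ v : TangentSpace (𝓡 D) x,
    mfderiv (𝓡 D) 𝓘(ℝ, ℝ) Φ.r x v = 1 ∧ c = Φ.gTilde x v}

/-- Functions `x^i` on the open set `O` that serve as coordinates with `V_(j) = ∂/∂x^j`. -/
def IsAdapted (X : Fin (m + 1) → M → ℝ) (O : Set M) : Prop :=
  (∀ i, ContMDiffOn (𝓡 D) 𝓘(ℝ, ℝ) ∞ (X i) O) ∧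
  ∀ y ∈ O, ∀ i j, mfderiv (𝓡 D) 𝓘(ℝ, ℝ) (X i) y (Φ.V j y) = if i = j then (1 : ℝ) else 0

/-- The gauge field `A^i = θ^i - dx^i` that belongs to the functions `x^i`. -/
noncomputable def gaugeField (X : Fin (m + 1) → M → ℝ) (i : Fin (m + 1)) (x : M)
    (v : TangentSpace (𝓡 D) x) : ℝ :=
  Φ.theta i x v - (show ℝ from mfderiv (𝓡 D) 𝓘(ℝ, ℝ) (X i) x v)

/-- Regularity of the canonical form of the metric for `r → 0` near `x`: with a suitable choice of
the coordinates `x^i`, the gauge fields `A^i` do not go to infinity (in the norm of `g̃`), and `g_rr`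
stays bounded and bounded away from zero. -/
def RegularNear (E : Set M) (x : M) : Prop :=
  ∃ U : Set M, IsOpen U ∧ x ∈ U ∧
    (∃ X : Fin (m + 1) → M → ℝ, Φ.IsAdapted X {y ∈ U ∩ E | (Φ.G y).det ≠ 0} ∧
      ∃ C : ℝ, ∀ y ∈ U ∩ E, (Φ.G y).det ≠ 0 → ∀ i, ∀ v : TangentSpace (𝓡 D) y,
        Φ.gaugeField X i y v ^ 2 ≤ C * Φ.gTilde y v) ∧
    ∃ c C : ℝ, 0 < c ∧ ∀ y ∈ U ∩ E, (Φ.G y).det ≠ 0 → c ≤ Φ.g_rr y ∧ Φ.g_rr y ≤ C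

/-- The canonical form of the metric is regular at the points of the boundary of `E` at which
`dim ker G < 2`. -/
def RegularAtBoundary (E : Set M) : Prop :=
  ∀ x ∈ frontier E, Module.finrank ℝ (LinearMap.ker (Φ.G x).mulVecLin) < 2 → Φ.RegularNear E x

end IsometricAction

/-- The boundary of `E` is a smooth hypersurface with `E` on one side of it, that is, `closure E` is
a smooth manifold with boundary. -/
def HasSmoothBoundary {D : ℕ} {M : Type*} [TopologicalSpace M]
    [ChartedSpace (EuclideanSpace ℝ (Fin D)) M] (E : Set M) : Prop :=
  ∀ x ∈ frontier E, ∃ U : Set M, IsOpen U ∧ x ∈ U ∧ ∃ u : M → ℝ,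
    ContMDiffOn (𝓡 D) 𝓘(ℝ, ℝ) ∞ u U ∧ mfderiv (𝓡 D) 𝓘(ℝ, ℝ) u x ≠ 0 ∧
    E ∩ U = {y ∈ U | 0 < u y}

/-- The coordinates `(t, y, θ)` of `ℝ × ℝ^d × ℝ^q`, the universal cover of Kaluza-Klein space
`ℝ^(1,d) × T^q`. -/
abbrev KKCover (d q : ℕ) : Type := ℝ × EuclideanSpace ℝ (Fin d) × (Fin q → ℝ)

/-- The flat metric `-dt² + dy² + h_ab dθ^a dθ^b`. -/
noncomputable def flatForm {d q : ℕ} (h : Matrix (Fin q) (Fin q) ℝ) (ξ η : KKCover d q) : ℝ :=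
  -(ξ.1 * η.1) + inner ℝ ξ.2.1 η.2.1 + ξ.2.2 ⬝ᵥ (h *ᵥ η.2.2)

/-- `E` is asymptotic to Kaluza-Klein space `ℝ^(1,d) × T^q` (to Minkowski space if `q = 0`). There
are asymptotic coordinates `(t, y, θ)` with `R < ‖y‖`, in which the metric tends to a flat one
for `‖y‖ → ∞`, `V_(0)` generates the time translations, and the other `V_(i)` generate rotations of
`y` and translations of the torus. Up to the symmetries, the rest of the space-time is compact. -/
structure AsymptoticEnd {D m : ℕ} {M : Type*} [TopologicalSpace M]
    [ChartedSpace (EuclideanSpace ℝ (Fin D)) M] [IsManifold (𝓡 D) ∞ M]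
    {g : LorentzMetric D M} (Φ : IsometricAction g m) (E : Set M) (d q : ℕ) where
  /-- the radius beyond which the coordinates are defined -/
  R : ℝ
  /-- the parametrization of the asymptotic region -/
  Ψ : KKCover d q → M
  /-- the metric of the torus -/
  h : Matrix (Fin q) (Fin q) ℝ
  /-- the rotations of `y` -/
  rot : (Fin m → ℝ) → EuclideanSpace ℝ (Fin d) ≃ₗᵢ[ℝ] EuclideanSpace ℝ (Fin d)
  /-- the translations of the torus -/
  shift : (Fin m → ℝ) →ₗ[ℝ] (Fin q → ℝ)
  h_posDef : h.PosDef
  isLocalDiffeo : IsLocalDiffeomorphOn 𝓘(ℝ, KKCover d q) (𝓡 D) ∞ Ψ {z | R < ‖z.2.1‖}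
  eq_iff (z w : KKCover d q) : R < ‖z.2.1‖ → R < ‖w.2.1‖ →
    (Ψ z = Ψ w ↔ z.1 = w.1 ∧ z.2.1 = w.2.1 ∧
      ∀ a, ∃ k : ℤ, z.2.2 a - w.2.2 a = 2 * Real.pi * k)
  subset : Ψ '' {z | R < ‖z.2.1‖} ⊆ E
  flow_eq (s : Fin (m + 1) → ℝ) (z : KKCover d q) : R < ‖z.2.1‖ →
    Φ.flow s (Ψ z) =
      Ψ (z.1 + s 0, rot (fun i => s i.succ) z.2.1, z.2.2 + shift (fun i => s i.succ))
  tendsto_flat (ξ η : KKCover d q) :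
    Tendsto (fun z : KKCover d q => g.val (Ψ z) (mfderiv 𝓘(ℝ, KKCover d q) (𝓡 D) Ψ z ξ)
      (mfderiv 𝓘(ℝ, KKCover d q) (𝓡 D) Ψ z η))
      (comap (fun z : KKCover d q => ‖z.2.1‖) atTop) (𝓝 (flatForm h ξ η))
  compact_rest : ∃ K : Set M, IsCompact K ∧
    closure E ⊆ Ψ '' {z | R < ‖z.2.1‖} ∪ ⋃ s, Φ.flow s '' K

end DomainStructure

/-! In `E` the orbits are time-like, so a Killing field in the kernel of `G` is null and orthogonal
to a time-like vector and therefore vanishes (`killing_eq_zero_of_G`). Inside `E`, the set `B` thus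
consists of the points with nontrivial isotropy algebra. The rest of `B` is the boundary of `E`,
where `G` is positive semidefinite and degenerate (`det_G_eq_zero_of_mem_frontier`).

Isotropy: by properness, stabilizers have no time component and are compact modulo the periods.
Averaging gives, at every point of the closure of `E`, a chart in which the stabilizer acts linearly
and orthogonally and the boundary is an invariant hyperplane (`exists_isLinearModel`). Nearby
isotropy algebras are the annihilators of vectors under a commuting family of skew operators. There
are finitely many of them; effectiveness makes the generic one trivial, and a one-dimensional one
occurs whenever the family is nonzero (`exists_annihilator_eq_span`). A one-dimensional isotropy
algebra contains a nonzero period and hence a primitive integer vector, and Killing fields that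
vanish at a point are space-like or zero nearby (`eventually_pos`).

Horizons: at a boundary point with `dim ker G ≤ 1` the isotropy is trivial, and `f = -det G` is
positive in `E` and zero on the boundary (`IsHorizonModel`). Boundedness of the gauge fields means
that each `dx^i` equals a form built from `adj G`, divided by `-f`, up to smaller errors. Since the
`x^i` are functions, this is very restrictive. If the kernel of `G` were not normal to the boundary,
a combination of the `x^i` would change by arbitrarily large amounts between two fixed points
(`form_eq_zero`). The bound on `g_rr` forces `f` to vanish only to first order
(`fderiv_neg_det_pos`). Then `dx^i ∼ -k^i dt / t` along normal lines with a vector `k` that spans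
the kernel; tangentially the `x^i` vary boundedly, so a logarithmic divergence is avoided only if
`k` is constant (`form_div_eq`), an analogue of the constancy of surface gravity. The constant
kernel direction is time-like in `E` (`eventually_timelike`), so it is not a rotation and its
`V_(0)` component can be normalized. At boundary points with isotropy the same direction persists,
because the generic points are dense and joined by broken lines in the linear model
(`exists_isGenerator`).

Finally, every point has a neighbourhood in which finitely many domains arise, and all domains meet
one compact set because isotropy is constant along the rays of the asymptotic region; this gives
finiteness (`finite_isDomain`). The domains cover `B` (`exists_isDomain_mem`), and each has a
direction of one of the two kinds (`exists_direction`). -/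

namespace DomainStructure

/-! ### Bilinear forms of Lorentzian signature -/

section Lorentz

variable {V : Type*} [AddCommGroup V] [Module ℝ V] [TopologicalSpace V]

/-- A symmetric bilinear form of signature `(-,+,…,+)`. -/
structure IsLorentz (B : V →L[ℝ] V →L[ℝ] ℝ) : Prop where
  symm (v w : V) : B v w = B w v
  signature : ∃ v : V, B v v < 0 ∧ ∀ w : V, B v w = 0 → w ≠ 0 → 0 < B w w

namespace IsLorentz

variable {B : V →L[ℝ] V →L[ℝ] ℝ} (hB : IsLorentz B)
include hB

/-- The signature provides only one time-like `v` with positive complement; the property is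
transferred to every time-like `T`. The combination of `T` and `w` orthogonal to `v` has norm `(B v
w)² B T T + (B v T)² B w w`. If `B w w ≤ 0` this is nonpositive, so the combination is zero, which
is contradictory as well. -/
theorem pos_of_orthogonal {T w : V} (hT : B T T < 0) (hw : B T w = 0) (h0 : w ≠ 0) :
    0 < B w w := by
  obtain ⟨v, hv, hpos⟩ := hB.signature
  by_contra! hneg
  have hort : B v (B v w • T - B v T • w) = 0 := by
    simp only [map_sub, map_smul, smul_eq_mul]; ring
  have hval : B (B v w • T - B v T • w) (B v w • T - B v T • w)
      = (B v w) ^ 2 * B T T + (B v T) ^ 2 * B w w := by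
    simp only [map_sub, map_smul, smul_eq_mul, sub_apply, smul_apply, hB.symm w T, hw]; ring
  by_cases hu : B v w • T - B v T • w = 0
  · have h1 : B T (B v w • T - B v T • w) = 0 := by rw [hu, map_zero]
    simp only [map_sub, map_smul, smul_eq_mul, hw] at h1
    have h2 : B v w = 0 := by
      rcases mul_eq_zero.1 (by linarith : B v w * B T T = 0) with h | h
      · exact h
      · exact absurd h hT.ne
    rw [h2, zero_smul, zero_sub, neg_eq_zero, smul_eq_zero] at hu
    rcases hu with h | h
    · have : T ≠ 0 := by rintro rfl; simp at hT
      exact absurd (hpos T h this) (by linarith)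
    · exact h0 h
  · have := hpos _ hort hu
    rw [hval] at this
    nlinarith [sq_nonneg (B v w), sq_nonneg (B v T)]

theorem nonneg_of_orthogonal {T w : V} (hT : B T T < 0) (hw : B T w = 0) : 0 ≤ B w w := by
  by_cases h0 : w = 0
  · simp [h0]
  · exact (hB.pos_of_orthogonal hT hw h0).le

/-- The component of `w` orthogonal to `T` has nonnegative norm; it is multiplied by `B T T` to
avoid a division. -/
theorem reverse_cauchy_schwarz {T : V} (hT : B T T < 0) (w : V) :
    B T T * B w w ≤ B T w ^ 2 := by
  have hort : B T (B T T • w - B T w • T) = 0 := by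
    simp only [map_sub, map_smul, smul_eq_mul]; ring
  have h := hB.nonneg_of_orthogonal hT hort
  simp only [map_sub, map_smul, smul_eq_mul, sub_apply, smul_apply, hB.symm w T] at h
  have h2 : 0 ≤ B T T * (B T T * B w w - B T w ^ 2) := by nlinarith
  nlinarith

/-- The orthogonal complement of a time-like vector is positive definite, so that the
Cauchy-Schwarz inequality holds there. -/
theorem cauchy_schwarz_of_orthogonal {T u w : V} (hT : B T T < 0) (hu : B T u = 0)
    (hw : B T w = 0) : B u w ^ 2 ≤ B u u * B w w := by
  by_cases h0 : u = 0
  · simp [h0]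
  have hpos := hB.pos_of_orthogonal hT hu h0
  have h := hB.nonneg_of_orthogonal hT (w := B u u • w - B u w • u) (by
    simp only [map_sub, map_smul, smul_eq_mul, hu, hw]; ring)
  simp only [map_sub, map_smul, smul_eq_mul, sub_apply, smul_apply, hB.symm w u] at h
  have h2 : 0 ≤ B u u * (B u u * B w w - B u w ^ 2) := by nlinarith
  nlinarith

theorem nondegenerate {u : V} (h : ∀ w, B u w = 0) : u = 0 := by
  obtain ⟨v, hv, hpos⟩ := hB.signature
  by_contra h0
  have := hpos u (by rw [hB.symm]; exact h v) h0
  rw [h u] at this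
  exact lt_irrefl _ this

/-- Two orthogonal null vectors are linearly dependent. -/
theorem dependent_of_null {u w : V} (hu : B u u = 0) (hw : B w w = 0) (huw : B u w = 0) :
    ∃ α β : ℝ, (α ≠ 0 ∨ β ≠ 0) ∧ α • u + β • w = 0 := by
  obtain ⟨v, hv, hpos⟩ := hB.signature
  by_cases hvu : B v u = 0
  · have : u = 0 := by
      by_contra h0
      exact (hpos u hvu h0).ne' hu
    exact ⟨1, 0, Or.inl one_ne_zero, by simp [this]⟩
  · refine ⟨-B v w, B v u, Or.inr hvu, ?_⟩
    by_contra h0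
    have := hpos _ (by simp only [map_add, map_smul, smul_eq_mul]; ring) h0
    simp only [map_add, map_smul, smul_eq_mul, add_apply, smul_apply, hB.symm w u, hu, hw, huw]
      at this
    linarith

end IsLorentz

end Lorentz

/-! ### Elementary properties of the action and of the Killing vector fields -/

section Basic

variable {D : ℕ} {M : Type*} [TopologicalSpace M]
  [ChartedSpace (EuclideanSpace ℝ (Fin D)) M] [IsManifold (𝓡 D) ∞ M]

theorem LorentzMetric.isLorentz (g : LorentzMetric D M) (x : M) : IsLorentz (g.val x) :=
  ⟨g.symm x, g.signature x⟩

namespace IsometricAction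

variable {m : ℕ} {g : LorentzMetric D M} (Φ : IsometricAction g m)

theorem contMDiff_flow (s : Fin (m + 1) → ℝ) : ContMDiff (𝓡 D) (𝓡 D) ∞ (Φ.flow s) :=
  Φ.smooth.comp (contMDiff_const.prodMk contMDiff_id :
      ContMDiff (𝓡 D) (𝓘(ℝ, Fin (m + 1) → ℝ).prod (𝓡 D)) ∞ fun y : M => (s, y))

theorem contMDiff_orbit (x : M) :
    ContMDiff 𝓘(ℝ, Fin (m + 1) → ℝ) (𝓡 D) ∞ (fun s => Φ.flow s x) :=
  Φ.smooth.comp (contMDiff_id.prodMk contMDiff_const :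
      ContMDiff 𝓘(ℝ, Fin (m + 1) → ℝ) (𝓘(ℝ, Fin (m + 1) → ℝ).prod (𝓡 D)) ∞
        fun t : Fin (m + 1) → ℝ => (t, x))

theorem continuous_flow : Continuous fun z : (Fin (m + 1) → ℝ) × M => Φ.flow z.1 z.2 :=
  Φ.smooth.continuous

theorem continuous_flow_right (s : Fin (m + 1) → ℝ) : Continuous (Φ.flow s) :=
  (Φ.contMDiff_flow s).continuous

theorem flow_neg_flow (s : Fin (m + 1) → ℝ) (x : M) : Φ.flow (-s) (Φ.flow s x) = x := by
  rw [← Φ.flow_add, neg_add_cancel, Φ.flow_zero]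

/-- The flow of an element of the stabilizer subgroup. -/
theorem flow_neg_eq {s : Fin (m + 1) → ℝ} {x : M} (h : Φ.flow s x = x) : Φ.flow (-s) x = x := by
  conv_lhs => rw [← h]
  exact Φ.flow_neg_flow s x

theorem flow_nsmul_eq {s : Fin (m + 1) → ℝ} {x : M} (h : Φ.flow s x = x) (n : ℕ) :
    Φ.flow (n • s) x = x := by
  induction n with
  | zero => simp [Φ.flow_zero]
  | succ n ih => rw [succ_nsmul, Φ.flow_add, h, ih]

theorem flow_zsmul_eq {s : Fin (m + 1) → ℝ} {x : M} (h : Φ.flow s x = x) (n : ℤ) :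
    Φ.flow (n • s) x = x := by
  cases n with
  | ofNat n => simpa using Φ.flow_nsmul_eq h n
  | negSucc n =>
    rw [negSucc_zsmul]
    exact Φ.flow_neg_eq (Φ.flow_nsmul_eq h _)

theorem flow_sum_eq {ι : Type*} (F : Finset ι) {s : ι → Fin (m + 1) → ℝ} {x : M}
    (h : ∀ i ∈ F, Φ.flow (s i) x = x) : Φ.flow (∑ i ∈ F, s i) x = x := by
  classical
  induction F using Finset.induction_on with
  | empty => simp [Φ.flow_zero]
  | insert i F hi ih =>
    rw [Finset.sum_insert hi, Φ.flow_add, ih fun j hj => h j (Finset.mem_insert_of_mem hj),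
      h i (Finset.mem_insert_self _ _)]

/-- The flow is `2π`-periodic in the rotational directions. -/
theorem flow_lattice {s : Fin (m + 1) → ℝ} (h0 : s 0 = 0)
    (hs : ∀ i : Fin m, ∃ k : ℤ, s i.succ = 2 * Real.pi * k) (x : M) : Φ.flow s x = x := by
  choose k hk using hs
  have : s = ∑ i : Fin m, k i • (Pi.single i.succ (2 * Real.pi) : Fin (m + 1) → ℝ) := by
    funext j
    rw [Finset.sum_apply]
    refine Fin.cases ?_ (fun j => ?_) j
    · rw [h0]; symm
      apply Finset.sum_eq_zero
      intro i _
      simp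
    · rw [Finset.sum_eq_single j]
      · simp [hk, mul_comm]
      · intro i _ hij
        simp [hij.symm]
      · simp
  rw [this]
  exact Φ.flow_sum_eq _ fun i _ => Φ.flow_zsmul_eq (Φ.periodic i x) (k i)

/-! ### Killing vector fields -/

theorem killing_add (a b : Fin (m + 1) → ℝ) (x : M) :
    Φ.killing (a + b) x = Φ.killing a x + Φ.killing b x := by
  unfold killing; exact map_add (mfderiv 𝓘(ℝ, Fin (m + 1) → ℝ) (𝓡 D) (fun s => Φ.flow s x) 0) a b

theorem killing_smul (c : ℝ) (a : Fin (m + 1) → ℝ) (x : M) :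
    Φ.killing (c • a) x = c • Φ.killing a x := by
  unfold killing
  exact map_smul (mfderiv 𝓘(ℝ, Fin (m + 1) → ℝ) (𝓡 D) (fun s => Φ.flow s x) 0) c a

/-- The evaluation of the Killing vector fields at a point. -/
noncomputable def killingₗ (x : M) : (Fin (m + 1) → ℝ) →ₗ[ℝ] TangentSpace (𝓡 D) x where
  toFun a := Φ.killing a x
  map_add' a b := Φ.killing_add a b x
  map_smul' c a := Φ.killing_smul c a x

@[simp] theorem killingₗ_apply (x : M) (a : Fin (m + 1) → ℝ) : Φ.killingₗ x a = Φ.killing a x := rfl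

theorem killing_eq_sum (a : Fin (m + 1) → ℝ) (x : M) :
    Φ.killing a x = ∑ i, a i • Φ.V i x := by
  have : a = ∑ i, a i • (Pi.single i 1 : Fin (m + 1) → ℝ) := by
    funext j; simp [Finset.sum_apply, Pi.single_apply]
  conv_lhs => rw [this]
  rw [← killingₗ_apply, map_sum]
  simp [V]

theorem dotProduct_G (x : M) (a b : Fin (m + 1) → ℝ) :
    a ⬝ᵥ (Φ.G x *ᵥ b) = g.val x (Φ.killing a x) (Φ.killing b x) := by
  rw [killing_eq_sum, killing_eq_sum]
  simp only [map_sum, map_smul, sum_apply, smul_apply, dotProduct,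
    Matrix.mulVec, G, Matrix.of_apply, smul_eq_mul, Finset.mul_sum]
  rw [Finset.sum_comm]
  refine Finset.sum_congr rfl fun i _ => Finset.sum_congr rfl fun j _ => by ring

theorem G_mulVec_apply (x : M) (a : Fin (m + 1) → ℝ) (i : Fin (m + 1)) :
    (Φ.G x *ᵥ a) i = g.val x (Φ.V i x) (Φ.killing a x) := by
  have := Φ.dotProduct_G x (Pi.single i 1) a
  rwa [single_dotProduct, one_mul] at this

theorem G_transpose (x : M) : (Φ.G x)ᵀ = Φ.G x := by
  ext i j; simp [G, g.symm]

theorem G_mulVec_eq_zero_iff (x : M) (a : Fin (m + 1) → ℝ) :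
    Φ.G x *ᵥ a = 0 ↔ ∀ b, g.val x (Φ.killing b x) (Φ.killing a x) = 0 := by
  constructor
  · intro h b; rw [← dotProduct_G, h, dotProduct_zero]
  · intro h; funext i; rw [G_mulVec_apply]; exact h _

theorem G_mulVec_eq_zero_of_killing {x : M} {a : Fin (m + 1) → ℝ} (h : Φ.killing a x = 0) :
    Φ.G x *ᵥ a = 0 := by
  rw [G_mulVec_eq_zero_iff]; intro b; rw [h, map_zero]

theorem det_G_eq_zero_iff (x : M) : (Φ.G x).det = 0 ↔ ∃ a, a ≠ 0 ∧ Φ.G x *ᵥ a = 0 :=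
  Matrix.exists_mulVec_eq_zero_iff.symm

end IsometricAction

end Basic

end DomainStructure

namespace DomainStructure

/-! ### Calculus in a half ball -/

section HalfBall

variable {V : Type*} [NormedAddCommGroup V] [NormedSpace ℝ V]

/-- A function whose derivative in the direction `e` is bounded below grows along `e`. -/
theorem mul_le_sub_of_le_fderiv {Y : V → ℝ} {p e : V} {a b L : ℝ} (hab : a ≤ b)
    (hY : ∀ s ∈ Icc a b, DifferentiableAt ℝ Y (p + s • e))
    (hL : ∀ s ∈ Icc a b, L ≤ fderiv ℝ Y (p + s • e) e) :
    L * (b - a) ≤ Y (p + b • e) - Y (p + a • e) := by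
  have hder : ∀ s ∈ Icc a b, HasDerivAt (fun s : ℝ => Y (p + s • e))
      (fderiv ℝ Y (p + s • e) e) s := by
    intro s hs
    have h1 : HasDerivAt (fun s : ℝ => p + s • e) e s := by
      simpa using ((hasDerivAt_id s).smul_const e).const_add p
    exact (hY s hs).hasFDerivAt.comp_hasDerivAt s h1
  refine (convex_Icc a b).mul_sub_le_image_sub_of_le_deriv
    (fun s hs => (hder s hs).continuousAt.continuousWithinAt)
    (fun s hs => (hder s (interior_subset hs)).differentiableAt.differentiableWithinAt)
    (fun s hs => ?_) a (left_mem_Icc.2 hab) b (right_mem_Icc.2 hab) hab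
  rw [(hder s (interior_subset hs)).deriv]
  exact hL s (interior_subset hs)

theorem sub_le_mul_of_fderiv_le {Y : V → ℝ} {p e : V} {a b L : ℝ} (hab : a ≤ b)
    (hY : ∀ s ∈ Icc a b, DifferentiableAt ℝ Y (p + s • e))
    (hL : ∀ s ∈ Icc a b, fderiv ℝ Y (p + s • e) e ≤ L) :
    Y (p + b • e) - Y (p + a • e) ≤ L * (b - a) := by
  have := mul_le_sub_of_le_fderiv (Y := fun z => -Y z) (p := p) (e := e) (L := -L) hab
    (fun s hs => (hY s hs).neg) (fun s hs => by
      rw [fderiv_fun_neg, neg_apply]; linarith [hL s hs])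
  linarith

/-- A `C¹` function that vanishes on a hyperplane is bounded by the distance from it. -/
theorem exists_norm_le_of_eq_zero_on_hyperplane {W : Type*} [NormedAddCommGroup W]
    [NormedSpace ℝ W] {F : V → W} {z₀ : V} {ℓ : V →L[ℝ] ℝ} (hℓ : ℓ ≠ 0) (hz : ℓ z₀ = 0)
    (hF : ContDiffAt ℝ 1 F z₀) (h0 : ∀ᶠ z in 𝓝 z₀, ℓ z = 0 → F z = 0) :
    ∃ C, 0 ≤ C ∧ ∀ᶠ z in 𝓝 z₀, ‖F z‖ ≤ C * |ℓ z| := by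
  obtain ⟨n, hn⟩ : ∃ n, ℓ n = 1 := by
    obtain ⟨v, hv⟩ : ∃ v, ℓ v ≠ 0 := by
      by_contra! h; exact hℓ (ContinuousLinearMap.ext h)
    exact ⟨(ℓ v)⁻¹ • v, by simp [hv]⟩
  obtain ⟨K, t, ht, hK⟩ := hF.exists_lipschitzOnWith
  -- The point `z - ℓ z • n` lies on the hyperplane at distance `|ℓ z| * ‖n‖` from `z`, so a local
  -- Lipschitz constant gives the bound.
  have hproj : Tendsto (fun z => z - ℓ z • n) (𝓝 z₀) (𝓝 z₀) := by
    have : ContinuousAt (fun z => z - ℓ z • n) z₀ := by fun_prop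
    simpa [ContinuousAt, hz] using this
  refine ⟨K * ‖n‖, by positivity, ?_⟩
  filter_upwards [ht, hproj ht, hproj h0] with z h1 h2 h3
  have h4 : F (z - ℓ z • n) = 0 := h3 (by simp [hn])
  have := hK.norm_sub_le h1 h2
  rw [h4, sub_zero] at this
  refine this.trans (le_of_eq ?_)
  rw [sub_sub_cancel, norm_smul, Real.norm_eq_abs]; ring

/-- Let the differential of `Y` be `ϑ / f` up to terms of lower order, where `f → 0` at the
boundary `ℓ = 0` of the half ball. Then `ϑ` is normal to the boundary. -/
theorem eq_zero_of_fderiv_asymptotic {z₀ : V} {ℓ : V →L[ℝ] ℝ} (hz : ℓ z₀ = 0)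
    {f Y : V → ℝ} {ϑ : V → V →L[ℝ] ℝ} {C Cf : ℝ} (hC : 0 ≤ C)
    (hϑ : ContinuousAt ϑ z₀)
    (hf : ∀ᶠ z in 𝓝 z₀, 0 < ℓ z → 0 < f z ∧ f z ≤ Cf * ℓ z)
    (hY : ∀ᶠ z in 𝓝 z₀, 0 < ℓ z → DifferentiableAt ℝ Y z ∧
      ∀ v, |fderiv ℝ Y z v - ϑ z v / f z| ≤ C * (‖v‖ + |ϑ z v| / √(f z)))
    {v : V} (hv : ℓ v = 0) (n : V) (hn : ℓ n = 1) : ϑ z₀ v = 0 := by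
  by_contra hne
  wlog hpos : 0 < ϑ z₀ v generalizing v
  · refine this (v := -v) (by simp [hv]) (by simpa using hne) ?_
    rw [map_neg]
    exact neg_pos.2 (lt_of_le_of_ne (not_lt.1 hpos) hne)
  -- a lower bound of the derivative in a fixed direction
  have key : ∀ e : V, 0 < ϑ z₀ e → ∃ c > 0, ∀ᶠ z in 𝓝 z₀, 0 < ℓ z →
      c / f z ≤ fderiv ℝ Y z e := by
    intro e he
    refine ⟨ϑ z₀ e / 8, by positivity, ?_⟩
    have hce : ∀ᶠ z in 𝓝 z₀, ϑ z₀ e / 2 < ϑ z e :=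
      (((ContinuousLinearMap.apply ℝ ℝ e).continuous.continuousAt.comp hϑ).eventually
        (lt_mem_nhds (by simpa using half_lt_self he)))
    -- Since `f ≤ Cf * ℓ`, both error terms, once multiplied by `f`, are small near the boundary,
    -- and a definite fraction of `ϑ z₀ e` is left over.
    have hsmall : ∀ᶠ z in 𝓝 z₀, C * √(Cf * ℓ z) < 1 / 4 ∧
        C * ‖e‖ * (Cf * ℓ z) < ϑ z₀ e / 8 := by
      have h1 : ContinuousAt (fun z => C * √(Cf * ℓ z)) z₀ := by fun_prop
      have h2 : ContinuousAt (fun z => C * ‖e‖ * (Cf * ℓ z)) z₀ := by fun_prop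
      refine (h1.eventually (gt_mem_nhds ?_)).and (h2.eventually (gt_mem_nhds ?_))
      · simp [hz]
      · simp only [hz, mul_zero]; positivity
    filter_upwards [hf, hY, hce, hsmall] with z h1 h2 h3 h4 hl
    obtain ⟨hf0, hfl⟩ := h1 hl
    have h5 := (abs_le.1 ((h2 hl).2 e)).1
    have hs0 : 0 < √(f z) := Real.sqrt_pos.2 hf0
    have hs1 : C * √(f z) ≤ 1 / 4 :=
      (mul_le_mul_of_nonneg_left (Real.sqrt_le_sqrt hfl) hC).trans h4.1.le
    have hs2 : C * ‖e‖ * f z ≤ ϑ z₀ e / 8 :=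
      (mul_le_mul_of_nonneg_left hfl (by positivity)).trans h4.2.le
    have hϑ0 : 0 < ϑ z e := by linarith
    rw [abs_of_pos hϑ0] at h5
    have h6 : C * (‖e‖ + ϑ z e / √(f z)) * f z ≤ ϑ z e / 2 := by
      have : ϑ z e / √(f z) * f z = ϑ z e * √(f z) := by
        conv_lhs => rw [← Real.mul_self_sqrt hf0.le]
        rw [Real.sqrt_mul_self hs0.le]; field_simp
      calc C * (‖e‖ + ϑ z e / √(f z)) * f z
          = C * ‖e‖ * f z + C * (ϑ z e / √(f z) * f z) := by ring
        _ = C * ‖e‖ * f z + (C * √(f z)) * ϑ z e := by rw [this]; ring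
        _ ≤ ϑ z₀ e / 8 + 1 / 4 * ϑ z e := by gcongr
        _ ≤ _ := by linarith
    rw [div_le_iff₀ hf0]
    have h7 : ϑ z e / f z * f z = ϑ z e := div_mul_cancel₀ _ hf0.ne'
    nlinarith
  -- For large `K` the form `ϑ z₀` is positive on `n + K • v` and on `K • v - n`, the directions of
  -- the legs of a trapezoid, because `ϑ z₀ v > 0` dominates `ϑ z₀ n`.
  obtain ⟨K, hK0, hK1, hK2⟩ : ∃ K : ℝ, 0 < K ∧ 0 < ϑ z₀ (n + K • v) ∧ 0 < ϑ z₀ (K • v - n) := by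
    refine ⟨(|ϑ z₀ n| + 1) / ϑ z₀ v, by positivity, ?_, ?_⟩
    · simp only [map_add, map_smul, smul_eq_mul, div_mul_cancel₀ _ hpos.ne']
      linarith [neg_abs_le (ϑ z₀ n)]
    · simp only [map_sub, map_smul, smul_eq_mul, div_mul_cancel₀ _ hpos.ne']
      linarith [le_abs_self (ϑ z₀ n)]
  obtain ⟨c₁, hc₁, hv₁⟩ := key v hpos
  obtain ⟨c₂, hc₂, hv₂⟩ := key _ hK1
  obtain ⟨c₃, hc₃, hv₃⟩ := key _ hK2
  obtain ⟨R, hR, hball⟩ := Metric.eventually_nhds_iff_ball.1 (hf.and (hY.and (hv₁.and (hv₂.and hv₃))))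
  -- the dimensions of the trapezoid
  set S := ‖v‖ + ‖n‖ + 1 with hS
  have hSv : ‖v‖ ≤ S := by linarith [norm_nonneg n]
  have hSn : ‖n‖ ≤ S := by linarith [norm_nonneg v]
  have hS1 : 0 < S := by positivity
  set δ := R / (4 * S) with hδ
  have hδ0 : 0 < δ := by positivity
  set ε := min (δ / (2 * K)) δ with hε
  have hε0 : 0 < ε := by positivity
  have hKε : K * ε ≤ δ / 2 := by
    calc K * ε ≤ K * (δ / (2 * K)) := by gcongr; exact min_le_left _ _
      _ = δ / 2 := by field_simp
  have hεδ : ε ≤ δ := min_le_right _ _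
  have hδS : δ * S = R / 4 := by rw [hδ]; field_simp
  have hmem : ∀ t s : ℝ, 0 < t → t ≤ ε → |s| ≤ δ → z₀ + t • n + s • v ∈ Metric.ball z₀ R := by
    intro t s ht hte hs
    rw [Metric.mem_ball, dist_eq_norm]
    calc ‖z₀ + t • n + s • v - z₀‖ = ‖t • n + s • v‖ := by congr 1; abel
      _ ≤ t * ‖n‖ + |s| * ‖v‖ := by
        refine (norm_add_le _ _).trans ?_
        rw [norm_smul, norm_smul, Real.norm_eq_abs, Real.norm_eq_abs, abs_of_pos ht]
      _ ≤ δ * S + δ * S := by gcongr; exact hte.trans hεδ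
      _ < R := by linarith
  have hℓ : ∀ t s : ℝ, ℓ (z₀ + t • n + s • v) = t := by intro t s; simp [hz, hn, hv]
  have hgood := fun (t s : ℝ) (ht : 0 < t) (hte : t ≤ ε) (hs : |s| ≤ δ) =>
    hball _ (hmem t s ht hte hs)
  set Yr := Y (z₀ + ε • n + δ • v)
  set Yl := Y (z₀ + ε • n + (-δ) • v)
  -- The top edge at height `ε` has fixed ends and the bottom edge lies at height `t`. Along the
  -- bottom edge `Y` grows at a rate of at least `c₁ / (Cf * t)`, and its changes along the two legs
  -- only add to this. So the difference at the top exceeds every bound as `t → 0`.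
  have main : ∀ t, 0 < t → t ≤ ε → c₁ / (Cf * t) * δ ≤ Yr - Yl := by
    intro t ht hte
    set σ := δ + K * (t - ε) with hσ
    have hσ1 : δ / 2 ≤ σ := by nlinarith
    have hσ2 : σ ≤ δ := by nlinarith
    have hCf : 0 < Cf * t := by
      obtain ⟨h1, h2⟩ := (hgood t 0 ht hte (by simp [hδ0.le])).1 (by rw [hℓ]; exact ht)
      rw [hℓ] at h2; linarith
    have habs : ∀ s ∈ Icc (-σ) σ, |s| ≤ δ := fun s hs => (abs_le.2 hs).trans hσ2
    have h1 := mul_le_sub_of_le_fderiv (Y := Y) (p := z₀ + t • n) (e := v) (a := -σ) (b := σ)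
      (L := c₁ / (Cf * t)) (by linarith)
      (fun s hs => ((hgood t s ht hte (habs s hs)).2.1 (by rw [hℓ]; exact ht)).1)
      (fun s hs => by
        have hg := hgood t s ht hte (habs s hs)
        have hl : 0 < ℓ (z₀ + t • n + s • v) := by rw [hℓ]; exact ht
        have hfz := hg.1 hl
        refine le_trans ?_ (hg.2.2.1 hl)
        rw [hℓ] at hfz
        exact div_le_div_of_nonneg_left hc₁.le hfz.1 hfz.2)
    have hτ : ∀ s ∈ Icc 0 (ε - t), 0 < t + s ∧ t + s ≤ ε ∧ |σ + K * s| ≤ δ ∧ |-σ - K * s| ≤ δ := by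
      intro s hs
      have h1 : 0 ≤ σ + K * s := by
        have := mul_nonneg hK0.le hs.1; linarith
      have h2 : σ + K * s ≤ δ := by nlinarith [hs.2]
      refine ⟨by linarith [hs.1], by linarith [hs.2], by rwa [abs_of_nonneg h1], ?_⟩
      rw [show -σ - K * s = -(σ + K * s) by ring, abs_neg, abs_of_nonneg h1]; exact h2
    have e2 : ∀ s : ℝ, z₀ + t • n + σ • v + s • (n + K • v)
        = z₀ + (t + s) • n + (σ + K * s) • v := by intro s; module
    have e3 : ∀ s : ℝ, z₀ + t • n + (-σ) • v + s • -(K • v - n)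
        = z₀ + (t + s) • n + (-σ - K * s) • v := by intro s; module
    have h2 := mul_le_sub_of_le_fderiv (Y := Y) (p := z₀ + t • n + σ • v) (e := n + K • v) (a := 0)
      (b := ε - t) (L := 0) (by linarith)
      (fun s hs => by
        rw [e2]
        obtain ⟨ha, hb, hc, hd⟩ := hτ s hs
        exact ((hgood _ _ ha hb hc).2.1 (by rw [hℓ]; exact ha)).1)
      (fun s hs => by
        rw [e2]
        obtain ⟨ha, hb, hc, hd⟩ := hτ s hs
        have hl : 0 < ℓ (z₀ + (t + s) • n + (σ + K * s) • v) := by rw [hℓ]; exact ha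
        have hg := hgood _ _ ha hb hc
        exact (div_nonneg hc₂.le (hg.1 hl).1.le).trans (hg.2.2.2.1 hl))
    have h3 := sub_le_mul_of_fderiv_le (Y := Y) (p := z₀ + t • n + (-σ) • v) (e := -(K • v - n))
      (a := 0) (b := ε - t) (L := 0) (by linarith)
      (fun s hs => by
        rw [e3]
        obtain ⟨ha, hb, hc, hd⟩ := hτ s hs
        exact ((hgood _ _ ha hb hd).2.1 (by rw [hℓ]; exact ha)).1)
      (fun s hs => by
        rw [e3]
        obtain ⟨ha, hb, hc, hd⟩ := hτ s hs
        have hl : 0 < ℓ (z₀ + (t + s) • n + (-σ - K * s) • v) := by rw [hℓ]; exact ha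
        have hg := hgood _ _ ha hb hd
        have := (div_nonneg hc₃.le (hg.1 hl).1.le).trans (hg.2.2.2.2 hl)
        rw [map_neg]; linarith)
    rw [e2, e2] at h2
    rw [e3, e3] at h3
    rw [show t + (ε - t) = ε by ring, show σ + K * (ε - t) = δ by rw [hσ]; ring, add_zero, mul_zero,
      add_zero] at h2
    rw [show t + (ε - t) = ε by ring, show -σ - K * (ε - t) = -δ by rw [hσ]; ring, add_zero,
      mul_zero, sub_zero] at h3
    have h4 : c₁ / (Cf * t) * δ ≤ c₁ / (Cf * t) * (σ - -σ) := by
      gcongr; linarith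
    linarith
  have hCf : 0 < Cf := by
    obtain ⟨h1, h2⟩ := (hgood ε 0 hε0 le_rfl (by simp [hδ0.le])).1 (by rw [hℓ]; exact hε0)
    rw [hℓ] at h2; exact pos_of_mul_pos_left (h1.trans_le h2) hε0.le
  have hbig := main ε hε0 le_rfl
  have hYpos : 0 < Yr - Yl := lt_of_lt_of_le (by positivity) hbig
  -- For this `t` the lower bound in `main` is at least `2 * (Yr - Yl)`.
  set t := min ε (c₁ * δ / (2 * Cf * (Yr - Yl)))
  have ht : 0 < t := by positivity
  have h1 := main t ht (min_le_left _ _)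
  have h2 : t ≤ c₁ * δ / (2 * Cf * (Yr - Yl)) := min_le_right _ _
  rw [div_mul_eq_mul_div, div_le_iff₀ (by positivity)] at h1
  rw [le_div_iff₀ (by positivity)] at h2
  nlinarith [mul_pos hc₁ hδ0]

/-- Let the differential of `X` be `-Θ / f` up to terms of lower order, where `f` vanishes to first
order and `Θ(n) / f ∼ k / t` at the ends of the lines `z₀ + t n` and `z₁ + t n` in the boundary.
Then `k` has the same value at both points. -/
theorem eq_of_fderiv_log_asymptotic {z₀ z₁ n : V} {f X : V → ℝ} {Θ ϑ : V → V →L[ℝ] ℝ} {C c k₀ k₁ ε : ℝ}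
    (hC : 0 ≤ C) (hc : 0 < c) (hε : 0 < ε)
    (hf : ∀ t ∈ Ioc 0 ε, ∀ s ∈ Icc (0 : ℝ) 1, c * t ≤ f (z₀ + t • n + s • (z₁ - z₀)))
    (hX : ∀ t ∈ Ioc 0 ε, ∀ s ∈ Icc (0 : ℝ) 1, DifferentiableAt ℝ X (z₀ + t • n + s • (z₁ - z₀)) ∧
      ∀ v, |fderiv ℝ X (z₀ + t • n + s • (z₁ - z₀)) v
          + Θ (z₀ + t • n + s • (z₁ - z₀)) v / f (z₀ + t • n + s • (z₁ - z₀))|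
        ≤ C * (‖v‖ + |ϑ (z₀ + t • n + s • (z₁ - z₀)) v| / √(f (z₀ + t • n + s • (z₁ - z₀)))))
    (htan : ∀ t ∈ Ioc 0 ε, ∀ s ∈ Icc (0 : ℝ) 1,
      |Θ (z₀ + t • n + s • (z₁ - z₀)) (z₁ - z₀)| ≤ C * t ∧
      |ϑ (z₀ + t • n + s • (z₁ - z₀)) (z₁ - z₀)| ≤ C * t)
    (hnor : ∀ t ∈ Ioc 0 ε, |ϑ (z₀ + t • n) n| ≤ C ∧ |ϑ (z₁ + t • n) n| ≤ C ∧
      |Θ (z₀ + t • n) n / f (z₀ + t • n) - k₀ / t| ≤ C ∧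
      |Θ (z₁ + t • n) n / f (z₁ + t • n) - k₁ / t| ≤ C) :
    k₀ = k₁ := by
  have e0 : ∀ t : ℝ, z₀ + t • n + (0 : ℝ) • (z₁ - z₀) = z₀ + t • n := by intro t; module
  have e1 : ∀ t : ℝ, z₀ + t • n + (1 : ℝ) • (z₁ - z₀) = z₁ + t • n := by intro t; module
  -- the difference of `X` between the two lines is bounded
  obtain ⟨B, hB⟩ : ∃ B, ∀ t ∈ Ioc 0 ε, |X (z₁ + t • n) - X (z₀ + t • n)| ≤ B := by
    -- Tangentially `Θ` and `ϑ` are `O(t)` while `f ≥ c * t`, so the main term is at most `C / c`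
    -- and `|ϑ| / √f` is of order `√t`.
    refine ⟨C / c + C * (‖z₁ - z₀‖ + C * √ε / √c), fun t ht => ?_⟩
    have hbound : ∀ s ∈ Icc (0 : ℝ) 1, |fderiv ℝ X (z₀ + t • n + s • (z₁ - z₀)) (z₁ - z₀)|
        ≤ C / c + C * (‖z₁ - z₀‖ + C * √ε / √c) := by
      intro s hs
      set z := z₀ + t • n + s • (z₁ - z₀)
      have hft : c * t ≤ f z := hf t ht s hs
      have hct : 0 < c * t := mul_pos hc ht.1
      have hf0 : 0 < f z := hct.trans_le hft
      have h1 : |fderiv ℝ X z (z₁ - z₀) + Θ z (z₁ - z₀) / f z|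
        ≤ C * (‖z₁ - z₀‖ + |ϑ z (z₁ - z₀)| / √(f z)) := (hX t ht s hs).2 (z₁ - z₀)
      have h2 : |Θ z (z₁ - z₀)| ≤ C * t := (htan t ht s hs).1
      have h3 : |ϑ z (z₁ - z₀)| ≤ C * t := (htan t ht s hs).2
      have h4 : |Θ z (z₁ - z₀) / f z| ≤ C / c := by
        rw [abs_div, abs_of_pos hf0, div_le_div_iff₀ hf0 hc]
        calc |Θ z (z₁ - z₀)| * c ≤ C * t * c := by gcongr
          _ = C * (c * t) := by ring
          _ ≤ C * f z := by gcongr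
      have h5 : |ϑ z (z₁ - z₀)| / √(f z) ≤ C * √ε / √c := by
        have hst : √(c * t) ≤ √(f z) := Real.sqrt_le_sqrt hft
        have hst0 : 0 < √(c * t) := Real.sqrt_pos.2 hct
        have hCt : 0 ≤ C * t := mul_nonneg hC ht.1.le
        calc |ϑ z (z₁ - z₀)| / √(f z) ≤ C * t / √(c * t) := by
              gcongr
          _ = C * √t / √c := by
              have h6 : √t ≠ 0 := (Real.sqrt_pos.2 ht.1).ne'
              have h7 : √c ≠ 0 := (Real.sqrt_pos.2 hc).ne'
              rw [Real.sqrt_mul hc.le]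
              have : t = √t * √t := (Real.mul_self_sqrt ht.1.le).symm
              field_simp
              nlinarith
          _ ≤ C * √ε / √c := by gcongr; exact ht.2
      have h6 : |fderiv ℝ X z (z₁ - z₀)| ≤ |fderiv ℝ X z (z₁ - z₀) + Θ z (z₁ - z₀) / f z|
          + |Θ z (z₁ - z₀) / f z| := by
        have := abs_sub (fderiv ℝ X z (z₁ - z₀) + Θ z (z₁ - z₀) / f z) (Θ z (z₁ - z₀) / f z)
        rwa [add_sub_cancel_right] at this
      have h7 : C * (‖z₁ - z₀‖ + |ϑ z (z₁ - z₀)| / √(f z))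
          ≤ C * (‖z₁ - z₀‖ + C * √ε / √c) := by gcongr
      linarith
    have h1 := mul_le_sub_of_le_fderiv (Y := X) (p := z₀ + t • n) (e := z₁ - z₀) zero_le_one
      (fun s hs => (hX t ht s hs).1) (fun s hs => (abs_le.1 (hbound s hs)).1)
    have h2 := sub_le_mul_of_fderiv_le (Y := X) (p := z₀ + t • n) (e := z₁ - z₀) zero_le_one
      (fun s hs => (hX t ht s hs).1) (fun s hs => (abs_le.1 (hbound s hs)).2)
    rw [e0, e1] at h1 h2
    rw [abs_le]; constructor <;> linarith
  -- the derivative along the lines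
  have hd0 : ∀ t ∈ Ioc 0 ε, DifferentiableAt ℝ X (z₀ + t • n) ∧
      |fderiv ℝ X (z₀ + t • n) n + k₀ / t| ≤ C + C * (‖n‖ + C / √(c * t)) := by
    intro t ht
    have h1 := hX t ht 0 ⟨le_rfl, zero_le_one⟩
    have h2 := hf t ht 0 ⟨le_rfl, zero_le_one⟩
    rw [e0] at h1 h2
    refine ⟨h1.1, ?_⟩
    have h3 := h1.2 n
    obtain ⟨h4, -, h5, -⟩ := hnor t ht
    have h6 : |ϑ (z₀ + t • n) n| / √(f (z₀ + t • n)) ≤ C / √(c * t) := by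
      have := Real.sqrt_pos.2 (mul_pos hc ht.1)
      gcongr
    have h7 : C * (‖n‖ + |ϑ (z₀ + t • n) n| / √(f (z₀ + t • n))) ≤ C * (‖n‖ + C / √(c * t)) := by
      gcongr
    rw [abs_le] at *
    constructor <;> linarith [h3.1, h3.2, h5.1, h5.2]
  have hd1 : ∀ t ∈ Ioc 0 ε, DifferentiableAt ℝ X (z₁ + t • n) ∧
      |fderiv ℝ X (z₁ + t • n) n + k₁ / t| ≤ C + C * (‖n‖ + C / √(c * t)) := by
    intro t ht
    have h1 := hX t ht 1 ⟨zero_le_one, le_rfl⟩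
    have h2 := hf t ht 1 ⟨zero_le_one, le_rfl⟩
    rw [e1] at h1 h2
    refine ⟨h1.1, ?_⟩
    have h3 := h1.2 n
    obtain ⟨-, h4, -, h5⟩ := hnor t ht
    have h6 : |ϑ (z₁ + t • n) n| / √(f (z₁ + t • n)) ≤ C / √(c * t) := by
      have := Real.sqrt_pos.2 (mul_pos hc ht.1)
      gcongr
    have h7 : C * (‖n‖ + |ϑ (z₁ + t • n) n| / √(f (z₁ + t • n))) ≤ C * (‖n‖ + C / √(c * t)) := by
      gcongr
    rw [abs_le] at *
    constructor <;> linarith [h3.1, h3.2, h5.1, h5.2]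
  by_contra hk
  set Δ := |k₁ - k₀| with hΔ
  have hΔ0 : 0 < Δ := abs_pos.2 (sub_ne_zero.2 (Ne.symm hk))
  obtain ⟨σ, hσ1, hσ2⟩ : ∃ σ : ℝ, |σ| = 1 ∧ σ * (k₁ - k₀) = Δ := by
    rcases le_total 0 (k₁ - k₀) with h | h
    · exact ⟨1, by simp, by rw [hΔ, abs_of_nonneg h, one_mul]⟩
    · exact ⟨-1, by simp, by rw [hΔ, abs_of_nonpos h]; ring⟩
  -- the error terms are dominated by `Δ / t`
  obtain ⟨ε₁, hε₁, hsmall⟩ : ∃ ε₁ > 0, ∀ t ∈ Ioc 0 ε₁,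
      2 * (C + C * (‖n‖ + C / √(c * t))) ≤ Δ / 2 / t := by
    have h1 : ContinuousAt (fun t : ℝ => 2 * (C * t + C * (‖n‖ * t + C / √c * √t))) 0 := by
      fun_prop
    have h1' : (fun t : ℝ => 2 * (C * t + C * (‖n‖ * t + C / √c * √t))) 0 < Δ / 2 := by
      simp only [mul_zero, Real.sqrt_zero, add_zero]; positivity
    have h2 := h1.eventually (gt_mem_nhds h1')
    obtain ⟨e, he, hb⟩ := Metric.eventually_nhds_iff_ball.1 h2
    refine ⟨e / 2, by positivity, fun t ht => ?_⟩
    have h3 := hb t (by rw [Metric.mem_ball, dist_zero_right, Real.norm_eq_abs, abs_of_pos ht.1]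
                        linarith [ht.2])
    rw [le_div_iff₀ ht.1]
    refine le_trans (le_of_eq ?_) h3.le
    have h6 : √t ≠ 0 := (Real.sqrt_pos.2 ht.1).ne'
    have h7 : √c ≠ 0 := (Real.sqrt_pos.2 hc).ne'
    rw [Real.sqrt_mul hc.le]
    have h8 : C / (√c * √t) * t = C / √c * √t := by
      conv_lhs => rw [← Real.mul_self_sqrt ht.1.le]
      rw [Real.sqrt_mul_self (Real.sqrt_nonneg t)]
      field_simp
    linear_combination (2 * C) * h8
  set η := min ε ε₁ with hη
  have hη0 : 0 < η := lt_min hε hε₁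
  -- Up to the sign `σ`, the difference of `X` has derivative close to `-Δ / t`. With `Δ / 2 * log
  -- t` added it is still decreasing in `t`. As the difference is bounded, `log t` would be bounded
  -- below for `t → 0`.
  have hder : ∀ t ∈ Ioc 0 η, HasDerivAt
      (fun t : ℝ => σ * (X (z₁ + t • n) - X (z₀ + t • n)) + Δ / 2 * Real.log t)
      (σ * (fderiv ℝ X (z₁ + t • n) n - fderiv ℝ X (z₀ + t • n) n) + Δ / 2 * t⁻¹) t := by
    intro t ht
    have ht' : t ∈ Ioc 0 ε := ⟨ht.1, ht.2.trans (min_le_left _ _)⟩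
    have hl : ∀ z : V, HasDerivAt (fun s : ℝ => z + s • n) n t := fun z => by
      simpa using ((hasDerivAt_id t).smul_const n).const_add z
    exact ((((hd1 t ht').1.hasFDerivAt.comp_hasDerivAt t (hl z₁)).sub
      ((hd0 t ht').1.hasFDerivAt.comp_hasDerivAt t (hl z₀))).const_mul σ).add
      ((Real.hasDerivAt_log ht.1.ne').const_mul (Δ / 2))
  have hneg : ∀ t ∈ Ioc 0 η,
      σ * (fderiv ℝ X (z₁ + t • n) n - fderiv ℝ X (z₀ + t • n) n) + Δ / 2 * t⁻¹ ≤ 0 := by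
    intro t ht
    have ht' : t ∈ Ioc 0 ε := ⟨ht.1, ht.2.trans (min_le_left _ _)⟩
    have h0 := (hd0 t ht').2
    have h1 := (hd1 t ht').2
    have h2 := hsmall t ⟨ht.1, ht.2.trans (min_le_right _ _)⟩
    set E := C + C * (‖n‖ + C / √(c * t))
    have h3 : |σ * ((fderiv ℝ X (z₁ + t • n) n + k₁ / t) - (fderiv ℝ X (z₀ + t • n) n + k₀ / t))|
        ≤ 2 * E := by
      rw [abs_mul, hσ1, one_mul]
      exact (abs_sub _ _).trans (by linarith)
    have h4 := (abs_le.1 h3).2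
    have h5 : σ * (k₁ / t - k₀ / t) = Δ / t := by rw [← hσ2]; ring
    have h6 : Δ / 2 / t + Δ / 2 / t = Δ / t := by ring
    have h7 : Δ / 2 * t⁻¹ = Δ / 2 / t := rfl
    linarith
  have hmono : ∀ t ∈ Ioc 0 η, σ * (X (z₁ + η • n) - X (z₀ + η • n)) + Δ / 2 * Real.log η
      ≤ σ * (X (z₁ + t • n) - X (z₀ + t • n)) + Δ / 2 * Real.log t := by
    intro t ht
    have hsub : ∀ s ∈ Icc t η, s ∈ Ioc 0 η := fun s hs => ⟨ht.1.trans_le hs.1, hs.2⟩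
    exact antitoneOn_of_deriv_nonpos (convex_Icc t η)
      (fun s hs => (hder s (hsub s hs)).continuousAt.continuousWithinAt)
      (fun s hs => (hder s (hsub s (interior_subset hs))).differentiableAt.differentiableWithinAt)
      (fun s hs => by
        rw [(hder s (hsub s (interior_subset hs))).deriv]
        exact hneg s (hsub s (interior_subset hs)))
      (left_mem_Icc.2 ht.2) (right_mem_Icc.2 ht.2) ht.2
  have hσB : ∀ t ∈ Ioc 0 η, |σ * (X (z₁ + t • n) - X (z₀ + t • n))| ≤ B := by
    intro t ht
    rw [abs_mul, hσ1, one_mul]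
    exact hB t ⟨ht.1, ht.2.trans (min_le_left _ _)⟩
  have hlog : ∀ t ∈ Ioc 0 η, Δ / 2 * Real.log η - 2 * B ≤ Δ / 2 * Real.log t := by
    intro t ht
    have h1 := hmono t ht
    have h2 := (abs_le.1 (hσB t ht)).2
    have h3 := (abs_le.1 (hσB η ⟨hη0, le_rfl⟩)).1
    linarith
  have hlim : Tendsto (fun t => Δ / 2 * Real.log t) (𝓝[>] 0) atBot :=
    Real.tendsto_log_nhdsGT_zero.const_mul_atBot (by positivity)
  have h1 := hlim.eventually (eventually_lt_atBot (Δ / 2 * Real.log η - 2 * B))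
  obtain ⟨t, h2, h3⟩ := (h1.and (Ioc_mem_nhdsGT hη0)).exists
  linarith [hlog t h3]

end HalfBall

end DomainStructure

/-! ### Functions that vanish to first order at the boundary of a half ball -/

namespace DomainStructure

section HalfBall

variable {V : Type*} [NormedAddCommGroup V] [InnerProductSpace ℝ V] [FiniteDimensional ℝ V]

omit [FiniteDimensional ℝ V] in
/-- An estimate of Glaeser type: the derivative of a nonnegative function at a distance `t` from
the boundary of its domain. -/
theorem abs_fderiv_le_of_nonneg {f : V → ℝ} {y n : V} {t K : ℝ} (ht : 0 < t) (hK : 0 ≤ K)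
    (hpos : 0 < f y) (hf : ∀ s ∈ Icc (-t) t, 0 ≤ f (y + s • n))
    (hd : ∀ s ∈ Icc (-t) t, DifferentiableAt ℝ f (y + s • n))
    (hL : ∀ s ∈ Icc (-t) t, |fderiv ℝ f (y + s • n) n - fderiv ℝ f y n| ≤ K * |s|) :
    |fderiv ℝ f y n| ≤ f y / t + (1 + K) * √(f y) := by
  have hstep : ∀ s ∈ Ioc 0 t, |fderiv ℝ f y n| * s ≤ f y + K * s ^ 2 := by
    intro s hs
    have h1 := sub_le_mul_of_fderiv_le (Y := f) (p := y) (e := n) (a := 0) (b := s)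
      (L := fderiv ℝ f y n + K * s) hs.1.le
      (fun u hu => hd u ⟨by linarith [hu.1], hu.2.trans hs.2⟩) (fun u hu => by
        have := (abs_le.1 (hL u ⟨by linarith [hu.1], hu.2.trans hs.2⟩)).2
        rw [abs_of_nonneg hu.1] at this
        nlinarith [hu.2])
    have h2 := mul_le_sub_of_le_fderiv (Y := f) (p := y) (e := n) (a := -s) (b := 0)
      (L := fderiv ℝ f y n - K * s) (by linarith [hs.1])
      (fun u hu => hd u ⟨by linarith [hu.1, hs.2], by linarith [hu.2]⟩) (fun u hu => by
        have := (abs_le.1 (hL u ⟨by linarith [hu.1, hs.2], by linarith [hu.2]⟩)).1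
        rw [abs_of_nonpos hu.2] at this
        nlinarith [hu.1])
    have h3 := hf s ⟨by linarith [hs.1], hs.2⟩
    have h4 := hf (-s) ⟨by linarith [hs.2], by linarith [hs.1]⟩
    rw [zero_smul, add_zero] at h1 h2
    rcases abs_cases (fderiv ℝ f y n) with ⟨h, -⟩ | ⟨h, -⟩ <;> rw [h] <;> nlinarith only [h1, h2, h3, h4]
  have hr : 0 < √(f y) := Real.sqrt_pos.2 hpos
  have hrr : √(f y) * √(f y) = f y := Real.mul_self_sqrt hpos.le
  -- The bound `f / s + K * s` is best for `s` of order `√f`, which is allowed only if `√f ≤ t`;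
  -- otherwise `s = t` is used.
  rcases le_total t √(f y) with h | h
  · have h1 := hstep t ⟨ht, le_rfl⟩
    have h2 : |fderiv ℝ f y n| ≤ f y / t + K * t := by
      rw [div_add' _ _ _ ht.ne', le_div_iff₀ ht]; nlinarith
    nlinarith only [h2, mul_le_mul_of_nonneg_left h hK, hr]
  · have h1 := hstep _ ⟨hr, h⟩
    have h2 : |fderiv ℝ f y n| ≤ (1 + K) * √(f y) := by
      by_contra! h3
      nlinarith only [h1, h3, hrr, hr]
    have : 0 ≤ f y / t := by positivity
    linarith

set_option maxHeartbeats 1000000 in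
/-- Let `f` be positive in a half ball and zero on its boundary, where `r = √f` has a gradient
bounded away from zero in terms of (inverse) metrics `q z` for which the boundary is null. Then `f`
vanishes only to first order at the boundary. -/
theorem fderiv_normal_ne_zero {z₀ n : V} {ℓ : V →L[ℝ] ℝ} (hz : ℓ z₀ = 0) (hn : ℓ n = 1)
    {f : V → ℝ} (hf : ContDiffAt ℝ 2 f z₀) (h0 : ∀ᶠ z in 𝓝 z₀, ℓ z = 0 → f z = 0)
    (hpos : ∀ᶠ z in 𝓝 z₀, 0 < ℓ z → 0 < f z)
    {q : V → (V →L[ℝ] ℝ) →L[ℝ] V} {C c₀ : ℝ} (hc₀ : 0 < c₀)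
    (hq : ∀ᶠ z in 𝓝 z₀, 0 < ℓ z → ‖q z‖ ≤ C ∧ ℓ (q z ℓ) ≤ C * ℓ z ∧
      c₀ ≤ fderiv ℝ (fun y => √(f y)) z (q z (fderiv ℝ (fun y => √(f y)) z))) :
    fderiv ℝ f z₀ n ≠ 0 := by
  -- If the normal derivative vanished at `z₀`, then `f` would be so small on a disc at height `t`
  -- that, at a suitable point, the differential of `√f` has a small tangential part and a normal
  -- part of order at most `t^(-1/2)`. The factor `ℓ (q z ℓ) = O(t)` of a null boundary compensates
  -- the latter, against the lower bound `c₀`.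
  intro hzero
  have hf1 : ContDiffAt ℝ 1 (fderiv ℝ f) z₀ := hf.fderiv_right (by norm_num)
  obtain ⟨K₀, U, hU, hK₀⟩ := hf1.exists_lipschitzOnWith
  have hdiff : ∀ᶠ z in 𝓝 z₀, DifferentiableAt ℝ f z :=
    (hf.eventually (by simp)).mono fun z h => h.differentiableAt (by norm_num)
  obtain ⟨R, hR, hball⟩ := Metric.eventually_nhds_iff_ball.1
    (hdiff.and (h0.and (hpos.and (hq.and (eventually_mem_set.2 hU)))))
  obtain ⟨b, hb⟩ : ∃ x, x = ‖n‖ + 1 := ⟨_, rfl⟩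
  have hb0 : 0 < b := by rw [hb]; positivity
  have hnb : ‖n‖ ≤ b := by linarith
  obtain ⟨K, hK⟩ : ∃ x, x = K₀ * b * b := ⟨_, rfl⟩
  have hK0 : 0 ≤ K := by rw [hK]; positivity
  have hC : 0 ≤ C := by
    set t := R / (2 * b)
    have ht : 0 < t := by positivity
    have hmem : z₀ + t • n ∈ Metric.ball z₀ R := by
      rw [Metric.mem_ball, dist_eq_norm, add_sub_cancel_left, norm_smul, Real.norm_eq_abs,
        abs_of_pos ht]
      calc t * ‖n‖ ≤ t * b := by gcongr
        _ = R / 2 := by simp only [t]; field_simp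
        _ < R := by linarith
    have := ((hball _ hmem).2.2.2.1 (by simp [hz, hn, ht])).1
    exact (ContinuousLinearMap.opNorm_nonneg _).trans this
  have hlip : ∀ z ∈ Metric.ball z₀ R, ∀ z' ∈ Metric.ball z₀ R, ∀ s : ℝ, z' = z + s • n →
      |fderiv ℝ f z' n - fderiv ℝ f z n| ≤ K * |s| := by
    intro z h z' h' s hs
    have h1 := hK₀.norm_sub_le (hball z' h').2.2.2.2 (hball z h).2.2.2.2
    rw [hs, add_sub_cancel_left, norm_smul, Real.norm_eq_abs, ← hs] at h1
    have h2 := (fderiv ℝ f z' - fderiv ℝ f z).le_opNorm n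
    rw [sub_apply, Real.norm_eq_abs] at h2
    calc |fderiv ℝ f z' n - fderiv ℝ f z n| ≤ ‖fderiv ℝ f z' - fderiv ℝ f z‖ * ‖n‖ := h2
      _ ≤ (K₀ * (|s| * b)) * b := by gcongr; exact h1.trans (by gcongr)
      _ = K * |s| := by rw [hK]; ring
  have hin : ∀ (z : V) (s δ : ℝ), ‖z - z₀‖ ≤ δ → δ + |s| * b < R → z + s • n ∈ Metric.ball z₀ R := by
    intro z s δ h1 h2
    rw [Metric.mem_ball, dist_eq_norm]
    calc ‖z + s • n - z₀‖ = ‖(z - z₀) + s • n‖ := by congr 1; abel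
      _ ≤ ‖z - z₀‖ + |s| * ‖n‖ := by
        refine (norm_add_le _ _).trans ?_
        rw [norm_smul, Real.norm_eq_abs]
      _ ≤ δ + |s| * b := by gcongr
      _ < R := h2
  have hℓ : ∀ (z : V) (s : ℝ), ℓ z = 0 → ℓ (z + s • n) = s := by
    intro z s h; simp [h, hn]
  have htaylor : ∀ (z : V) (t δ : ℝ), ℓ z = 0 → ‖z - z₀‖ ≤ δ → 0 < t → δ + t * b < R →
      f (z + t • n) ≤ t * fderiv ℝ f z n + K * t ^ 2 := by
    intro z t δ h1 h2 h3 h4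
    have hz' := hin z 0 δ h2 (by simp; nlinarith [mul_pos h3 hb0])
    rw [zero_smul, add_zero] at hz'
    have hs : ∀ s ∈ Icc 0 t, z + s • n ∈ Metric.ball z₀ R := fun s hs =>
      hin z s δ h2 (by rw [abs_of_nonneg hs.1]; nlinarith only [hs.2, h4, hb0])
    have h5 := sub_le_mul_of_fderiv_le (Y := f) (p := z) (e := n) (a := 0) (b := t)
      (L := fderiv ℝ f z n + K * t) h3.le (fun s h => (hball _ (hs s h)).1) (fun s h => by
        have := (abs_le.1 (hlip z hz' _ (hs s h) s rfl)).2
        rw [abs_of_nonneg h.1] at this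
        nlinarith only [h.2, this, hK0])
    rw [zero_smul, add_zero, (hball z hz').2.1 h1] at h5
    nlinarith only [h5]
  -- The inward derivative cannot be negative, since `f` is zero on the boundary and positive
  -- inside. As it vanishes at `z₀`, this point is a minimum on the boundary, and the tangential
  -- derivatives of the normal derivative vanish there too.
  have hφ : ∀ z, ℓ z = 0 → z ∈ Metric.ball z₀ R → 0 ≤ fderiv ℝ f z n := by
    intro z h1 h2
    rw [Metric.mem_ball, dist_eq_norm] at h2
    by_contra! h3
    set t := min ((R - ‖z - z₀‖) / (2 * b)) (-fderiv ℝ f z n / (2 * (K + 1)))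
    have ht : 0 < t := by
      refine lt_min (div_pos (by linarith) (by positivity)) (div_pos (by linarith) (by positivity))
    have ht1 : t * b ≤ (R - ‖z - z₀‖) / 2 := by
      calc t * b ≤ (R - ‖z - z₀‖) / (2 * b) * b := by gcongr; exact min_le_left _ _
        _ = _ := by field_simp
    have ht2 : t * (K + 1) ≤ -fderiv ℝ f z n / 2 := by
      calc t * (K + 1) ≤ -fderiv ℝ f z n / (2 * (K + 1)) * (K + 1) := by
            gcongr; exact min_le_right _ _
        _ = _ := by field_simp
    have h4 := htaylor z t _ h1 le_rfl ht (by linarith)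
    have h5 := (hball _ (hin z t _ le_rfl (by rw [abs_of_pos ht]; linarith))).2.2.1
      (by rw [hℓ z t h1]; exact ht)
    nlinarith only [h4, h5, ht2, ht, h3, hK0, mul_le_mul_of_nonneg_left ht2 ht.le]
  -- the normal derivative is small near `z₀`
  have hφo : ∀ ε > 0, ∀ᶠ z in 𝓝 z₀, ℓ z = 0 → fderiv ℝ f z n ≤ ε * ‖z - z₀‖ := by
    intro ε hε
    have hd : HasFDerivAt (fun z => fderiv ℝ f z n)
        (fderiv ℝ (fun z => fderiv ℝ f z n) z₀) z₀ :=
      ((hf1.differentiableAt one_ne_zero).clm_apply (differentiableAt_const n)).hasFDerivAt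
    set ψ := fderiv ℝ (fun z => fderiv ℝ f z n) z₀
    have htan : ∀ e, ℓ e = 0 → ψ e = 0 := by
      intro e he
      have hl : HasDerivAt (fun s : ℝ => z₀ + s • e) e 0 := by
        simpa using ((hasDerivAt_id (0 : ℝ)).smul_const e).const_add z₀
      have h1 : HasDerivAt (fun s : ℝ => fderiv ℝ f (z₀ + s • e) n) (ψ e) 0 :=
        HasFDerivAt.comp_hasDerivAt (f := fun s : ℝ => z₀ + s • e)
          (l := fun z => fderiv ℝ f z n) 0 (by simpa using hd) hl
      refine IsLocalMin.hasDerivAt_eq_zero (f := fun s : ℝ => fderiv ℝ f (z₀ + s • e) n) ?_ h1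
      have h2 : Tendsto (fun s : ℝ => z₀ + s • e) (𝓝 0) (𝓝 z₀) := by
        simpa [ContinuousAt] using hl.continuousAt
      filter_upwards [h2 (Metric.ball_mem_nhds z₀ hR)] with s hs
      simp only [zero_smul, add_zero, hzero]
      exact hφ _ (by simp [hz, he]) hs
    have := (hasFDerivAt_iff_isLittleO.1 hd).def hε
    filter_upwards [this] with z h1 h2
    rw [htan (z - z₀) (by simp [hz, h2]), hzero, sub_zero, sub_zero, Real.norm_eq_abs] at h1
    exact (le_abs_self _).trans h1
  -- the choice of the constants
  set L := ‖ℓ‖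
  obtain ⟨N, hN⟩ : ∃ x, x = 1 + L * b := ⟨_, rfl⟩
  have hN0 : 0 < N := by rw [hN]; positivity
  -- `E` collects the coefficients of the four terms of `β (q y β)` at the end: `2` from the normal
  -- part, `8 * L * N` from each mixed term and `32 * N ^ 2` from the tangential part. `N` bounds
  -- the projection to the hyperplane along `n`.
  obtain ⟨E, hE⟩ : ∃ x, x = 2 + 16 * L * N + 32 * N ^ 2 := ⟨_, rfl⟩
  have hE0 : 0 < E := by rw [hE]; positivity
  obtain ⟨ε, hε⟩ : ∃ x, x = c₀ / (2 * (C + 1) * E) := ⟨_, rfl⟩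
  have hε0 : 0 < ε := by rw [hε]; positivity
  obtain ⟨δ₀, hδ₀, hδb⟩ := Metric.eventually_nhds_iff_ball.1 (hφo ε hε0)
  obtain ⟨δ, hδ⟩ : ∃ x, x = min (min (δ₀ / 2) (R / 4)) 1 := ⟨_, rfl⟩
  have hδ0 : 0 < δ := by rw [hδ]; positivity
  have hδ1 : δ ≤ 1 := hδ ▸ min_le_right _ _
  have hδR : δ ≤ R / 4 := hδ ▸ (min_le_left _ _).trans (min_le_right _ _)
  have hδδ : δ < δ₀ := by
    have : δ ≤ δ₀ / 2 := hδ ▸ (min_le_left _ _).trans (min_le_left _ _)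
    linarith
  obtain ⟨t, ht⟩ : ∃ x, x = min (min (ε * δ / (1 + K) ^ 2) δ) (R / (8 * b)) := ⟨_, rfl⟩
  have ht0 : 0 < t := by rw [ht]; positivity
  have htδ : t ≤ δ := ht ▸ (min_le_left _ _).trans (min_le_right _ _)
  have htR : t * b ≤ R / 8 := by
    calc t * b ≤ R / (8 * b) * b := by gcongr; exact ht ▸ min_le_right _ _
      _ = R / 8 := by field_simp
  have htK : (1 + K) ^ 2 * t ≤ ε * δ := by
    calc (1 + K) ^ 2 * t ≤ (1 + K) ^ 2 * (ε * δ / (1 + K) ^ 2) := by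
          gcongr; exact ht ▸ (min_le_left _ _).trans (min_le_left _ _)
      _ = ε * δ := by field_simp
  have htK' : K * t ≤ ε * δ := by
    have : K ≤ (1 + K) ^ 2 := by nlinarith only [hK0]
    exact (mul_le_mul_of_nonneg_right this ht0.le).trans htK
  -- This will bound `√f` on the disc of radius `δ` at height `t`.
  obtain ⟨ρ, hρ⟩ : ∃ x, x = √(2 * ε * δ * t) := ⟨_, rfl⟩
  have hρ0 : 0 < ρ := hρ ▸ Real.sqrt_pos.2 (by positivity)
  have hρ2 : ρ ^ 2 = 2 * ε * δ * t := hρ ▸ Real.sq_sqrt (by positivity)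
  have hpt : ∀ z, ‖z - z₀‖ ≤ δ → z + t • n ∈ Metric.ball z₀ R := fun z h =>
    hin z t δ h (by rw [abs_of_pos ht0]; linarith)
  have hft : ∀ z, ℓ z = 0 → ‖z - z₀‖ ≤ δ → f (z + t • n) ≤ 2 * ε * δ * t := by
    intro z h1 h2
    have h3 := htaylor z t δ h1 h2 ht0 (by linarith)
    have h4 := hδb z (by rw [Metric.mem_ball, dist_eq_norm]; linarith) h1
    have h5 : ε * ‖z - z₀‖ ≤ ε * δ := by gcongr
    calc f (z + t • n) ≤ t * fderiv ℝ f z n + K * t ^ 2 := h3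
      _ ≤ t * (ε * δ) + K * t * t := by rw [sq, mul_assoc]; gcongr; exact h4.trans h5
      _ ≤ t * (ε * δ) + ε * δ * t := by gcongr
      _ = 2 * ε * δ * t := by ring
  have hr : ∀ z, ℓ z = 0 → ‖z - z₀‖ ≤ δ → √(f (z + t • n)) ≤ ρ := fun z h1 h2 =>
    hρ ▸     Real.sqrt_le_sqrt (hft z h1 h2)
  have hfpos : ∀ z, ℓ z = 0 → ‖z - z₀‖ ≤ δ → 0 < f (z + t • n) := fun z h1 h2 =>
    (hball _ (hpt z h2)).2.2.1 (by rw [hℓ z t h1]; exact ht0)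
  -- a penalized maximum of `r` on a disc parallel to the boundary
  obtain ⟨A, hA⟩ : ∃ x, x = 2 * ρ / δ ^ 2 := ⟨_, rfl⟩
  have hA0 : 0 < A := by rw [hA]; positivity
  obtain ⟨w, ⟨hw1, hw2⟩, hw3⟩ : ∃ w ∈ {z | ℓ z = 0} ∩ Metric.closedBall z₀ δ,
      IsMaxOn (fun z => √(f (z + t • n)) - A * ‖z - z₀‖ ^ 2)
        ({z | ℓ z = 0} ∩ Metric.closedBall z₀ δ) w := by
    refine IsCompact.exists_isMaxOn
      ((isCompact_closedBall z₀ δ).inter_left (isClosed_eq ℓ.continuous continuous_const))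
      ⟨z₀, hz, by simp [hδ0.le]⟩ ?_
    intro z hz'
    have h1 : ‖z - z₀‖ ≤ δ := by simpa [dist_eq_norm] using hz'.2
    have h2 : ContinuousAt f (z + t • n) := (hball _ (hpt z h1)).1.continuousAt
    have h3 : ContinuousAt (fun z => f (z + t • n)) z :=
      ContinuousAt.comp (g := f) (f := fun z => z + t • n) h2 (by fun_prop)
    exact ((h3.sqrt).sub (by fun_prop)).continuousWithinAt
  have hw1 : ℓ w = 0 := hw1
  have hw2 : ‖w - z₀‖ ≤ δ := by simpa [dist_eq_norm] using hw2
  -- On the rim of the disc the penalty `A * δ ^ 2 = 2 * ρ` exceeds the bound `ρ` of `√f`, so the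
  -- maximum is interior and the tangential derivative vanishes there.
  have hwδ : ‖w - z₀‖ < δ := by
    have h1 := hw3 (show z₀ ∈ {z | ℓ z = 0} ∩ Metric.closedBall z₀ δ from ⟨hz, by simp [hδ0.le]⟩)
    simp only [mem_ofPred_eq, sub_self, norm_zero] at h1
    have h2 : 0 < √(f (z₀ + t • n)) := Real.sqrt_pos.2 (hfpos z₀ hz (by simp [hδ0.le]))
    have h3 := hr w hw1 hw2
    have h4 : A * ‖w - z₀‖ ^ 2 < ρ := by linarith only [h1, h2, h3]
    by_contra! h5
    have h6 : δ ^ 2 ≤ ‖w - z₀‖ ^ 2 := by gcongr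
    have h7 : A * δ ^ 2 = 2 * ρ := by rw [hA]; field_simp
    nlinarith only [h4, h6, h7, hA0, hρ0]
  obtain ⟨y, hy⟩ : ∃ x, x = w + t • n := ⟨_, rfl⟩
  have hyR : y ∈ Metric.ball z₀ R := hy ▸ hpt w hw2
  have hyℓ : ℓ y = t := hy ▸ hℓ w t hw1
  have hyf : 0 < f y := hy ▸ hfpos w hw1 hw2
  have hry : 0 < √(f y) := Real.sqrt_pos.2 hyf
  have hrd : HasFDerivAt (fun y => √(f y)) ((1 / (2 * √(f y))) • fderiv ℝ f y) y :=
    (hball y hyR).1.hasFDerivAt.sqrt hyf.ne'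
  obtain ⟨β, hβ⟩ : ∃ x, x = fderiv ℝ (fun y => √(f y)) y := ⟨_, rfl⟩
  have hβe : β = (1 / (2 * √(f y))) • fderiv ℝ f y := hβ ▸ hrd.fderiv
  have hrd' : HasFDerivAt (fun y => √(f y)) β y := by rw [hβe]; exact hrd
  -- the tangential part of the differential of `r`
  have htan : ∀ e, ℓ e = 0 → |β e| ≤ 4 * ρ / δ * ‖e‖ := by
    intro e he
    have hl : HasDerivAt (fun s : ℝ => w + t • n + s • e) e 0 := by
      simpa using ((hasDerivAt_id (0 : ℝ)).smul_const e).const_add (w + t • n)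
    have h1 : HasDerivAt (fun s : ℝ => √(f (w + t • n + s • e))) (β e) 0 :=
      HasFDerivAt.comp_hasDerivAt (f := fun s : ℝ => w + t • n + s • e)
        (l := fun y => √(f y)) 0 (by simpa [← hy] using hrd') hl
    have hl2 : HasDerivAt (fun s : ℝ => w + s • e - z₀) e 0 := by
      simpa using (((hasDerivAt_id (0 : ℝ)).smul_const e).const_add w).sub_const z₀
    have h2 := hl2.norm_sq
    have h3 := h1.sub (h2.const_mul A)
    have hmax : IsLocalMax (fun s : ℝ => √(f (w + t • n + s • e)) - A * ‖w + s • e - z₀‖ ^ 2) 0 := by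
      have h5 : Tendsto (fun s : ℝ => ‖w + s • e - z₀‖) (𝓝 0) (𝓝 ‖w - z₀‖) := by
        have := hl2.continuousAt.norm
        simpa [ContinuousAt] using this
      filter_upwards [h5.eventually (gt_mem_nhds hwδ)] with s hs
      have h6 := hw3 (show w + s • e ∈ {z | ℓ z = 0} ∩ Metric.closedBall z₀ δ from
        ⟨by simp [hw1, he], by simpa [dist_eq_norm] using hs.le⟩)
      simp only [mem_ofPred_eq] at h6
      simpa [add_right_comm] using h6
    have h4 := hmax.hasDerivAt_eq_zero h3
    simp only [zero_smul, add_zero] at h4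
    have h5 : β e = A * (2 * inner ℝ (w - z₀) e) := by linarith
    rw [h5, abs_mul, abs_mul, abs_of_pos hA0, abs_two]
    have h6 : |inner ℝ (w - z₀) e| ≤ δ * ‖e‖ :=
      (abs_real_inner_le_norm _ _).trans (by gcongr)
    calc A * (2 * |inner ℝ (w - z₀) e|) ≤ A * (2 * (δ * ‖e‖)) := by gcongr
      _ = 4 * ρ / δ * ‖e‖ := by rw [hA]; field_simp; ring
  obtain ⟨u, hu⟩ : ∃ x, x = β n := ⟨_, rfl⟩
  obtain ⟨η, hη⟩ : ∃ x, x = β - u • ℓ := ⟨_, rfl⟩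
  have hηnorm : ‖η‖ ≤ 4 * ρ / δ * N := by
    refine ContinuousLinearMap.opNorm_le_bound _ (by positivity) fun v => ?_
    have h1 : η v = β (v - ℓ v • n) := by
      simp [hη, hu]; ring
    rw [h1, Real.norm_eq_abs]
    refine (htan _ (by simp [hn])).trans ?_
    have h2 : ‖v - ℓ v • n‖ ≤ N * ‖v‖ := by
      calc ‖v - ℓ v • n‖ ≤ ‖v‖ + ‖ℓ v‖ * ‖n‖ := by
            refine (norm_sub_le _ _).trans ?_
            rw [norm_smul]
        _ ≤ ‖v‖ + (L * ‖v‖) * b := by gcongr; exact ℓ.le_opNorm v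
        _ = N * ‖v‖ := by rw [hN]; ring
    calc 4 * ρ / δ * ‖v - ℓ v • n‖ ≤ 4 * ρ / δ * (N * ‖v‖) := by gcongr
      _ = _ := by ring
  have hη2 : ‖η‖ ^ 2 ≤ 32 * N ^ 2 * ε * (t / δ) := by
    calc ‖η‖ ^ 2 ≤ (4 * ρ / δ * N) ^ 2 := by gcongr
      _ = 16 * N ^ 2 * ρ ^ 2 / δ ^ 2 := by ring
      _ = 32 * N ^ 2 * ε * (t / δ) := by rw [hρ2]; field_simp; ring
  -- the normal part of the differential of `r`
  have hfu : |fderiv ℝ f y n| ≤ f y / t + (1 + K) * √(f y) := by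
    have hs : ∀ s ∈ Icc (-t) t, y + s • n ∈ Metric.ball z₀ R := by
      intro s hs
      rw [show y + s • n = w + (t + s) • n by rw [hy]; module]
      refine hin w _ δ hw2 ?_
      rw [abs_of_nonneg (by linarith [hs.1])]
      nlinarith only [hs.2, hb0, htR, hδR, hR]
    refine abs_fderiv_le_of_nonneg ht0 hK0 hyf (fun s h => ?_) (fun s h => (hball _ (hs s h)).1)
      (fun s h => hlip y hyR _ (hs s h) s rfl)
    have h1 : ℓ (y + s • n) = t + s := by simp [hyℓ, hn]
    rcases (show 0 ≤ t + s by linarith [h.1]).eq_or_lt with h2 | h2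
    · exact ((hball _ (hs s h)).2.1 (by rw [h1]; exact h2.symm)).ge
    · exact ((hball _ (hs s h)).2.2.1 (by rw [h1]; exact h2)).le
  have hub : |u| ≤ (√(f y) / t + (1 + K)) / 2 := by
    rw [hu, hβe, smul_apply, smul_eq_mul, abs_mul, abs_of_pos (by positivity)]
    calc 1 / (2 * √(f y)) * |fderiv ℝ f y n|
        ≤ 1 / (2 * √(f y)) * (f y / t + (1 + K) * √(f y)) := by gcongr
      _ = _ := by
        have : f y = √(f y) ^ 2 := (Real.sq_sqrt hyf.le).symm
        rw [show f y / t = √(f y) ^ 2 / t by rw [← this]]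
        field_simp
  have hu2 : t * u ^ 2 ≤ 2 * ε * δ := by
    have h1 : u ^ 2 ≤ ((√(f y) / t + (1 + K)) / 2) ^ 2 := by
      rw [← sq_abs u]; gcongr
    have h2 : ((√(f y) / t + (1 + K)) / 2) ^ 2 ≤ (f y / t ^ 2 + (1 + K) ^ 2) / 2 := by
      have : f y / t ^ 2 = (√(f y) / t) ^ 2 := by rw [div_pow, Real.sq_sqrt hyf.le]
      rw [this]
      nlinarith only [sq_nonneg (√(f y) / t - (1 + K))]
    have h3 : t * (f y / t ^ 2) ≤ 2 * ε * δ := by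
      have : t * (f y / t ^ 2) = f y / t := by field_simp
      rw [this, div_le_iff₀ ht0]
      rw [hy]; exact hft w hw1 hw2
    calc t * u ^ 2 ≤ t * ((f y / t ^ 2 + (1 + K) ^ 2) / 2) := by gcongr; exact h1.trans h2
      _ = (t * (f y / t ^ 2) + (1 + K) ^ 2 * t) / 2 := by ring
      _ ≤ (2 * ε * δ + ε * δ) / 2 := by gcongr
      _ ≤ 2 * ε * δ := by nlinarith only [mul_pos hε0 hδ0]
  have hcross : |u| * ‖η‖ ≤ 8 * N * ε := by
    refine abs_le_of_sq_le_sq' ?_ (by positivity) |>.2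
    have h1 : u ^ 2 ≤ 2 * ε * δ / t := by rw [le_div_iff₀ ht0]; linarith
    calc (|u| * ‖η‖) ^ 2 = u ^ 2 * ‖η‖ ^ 2 := by rw [mul_pow, sq_abs]
      _ ≤ 2 * ε * δ / t * (32 * N ^ 2 * ε * (t / δ)) := by gcongr
      _ = (8 * N * ε) ^ 2 := by field_simp; ring
  obtain ⟨hq1, hq2, hq3⟩ := (hball y hyR).2.2.2.1 (by rw [hyℓ]; exact ht0)
  rw [← hβ] at hq3
  have hqb : ∀ α γ : V →L[ℝ] ℝ, α (q y γ) ≤ C * (‖α‖ * ‖γ‖) := by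
    intro α γ
    calc α (q y γ) ≤ ‖α‖ * (‖q y‖ * ‖γ‖) :=
          (le_abs_self _).trans ((α.le_opNorm _).trans (by gcongr; exact (q y).le_opNorm γ))
      _ ≤ ‖α‖ * (C * ‖γ‖) := by gcongr
      _ = _ := by ring
  have hβ2 : β = u • ℓ + η := by rw [hη]; abel
  have hexp : β (q y β) = u ^ 2 * ℓ (q y ℓ) + (u • ℓ) (q y η) + η (q y (u • ℓ)) + η (q y η) := by
    rw [hβ2]
    simp only [map_add, map_smul, add_apply, smul_apply, smul_eq_mul]; ring
  -- Here the nullity of the boundary enters: `ℓ (q y ℓ)` is of order `t`, while `u ^ 2` may be of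
  -- order `1 / t`.
  have h1 : u ^ 2 * ℓ (q y ℓ) ≤ C * (2 * ε) := by
    calc u ^ 2 * ℓ (q y ℓ) ≤ u ^ 2 * (C * t) := by gcongr; rw [← hyℓ]; exact hq2
      _ = C * (t * u ^ 2) := by ring
      _ ≤ C * (2 * ε) := by
        refine mul_le_mul_of_nonneg_left (hu2.trans ?_) hC
        exact mul_le_of_le_one_right (by positivity) hδ1
  have h2 : ‖u • ℓ‖ = |u| * L := by rw [norm_smul, Real.norm_eq_abs]
  have h3 : (u • ℓ) (q y η) ≤ C * (8 * L * N * ε) := by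
    calc (u • ℓ) (q y η) ≤ C * (|u| * L * ‖η‖) := by rw [← h2]; exact hqb _ _
      _ = C * (L * (|u| * ‖η‖)) := by ring
      _ ≤ C * (L * (8 * N * ε)) := by gcongr
      _ = _ := by ring
  have h4 : η (q y (u • ℓ)) ≤ C * (8 * L * N * ε) := by
    calc η (q y (u • ℓ)) ≤ C * (‖η‖ * (|u| * L)) := by rw [← h2]; exact hqb _ _
      _ = C * (L * (|u| * ‖η‖)) := by ring
      _ ≤ C * (L * (8 * N * ε)) := by gcongr
      _ = _ := by ring
  have h5 : η (q y η) ≤ C * (32 * N ^ 2 * ε) := by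
    calc η (q y η) ≤ C * (‖η‖ * ‖η‖) := hqb _ _
      _ = C * ‖η‖ ^ 2 := by ring
      _ ≤ C * (32 * N ^ 2 * ε * (t / δ)) := by gcongr
      _ ≤ C * (32 * N ^ 2 * ε * 1) := by
        gcongr; exact (div_le_one hδ0).2 htδ
      _ = _ := by ring
  have h6 : β (q y β) ≤ C * E * ε := by
    rw [hexp, hE]; linarith only [h1, h3, h4, h5]
  have h7 : C * E * ε < c₀ := by
    have : (C + 1) * E * ε = c₀ / 2 := by rw [hε]; field_simp
    have h8 : (C + 1) * E * ε = C * E * ε + E * ε := by ring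
    have h9 := mul_pos hE0 hε0
    linarith only [this, h8, h9, hc₀]
  exact absurd (hq3.trans h6) (not_le.2 h7)

end HalfBall

end DomainStructure

namespace DomainStructure

/-! ### Coordinates -/

section Coordinates

variable {D : ℕ} {M : Type*} [TopologicalSpace M]
  [ChartedSpace (EuclideanSpace ℝ (Fin D)) M] [IsManifold (𝓡 D) ∞ M]

/-- Smooth local coordinates. -/
structure IsSmoothChart (φ : OpenPartialHomeomorph M (EuclideanSpace ℝ (Fin D))) : Prop where
  smooth : ContMDiffOn (𝓡 D) (𝓡 D) ∞ φ φ.source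
  smooth_symm : ContMDiffOn (𝓡 D) (𝓡 D) ∞ φ.symm φ.target

/-- The derivative of the inverse of local coordinates. -/
noncomputable def coordFrame (φ : OpenPartialHomeomorph M (EuclideanSpace ℝ (Fin D)))
    (z : EuclideanSpace ℝ (Fin D)) : EuclideanSpace ℝ (Fin D) →L[ℝ] EuclideanSpace ℝ (Fin D) :=
  (mfderiv (𝓡 D) (𝓡 D) φ.symm z :)

/-- The derivative of local coordinates. -/
noncomputable def coordDeriv (φ : OpenPartialHomeomorph M (EuclideanSpace ℝ (Fin D)))
    (x : M) : EuclideanSpace ℝ (Fin D) →L[ℝ] EuclideanSpace ℝ (Fin D) :=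
  (mfderiv (𝓡 D) (𝓡 D) φ x :)

/-- The Lorentz metric in local coordinates. -/
noncomputable def coordMetric (g : LorentzMetric D M)
    (φ : OpenPartialHomeomorph M (EuclideanSpace ℝ (Fin D))) (z : EuclideanSpace ℝ (Fin D)) :
    EuclideanSpace ℝ (Fin D) →L[ℝ] EuclideanSpace ℝ (Fin D) →L[ℝ] ℝ :=
  ContinuousLinearMap.bilinearComp
    (show EuclideanSpace ℝ (Fin D) →L[ℝ] EuclideanSpace ℝ (Fin D) →L[ℝ] ℝ from g.val (φ.symm z))
    (coordFrame φ z) (coordFrame φ z)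

variable {φ : OpenPartialHomeomorph M (EuclideanSpace ℝ (Fin D))} {g : LorentzMetric D M}

namespace IsSmoothChart

set_option linter.unusedSectionVars false

variable (hφ : IsSmoothChart φ)
include hφ

theorem mdifferentiableAt {x : M} (hx : x ∈ φ.source) : MDifferentiableAt (𝓡 D) (𝓡 D) φ x :=
  ((hφ.smooth x hx).contMDiffAt (φ.open_source.mem_nhds hx)).mdifferentiableAt (by simp)

theorem contMDiffAt_symm {z : EuclideanSpace ℝ (Fin D)} (hz : z ∈ φ.target) :
    ContMDiffAt (𝓡 D) (𝓡 D) ∞ φ.symm z :=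
  (hφ.smooth_symm z hz).contMDiffAt (φ.open_target.mem_nhds hz)

theorem contMDiffAt {x : M} (hx : x ∈ φ.source) :
    ContMDiffAt (𝓡 D) (𝓡 D) ∞ φ x :=
  (hφ.smooth x hx).contMDiffAt (φ.open_source.mem_nhds hx)

theorem mdifferentiableAt_symm {z : EuclideanSpace ℝ (Fin D)} (hz : z ∈ φ.target) :
    MDifferentiableAt (𝓡 D) (𝓡 D) φ.symm z :=
  (hφ.contMDiffAt_symm hz).mdifferentiableAt (by simp)

theorem coordDeriv_coordFrame {z : EuclideanSpace ℝ (Fin D)} (hz : z ∈ φ.target)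
    (v : EuclideanSpace ℝ (Fin D)) : coordDeriv φ (φ.symm z) (coordFrame φ z v) = v := by
  have h1 : mfderiv (𝓡 D) (𝓡 D) (φ ∘ φ.symm) z
      = (mfderiv (𝓡 D) (𝓡 D) φ (φ.symm z)).comp (mfderiv (𝓡 D) (𝓡 D) φ.symm z) :=
    mfderiv_comp z (hφ.mdifferentiableAt (φ.map_target hz)) (hφ.mdifferentiableAt_symm hz)
  have h2 : (φ ∘ φ.symm) =ᶠ[𝓝 z] id := by
    filter_upwards [φ.open_target.mem_nhds hz] with w hw using φ.right_inv hw
  rw [h2.mfderiv_eq] at h1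
  have h3 := congrArg (fun L => L v) h1
  rw [mfderiv_eq_fderiv, fderiv_id] at h3
  exact h3.symm

theorem coordFrame_coordDeriv {x : M} (hx : x ∈ φ.source) (v : EuclideanSpace ℝ (Fin D)) :
    coordFrame φ (φ x) (coordDeriv φ x v) = v := by
  have h1 : mfderiv (𝓡 D) (𝓡 D) (φ.symm ∘ φ) x
      = (mfderiv (𝓡 D) (𝓡 D) φ.symm (φ x)).comp (mfderiv (𝓡 D) (𝓡 D) φ x) :=
    mfderiv_comp x (hφ.mdifferentiableAt_symm (φ.map_source hx)) (hφ.mdifferentiableAt hx)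
  have h2 : (φ.symm ∘ φ) =ᶠ[𝓝 x] id := by
    filter_upwards [φ.open_source.mem_nhds hx] with w hw using φ.left_inv hw
  rw [h2.mfderiv_eq] at h1
  have h3 := congrArg (fun L => L v) h1
  rw [mfderiv_id] at h3
  exact h3.symm

theorem coordFrame_injective {z : EuclideanSpace ℝ (Fin D)} (hz : z ∈ φ.target) :
    Function.Injective (coordFrame φ z) :=
  Function.LeftInverse.injective (hφ.coordDeriv_coordFrame hz)

theorem coordFrame_coordDeriv' {z : EuclideanSpace ℝ (Fin D)} (hz : z ∈ φ.target)
    (v : EuclideanSpace ℝ (Fin D)) : coordFrame φ z (coordDeriv φ (φ.symm z) v) = v := by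
  have := hφ.coordFrame_coordDeriv (φ.map_target hz) v
  rwa [φ.right_inv hz] at this

theorem isLorentz_coordMetric {z : EuclideanSpace ℝ (Fin D)} (hz : z ∈ φ.target) :
    IsLorentz (coordMetric g φ z) := by
  refine ⟨fun v w => g.symm _ _ _, ?_⟩
  obtain ⟨v, hv, hpos⟩ := g.signature (φ.symm z)
  have e : coordFrame φ z (coordDeriv φ (φ.symm z) v) = v := hφ.coordFrame_coordDeriv' hz v
  refine ⟨coordDeriv φ (φ.symm z) v, ?_, fun w hw hw0 => ?_⟩
  · change g.val (φ.symm z) (coordFrame φ z _) (coordFrame φ z _) < 0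
    rw [e]; exact hv
  · change g.val (φ.symm z) (coordFrame φ z _) (coordFrame φ z _) = 0 at hw
    rw [e] at hw
    refine hpos _ hw fun h => hw0 (hφ.coordFrame_injective hz ?_)
    rw [map_zero]; exact h

theorem contMDiffAt_frame {z : EuclideanSpace ℝ (Fin D)} (hz : z ∈ φ.target)
    (v : EuclideanSpace ℝ (Fin D)) :
    ContMDiffAt (𝓡 D) ((𝓡 D).prod (𝓡 D)) ∞
      (fun w => Bundle.TotalSpace.mk' (EuclideanSpace ℝ (Fin D))
        (E := fun x : M => TangentSpace (𝓡 D) x) (φ.symm w)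
        (mfderiv (𝓡 D) (𝓡 D) φ.symm w v)) z := by
  have h1 : ContMDiffOn (𝓡 D).tangent (𝓡 D).tangent ∞
      (tangentMapWithin (𝓡 D) (𝓡 D) φ.symm φ.target)
      (Bundle.TotalSpace.proj ⁻¹' φ.target) :=
    hφ.smooth_symm.contMDiffOn_tangentMapWithin (by simp) φ.open_target.uniqueMDiffOn
  have h2 : ContMDiff (𝓡 D) (𝓡 D).tangent ∞ (fun w : EuclideanSpace ℝ (Fin D) =>
      (⟨w, v⟩ : TangentBundle (𝓡 D) (EuclideanSpace ℝ (Fin D)))) := by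
    intro w
    exact contMDiffAt_vectorSpace_iff_contDiffAt (V := fun _ => v).2 contDiffAt_const
  have h3 := h1.comp (s := φ.target) (f := fun w : EuclideanSpace ℝ (Fin D) =>
      (⟨w, v⟩ : TangentBundle (𝓡 D) (EuclideanSpace ℝ (Fin D)))) h2.contMDiffOn (fun w hw => hw)
  refine ((h3 z hz).contMDiffAt (φ.open_target.mem_nhds hz)).congr_of_eventuallyEq ?_
  filter_upwards [φ.open_target.mem_nhds hz] with w hw
  simp only [Function.comp, tangentMapWithin]
  rw [mfderivWithin_of_isOpen φ.open_target hw]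

theorem contDiffOn_coordMetric : ContDiffOn ℝ ∞ (coordMetric g φ) φ.target := by
  rw [contDiffOn_clm_apply]
  intro u
  rw [contDiffOn_clm_apply]
  intro v z hz
  have h1 := (g.smooth (φ.symm z)).comp z (hφ.contMDiffAt_symm hz)
  have h2 := ContMDiffAt.clm_bundle_apply₂ (𝕜 := ℝ) (F₁ := EuclideanSpace ℝ (Fin D))
    (F₂ := EuclideanSpace ℝ (Fin D)) (F₃ := ℝ) (E₁ := fun x : M => TangentSpace (𝓡 D) x)
    (E₂ := fun x : M => TangentSpace (𝓡 D) x) (E₃ := fun _ : M => ℝ)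
    (b := φ.symm) (ψ := fun w => g.val (φ.symm w))
    (v := fun w => mfderiv (𝓡 D) (𝓡 D) φ.symm w u)
    (w := fun w => mfderiv (𝓡 D) (𝓡 D) φ.symm w v) h1
    (hφ.contMDiffAt_frame hz u) (hφ.contMDiffAt_frame hz v)
  have h3 := (Bundle.contMDiffAt_totalSpace.1 h2).2
  exact (contMDiffAt_iff_contDiffAt.1 h3).contDiffWithinAt

theorem contDiffAt_coordMetric {z : EuclideanSpace ℝ (Fin D)} (hz : z ∈ φ.target) :
    ContDiffAt ℝ ∞ (coordMetric g φ) z :=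
  (hφ.contDiffOn_coordMetric z hz).contDiffAt (φ.open_target.mem_nhds hz)

end IsSmoothChart

theorem isSmoothChart_chartAt (x : M) :
    IsSmoothChart (D := D) (chartAt (EuclideanSpace ℝ (Fin D)) x) :=
  ⟨contMDiffOn_chart, contMDiffOn_chart_symm⟩

end Coordinates

end DomainStructure

/-! ### The flow and the Killing vector fields in local coordinates -/

namespace DomainStructure

section CoordinateFlow

variable {D m : ℕ} {M : Type*} [TopologicalSpace M]
  [ChartedSpace (EuclideanSpace ℝ (Fin D)) M] [IsManifold (𝓡 D) ∞ M]
  {g : LorentzMetric D M} (Φ : IsometricAction g m)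
  (φ : OpenPartialHomeomorph M (EuclideanSpace ℝ (Fin D)))

namespace IsometricAction

/-- The flow in local coordinates. -/
noncomputable def coordFlow (s : Fin (m + 1) → ℝ) (z : EuclideanSpace ℝ (Fin D)) :
    EuclideanSpace ℝ (Fin D) := φ (Φ.flow s (φ.symm z))

/-- The domain of the flow in local coordinates. -/
def coordFlowDomain : Set ((Fin (m + 1) → ℝ) × EuclideanSpace ℝ (Fin D)) :=
  {p | p.2 ∈ φ.target ∧ Φ.flow p.1 (φ.symm p.2) ∈ φ.source}

/-- The Killing vector fields in local coordinates. -/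
noncomputable def coordKilling (z : EuclideanSpace ℝ (Fin D)) :
    (Fin (m + 1) → ℝ) →L[ℝ] EuclideanSpace ℝ (Fin D) :=
  fderiv ℝ (fun s => Φ.coordFlow φ s z) 0

/-- The derivative of the flow in local coordinates. -/
noncomputable def coordFlowDeriv (s : Fin (m + 1) → ℝ) (z : EuclideanSpace ℝ (Fin D)) :
    EuclideanSpace ℝ (Fin D) →L[ℝ] EuclideanSpace ℝ (Fin D) :=
  fderiv ℝ (fun w => Φ.coordFlow φ s w) z

variable {φ}

theorem isOpen_coordFlowDomain : IsOpen (Φ.coordFlowDomain φ) := by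
  have h : ContinuousOn (fun p : (Fin (m + 1) → ℝ) × EuclideanSpace ℝ (Fin D) =>
      Φ.flow p.1 (φ.symm p.2)) {p | p.2 ∈ φ.target} :=
    Φ.continuous_flow.comp_continuousOn
      (continuousOn_fst.prodMk (φ.continuousOn_symm.comp continuousOn_snd fun _ h => h))
  exact h.isOpen_inter_preimage (φ.open_target.preimage continuous_snd) φ.open_source

theorem mem_coordFlowDomain_zero {z : EuclideanSpace ℝ (Fin D)} (hz : z ∈ φ.target) :
    ((0 : Fin (m + 1) → ℝ), z) ∈ Φ.coordFlowDomain φ :=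
  ⟨hz, by rw [Φ.flow_zero]; exact φ.map_target hz⟩

theorem coordFlow_zero {z : EuclideanSpace ℝ (Fin D)} (hz : z ∈ φ.target) :
    Φ.coordFlow φ 0 z = z := by
  rw [coordFlow, Φ.flow_zero, φ.right_inv hz]

theorem symm_coordFlow {s : Fin (m + 1) → ℝ} {z : EuclideanSpace ℝ (Fin D)}
    (h : (s, z) ∈ Φ.coordFlowDomain φ) :
    φ.symm (Φ.coordFlow φ s z) = Φ.flow s (φ.symm z) := φ.left_inv h.2

theorem coordFlow_mem_target {s : Fin (m + 1) → ℝ} {z : EuclideanSpace ℝ (Fin D)}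
    (h : (s, z) ∈ Φ.coordFlowDomain φ) : Φ.coordFlow φ s z ∈ φ.target := φ.map_source h.2

theorem coordFlow_add (s : Fin (m + 1) → ℝ) {t : Fin (m + 1) → ℝ} {z : EuclideanSpace ℝ (Fin D)}
    (h : (t, z) ∈ Φ.coordFlowDomain φ) :
    Φ.coordFlow φ (s + t) z = Φ.coordFlow φ s (Φ.coordFlow φ t z) := by
  rw [coordFlow, Φ.flow_add, coordFlow, Φ.symm_coordFlow h]

variable (hφ : IsSmoothChart φ)
include hφ

theorem contDiffAt_coordFlow {s : Fin (m + 1) → ℝ} {z : EuclideanSpace ℝ (Fin D)}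
    (h : (s, z) ∈ Φ.coordFlowDomain φ) :
    ContDiffAt ℝ ∞ (fun p : (Fin (m + 1) → ℝ) × EuclideanSpace ℝ (Fin D) =>
      Φ.coordFlow φ p.1 p.2) (s, z) := by
  rw [← contMDiffAt_iff_contDiffAt]
  have h1 : ContMDiffAt 𝓘(ℝ, (Fin (m + 1) → ℝ) × EuclideanSpace ℝ (Fin D))
      (𝓘(ℝ, Fin (m + 1) → ℝ).prod (𝓡 D)) ∞
      (fun p : (Fin (m + 1) → ℝ) × EuclideanSpace ℝ (Fin D) => (p.1, φ.symm p.2)) (s, z) :=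
    (contDiff_fst.contMDiff _).prodMk
      (ContMDiffAt.comp (s, z) (hφ.contMDiffAt_symm h.1) (contDiff_snd.contMDiff _))
  exact ContMDiffAt.comp (s, z) (hφ.contMDiffAt h.2)
    (ContMDiffAt.comp (s, z) (Φ.smooth _) h1)

theorem differentiableAt_coordFlow {s : Fin (m + 1) → ℝ} {z : EuclideanSpace ℝ (Fin D)}
    (h : (s, z) ∈ Φ.coordFlowDomain φ) :
    DifferentiableAt ℝ (fun w => Φ.coordFlow φ s w) z := by
  have h1 := (Φ.contDiffAt_coordFlow hφ h).differentiableAt (by simp)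
  exact DifferentiableAt.comp (f := fun w => (s, w)) z h1 (by fun_prop)

theorem hasFDerivAt_coordFlow {s : Fin (m + 1) → ℝ} {z : EuclideanSpace ℝ (Fin D)}
    (h : (s, z) ∈ Φ.coordFlowDomain φ) :
    HasFDerivAt (fun w => Φ.coordFlow φ s w) (Φ.coordFlowDeriv φ s z) z :=
  (Φ.differentiableAt_coordFlow hφ h).hasFDerivAt

theorem hasFDerivAt_coordFlow_time {z : EuclideanSpace ℝ (Fin D)} (hz : z ∈ φ.target) :
    HasFDerivAt (fun s => Φ.coordFlow φ s z) (Φ.coordKilling φ z) 0 := by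
  have h1 := (Φ.contDiffAt_coordFlow hφ (Φ.mem_coordFlowDomain_zero hz)).differentiableAt (by simp)
  exact (DifferentiableAt.comp (f := fun s => (s, z)) (0 : Fin (m + 1) → ℝ) h1
    (by fun_prop)).hasFDerivAt

theorem contDiffAt_coordKilling {z : EuclideanSpace ℝ (Fin D)} (hz : z ∈ φ.target) :
    ContDiffAt ℝ ∞ (Φ.coordKilling φ) z := by
  have h1 : ContDiffAt ℝ ∞ (Function.uncurry fun (w : EuclideanSpace ℝ (Fin D))
      (s : Fin (m + 1) → ℝ) => Φ.coordFlow φ s w) (z, 0) :=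
    ContDiffAt.comp (f := fun p : EuclideanSpace ℝ (Fin D) × (Fin (m + 1) → ℝ) => (p.2, p.1))
      (z, 0) (Φ.contDiffAt_coordFlow hφ (Φ.mem_coordFlowDomain_zero hz))
      (contDiffAt_snd.prodMk contDiffAt_fst)
  exact h1.fderiv (g := fun _ => (0 : Fin (m + 1) → ℝ)) contDiffAt_const (by simp)

theorem contDiffAt_coordFlowDeriv {s : Fin (m + 1) → ℝ} {z : EuclideanSpace ℝ (Fin D)}
    (h : (s, z) ∈ Φ.coordFlowDomain φ) :
    ContDiffAt ℝ ∞ (fun p : (Fin (m + 1) → ℝ) × EuclideanSpace ℝ (Fin D) =>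
      Φ.coordFlowDeriv φ p.1 p.2) (s, z) := by
  have h1 : ContDiffAt ℝ ∞ (Function.uncurry
      fun (p : (Fin (m + 1) → ℝ) × EuclideanSpace ℝ (Fin D)) (w : EuclideanSpace ℝ (Fin D)) =>
        Φ.coordFlow φ p.1 w) ((s, z), z) :=
    ContDiffAt.comp (f := fun q : ((Fin (m + 1) → ℝ) × EuclideanSpace ℝ (Fin D)) ×
        EuclideanSpace ℝ (Fin D) => (q.1.1, q.2))
      ((s, z), z) (Φ.contDiffAt_coordFlow hφ h) (by fun_prop)
  exact h1.fderiv (g := fun p : (Fin (m + 1) → ℝ) × EuclideanSpace ℝ (Fin D) => p.2)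
    contDiffAt_snd (by simp)

theorem coordKilling_eq {z : EuclideanSpace ℝ (Fin D)} (hz : z ∈ φ.target)
    (a : Fin (m + 1) → ℝ) :
    Φ.coordKilling φ z a = coordDeriv φ (φ.symm z) (Φ.killing a (φ.symm z)) := by
  have hA : MDifferentiableAt (𝓡 D) (𝓡 D) φ (φ.symm z) := hφ.mdifferentiableAt (φ.map_target hz)
  have hB : MDifferentiableAt 𝓘(ℝ, Fin (m + 1) → ℝ) (𝓡 D) (fun t => Φ.flow t (φ.symm z)) 0 :=
    (Φ.contMDiff_orbit (φ.symm z)).mdifferentiable (by simp) 0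
  have := mfderiv_comp_apply_of_eq 0 hA hB (Φ.flow_zero (φ.symm z)) a
  rw [mfderiv_eq_fderiv] at this
  exact this

theorem coordFrame_coordKilling {z : EuclideanSpace ℝ (Fin D)} (hz : z ∈ φ.target)
    (a : Fin (m + 1) → ℝ) :
    coordFrame φ z (Φ.coordKilling φ z a) = Φ.killing a (φ.symm z) := by
  rw [Φ.coordKilling_eq hφ hz]; exact hφ.coordFrame_coordDeriv' hz _

theorem coordKilling_eq_zero_iff {z : EuclideanSpace ℝ (Fin D)} (hz : z ∈ φ.target)
    (a : Fin (m + 1) → ℝ) :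
    Φ.coordKilling φ z a = 0 ↔ Φ.killing a (φ.symm z) = 0 := by
  rw [← Φ.coordFrame_coordKilling hφ hz]
  constructor
  · intro h; rw [h, map_zero]; rfl
  · intro h; exact hφ.coordFrame_injective hz (by rw [map_zero]; exact h)

theorem dotProduct_G_coord {z : EuclideanSpace ℝ (Fin D)} (hz : z ∈ φ.target)
    (a b : Fin (m + 1) → ℝ) :
    a ⬝ᵥ (Φ.G (φ.symm z) *ᵥ b) =
      coordMetric g φ z (Φ.coordKilling φ z a) (Φ.coordKilling φ z b) := by
  rw [Φ.dotProduct_G, ← Φ.coordFrame_coordKilling hφ hz, ← Φ.coordFrame_coordKilling hφ hz]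
  rfl

omit hφ in
theorem coordFlowDeriv_zero {z : EuclideanSpace ℝ (Fin D)} (hz : z ∈ φ.target) :
    Φ.coordFlowDeriv φ 0 z = ContinuousLinearMap.id ℝ _ := by
  have : (fun w => Φ.coordFlow φ 0 w) =ᶠ[𝓝 z] id := by
    filter_upwards [φ.open_target.mem_nhds hz] with w hw using Φ.coordFlow_zero hw
  rw [coordFlowDeriv, this.fderiv_eq, fderiv_id]

omit hφ in
theorem eventually_mem_coordFlowDomain {s : Fin (m + 1) → ℝ} {z : EuclideanSpace ℝ (Fin D)}
    (h : (s, z) ∈ Φ.coordFlowDomain φ) : ∀ᶠ w in 𝓝 z, (s, w) ∈ Φ.coordFlowDomain φ :=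
  (Continuous.prodMk_right s).continuousAt.eventually
    (Φ.isOpen_coordFlowDomain.mem_nhds h)

omit hφ in
theorem coordFlowDomain_add {s t : Fin (m + 1) → ℝ} {z : EuclideanSpace ℝ (Fin D)}
    (ht : (t, z) ∈ Φ.coordFlowDomain φ) :
    (s + t, z) ∈ Φ.coordFlowDomain φ ↔ (s, Φ.coordFlow φ t z) ∈ Φ.coordFlowDomain φ := by
  simp only [coordFlowDomain, mem_ofPred_eq, Φ.flow_add, Φ.symm_coordFlow ht,
    Φ.coordFlow_mem_target ht, ht.1]

theorem coordFlowDeriv_add {s t : Fin (m + 1) → ℝ} {z : EuclideanSpace ℝ (Fin D)}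
    (ht : (t, z) ∈ Φ.coordFlowDomain φ) (hs : (s + t, z) ∈ Φ.coordFlowDomain φ) :
    Φ.coordFlowDeriv φ (s + t) z
      = (Φ.coordFlowDeriv φ s (Φ.coordFlow φ t z)).comp (Φ.coordFlowDeriv φ t z) := by
  have h1 : (fun w => Φ.coordFlow φ (s + t) w)
      =ᶠ[𝓝 z] (fun w => Φ.coordFlow φ s w) ∘ fun w => Φ.coordFlow φ t w := by
    filter_upwards [Φ.eventually_mem_coordFlowDomain ht] with w hw using Φ.coordFlow_add s hw
  rw [coordFlowDeriv, h1.fderiv_eq]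
  exact (HasFDerivAt.comp z
    (Φ.hasFDerivAt_coordFlow hφ ((Φ.coordFlowDomain_add ht).1 hs))
    (Φ.hasFDerivAt_coordFlow hφ ht)).fderiv

/-- The group is abelian, so `flow s` commutes with the flows of the Killing vector fields and
preserves these fields. -/
theorem coordKilling_coordFlow {s : Fin (m + 1) → ℝ} {z : EuclideanSpace ℝ (Fin D)}
    (h : (s, z) ∈ Φ.coordFlowDomain φ) (a : Fin (m + 1) → ℝ) :
    Φ.coordKilling φ (Φ.coordFlow φ s z) a = Φ.coordFlowDeriv φ s z (Φ.coordKilling φ z a) := by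
  have h1 : (fun t => Φ.coordFlow φ t (Φ.coordFlow φ s z))
      =ᶠ[𝓝 0] (fun w => Φ.coordFlow φ s w) ∘ fun t => Φ.coordFlow φ t z := by
    have : ∀ᶠ t in 𝓝 (0 : Fin (m + 1) → ℝ), (t, z) ∈ Φ.coordFlowDomain φ :=
      (Continuous.prodMk_left z).continuousAt.eventually
        (Φ.isOpen_coordFlowDomain.mem_nhds (Φ.mem_coordFlowDomain_zero h.1))
    filter_upwards [this] with t ht
    simp only [Function.comp]
    rw [← Φ.coordFlow_add _ h, ← Φ.coordFlow_add _ ht, add_comm]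
  have h2 := (Φ.hasFDerivAt_coordFlow_time hφ (Φ.coordFlow_mem_target h)).congr_of_eventuallyEq
    h1.symm
  have h3 : HasFDerivAt ((fun w => Φ.coordFlow φ s w) ∘ fun t => Φ.coordFlow φ t z)
      ((Φ.coordFlowDeriv φ s z).comp (Φ.coordKilling φ z)) 0 := by
    refine HasFDerivAt.comp 0 ?_ (Φ.hasFDerivAt_coordFlow_time hφ h.1)
    rw [Φ.coordFlow_zero h.1]
    exact Φ.hasFDerivAt_coordFlow hφ h
  rw [h2.unique h3]; rfl

theorem coordMetric_coordFlow {s : Fin (m + 1) → ℝ} {z : EuclideanSpace ℝ (Fin D)}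
    (h : (s, z) ∈ Φ.coordFlowDomain φ) (u v : EuclideanSpace ℝ (Fin D)) :
    coordMetric g φ (Φ.coordFlow φ s z) (Φ.coordFlowDeriv φ s z u) (Φ.coordFlowDeriv φ s z v)
      = coordMetric g φ z u v := by
  have key : ∀ u, coordFrame φ (Φ.coordFlow φ s z) (Φ.coordFlowDeriv φ s z u)
      = (mfderiv (𝓡 D) (𝓡 D) (Φ.flow s) (φ.symm z) (coordFrame φ z u) :) := by
    intro u
    have h1 : φ.symm ∘ (fun w => Φ.coordFlow φ s w) =ᶠ[𝓝 z] Φ.flow s ∘ φ.symm := by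
      filter_upwards [Φ.eventually_mem_coordFlowDomain h] with w hw using Φ.symm_coordFlow hw
    have h2 : mfderiv (𝓡 D) (𝓡 D) (Φ.flow s ∘ φ.symm) z
        = (mfderiv (𝓡 D) (𝓡 D) (Φ.flow s) (φ.symm z)).comp (mfderiv (𝓡 D) (𝓡 D) φ.symm z) :=
      mfderiv_comp z ((Φ.contMDiff_flow s).mdifferentiable (by simp) _)
        (hφ.mdifferentiableAt_symm h.1)
    have h3 : mfderiv (𝓡 D) (𝓡 D) (φ.symm ∘ (fun w => Φ.coordFlow φ s w)) z
        = (mfderiv (𝓡 D) (𝓡 D) φ.symm (Φ.coordFlow φ s z)).comp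
          (mfderiv (𝓡 D) (𝓡 D) (fun w => Φ.coordFlow φ s w) z) :=
      mfderiv_comp z (hφ.mdifferentiableAt_symm (Φ.coordFlow_mem_target h))
        (Φ.differentiableAt_coordFlow hφ h).mdifferentiableAt
    rw [h1.mfderiv_eq, h2, mfderiv_eq_fderiv] at h3
    exact (congrArg (fun L => L u) h3).symm
  have h4 := Φ.isometry s (φ.symm z) (coordFrame φ z u) (coordFrame φ z v)
  have h5 : coordMetric g φ (Φ.coordFlow φ s z) (Φ.coordFlowDeriv φ s z u)
      (Φ.coordFlowDeriv φ s z v) = g.val (φ.symm (Φ.coordFlow φ s z))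
        (coordFrame φ (Φ.coordFlow φ s z) (Φ.coordFlowDeriv φ s z u))
        (coordFrame φ (Φ.coordFlow φ s z) (Φ.coordFlowDeriv φ s z v)) := rfl
  rw [h5, key, key, Φ.symm_coordFlow h]
  exact h4

/-- The orbits in local coordinates are integral curves of the Killing vector fields. -/
theorem hasDerivAt_coordFlow_smul {z : EuclideanSpace ℝ (Fin D)} {a : Fin (m + 1) → ℝ} {t : ℝ}
    (h : (t • a, z) ∈ Φ.coordFlowDomain φ) :
    HasDerivAt (fun t : ℝ => Φ.coordFlow φ (t • a) z)
      (Φ.coordKilling φ (Φ.coordFlow φ (t • a) z) a) t := by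
  have h1 : (fun τ : ℝ => Φ.coordFlow φ (τ • a) z)
      = (fun s => Φ.coordFlow φ s (Φ.coordFlow φ (t • a) z)) ∘ fun τ : ℝ => (τ - t) • a := by
    funext τ
    simp only [Function.comp]
    rw [← Φ.coordFlow_add _ h, ← add_smul, sub_add_cancel]
  rw [h1]
  have h2 : HasDerivAt (fun τ : ℝ => (τ - t) • a) a t := by
    simpa using ((hasDerivAt_id t).sub_const t).smul_const a
  refine HasFDerivAt.comp_hasDerivAt t ?_ h2
  rw [sub_self, zero_smul]
  exact Φ.hasFDerivAt_coordFlow_time hφ (Φ.coordFlow_mem_target h)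

end IsometricAction

end CoordinateFlow

end DomainStructure

/-! ### Zeros of the Killing vector fields, and the exterior region -/

namespace DomainStructure

section Exterior

variable {D m : ℕ} {M : Type*} [TopologicalSpace M]
  [ChartedSpace (EuclideanSpace ℝ (Fin D)) M] [IsManifold (𝓡 D) ∞ M]
  {g : LorentzMetric D M} (Φ : IsometricAction g m)

theorem exists_isSmoothChart (x : M) :
    ∃ φ : OpenPartialHomeomorph M (EuclideanSpace ℝ (Fin D)), IsSmoothChart φ ∧ x ∈ φ.source :=
  ⟨chartAt _ x, isSmoothChart_chartAt x, mem_chart_source _ x⟩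

namespace IsometricAction

theorem killing_flow_eq_zero {a : Fin (m + 1) → ℝ} {x : M} (h : Φ.killing a x = 0)
    (s : Fin (m + 1) → ℝ) : Φ.killing a (Φ.flow s x) = 0 := by
  rw [killing_flow, h]; exact map_zero (mfderiv (𝓡 D) (𝓡 D) (Φ.flow s) x)

/-- By invariance under the flow, the field vanishes along the whole curve `t ↦ flow (t • a) x`. In
charts this curve has derivative zero, so it is locally constant; uniqueness for differential
equations is not needed. -/
theorem flow_smul_eq_of_killing_eq_zero [T2Space M] {a : Fin (m + 1) → ℝ} {x : M}
    (h : Φ.killing a x = 0) (t : ℝ) : Φ.flow (t • a) x = x := by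
  have hloc : IsLocallyConstant fun t : ℝ => Φ.flow (t • a) x := by
    rw [IsLocallyConstant.iff_eventually_eq]
    intro t₀
    set y := Φ.flow (t₀ • a) x with hy
    have hy0 : Φ.killing a y = 0 := Φ.killing_flow_eq_zero h _
    obtain ⟨φ, hφ, hyφ⟩ := exists_isSmoothChart (D := D) y
    set z := φ y
    have hz : z ∈ φ.target := φ.map_source hyφ
    have hψz : φ.symm z = y := φ.left_inv hyφ
    have hopen : {τ : ℝ | (τ • a, z) ∈ Φ.coordFlowDomain φ} ∈ 𝓝 (0 : ℝ) := by
      refine ContinuousAt.preimage_mem_nhds (f := fun τ : ℝ => (τ • a, z)) (by fun_prop) ?_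
      simpa using Φ.isOpen_coordFlowDomain.mem_nhds (Φ.mem_coordFlowDomain_zero hz)
    obtain ⟨ε, hε, hball⟩ := Metric.mem_nhds_iff.1 hopen
    have hconst : ∀ τ ∈ Metric.ball (0 : ℝ) ε, Φ.flow (τ • a) y = y := by
      intro τ hτ
      have hd : ∀ σ ∈ Metric.ball (0 : ℝ) ε,
          HasDerivAt (fun t : ℝ => Φ.coordFlow φ (t • a) z) 0 σ := by
        intro σ hσ
        have h1 := Φ.hasDerivAt_coordFlow_smul hφ (hball hσ)
        rwa [Φ.coordKilling_coordFlow hφ (hball hσ),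
          (Φ.coordKilling_eq_zero_iff hφ hz a).2 (by rw [hψz]; exact hy0), map_zero] at h1
      have := (Metric.isOpen_ball : IsOpen (Metric.ball (0 : ℝ) ε)).is_const_of_deriv_eq_zero
        (convex_ball 0 ε).isPreconnected
        (fun σ hσ => (hd σ hσ).differentiableAt.differentiableWithinAt)
        (fun σ hσ => (hd σ hσ).deriv) hτ (Metric.mem_ball_self hε)
      simp only [zero_smul, Φ.coordFlow_zero hz] at this
      have h2 := Φ.symm_coordFlow (hball hτ)
      rw [this, hψz] at h2
      exact h2.symm
    have : ∀ᶠ t in 𝓝 t₀, t - t₀ ∈ Metric.ball (0 : ℝ) ε := by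
      refine ContinuousAt.preimage_mem_nhds (f := fun t : ℝ => t - t₀) (by fun_prop) ?_
      rw [sub_self]; exact Metric.ball_mem_nhds _ hε
    filter_upwards [this] with t ht
    have h3 := hconst _ ht
    rw [hy, ← Φ.flow_add, ← add_smul, sub_add_cancel] at h3
    exact h3
  have := hloc.apply_eq_of_preconnectedSpace t 0
  simpa [Φ.flow_zero] using this

theorem killing_eq_zero_of_flow_eventually {a : Fin (m + 1) → ℝ} {x : M}
    (h : ∀ᶠ t : ℝ in 𝓝 0, Φ.flow (t • a) x = x) : Φ.killing a x = 0 := by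
  obtain ⟨φ, hφ, hxφ⟩ := exists_isSmoothChart (D := D) x
  have hz : φ x ∈ φ.target := φ.map_source hxφ
  have h1 := Φ.hasDerivAt_coordFlow_smul (a := a) (t := 0) hφ
    (by simpa using Φ.mem_coordFlowDomain_zero hz)
  have h2 : (fun t : ℝ => Φ.coordFlow φ (t • a) (φ x)) =ᶠ[𝓝 0] fun _ => φ x := by
    filter_upwards [h] with t ht
    rw [coordFlow, φ.left_inv hxφ, ht]
  have h3 := (h1.congr_of_eventuallyEq h2.symm).unique (hasDerivAt_const _ _)
  rw [zero_smul, Φ.coordFlow_zero hz, Φ.coordKilling_eq_zero_iff hφ hz, φ.left_inv hxφ] at h3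
  exact h3

theorem killing_eq_zero_iff_flow [T2Space M] {a : Fin (m + 1) → ℝ} {x : M} :
    Φ.killing a x = 0 ↔ ∀ t : ℝ, Φ.flow (t • a) x = x :=
  ⟨Φ.flow_smul_eq_of_killing_eq_zero,
    fun h => Φ.killing_eq_zero_of_flow_eventually (Eventually.of_forall h)⟩

/-! ### Continuity of `G` -/

theorem G_apply (x : M) (i j : Fin (m + 1)) :
    Φ.G x i j = (Pi.single i 1 : Fin (m + 1) → ℝ) ⬝ᵥ (Φ.G x *ᵥ Pi.single j 1) := by
  simp

theorem contDiffAt_G_coord {φ : OpenPartialHomeomorph M (EuclideanSpace ℝ (Fin D))}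
    (hφ : IsSmoothChart φ) {z : EuclideanSpace ℝ (Fin D)} (hz : z ∈ φ.target)
    (i j : Fin (m + 1)) : ContDiffAt ℝ ∞ (fun w => Φ.G (φ.symm w) i j) z := by
  have h1 : ContDiffAt ℝ ∞ (fun w => coordMetric g φ w (Φ.coordKilling φ w (Pi.single i 1))
      (Φ.coordKilling φ w (Pi.single j 1))) z :=
    ((hφ.contDiffAt_coordMetric hz).clm_apply
      ((Φ.contDiffAt_coordKilling hφ hz).clm_apply contDiffAt_const)).clm_apply
      ((Φ.contDiffAt_coordKilling hφ hz).clm_apply contDiffAt_const)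
  refine h1.congr_of_eventuallyEq ?_
  filter_upwards [φ.open_target.mem_nhds hz] with w hw
  rw [G_apply, Φ.dotProduct_G_coord hφ hw]

theorem continuous_G : Continuous Φ.G := by
  refine continuous_matrix fun i j => ?_
  rw [continuous_iff_continuousAt]
  intro x
  obtain ⟨φ, hφ, hx⟩ := exists_isSmoothChart (D := D) x
  have h1 : ContinuousAt ((fun w => Φ.G (φ.symm w) i j) ∘ φ) x :=
    ContinuousAt.comp (Φ.contDiffAt_G_coord hφ (φ.map_source hx) i j).continuousAt
      (φ.continuousAt hx)
  refine h1.congr ?_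
  filter_upwards [φ.open_source.mem_nhds hx] with y hy
  simp [φ.left_inv hy]

theorem continuous_dotProduct_G :
    Continuous fun p : (Fin (m + 1) → ℝ) × M => p.1 ⬝ᵥ (Φ.G p.2 *ᵥ p.1) :=
  continuous_fst.dotProduct ((Φ.continuous_G.comp continuous_snd).matrix_mulVec continuous_fst)

theorem continuous_dotProduct_G_right (a b : Fin (m + 1) → ℝ) :
    Continuous fun x : M => a ⬝ᵥ (Φ.G x *ᵥ b) :=
  continuous_const.dotProduct (Φ.continuous_G.matrix_mulVec continuous_const)

theorem isOpen_timelikeOrbits : IsOpen Φ.timelikeOrbits := by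
  have : Φ.timelikeOrbits = ⋃ a : Fin (m + 1) → ℝ, {x | a ⬝ᵥ (Φ.G x *ᵥ a) < 0} := by
    ext x; simp [timelikeOrbits]
  rw [this]
  exact isOpen_iUnion fun a => isOpen_lt (Φ.continuous_dotProduct_G_right a a) continuous_const

theorem flow_mem_timelikeOrbits {x : M} (h : x ∈ Φ.timelikeOrbits) (s : Fin (m + 1) → ℝ) :
    Φ.flow s x ∈ Φ.timelikeOrbits := by
  obtain ⟨a, ha⟩ := h
  exact ⟨a, by rwa [Φ.G_flow]⟩

/-- The Killing vector fields in the kernel of `G` are null and orthogonal to one another, so that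
any two of them are linearly dependent. -/
theorem dependent_of_G_mulVec {x : M} {a b : Fin (m + 1) → ℝ}
    (ha : Φ.G x *ᵥ a = 0) (hb : Φ.G x *ᵥ b = 0) :
    ∃ α β : ℝ, (α ≠ 0 ∨ β ≠ 0) ∧ Φ.killing (α • a + β • b) x = 0 := by
  rw [G_mulVec_eq_zero_iff] at ha hb
  obtain ⟨α, β, h, h0⟩ := (g.isLorentz x).dependent_of_null (ha a) (hb b) (hb a)
  exact ⟨α, β, h, by rw [Φ.killing_add, Φ.killing_smul, Φ.killing_smul]; exact h0⟩

variable {Φ} {E : Set M}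

namespace IsExterior

variable (hE : Φ.IsExterior E)
include hE

theorem subset : E ⊆ Φ.timelikeOrbits := by
  obtain ⟨x, hx, rfl⟩ := hE; exact connectedComponentIn_subset _ _

theorem isOpen : IsOpen E := by
  obtain ⟨x, hx, rfl⟩ := hE
  have := ChartedSpace.locallyConnectedSpace (EuclideanSpace ℝ (Fin D)) M
  exact Φ.isOpen_timelikeOrbits.connectedComponentIn

theorem isConnected : IsConnected E := by
  obtain ⟨x, hx, rfl⟩ := hE
  exact isConnected_connectedComponentIn_iff.2 hx

theorem eq_of_subset {T : Set M} (hT : IsPreconnected T) (hsub : T ⊆ Φ.timelikeOrbits)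
    (hne : (T ∩ E).Nonempty) : T ⊆ E := by
  obtain ⟨x, hx, rfl⟩ := hE
  obtain ⟨y, hyT, hyE⟩ := hne
  rw [connectedComponentIn_eq hyE]
  exact hT.subset_connectedComponentIn hyT hsub

theorem flow_mem {x : M} (hx : x ∈ E) (s : Fin (m + 1) → ℝ) : Φ.flow s x ∈ E := by
  have hT : IsPreconnected (range fun t : ℝ => Φ.flow (t • s) x) :=
    isPreconnected_range (Φ.continuous_flow.comp (by fun_prop : Continuous fun t : ℝ => (t • s, x)))
  refine hE.eq_of_subset hT ?_ ⟨x, ⟨0, by simp [Φ.flow_zero]⟩, hx⟩ ⟨1, by simp⟩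
  rintro _ ⟨t, rfl⟩
  exact Φ.flow_mem_timelikeOrbits (hE.subset hx) _

theorem flow_mem_iff {x : M} (s : Fin (m + 1) → ℝ) : Φ.flow s x ∈ E ↔ x ∈ E := by
  refine ⟨fun h => ?_, fun h => hE.flow_mem h s⟩
  have := hE.flow_mem h (-s)
  rwa [Φ.flow_neg_flow] at this

theorem flow_mem_closure {x : M} (hx : x ∈ closure E) (s : Fin (m + 1) → ℝ) :
    Φ.flow s x ∈ closure E :=
  map_mem_closure (Φ.continuous_flow_right s) hx fun _ hy => hE.flow_mem hy s

theorem flow_mem_closure_iff {x : M} (s : Fin (m + 1) → ℝ) :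
    Φ.flow s x ∈ closure E ↔ x ∈ closure E := by
  refine ⟨fun h => ?_, fun h => hE.flow_mem_closure h s⟩
  have := hE.flow_mem_closure h (-s)
  rwa [Φ.flow_neg_flow] at this

theorem mem_frontier_iff {x : M} : x ∈ frontier E ↔ x ∈ closure E ∧ x ∉ E := by
  rw [frontier, hE.isOpen.interior_eq]; rfl

theorem flow_mem_frontier_iff {x : M} (s : Fin (m + 1) → ℝ) :
    Φ.flow s x ∈ frontier E ↔ x ∈ frontier E := by
  rw [hE.mem_frontier_iff, hE.mem_frontier_iff, hE.flow_mem_closure_iff, hE.flow_mem_iff]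

theorem mem_or_mem_frontier {x : M} (hx : x ∈ closure E) : x ∈ E ∨ x ∈ frontier E := by
  by_cases h : x ∈ E
  · exact Or.inl h
  · exact Or.inr (hE.mem_frontier_iff.2 ⟨hx, h⟩)

/-- Components of the open set `timelikeOrbits` are open. The component of a boundary point in that
set would meet `E` and hence be contained in it. -/
theorem notMem_timelikeOrbits_of_mem_frontier {x : M} (hx : x ∈ frontier E) :
    x ∉ Φ.timelikeOrbits := by
  intro h
  obtain ⟨hcl, hnot⟩ := hE.mem_frontier_iff.1 hx
  have := ChartedSpace.locallyConnectedSpace (EuclideanSpace ℝ (Fin D)) M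
  have h1 : connectedComponentIn Φ.timelikeOrbits x ∈ 𝓝 x :=
    Φ.isOpen_timelikeOrbits.connectedComponentIn.mem_nhds (mem_connectedComponentIn h)
  obtain ⟨y, hy1, hy2⟩ := mem_closure_iff_nhds.1 hcl _ h1
  exact hnot (hE.eq_of_subset isPreconnected_connectedComponentIn
    (connectedComponentIn_subset _ _) ⟨y, hy1, hy2⟩ (mem_connectedComponentIn h))

theorem dotProduct_G_nonneg {x : M} (hx : x ∈ frontier E) (a : Fin (m + 1) → ℝ) :
    0 ≤ a ⬝ᵥ (Φ.G x *ᵥ a) := by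
  by_contra! h
  exact hE.notMem_timelikeOrbits_of_mem_frontier hx ⟨a, h⟩

theorem posSemidef_G {x : M} (hx : x ∈ frontier E) : (Φ.G x).PosSemidef := by
  refine Matrix.PosSemidef.of_dotProduct_mulVec_nonneg ?_ fun a => ?_
  · rw [Matrix.IsHermitian, Matrix.conjTranspose_eq_transpose_of_trivial, Φ.G_transpose]
  · simpa using hE.dotProduct_G_nonneg hx a

theorem exists_timelike {x : M} (hx : x ∈ E) :
    ∃ a, g.val x (Φ.killing a x) (Φ.killing a x) < 0 := by
  obtain ⟨a, ha⟩ := hE.subset hx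
  exact ⟨a, by rwa [Φ.dotProduct_G] at ha⟩

/-- In the exterior, a vector in the kernel of `G` is a Killing vector field that vanishes. -/
theorem killing_eq_zero_of_G {x : M} (hx : x ∈ E) {a : Fin (m + 1) → ℝ}
    (ha : Φ.G x *ᵥ a = 0) : Φ.killing a x = 0 := by
  rw [G_mulVec_eq_zero_iff] at ha
  obtain ⟨b, hb⟩ := hE.exists_timelike hx
  by_contra h
  exact ((g.isLorentz x).pos_of_orthogonal hb (ha b) h).ne' (ha a)

theorem G_mulVec_eq_zero_iff_killing {x : M} (hx : x ∈ E) {a : Fin (m + 1) → ℝ} :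
    Φ.G x *ᵥ a = 0 ↔ Φ.killing a x = 0 :=
  ⟨hE.killing_eq_zero_of_G hx, Φ.G_mulVec_eq_zero_of_killing⟩

/-- On the boundary of the exterior, `det G = 0`. -/
theorem det_G_eq_zero_of_mem_frontier {x : M} (hx : x ∈ frontier E) : (Φ.G x).det = 0 := by
  by_contra hdet
  have hpos : ∀ a : Fin (m + 1) → ℝ, a ≠ 0 → 0 < a ⬝ᵥ (Φ.G x *ᵥ a) := by
    intro a ha
    have h1 := hE.dotProduct_G_nonneg hx a
    refine h1.lt_of_ne fun h0 => ha ?_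
    have h2 := (hE.posSemidef_G hx).dotProduct_mulVec_zero_iff a
    simp only [star_trivial] at h2
    exact Matrix.eq_zero_of_mulVec_eq_zero hdet (h2.1 h0.symm)
  -- positivity on the unit sphere persists in a neighbourhood
  have hK : IsCompact (Metric.sphere (0 : Fin (m + 1) → ℝ) 1) := isCompact_sphere _ _
  have hopen : IsOpen {p : (Fin (m + 1) → ℝ) × M | 0 < p.1 ⬝ᵥ (Φ.G p.2 *ᵥ p.1)} :=
    isOpen_lt continuous_const Φ.continuous_dotProduct_G
  obtain ⟨U, V, hU, hV, hKU, hxV, hUV⟩ := generalized_tube_lemma hK (isCompact_singleton (x := x))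
    hopen (by
      rintro ⟨a, y⟩ ⟨ha, rfl⟩
      exact hpos a (by rintro rfl; simp at ha))
  obtain ⟨y, hyV, hyE⟩ := mem_closure_iff_nhds.1 (hE.mem_frontier_iff.1 hx).1 V
    (hV.mem_nhds (hxV rfl))
  obtain ⟨a, ha⟩ := hE.subset hyE
  have ha0 : a ≠ 0 := by rintro rfl; simp at ha
  have h1 : 0 < (‖a‖⁻¹ • a) ⬝ᵥ (Φ.G y *ᵥ (‖a‖⁻¹ • a)) := by
    refine hUV (show ((‖a‖⁻¹ • a), y) ∈ U ×ˢ V from ⟨hKU ?_, hyV⟩)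
    simp [norm_smul, ha0]
  rw [Matrix.mulVec_smul, dotProduct_smul, smul_dotProduct, smul_smul, smul_eq_mul] at h1
  have h2 : 0 < ‖a‖⁻¹ * ‖a‖⁻¹ := by positivity
  nlinarith

end IsExterior

/-- A zero of the Killing field `a` is fixed by all `flow (t • a)`, and properness, applied to a
single point, bounds the times `t * a 0`. -/
theorem IsProper.apply_zero_eq_zero [T2Space M] (hproper : Φ.IsProper E) {x : M}
    (hx : x ∈ closure E) {a : Fin (m + 1) → ℝ} (ha : Φ.killing a x = 0) : a 0 = 0 := by
  obtain ⟨T, hT⟩ := hproper {x} (singleton_subset_iff.2 hx) isCompact_singleton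
  have h1 : ∀ t : ℝ, |t * a 0| ≤ T := fun t => by
    have := hT (t • a) x rfl (Φ.flow_smul_eq_of_killing_eq_zero ha t)
    simpa using this
  by_contra h0
  have h2 := h1 ((T + 1) / a 0)
  rw [div_mul_cancel₀ _ h0] at h2
  linarith [le_abs_self (T + 1)]

theorem IsProper.apply_zero_eq_zero_of_flow (hproper : Φ.IsProper E) {x : M}
    (hx : x ∈ closure E) {s : Fin (m + 1) → ℝ} (hs : Φ.flow s x = x) : s 0 = 0 := by
  obtain ⟨T, hT⟩ := hproper {x} (singleton_subset_iff.2 hx) isCompact_singleton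
  have h1 : ∀ n : ℕ, |n * s 0| ≤ T := fun n => by
    have := hT (n • s) x rfl (Φ.flow_nsmul_eq hs n)
    simpa using this
  by_contra h0
  obtain ⟨n, hn⟩ := exists_nat_gt (T / |s 0|)
  have h2 := h1 n
  rw [div_lt_iff₀ (abs_pos.2 h0)] at hn
  rw [abs_mul, Nat.abs_cast] at h2
  linarith

end IsometricAction

end Exterior

end DomainStructure

namespace DomainStructure

/-! ### Commuting skew-symmetric operators -/

section SkewFamily

open Module

variable {V J : Type*} [NormedAddCommGroup V] [InnerProductSpace ℝ V] [FiniteDimensional ℝ V]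
  [AddCommGroup J] [Module ℝ J] {A : J →ₗ[ℝ] V →ₗ[ℝ] V}

/-- A linear family of commuting skew-symmetric operators. -/
structure IsSkewFamily (A : J →ₗ[ℝ] V →ₗ[ℝ] V) : Prop where
  skew (a : J) (u v : V) : inner ℝ (A a u) v = -inner ℝ u (A a v)
  comm (a b : J) (v : V) : A a (A b v) = A b (A a v)

/-- The elements of the family that annihilate a vector. -/
def annihilator (A : J →ₗ[ℝ] V →ₗ[ℝ] V) (v : V) : Submodule ℝ J := LinearMap.ker (A.flip v)

omit [FiniteDimensional ℝ V] in
theorem mem_annihilator {v : V} {a : J} : a ∈ annihilator A v ↔ A a v = 0 := by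
  simp [annihilator]

namespace IsSkewFamily

variable (hA : IsSkewFamily A)
include hA

omit [FiniteDimensional ℝ V] in
-- Skewness gives `‖A a v‖² = -⟪v, A a (A a v)⟫`. Vanishing can thus be tested on products of two
-- operators, which are symmetric and diagonalizable over `ℝ`.
theorem eq_zero_of_apply_apply {a : J} {v : V} (h : A a (A a v) = 0) : A a v = 0 := by
  have := hA.skew a v (A a v)
  rwa [h, inner_zero_right, neg_zero, inner_self_eq_zero] at this

/-- The joint eigenspaces of the products of two operators of the family. -/
def weightSpace (_ : IsSkewFamily A) (χ : J × J → ℝ) : Submodule ℝ V :=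
  ⨅ ab : J × J, End.eigenspace (A ab.1 * A ab.2) (χ ab)

omit [FiniteDimensional ℝ V] in
theorem mem_weightSpace {χ : J × J → ℝ} {v : V} :
    v ∈ hA.weightSpace χ ↔ ∀ a b, A a (A b v) = χ (a, b) • v := by
  simp [weightSpace, Submodule.mem_iInf]

omit [FiniteDimensional ℝ V] in
theorem isSymmetric (ab : J × J) : (A ab.1 * A ab.2 : V →ₗ[ℝ] V).IsSymmetric := by
  intro u v
  simp only [Module.End.mul_apply]
  rw [hA.skew, hA.skew, neg_neg, hA.comm]

theorem iSup_weightSpace : ⨆ χ, hA.weightSpace χ = ⊤ := by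
  refine LinearMap.IsSymmetric.iSup_iInf_eq_top_of_commute hA.isSymmetric fun ab cd _ => ?_
  ext v
  simp only [Module.End.mul_apply]
  rw [hA.comm ab.2 cd.1, hA.comm ab.1 cd.1, hA.comm ab.2 cd.2, hA.comm ab.1 cd.2]

omit [FiniteDimensional ℝ V] in
theorem orthogonalFamily_weightSpace :
    OrthogonalFamily ℝ (fun χ => hA.weightSpace χ) fun χ => (hA.weightSpace χ).subtypeₗᵢ :=
  LinearMap.IsSymmetric.orthogonalFamily_iInf_eigenspaces hA.isSymmetric

omit [FiniteDimensional ℝ V] in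
theorem annihilator_of_mem_weightSpace {χ : J × J → ℝ} {v : V} (hv : v ∈ hA.weightSpace χ)
    (h0 : v ≠ 0) {a : J} : a ∈ annihilator A v ↔ χ (a, a) = 0 := by
  rw [mem_annihilator]
  have h1 := hA.mem_weightSpace.1 hv a a
  refine ⟨fun h => ?_, fun h => hA.eq_zero_of_apply_apply (by rw [h1, h, zero_smul])⟩
  rw [h, map_zero] at h1
  exact (smul_eq_zero.1 h1.symm).resolve_right h0

omit [FiniteDimensional ℝ V] in
/-- The annihilator of a weight vector has codimension at most one. -/
theorem exists_sub_smul_mem {χ : J × J → ℝ} {v : V} (hv : v ∈ hA.weightSpace χ) {b : J}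
    (hb : b ∉ annihilator A v) (a : J) : ∃ t : ℝ, a - t • b ∈ annihilator A v := by
  have h0 : v ≠ 0 := by rintro rfl; exact hb (mem_annihilator.2 (map_zero _))
  have hbb : χ (b, b) ≠ 0 := fun h => hb ((hA.annihilator_of_mem_weightSpace hv h0).2 h)
  have hw := hA.mem_weightSpace.1 hv
  -- Two evaluations of the square of `A a A b` on the weight vector. By this identity the square of
  -- `A (a - t • b)` with `t = χ (a, b) / χ (b, b)` kills `v`.
  have key : χ (a, b) * χ (a, b) = χ (a, a) * χ (b, b) := by
    have h1 : A a (A b (A a (A b v))) = (χ (a, b) * χ (a, b)) • v := by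
      rw [hw a b, map_smul, map_smul, hw a b, smul_smul]
    have h2 : A a (A b (A a (A b v))) = (χ (a, a) * χ (b, b)) • v := by
      rw [hA.comm b a, hw b b, map_smul, map_smul, hw a a, smul_smul, mul_comm]
    exact smul_left_injective ℝ h0 (h1.symm.trans h2)
  have hab : χ (b, a) = χ (a, b) := by
    refine smul_left_injective ℝ h0 ?_
    simp only
    rw [← hw, ← hw, hA.comm]
  refine ⟨χ (a, b) / χ (b, b), mem_annihilator.2 (hA.eq_zero_of_apply_apply ?_)⟩
  simp only [map_sub, map_smul, LinearMap.sub_apply, LinearMap.smul_apply, hw, hab, smul_smul,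
    ← sub_smul]
  convert zero_smul ℝ v
  field_simp
  linear_combination -key

/-- There are finitely many annihilators. -/
theorem finite_range_annihilator : (range (annihilator A)).Finite := by
  classical
  have hfin : {χ | hA.weightSpace χ ≠ ⊥}.Finite :=
    WellFoundedGT.finite_ne_bot_of_iSupIndep hA.orthogonalFamily_weightSpace.independent
  -- The annihilator of a sum of weight vectors is the intersection of the annihilators of its
  -- components, because the vectors `A a (f χ)` are orthogonal to one another. Each of these is
  -- determined by its weight, and only finitely many weights occur.
  let N : (J × J → ℝ) → Set J := fun χ => {a | χ (a, a) = 0}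
  have hsub : (fun S : Submodule ℝ J => (S : Set J)) '' range (annihilator A) ⊆
      (fun T : Set (J × J → ℝ) => ⋂ χ ∈ T, N χ) '' {T | T ⊆ {χ | hA.weightSpace χ ≠ ⊥}} := by
    rintro _ ⟨_, ⟨v, rfl⟩, rfl⟩
    have hv : v ∈ ⨆ χ, hA.weightSpace χ := by rw [hA.iSup_weightSpace]; trivial
    obtain ⟨f, hf, rfl⟩ := (Submodule.mem_iSup_iff_exists_finsupp _ _).1 hv
    refine ⟨f.support, fun χ hχ h => ?_, ?_⟩
    · have := hf χ
      rw [h, Submodule.mem_bot] at this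
      exact Finsupp.mem_support_iff.1 hχ this
    · ext a
      have hmem : ∀ χ, A a (f χ) ∈ hA.weightSpace χ := fun χ => by
        refine hA.mem_weightSpace.2 fun b c => ?_
        rw [hA.comm c a, hA.comm b a, hA.mem_weightSpace.1 (hf χ), map_smul]
      have hin : ∀ χ ∈ f.support, inner ℝ (A a (f χ)) (A a (f.sum fun _ x => x))
          = inner ℝ (A a (f χ)) (A a (f χ)) := by
        intro χ hχ
        rw [Finsupp.sum, map_sum, inner_sum, Finset.sum_eq_single χ]
        · intro χ' _ hne
          exact hA.orthogonalFamily_weightSpace (Ne.symm hne) ⟨_, hmem χ⟩ ⟨_, hmem χ'⟩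
        · intro h; exact absurd hχ h
      simp only [mem_iInter, SetLike.mem_coe, mem_annihilator]
      constructor
      · intro h
        rw [Finsupp.sum, map_sum]
        refine Finset.sum_eq_zero fun χ hχ => ?_
        exact mem_annihilator.1 ((hA.annihilator_of_mem_weightSpace (hf χ)
          (Finsupp.mem_support_iff.1 hχ)).2 (h χ hχ))
      · intro h χ hχ
        have h1 := hin χ hχ
        rw [h, inner_zero_right] at h1
        exact (hA.annihilator_of_mem_weightSpace (hf χ) (Finsupp.mem_support_iff.1 hχ)).1
          (mem_annihilator.2 (inner_self_eq_zero.1 h1.symm))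
  exact ((hfin.finite_subsets.image _).subset hsub).of_finite_image
    SetLike.coe_injective.injOn

/-- Along a line with generic direction, the annihilator is the generic one up to finitely many
exceptions. -/
theorem finite_not_annihilator_le (u v : V) :
    {t : ℝ | ¬ annihilator A (v + t • u) ≤ annihilator A u}.Finite := by
  refine Set.Finite.of_finite_image (f := fun t : ℝ => annihilator A (v + t • u))
    (hA.finite_range_annihilator.subset ?_) ?_
  · rintro _ ⟨t, -, rfl⟩; exact mem_range_self _
  · intro t ht s _ hts
    by_contra hne
    refine ht fun a ha => ?_
    have ha' : a ∈ annihilator A (v + s • u) := by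
      have : annihilator A (v + t • u) = annihilator A (v + s • u) := hts
      rwa [← this]
    rw [mem_annihilator] at ha ha' ⊢
    have h1 : (t - s) • A a u = 0 := by
      rw [map_add, map_smul] at ha ha'
      rw [sub_smul, ← add_sub_add_left_eq_sub _ _ (A a v), ha, ha', sub_zero]
    exact (smul_eq_zero.1 h1).resolve_left (sub_ne_zero.2 hne)

/-- For all but finitely many `t` the annihilator of `v + t • u` is contained in that of `u`, and
then also in that of `v`. So the annihilators are closed under intersection, on which the minimality
arguments below rely. -/
theorem exists_annihilator_eq_inf (u v : V) : ∃ w, annihilator A w =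
    annihilator A v ⊓ annihilator A u := by
  obtain ⟨t, ht⟩ := (hA.finite_not_annihilator_le u v).infinite_compl.nonempty
  have ht : annihilator A (v + t • u) ≤ annihilator A u := not_not.1 ht
  refine ⟨v + t • u, le_antisymm ?_ ?_⟩
  · intro a ha
    refine ⟨?_, ht ha⟩
    have h1 := mem_annihilator.1 ha
    have h2 := mem_annihilator.1 (ht ha)
    rw [map_add, map_smul, h2, smul_zero, add_zero] at h1
    exact mem_annihilator.2 h1
  · intro a ha
    have h1 := mem_annihilator.1 ha.1
    have h2 := mem_annihilator.1 ha.2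
    rw [mem_annihilator, map_add, map_smul, h1, h2, smul_zero, add_zero]

variable (hinj : ∀ a, A a = 0 → a = 0)
include hinj

/-- A minimal annihilator is contained in all others, so its elements act as zero. -/
theorem exists_annihilator_eq_bot : ∃ v, annihilator A v = ⊥ := by
  obtain ⟨_, ⟨v, rfl⟩, hv⟩ := hA.finite_range_annihilator.exists_minimal (range_nonempty _)
  refine ⟨v, (Submodule.eq_bot_iff _).2 fun a ha => hinj a ?_⟩
  ext u
  obtain ⟨w, hw⟩ := hA.exists_annihilator_eq_inf u v
  have h1 : annihilator A v ≤ annihilator A w := hv ⟨w, rfl⟩ (by rw [hw]; exact inf_le_left)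
  have h2 := h1 ha
  rw [hw] at h2
  exact mem_annihilator.1 h2.2

/-- Some vector has a one-dimensional annihilator. -/
theorem exists_annihilator_eq_span [Nontrivial J] :
    ∃ v, ∃ b : J, b ≠ 0 ∧ annihilator A v = ℝ ∙ b := by
  have hne : (range (annihilator A) ∩ {S | S ≠ ⊥}).Nonempty := by
    refine ⟨_, ⟨0, rfl⟩, ?_⟩
    have : annihilator A 0 = ⊤ := by ext a; simp [mem_annihilator]
    simp only [this]
    exact top_ne_bot
  obtain ⟨_, ⟨⟨v, rfl⟩, hv0⟩, hv⟩ :=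
    (hA.finite_range_annihilator.inter_of_left _).exists_minimal hne
  obtain ⟨b, hb, hb0⟩ := (Submodule.ne_bot_iff _).1 hv0
  -- Here `v` has a minimal nonzero annihilator, and `u` is a weight vector that `b` does not kill.
  -- By minimality their annihilators intersect trivially; as the one of `u` has codimension at most
  -- one, the one of `v` is the line through `b`.
  have hex : ∃ χ, ∃ u ∈ hA.weightSpace χ, A b u ≠ 0 := by
    by_contra! h
    refine hb0 (hinj b ?_)
    have h1 : ⨆ χ, hA.weightSpace χ ≤ LinearMap.ker (A b) := iSup_le fun χ u hu => h χ u hu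
    rw [hA.iSup_weightSpace, top_le_iff] at h1
    exact LinearMap.ker_eq_top.1 h1
  obtain ⟨χ, u, hu, hbu⟩ := hex
  obtain ⟨w, hw⟩ := hA.exists_annihilator_eq_inf u v
  have hbot : annihilator A v ⊓ annihilator A u = ⊥ := by
    by_contra hnb
    have h1 : annihilator A v ≤ annihilator A w :=
      hv ⟨⟨w, rfl⟩, by rw [hw]; exact hnb⟩ (by rw [hw]; exact inf_le_left)
    have h2 := h1 hb
    rw [hw] at h2
    exact hbu (mem_annihilator.1 h2.2)
  refine ⟨v, b, hb0, le_antisymm (fun a ha => ?_) ?_⟩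
  · obtain ⟨t, ht⟩ := hA.exists_sub_smul_mem hu (fun h => hbu (mem_annihilator.1 h)) a
    have h1 : a - t • b ∈ annihilator A v ⊓ annihilator A u :=
      ⟨Submodule.sub_mem _ ha (Submodule.smul_mem _ t hb), ht⟩
    rw [hbot, Submodule.mem_bot, sub_eq_zero] at h1
    exact Submodule.mem_span_singleton.2 ⟨t, h1.symm⟩
  · rwa [Submodule.span_singleton_le_iff_mem]

variable {ℓ : V →L[ℝ] ℝ} (hℓ : ∀ a v, ℓ (A a v) = 0)
include hℓ

omit hinj in
-- The vector `ν` dual to the invariant functional is annihilated: `‖A a ν‖² = -⟪ν, A a (A a ν)⟫ =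
-- -ℓ (A a (A a ν)) = 0`.
theorem exists_invariant_vector (h0 : ℓ ≠ 0) : ∃ ν, ℓ ν = 1 ∧ ∀ a, A a ν = 0 := by
  have hne : (InnerProductSpace.toDual ℝ V).symm ℓ ≠ 0 := by simpa using h0
  obtain ⟨ν, hν⟩ : ∃ ν, ν = (InnerProductSpace.toDual ℝ V).symm ℓ := ⟨_, rfl⟩
  have hin : ∀ v, inner ℝ ν v = ℓ v := fun v => by simp [hν]
  rw [← hν] at hne
  have hν1 : ℓ ν ≠ 0 := by rw [← hin]; exact inner_self_ne_zero.2 hne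
  refine ⟨(ℓ ν)⁻¹ • ν, by simp [hν1], fun a => ?_⟩
  rw [map_smul]
  have : A a ν = 0 := by
    rw [← inner_self_eq_zero (𝕜 := ℝ), hA.skew, hin, hℓ, neg_zero]
  rw [this, smul_zero]

/-- Subtracting a multiple of the invariant vector moves a generic vector into the hyperplane
without changing its annihilator. -/
theorem exists_mem_ker_annihilator_eq_bot : ∃ v, ℓ v = 0 ∧ annihilator A v = ⊥ := by
  obtain ⟨v, hv⟩ := hA.exists_annihilator_eq_bot hinj
  by_cases h0 : ℓ = 0
  · exact ⟨v, by simp [h0], hv⟩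
  obtain ⟨ν, hν1, hν⟩ := hA.exists_invariant_vector hℓ h0
  refine ⟨v - ℓ v • ν, by simp [hν1], ?_⟩
  rw [← hv]
  ext a
  simp [mem_annihilator, hν]

omit hinj in
/-- In an invariant hyperplane, the vectors with trivial annihilator are connected by broken
lines. -/
theorem exists_generic_vertex {v₀ v₁ : V} (hv₀ : annihilator A v₀ = ⊥)
    (hv₁ : annihilator A v₁ = ⊥) (hℓ₀ : ℓ v₀ = 0) (hℓ₁ : ℓ v₁ = 0) :
    ∃ u, ℓ u = 0 ∧ ∀ α β : ℝ, (α ≠ 0 ∨ β ≠ 0) →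
      annihilator A (α • v₀ + β • u) = ⊥ ∧ annihilator A (α • v₁ + β • u) = ⊥ := by
  classical
  let Z : Submodule ℝ V := LinearMap.ker (ℓ : V →ₗ[ℝ] ℝ)
  -- If some `α • v + β • u` with `β ≠ 0` is annihilated by `S`, then `u` belongs to `p S v`. A real
  -- vector space is not a finite union of proper subspaces, so it suffices that these are proper.
  let p : Submodule ℝ J → V → Submodule ℝ Z := fun S v =>
    ((⨅ a : S, LinearMap.ker (A a)) ⊔ (ℝ ∙ v)).comap Z.subtype
  have hfin : (range (annihilator A) ∩ {S | S ≠ ⊥}).Finite :=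
    hA.finite_range_annihilator.inter_of_left _
  have hproper : ∀ S : Submodule ℝ J, S ≠ ⊥ → ∀ v, ℓ v = 0 → annihilator A v = ⊥ →
      p S v ≠ ⊤ := by
    intro S hS v hv hgen htop
    obtain ⟨a, ha, ha0⟩ := (Submodule.ne_bot_iff _).1 hS
    have hav : A a v ≠ 0 := fun h => ha0 ((Submodule.mem_bot ℝ).1 (hgen ▸ mem_annihilator.2 h))
    -- `A a v` lies in the hyperplane but not in `p S v`: if `A a v = k + t • v` with `A a k = 0`,
    -- then `⟪A a v, k⟫` and `⟪A a v, v⟫` vanish by skewness, so `A a v = 0`.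
    have hmem : (⟨A a v, by simp [Z, hℓ]⟩ : Z) ∈ p S v := by rw [htop]; trivial
    obtain ⟨k, hk, y, hy, hky⟩ := Submodule.mem_sup.1 (Submodule.mem_comap.1 hmem)
    obtain ⟨t, rfl⟩ := Submodule.mem_span_singleton.1 hy
    have hka : A a k = 0 := by
      have := (Submodule.mem_iInf _).1 hk ⟨a, ha⟩
      simpa using this
    have hky : k + t • v = A a v := hky
    apply hav
    have hvv : inner ℝ (A a v) v = (0 : ℝ) := by
      have h := hA.skew a v v
      rw [real_inner_comm (A a v) v] at h
      linarith [real_inner_comm v (A a v)]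
    rw [← inner_self_eq_zero (𝕜 := ℝ)]
    nth_rw 2 [← hky]
    rw [inner_add_right, inner_smul_right, hvv, hA.skew, hka]
    simp
  obtain ⟨s, hs⟩ : ∃ s : Finset (Submodule ℝ Z), ∀ q, q ∈ s ↔
      ∃ S ∈ range (annihilator A) ∩ {S | S ≠ ⊥}, q = p S v₀ ∨ q = p S v₁ := by
    refine ⟨((hfin.image fun S => p S v₀).union (hfin.image fun S => p S v₁)).toFinset,
      fun q => ?_⟩
    simp only [Set.Finite.mem_toFinset, mem_union, mem_image]
    constructor
    · rintro (⟨S, hS, rfl⟩ | ⟨S, hS, rfl⟩)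
      · exact ⟨S, hS, Or.inl rfl⟩
      · exact ⟨S, hS, Or.inr rfl⟩
    · rintro ⟨S, hS, rfl | rfl⟩
      · exact Or.inl ⟨S, hS, rfl⟩
      · exact Or.inr ⟨S, hS, rfl⟩
  have htop : (⊤ : Submodule ℝ Z) ∉ s := by
    rw [hs]
    rintro ⟨S, ⟨-, hS⟩, h | h⟩
    · exact hproper S hS v₀ hℓ₀ hv₀ h.symm
    · exact hproper S hS v₁ hℓ₁ hv₁ h.symm
  obtain ⟨u, hu⟩ := (ne_univ_iff_exists_notMem _).1 (Subspace.biUnion_ne_univ_of_top_notMem htop)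
  have hu' : ∀ S, S ∈ range (annihilator A) → S ≠ ⊥ → u ∉ p S v₀ ∧ u ∉ p S v₁ := by
    intro S hS hS0
    simp only [mem_iUnion, not_exists] at hu
    exact ⟨hu _ ((hs _).2 ⟨S, ⟨hS, hS0⟩, Or.inl rfl⟩), hu _ ((hs _).2 ⟨S, ⟨hS, hS0⟩, Or.inr rfl⟩)⟩
  have main : ∀ v, annihilator A v = ⊥ →
      (∀ S, S ∈ range (annihilator A) → S ≠ ⊥ → u ∉ p S v) →
      ∀ α β : ℝ, (α ≠ 0 ∨ β ≠ 0) → annihilator A (α • v + β • (u : V)) = ⊥ := by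
    intro v hv hup α β hαβ
    by_contra hne
    by_cases hβ : β = 0
    · have hα : α ≠ 0 := hαβ.resolve_right (not_not.2 hβ)
      refine hne ((Submodule.eq_bot_iff _).2 fun a ha => ?_)
      rw [mem_annihilator, hβ, zero_smul, add_zero, map_smul] at ha
      have h1 := (smul_eq_zero.1 ha).resolve_left hα
      have h2 : a ∈ annihilator A v := mem_annihilator.2 h1
      rwa [hv] at h2
    · refine hup _ ⟨_, rfl⟩ hne ?_
      have hmem : α • v + β • (u : V) ∈
          ⨅ a : annihilator A (α • v + β • (u : V)), LinearMap.ker (A a) := by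
        refine (Submodule.mem_iInf _).2 fun a => ?_
        exact mem_annihilator.1 a.2
      have h3 : (u : V) = β⁻¹ • (α • v + β • (u : V)) + (-(β⁻¹ * α)) • v := by
        rw [smul_add, smul_smul, smul_smul, inv_mul_cancel₀ hβ, one_smul, neg_smul]
        abel
      exact Submodule.mem_comap.2 (Submodule.mem_sup.2 ⟨_, Submodule.smul_mem _ β⁻¹ hmem, _,
        Submodule.mem_span_singleton.2 ⟨_, rfl⟩, h3.symm⟩)
  exact ⟨u, u.2, fun α β hαβ => ⟨main v₀ hv₀ (fun S hS h => (hu' S hS h).1) α β hαβ,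
    main v₁ hv₁ (fun S hS h => (hu' S hS h).2) α β hαβ⟩⟩

end IsSkewFamily

end SkewFamily

end DomainStructure

namespace DomainStructure

/-! ### Stabilizers -/

section Lattice

variable {m : ℕ}

/-- The periods of the `U(1)` flows. -/
def periodLattice (m : ℕ) : AddSubgroup (Fin (m + 1) → ℝ) where
  carrier := {s | s 0 = 0 ∧ ∀ i : Fin m, ∃ k : ℤ, s i.succ = 2 * Real.pi * k}
  zero_mem' := ⟨rfl, fun _ => ⟨0, by simp⟩⟩
  add_mem' := by
    rintro a b ⟨ha0, ha⟩ ⟨hb0, hb⟩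
    refine ⟨by simp [ha0, hb0], fun i => ?_⟩
    obtain ⟨k, hk⟩ := ha i
    obtain ⟨l, hl⟩ := hb i
    exact ⟨k + l, by simp [hk, hl]; ring⟩
  neg_mem' := by
    rintro a ⟨ha0, ha⟩
    refine ⟨by simp [ha0], fun i => ?_⟩
    obtain ⟨k, hk⟩ := ha i
    exact ⟨-k, by simp [hk]⟩

theorem mem_periodLattice {s : Fin (m + 1) → ℝ} : s ∈ periodLattice m ↔
    s 0 = 0 ∧ ∀ i : Fin m, ∃ k : ℤ, s i.succ = 2 * Real.pi * k := Iff.rfl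

/-- A stabilizer without time components is thereby compact modulo the periods: its elements need
only be considered in a ball of radius `2π`. -/
theorem exists_periodLattice_sub_norm_le {s : Fin (m + 1) → ℝ} (hs : s 0 = 0) :
    ∃ l ∈ periodLattice m, ‖s - l‖ ≤ 2 * Real.pi := by
  have hpi := Real.pi_pos
  refine ⟨Fin.cons 0 fun i => 2 * Real.pi * (⌊s i.succ / (2 * Real.pi)⌋ : ℤ),
    mem_periodLattice.2 ⟨rfl, fun i => ⟨⌊s i.succ / (2 * Real.pi)⌋, by simp⟩⟩, ?_⟩
  refine (pi_norm_le_iff_of_nonneg (by positivity)).2 fun j => ?_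
  refine Fin.cases ?_ (fun i => ?_) j
  · simp [hs]; positivity
  · have h1 := Int.floor_le (s i.succ / (2 * Real.pi))
    have h2 := Int.lt_floor_add_one (s i.succ / (2 * Real.pi))
    rw [le_div_iff₀ (by positivity)] at h1
    rw [div_lt_iff₀ (by positivity)] at h2
    simp only [Pi.sub_apply, Fin.cons_succ, Real.norm_eq_abs]
    rw [abs_le]
    constructor <;> nlinarith

/-- Averaging over a closed subgroup of the torus. -/
theorem exists_invariant_mean {H : AddSubgroup (Fin (m + 1) → ℝ)}
    (hclosed : IsClosed (H : Set (Fin (m + 1) → ℝ))) (hH : ∀ s ∈ H, s 0 = 0)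
    (hL : periodLattice m ≤ H) :
    ∃ (Q : Type) (_ : MeasurableSpace Q) (μ : MeasureTheory.Measure Q)
      (σ : Q → Fin (m + 1) → ℝ), MeasureTheory.IsProbabilityMeasure μ ∧ (∀ q, σ q ∈ H) ∧
      ∀ (F : Type) [NormedAddCommGroup F] [NormedSpace ℝ F] [SecondCountableTopology F]
        (f : (Fin (m + 1) → ℝ) → F), ContinuousOn f H →
        (∀ s ∈ H, ∀ l ∈ periodLattice m, f (s + l) = f s) →
        MeasureTheory.Integrable (fun q => f (σ q)) μ ∧
        (∀ t ∈ H, ∫ q, f (t + σ q) ∂μ = ∫ q, f (σ q) ∂μ) := by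
  let L : AddSubgroup H := (periodLattice m).addSubgroupOf H
  let Q := H ⧸ L
  let _ : MeasurableSpace Q := borel Q
  have : BorelSpace Q := ⟨rfl⟩
  have hcompact : CompactSpace Q := by
    have hK : IsCompact ((↑) ⁻¹' Metric.closedBall (0 : Fin (m + 1) → ℝ) (2 * Real.pi) : Set H) :=
      hclosed.isClosedEmbedding_subtypeVal.isCompact_preimage (isCompact_closedBall _ _)
    have himg := hK.image (QuotientAddGroup.continuous_mk (N := L))
    suffices hsurj : (QuotientAddGroup.mk : H → Q) '' ((↑) ⁻¹' Metric.closedBall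
        (0 : Fin (m + 1) → ℝ) (2 * Real.pi)) = univ from ⟨hsurj ▸ himg⟩
    refine eq_univ_of_forall fun q => ?_
    induction q using Quotient.inductionOn' with
    | h s =>
      obtain ⟨l, hl, hsl⟩ := exists_periodLattice_sub_norm_le (hH s s.2)
      refine ⟨s - ⟨l, hL hl⟩, by simpa using hsl, ?_⟩
      refine (QuotientAddGroup.eq (s := L)).2 ?_
      simpa [L, AddSubgroup.mem_addSubgroupOf] using hl
  let μ : MeasureTheory.Measure Q := MeasureTheory.Measure.addHaarMeasure ⊤
  have hμ : MeasureTheory.IsProbabilityMeasure μ :=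
    ⟨by simpa using MeasureTheory.Measure.addHaarMeasure_self (K₀ := (⊤ : TopologicalSpace.PositiveCompacts Q))⟩
  refine ⟨Q, inferInstance, μ, fun q => (Quotient.out q : H), hμ, fun q => (Quotient.out q).2, ?_⟩
  intro F _ _ _ f hf hper
  -- `Quotient.out` is a discontinuous choice of representatives, but a periodic `f` does not see
  -- the choice. So `f` composed with it is the continuous function that `f` induces on the
  -- quotient.
  have hout : ∀ t s : H, f (t + (Quotient.out (QuotientAddGroup.mk s : Q) : H)) = f (t + s) := by
    intro t s
    have h1 : -(Quotient.out (QuotientAddGroup.mk s : Q) : H) + s ∈ L :=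
      QuotientAddGroup.eq.1 (Quotient.out_eq' (s₁ := QuotientAddGroup.leftRel L) _)
    have h2 := hper (t + (Quotient.out (QuotientAddGroup.mk s : Q) : H))
      (H.add_mem t.2 (Quotient.out (QuotientAddGroup.mk s : Q) : H).2) _ (AddSubgroup.mem_addSubgroupOf.1 h1)
    rw [← h2]
    congr 1
    simp only [AddSubgroup.coe_add, NegMemClass.coe_neg]
    abel
  have hcont : Continuous fun q : Q => f ((Quotient.out q : H)) := by
    refine (QuotientAddGroup.isQuotientMap_mk (N := L)).continuous_iff.2 ?_
    have : (fun q : Q => f ((Quotient.out q : H))) ∘ (QuotientAddGroup.mk : H → Q)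
        = fun s : H => f s := by
      funext s
      simpa using hout 0 s
    rw [this]
    exact continuousOn_iff_continuous_domRestrict.1 hf
  refine ⟨?_, fun t ht => ?_⟩
  · exact hcont.integrable_of_hasCompactSupport (HasCompactSupport.of_compactSpace _)
  · rw [← MeasureTheory.integral_add_left_eq_self (μ := μ) (fun q : Q => f ((Quotient.out q : H)))
      (QuotientAddGroup.mk (⟨t, ht⟩ : H) : Q)]
    refine MeasureTheory.integral_congr_ae (Eventually.of_forall fun q => ?_)
    induction q using Quotient.inductionOn' with
    | h s =>
      have h1 := hout ⟨t, ht⟩ s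
      have h2 := hout 0 (⟨t, ht⟩ + s)
      simp only [AddSubgroup.coe_zero, zero_add, AddSubgroup.coe_add] at h2
      exact h1.trans h2.symm

end Lattice

namespace IsometricAction

variable {D m : ℕ} {M : Type*} [TopologicalSpace M]
  [ChartedSpace (EuclideanSpace ℝ (Fin D)) M] [IsManifold (𝓡 D) ∞ M]
  {g : LorentzMetric D M} (Φ : IsometricAction g m)

/-- The stabilizer of a point. -/
def stabilizer (x : M) : AddSubgroup (Fin (m + 1) → ℝ) where
  carrier := {s | Φ.flow s x = x}
  zero_mem' := Φ.flow_zero x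
  add_mem' := by
    intro a b (ha : Φ.flow a x = x) (hb : Φ.flow b x = x)
    rw [Set.mem_ofPred_eq, Φ.flow_add, hb, ha]
  neg_mem' := fun h => Φ.flow_neg_eq h

/-- The Killing vector fields that vanish at a point. -/
noncomputable def isotropy (x : M) : Submodule ℝ (Fin (m + 1) → ℝ) := LinearMap.ker (Φ.killingₗ x)

variable {Φ}

theorem mem_stabilizer {s : Fin (m + 1) → ℝ} {x : M} : s ∈ Φ.stabilizer x ↔ Φ.flow s x = x :=
  Iff.rfl

theorem mem_isotropy {a : Fin (m + 1) → ℝ} {x : M} : a ∈ Φ.isotropy x ↔ Φ.killing a x = 0 :=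
  Iff.rfl

theorem periodLattice_le_stabilizer (x : M) : periodLattice m ≤ Φ.stabilizer x :=
  fun _ hs => Φ.flow_lattice hs.1 hs.2 x

theorem isotropy_le_stabilizer [T2Space M] {a : Fin (m + 1) → ℝ} {x : M} (ha : a ∈ Φ.isotropy x) :
    a ∈ Φ.stabilizer x := by
  have := Φ.flow_smul_eq_of_killing_eq_zero ha 1
  rwa [one_smul] at this

theorem isClosed_stabilizer [T2Space M] (x : M) :
    IsClosed (Φ.stabilizer x : Set (Fin (m + 1) → ℝ)) :=
  isClosed_eq (Φ.contMDiff_orbit x).continuous continuous_const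

/-- Every neighbourhood of `x` contains one that the stabilizer of `x` keeps inside. -/
theorem eventually_forall_stabilizer [T2Space M] {x : M} (hH : ∀ s ∈ Φ.stabilizer x, s 0 = 0)
    {U : Set M} (hU : U ∈ 𝓝 x) : ∀ᶠ y in 𝓝 x, ∀ s ∈ Φ.stabilizer x, Φ.flow s y ∈ U := by
  have hK : IsCompact ((Φ.stabilizer x : Set (Fin (m + 1) → ℝ)) ∩
      Metric.closedBall 0 (2 * Real.pi)) :=
    (isCompact_closedBall _ _).inter_left (isClosed_stabilizer x)
  have h1 : ∀ s ∈ (Φ.stabilizer x : Set (Fin (m + 1) → ℝ)) ∩ Metric.closedBall 0 (2 * Real.pi),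
      ∀ᶠ p : M × (Fin (m + 1) → ℝ) in 𝓝 (x, s), Φ.flow p.2 p.1 ∈ U := by
    rintro s ⟨hs, -⟩
    refine (Φ.continuous_flow.comp continuous_swap).continuousAt.preimage_mem_nhds ?_
    simp only [Function.comp, Prod.fst_swap, Prod.snd_swap]
    simp only [mem_stabilizer.1 hs]
    exact hU
  have h2 := hK.eventually_forall_of_forall_eventually (P := fun y s => Φ.flow s y ∈ U)
    fun s hs => h1 s hs
  filter_upwards [h2] with y hy s hs
  obtain ⟨l, hl, hsl⟩ := exists_periodLattice_sub_norm_le (hH s hs)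
  have h3 := hy (s - l) ⟨(Φ.stabilizer x).sub_mem hs (periodLattice_le_stabilizer x hl),
    by simpa using hsl⟩
  rwa [← Φ.flow_lattice hl.1 hl.2 y, ← Φ.flow_add, sub_add_cancel] at h3

/-- Transversally to the isotropy algebra, the flow moves points uniformly. -/
theorem exists_le_norm_coordFlow_sub {x : M}
    {φ : OpenPartialHomeomorph M (EuclideanSpace ℝ (Fin D))} (hφ : IsSmoothChart φ)
    (hx : x ∈ φ.source) : ∃ (C : Submodule ℝ (Fin (m + 1) → ℝ)) (c ε : ℝ),
      IsCompl (Φ.isotropy x) C ∧ 0 < c ∧ 0 < ε ∧ ∀ᶠ z in 𝓝 (φ x), ∀ s ∈ C, ‖s‖ ≤ ε →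
        (s, z) ∈ Φ.coordFlowDomain φ ∧ c * ‖s‖ ≤ ‖Φ.coordFlow φ s z - z‖ := by
  obtain ⟨C, hC⟩ := (Φ.isotropy x).exists_isCompl
  have hz : φ x ∈ φ.target := φ.map_source hx
  -- The derivative of the orbit map at time zero is injective on a complement of the isotropy
  -- algebra. Strict differentiability extends the resulting lower bound to nearby points.
  have hker : LinearMap.ker ((Φ.coordKilling φ (φ x) : (Fin (m + 1) → ℝ) →ₗ[ℝ]
      EuclideanSpace ℝ (Fin D)).domRestrict C) = ⊥ := by
    refine (LinearMap.ker_eq_bot').2 fun s hs => ?_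
    have h1 : Φ.coordKilling φ (φ x) (s : Fin (m + 1) → ℝ) = 0 := hs
    rw [Φ.coordKilling_eq_zero_iff hφ hz, φ.left_inv hx] at h1
    have := hC.disjoint.le_bot ⟨mem_isotropy.2 h1, s.2⟩
    exact Subtype.ext ((Submodule.mem_bot ℝ).1 this)
  obtain ⟨K, hK, hanti⟩ := LinearMap.exists_antilipschitzWith _ hker
  have hlow : ∀ s ∈ C, (K : ℝ)⁻¹ * ‖s‖ ≤ ‖Φ.coordKilling φ (φ x) s‖ := by
    intro s hs
    have h1 := hanti.le_mul_dist ⟨s, hs⟩ 0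
    simp only [dist_eq_norm, map_zero, sub_zero] at h1
    rw [inv_mul_le_iff₀ (by exact_mod_cast hK)]
    exact h1
  have hK' : (0 : ℝ) < (K : ℝ)⁻¹ := inv_pos.2 (by exact_mod_cast hK)
  obtain ⟨c, hc⟩ : ∃ c : ℝ, c = (K : ℝ)⁻¹ / 2 := ⟨_, rfl⟩
  have hc0 : 0 < c := by rw [hc]; positivity
  have hd := (Φ.contDiffAt_coordFlow hφ (Φ.mem_coordFlowDomain_zero hz)).hasStrictFDerivAt
    (by simp)
  have hd0 : ∀ s, fderiv ℝ (fun p : (Fin (m + 1) → ℝ) × EuclideanSpace ℝ (Fin D) =>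
      Φ.coordFlow φ p.1 p.2) (0, φ x) (s, 0) = Φ.coordKilling φ (φ x) s := by
    intro s
    have h1 := hd.hasFDerivAt.comp (f := fun s => (s, φ x)) (0 : Fin (m + 1) → ℝ)
      (hasFDerivAt_prodMk_left 0 (φ x))
    have h2 := h1.unique (Φ.hasFDerivAt_coordFlow_time hφ hz)
    have h3 := congrArg (fun T => T s) h2
    simpa using h3
  have hs := (hd.isLittleO.def hc0)
  have hdom := Φ.isOpen_coordFlowDomain.mem_nhds (Φ.mem_coordFlowDomain_zero hz)
  have htend : Tendsto (fun p : (Fin (m + 1) → ℝ) × EuclideanSpace ℝ (Fin D) =>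
      ((p.1, p.2), ((0 : Fin (m + 1) → ℝ), p.2))) (𝓝 (0, φ x)) (𝓝 ((0, φ x), (0, φ x))) :=
    Continuous.tendsto' (by fun_prop) _ _ rfl
  have hev : ∀ᶠ p : (Fin (m + 1) → ℝ) × EuclideanSpace ℝ (Fin D) in 𝓝 (0, φ x),
      p ∈ Φ.coordFlowDomain φ ∧ (p.1 ∈ C → c * ‖p.1‖ ≤ ‖Φ.coordFlow φ p.1 p.2 - p.2‖) := by
    have htar : ∀ᶠ p : (Fin (m + 1) → ℝ) × EuclideanSpace ℝ (Fin D) in 𝓝 (0, φ x),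
        p.2 ∈ φ.target :=
      continuous_snd.continuousAt.eventually (φ.open_target.mem_nhds hz)
    filter_upwards [htend.eventually hs, hdom, htar] with p hp hpd hpt
    refine ⟨hpd, fun hpC => ?_⟩
    simp only [Prod.mk_sub_mk, sub_zero, sub_self, hd0, Φ.coordFlow_zero hpt] at hp
    have h1 : ‖((p.1, 0) : (Fin (m + 1) → ℝ) × EuclideanSpace ℝ (Fin D))‖ = ‖p.1‖ := by
      simp [Prod.norm_def]
    rw [h1] at hp
    have h2 := hlow p.1 hpC
    have h3 := norm_sub_norm_le (Φ.coordKilling φ (φ x) p.1) (Φ.coordFlow φ p.1 p.2 - p.2)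
    rw [norm_sub_rev (Φ.coordKilling φ (φ x) p.1)] at h3
    have h4 : (K : ℝ)⁻¹ = 2 * c := by rw [hc]; ring
    rw [h4] at h2
    linarith
  rw [nhds_prod_eq] at hev
  obtain ⟨u, hu, v, hv, huv⟩ := eventually_prod_iff.1 hev
  obtain ⟨ε, hε, hball⟩ := Metric.nhds_basis_closedBall.mem_iff.1 hu
  refine ⟨C, c, ε, hC, hc0, hε, ?_⟩
  filter_upwards [hv] with z hz s hsC hsε
  have := huv (hball (by simpa using hsε)) hz
  exact ⟨this.1, this.2 hsC⟩

variable [T2Space M]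

/-- Small elements of the stabilizer belong to the isotropy algebra. -/
theorem exists_stabilizer_subset_isotropy (x : M) :
    ∃ ε > 0, ∀ s ∈ Φ.stabilizer x, ‖s‖ < ε → s ∈ Φ.isotropy x := by
  obtain ⟨φ, hφ, hx⟩ := exists_isSmoothChart (D := D) x
  obtain ⟨C, c, ε, hC, hc, hε, hev⟩ := exists_le_norm_coordFlow_sub (Φ := Φ) hφ hx
  have h0 := hev.self_of_nhds
  let π : (Fin (m + 1) → ℝ) →ₗ[ℝ] C := C.projectionOnto (Φ.isotropy x) hC.symm
  obtain ⟨δ, hδ, hball⟩ := Metric.continuousAt_iff.1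
    ((LinearMap.toContinuousLinearMap π).continuous.continuousAt (x := 0)) ε hε
  refine ⟨δ, hδ, fun s hs hsδ => ?_⟩
  have h1 : ‖π s‖ < ε := by
    have := hball (x := s) (by simpa using hsδ)
    simpa using this
  have hsub : s - π s ∈ Φ.isotropy x := by
    refine (Submodule.projectionOnto_apply_eq_zero_iff hC.symm).1 ?_
    rw [map_sub, Submodule.projectionOnto_apply_left, sub_self]
  -- Isotropy elements belong to the stabilizer, so the component of `s` in the complement does as
  -- well. Being small, it would move `x` unless it is zero.
  have h2 : Φ.flow (π s : Fin (m + 1) → ℝ) x = x := by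
    have := (Φ.stabilizer x).sub_mem hs (isotropy_le_stabilizer hsub)
    rw [sub_sub_cancel] at this
    exact this
  have h3 := (h0 (π s) (π s).2 (by simpa using h1.le)).2
  rw [coordFlow, φ.left_inv hx, h2, sub_self, norm_zero] at h3
  have h4 : (π s : Fin (m + 1) → ℝ) = 0 := by
    rw [← norm_eq_zero]
    exact le_antisymm (by nlinarith) (norm_nonneg _)
  rwa [h4, sub_zero] at hsub

/-- The isotropy algebra is upper semicontinuous. -/
theorem eventually_isotropy_le {x : M} (hH : ∀ s ∈ Φ.stabilizer x, s 0 = 0) :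
    ∀ᶠ y in 𝓝 x, Φ.isotropy y ≤ Φ.isotropy x := by
  obtain ⟨φ, hφ, hx⟩ := exists_isSmoothChart (D := D) x
  obtain ⟨C, c, ε, hC, hc, hε, hev⟩ := exists_le_norm_coordFlow_sub (Φ := Φ) hφ hx
  have hU : φ.source ∩ φ ⁻¹' Metric.ball (φ x) (c * ε / 4) ∈ 𝓝 x :=
    inter_mem (φ.open_source.mem_nhds hx)
      ((φ.continuousAt hx).preimage_mem_nhds (Metric.ball_mem_nhds _ (by positivity)))
  filter_upwards [eventually_forall_stabilizer hH hU, (φ.continuousAt hx).eventually hev]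
    with y hy hev a ha
  have hy0 := hy 0 (Φ.stabilizer x).zero_mem
  rw [Φ.flow_zero] at hy0
  obtain ⟨a₁, ha₁, a₂, ha₂, rfl⟩ := Submodule.mem_sup.1 (hC.sup_eq_top ▸ Submodule.mem_top (x := a))
  by_contra hne
  have ha₂0 : a₂ ≠ 0 := by rintro rfl; rw [add_zero] at hne; exact hne ha₁
  have hn : 0 < ‖a₂‖ := norm_pos_iff.2 ha₂0
  obtain ⟨t, ht⟩ : ∃ t : ℝ, t = ε / ‖a₂‖ := ⟨_, rfl⟩
  have htn : ‖t • a₂‖ = ε := by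
    rw [norm_smul, ht, Real.norm_eq_abs, abs_of_pos (by positivity), div_mul_cancel₀ _ hn.ne']
  have h1 := (hev (t • a₂) (C.smul_mem t ha₂) htn.le).2
  -- As `a₁ + a₂` fixes `y`, flowing along `a₂` is flowing backwards along `a₁`. The latter is in
  -- the stabilizer of `x` and keeps `y` close to `x`, while the former, with `‖t • a₂‖ = ε`,
  -- displaces `y` by at least `c * ε`.
  have h2 : Φ.flow (t • a₂) y = Φ.flow (-(t • a₁)) y := by
    have h3 := Φ.flow_smul_eq_of_killing_eq_zero (mem_isotropy.1 ha) t
    conv_rhs => rw [← h3]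
    rw [← Φ.flow_add]
    congr 1
    rw [smul_add]; abel
  have h3 := hy (-(t • a₁)) ((Φ.stabilizer x).neg_mem
    (isotropy_le_stabilizer ((Φ.isotropy x).smul_mem t ha₁)))
  rw [coordFlow, φ.left_inv hy0.1, h2, htn] at h1
  have h4 : dist (φ (Φ.flow (-(t • a₁)) y)) (φ x) < c * ε / 4 := h3.2
  have h5 : dist (φ y) (φ x) < c * ε / 4 := hy0.2
  have h6 := dist_triangle_right (φ (Φ.flow (-(t • a₁)) y)) (φ y) (φ x)
  rw [← dist_eq_norm] at h1
  have : 0 < c * ε := by positivity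
  linarith

/-- A one-dimensional isotropy algebra is spanned by a primitive integer vector. -/
theorem exists_primitive_of_isotropy_eq_span {x : M} (hH : ∀ s ∈ Φ.stabilizer x, s 0 = 0)
    {a : Fin (m + 1) → ℝ} (ha : a ≠ 0) (hspan : Φ.isotropy x = ℝ ∙ a) :
    ∃ n : Fin m → ℤ, Finset.univ.gcd n = 1 ∧ ∃ c : ℝ, c ≠ 0 ∧
      (Fin.cons 0 fun i => (n i : ℝ) : Fin (m + 1) → ℝ) = c • a := by
  obtain ⟨ε, hε, hsmall⟩ := exists_stabilizer_subset_isotropy (Φ := Φ) x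
  -- Reduced modulo the periods, the multiples of `b` stay bounded, so two of them come close. Their
  -- difference `d` is a small element of the stabilizer, hence in the isotropy algebra, and it
  -- differs from a multiple of `b` by a period `w`, which is then in the isotropy algebra too.
  -- Since `‖b‖ = ε`, the bound `‖d‖ < ε` excludes `w = 0`.
  obtain ⟨b, hb⟩ : ∃ b : Fin (m + 1) → ℝ, b = (ε / ‖a‖) • a := ⟨_, rfl⟩
  have han : 0 < ‖a‖ := norm_pos_iff.2 ha
  have hbn : ‖b‖ = ε := by
    rw [hb, norm_smul, Real.norm_eq_abs, abs_of_pos (by positivity), div_mul_cancel₀ _ han.ne']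
  have hbI : b ∈ Φ.isotropy x := by
    rw [hspan, hb]; exact Submodule.mem_span_singleton.2 ⟨_, rfl⟩
  have hbH : b ∈ Φ.stabilizer x := isotropy_le_stabilizer hbI
  choose l hl hlb using fun j : ℕ => exists_periodLattice_sub_norm_le
    (hH _ ((Φ.stabilizer x).nsmul_mem hbH j))
  obtain ⟨p, -, u, hu, hlim⟩ := (isCompact_closedBall (0 : Fin (m + 1) → ℝ)
    (2 * Real.pi)).tendsto_subseq (x := fun j => j • b - l j) fun j => by simpa using hlb j
  obtain ⟨N, hN⟩ := Metric.cauchySeq_iff.1 hlim.cauchySeq ε hε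
  have hdist := hN (N + 1) (by omega) N le_rfl
  obtain ⟨j, hj⟩ : ∃ j : ℕ, u (N + 1) = u N + (j + 1) := by
    have : u N < u (N + 1) := hu (Nat.lt_succ_self N)
    exact ⟨u (N + 1) - u N - 1, by omega⟩
  obtain ⟨d, hd⟩ : ∃ d, d = (j + 1) • b - (l (u (N + 1)) - l (u N)) := ⟨_, rfl⟩
  have hdn : ‖d‖ < ε := by
    rw [dist_eq_norm] at hdist
    have e : ((fun j : ℕ => j • b - l j) ∘ u) (N + 1) - ((fun j : ℕ => j • b - l j) ∘ u) N = d := by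
      rw [hd]
      simp only [Function.comp, hj, add_smul]
      abel
    rwa [e] at hdist
  have hlam : l (u (N + 1)) - l (u N) ∈ periodLattice m := (periodLattice m).sub_mem (hl _) (hl _)
  have hdI : d ∈ Φ.isotropy x := by
    refine hsmall d ?_ hdn
    rw [hd]
    exact (Φ.stabilizer x).sub_mem ((Φ.stabilizer x).nsmul_mem hbH _)
      (periodLattice_le_stabilizer x hlam)
  obtain ⟨w, hw⟩ : ∃ w, w = l (u (N + 1)) - l (u N) := ⟨_, rfl⟩
  rw [← hw] at hlam hd
  have hwI : w ∈ Φ.isotropy x := by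
    have : w = (j + 1) • b - d := by rw [hd]; abel
    rw [this]
    exact Submodule.sub_mem _ (Submodule.smul_of_tower_mem _ _ hbI) hdI
  have hw0 : w ≠ 0 := by
    rintro rfl
    rw [sub_zero] at hd
    rw [hd, ← Nat.cast_smul_eq_nsmul ℝ, norm_smul, hbn] at hdn
    simp only [Nat.cast_add, Nat.cast_one, Real.norm_eq_abs] at hdn
    rw [abs_of_nonneg (by positivity)] at hdn
    nlinarith [(Nat.cast_nonneg j : (0 : ℝ) ≤ j)]
  obtain ⟨hw00, hwk⟩ := hlam
  choose k hk using hwk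
  have hk0 : ∃ i, k i ≠ 0 := by
    by_contra! h
    refine hw0 (funext fun i => ?_)
    refine Fin.cases hw00 (fun i => ?_) i
    rw [hk, h]; simp
  obtain ⟨i₀, hi₀⟩ := hk0
  obtain ⟨n, hn, hgcd⟩ := Finset.extract_gcd k ⟨i₀, Finset.mem_univ i₀⟩
  rw [hspan] at hwI
  obtain ⟨c, hc⟩ := Submodule.mem_span_singleton.1 hwI
  have hg : ((Finset.univ.gcd k : ℤ) : ℝ) ≠ 0 := by
    intro h
    have h' : Finset.univ.gcd k = 0 := by exact_mod_cast h
    exact hi₀ (by rw [hn i₀ (Finset.mem_univ _), h', zero_mul])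
  have hpi := Real.pi_pos
  refine ⟨n, hgcd, c / (2 * Real.pi * (Finset.univ.gcd k : ℤ)), ?_, ?_⟩
  · refine div_ne_zero ?_ (mul_ne_zero (by positivity) hg)
    rintro rfl
    rw [zero_smul] at hc
    exact hw0 hc.symm
  · funext i
    have hci : c * a i = w i := by rw [← hc]; simp
    refine Fin.cases ?_ (fun i hci => ?_) i hci
    · intro hci
      simp only [Fin.cons_zero, Pi.smul_apply, smul_eq_mul]
      rw [div_mul_eq_mul_div, hci, hw00, zero_div]
    · simp only [Fin.cons_succ, Pi.smul_apply, smul_eq_mul]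
      rw [div_mul_eq_mul_div, hci, hk, hn i (Finset.mem_univ _)]
      push_cast
      field_simp

end IsometricAction

end DomainStructure

namespace DomainStructure

/-! ### Charts that straighten the boundary -/

section FlatChart

variable {D : ℕ} {M : Type*} [TopologicalSpace M]
  [ChartedSpace (EuclideanSpace ℝ (Fin D)) M]

theorem IsSmoothChart.trans {φ : OpenPartialHomeomorph M (EuclideanSpace ℝ (Fin D))}
    (hφ : IsSmoothChart φ)
    {e : OpenPartialHomeomorph (EuclideanSpace ℝ (Fin D)) (EuclideanSpace ℝ (Fin D))}
    (he : ContDiffOn ℝ ∞ e e.source) (he' : ContDiffOn ℝ ∞ e.symm e.target) :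
    IsSmoothChart (φ.trans e) := by
  constructor
  · exact (contMDiffOn_iff_contDiffOn.2 he).comp (hφ.smooth.mono fun y hy => hy.1) fun y hy => hy.2
  · exact hφ.smooth_symm.comp ((contMDiffOn_iff_contDiffOn.2 he').mono fun y hy => hy.1)
      fun y hy => hy.2

/-- Local coordinates in which `E` is a half space. -/
structure IsFlatChart (φ : OpenPartialHomeomorph M (EuclideanSpace ℝ (Fin D)))
    (ℓ : EuclideanSpace ℝ (Fin D) →L[ℝ] ℝ) (E : Set M) : Prop where
  smoothChart : IsSmoothChart φ
  ne_zero : ℓ ≠ 0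
  mem_iff : ∀ y ∈ φ.source, y ∈ E ↔ 0 < ℓ (φ y)

namespace IsFlatChart

variable {φ : OpenPartialHomeomorph M (EuclideanSpace ℝ (Fin D))}
  {ℓ : EuclideanSpace ℝ (Fin D) →L[ℝ] ℝ} {E : Set M} (h : IsFlatChart φ ℓ E)
include h

theorem mem_closure_iff {y : M} (hy : y ∈ φ.source) : y ∈ closure E ↔ 0 ≤ ℓ (φ y) := by
  constructor
  · intro hcl
    by_contra! hneg
    have h1 : φ.source ∩ φ ⁻¹' {z | ℓ z < 0} ∈ 𝓝 y :=
      inter_mem (φ.open_source.mem_nhds hy) ((φ.continuousAt hy).preimage_mem_nhds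
        ((isOpen_lt ℓ.continuous continuous_const).mem_nhds hneg))
    obtain ⟨w, ⟨hw1, hw2⟩, hwE⟩ := mem_closure_iff_nhds.1 hcl _ h1
    have h3 : ℓ (φ w) < 0 := hw2
    linarith [(h.mem_iff w hw1).1 hwE]
  · intro hnn
    obtain ⟨n, hn⟩ : ∃ n, 0 < ℓ n := by
      obtain ⟨v, hv⟩ := DFunLike.ne_iff.1 h.ne_zero
      rcases lt_or_gt_of_ne hv with h1 | h1
      · exact ⟨-v, by simpa using h1⟩
      · exact ⟨v, by simpa using h1⟩
    have hz : φ y ∈ φ.target := φ.map_source hy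
    have hc : Tendsto (fun t : ℝ => φ y + t • n) (𝓝[>] 0) (𝓝 (φ y)) := by
      have : Tendsto (fun t : ℝ => φ y + t • n) (𝓝 0) (𝓝 (φ y)) :=
        Continuous.tendsto' (by fun_prop) _ _ (by simp)
      exact this.mono_left nhdsWithin_le_nhds
    have hs : Tendsto (fun t : ℝ => φ.symm (φ y + t • n)) (𝓝[>] 0) (𝓝 y) := by
      have := (φ.continuousAt_symm hz).tendsto.comp hc
      rwa [φ.left_inv hy] at this
    refine mem_closure_of_tendsto hs ?_
    filter_upwards [hc.eventually (φ.open_target.mem_nhds hz), self_mem_nhdsWithin] with t ht ht0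
    rw [h.mem_iff _ (φ.map_target ht), φ.right_inv ht, map_add, map_smul, smul_eq_mul]
    have : 0 < t * ℓ n := mul_pos ht0 hn
    linarith

theorem mem_frontier_iff (hE : IsOpen E) {y : M} (hy : y ∈ φ.source) :
    y ∈ frontier E ↔ ℓ (φ y) = 0 := by
  rw [frontier, hE.interior_eq, Set.mem_sdiff, h.mem_closure_iff hy, h.mem_iff y hy, not_lt]
  exact ⟨fun h => le_antisymm h.2 h.1, fun h => ⟨h.ge, h.le⟩⟩

end IsFlatChart

variable [IsManifold (𝓡 D) ∞ M]

/-- The inverse function theorem turns the defining function of the boundary into a linear function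
of the coordinates. -/
theorem HasSmoothBoundary.exists_isFlatChart {E : Set M} (hb : HasSmoothBoundary (D := D) E)
    (hE : IsOpen E) {x : M} (hx : x ∈ frontier E) :
    ∃ φ ℓ, IsFlatChart (D := D) φ ℓ E ∧ x ∈ φ.source ∧ φ x = 0 := by
  obtain ⟨U, hU, hxU, u, hu, hu0, hEU⟩ := hb x hx
  obtain ⟨φ₀, hφ₀, hx₀⟩ := exists_isSmoothChart (D := D) x
  obtain ⟨z₀, hz₀⟩ : ∃ z₀, z₀ = φ₀ x := ⟨_, rfl⟩
  have hzt : z₀ ∈ φ₀.target := hz₀ ▸ φ₀.map_source hx₀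
  have hsymm : φ₀.symm z₀ = x := by rw [hz₀, φ₀.left_inv hx₀]
  obtain ⟨f, hf⟩ : ∃ f, f = fun z => u (φ₀.symm z) := ⟨_, rfl⟩
  have hux : u x = 0 := by
    have hcont : ContinuousAt u x := (hu.continuousOn x hxU).continuousAt (hU.mem_nhds hxU)
    rw [frontier, hE.interior_eq] at hx
    refine le_antisymm ?_ ?_
    · by_contra! hpos
      have : x ∈ E ∩ U := by rw [hEU]; exact ⟨hxU, hpos⟩
      exact hx.2 this.1
    · by_contra! hneg
      obtain ⟨w, ⟨hw1, hw2⟩, hwE⟩ := mem_closure_iff_nhds.1 hx.1 _ (inter_mem (hU.mem_nhds hxU)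
        (hcont.preimage_mem_nhds (Iio_mem_nhds hneg)))
      have : w ∈ {y ∈ U | 0 < u y} := hEU ▸ ⟨hwE, hw1⟩
      exact absurd this.2 (not_lt.2 (le_of_lt hw2))
  have hdom : IsOpen (φ₀.target ∩ φ₀.symm ⁻¹' U) := φ₀.symm.isOpen_inter_preimage hU
  have hfs : ∀ z ∈ φ₀.target ∩ φ₀.symm ⁻¹' U, ContDiffAt ℝ ∞ f z := by
    rintro z ⟨hz, hzU⟩
    rw [← contMDiffAt_iff_contDiffAt, hf]
    exact ((hu _ hzU).contMDiffAt (hU.mem_nhds hzU)).comp z (hφ₀.contMDiffAt_symm hz)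
  have hz₀d : z₀ ∈ φ₀.target ∩ φ₀.symm ⁻¹' U := ⟨hzt, by rw [mem_preimage, hsymm]; exact hxU⟩
  obtain ⟨ℓ, hℓ⟩ : ∃ ℓ, ℓ = fderiv ℝ f z₀ := ⟨_, rfl⟩
  have hfd : HasFDerivAt f ℓ z₀ := hℓ ▸ ((hfs z₀ hz₀d).differentiableAt (by simp)).hasFDerivAt
  have hℓ0 : ℓ ≠ 0 := by
    intro h0
    have h1 : u =ᶠ[𝓝 x] f ∘ φ₀ := by
      filter_upwards [φ₀.open_source.mem_nhds hx₀] with y hy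
      simp [hf, φ₀.left_inv hy]
    have h2 : HasMFDerivAt (𝓡 D) 𝓘(ℝ, ℝ) f (φ₀ x) ℓ := by rw [← hz₀]; exact hfd.hasMFDerivAt
    have h3 := (h2.comp x (hφ₀.mdifferentiableAt hx₀).hasMFDerivAt).congr_of_eventuallyEq h1
    rw [h3.mfderiv, h0] at hu0
    exact hu0 (ContinuousLinearMap.zero_comp _)
  obtain ⟨n, hn⟩ : ∃ n, ℓ n = 1 := by
    obtain ⟨v, hv⟩ := DFunLike.ne_iff.1 hℓ0
    exact ⟨(ℓ v)⁻¹ • v, by rw [map_smul, smul_eq_mul]; exact inv_mul_cancel₀ hv⟩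
  -- The correction along `n` achieves `ℓ ∘ F = f` and leaves the derivative at `z₀` equal to the
  -- identity.
  obtain ⟨F, hF⟩ : ∃ F : EuclideanSpace ℝ (Fin D) → EuclideanSpace ℝ (Fin D),
    F = fun z => (z - z₀) + (f z - ℓ (z - z₀)) • n := ⟨_, rfl⟩
  have hFs : ∀ z ∈ φ₀.target ∩ φ₀.symm ⁻¹' U, ContDiffAt ℝ ∞ F z := by
    intro z hz
    rw [hF]
    have := hfs z hz
    fun_prop
  have hFd : HasFDerivAt F ((ContinuousLinearEquiv.refl ℝ (EuclideanSpace ℝ (Fin D)) :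
      EuclideanSpace ℝ (Fin D) →L[ℝ] EuclideanSpace ℝ (Fin D))) z₀ := by
    rw [hF]
    have h1 : HasFDerivAt (fun z => z - z₀) (ContinuousLinearMap.id ℝ _) z₀ :=
      (hasFDerivAt_id z₀).sub_const z₀
    have h2 : HasFDerivAt (fun z => ℓ (z - z₀)) ℓ z₀ := ℓ.hasFDerivAt.comp z₀ h1
    have h3 := h1.add ((hfd.sub h2).smul_const n)
    refine h3.congr_fderiv ?_
    ext v
    simp
  have hℓF : ∀ z, ℓ (F z) = f z := by
    intro z
    simp only [hF, map_add, map_smul, hn, smul_eq_mul, mul_one]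
    ring
  obtain ⟨e₀, he₀⟩ : ∃ e, e = (hFs z₀ hz₀d).toOpenPartialHomeomorph F hFd (by simp) := ⟨_, rfl⟩
  have he₀F : (e₀ : EuclideanSpace ℝ (Fin D) → EuclideanSpace ℝ (Fin D)) = F := by
    rw [he₀]; exact (hFs z₀ hz₀d).toOpenPartialHomeomorph_coe hFd (by simp)
  have he₀s : z₀ ∈ e₀.source := by
    rw [he₀]; exact (hFs z₀ hz₀d).mem_toOpenPartialHomeomorph_source hFd (by simp)
  -- The derivative stays invertible on `W`, which makes the inverse smooth on its whole domain and
  -- not only at the image of `z₀`.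
  have hW : φ₀.target ∩ φ₀.symm ⁻¹' U ∩ fderiv ℝ F ⁻¹' range ((↑) :
      (EuclideanSpace ℝ (Fin D) ≃L[ℝ] EuclideanSpace ℝ (Fin D)) → _) ∈ 𝓝 z₀ := by
    refine inter_mem (hdom.mem_nhds hz₀d) ?_
    refine ((hFs z₀ hz₀d).continuousAt_fderiv (by simp)).preimage_mem_nhds ?_
    rw [hFd.fderiv]
    exact ContinuousLinearEquiv.isOpen.mem_nhds (mem_range_self _)
  obtain ⟨W, hWsub, hWo, hzW⟩ := mem_nhds_iff.1 hW
  obtain ⟨e, he⟩ : ∃ e, e = e₀.restrOpen W hWo := ⟨_, rfl⟩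
  have heF : ∀ z, e z = F z := fun z => by rw [he, ← he₀F]; rfl
  have hes : ∀ z ∈ e.source, z ∈ W := fun z hz => by rw [he] at hz; exact hz.2
  have hsm : ContDiffOn ℝ ∞ e e.source := fun z hz =>
    ((hFs z (hWsub (hes z hz)).1).congr_of_eventuallyEq
      (Eventually.of_forall heF)).contDiffWithinAt
  have hsm' : ContDiffOn ℝ ∞ e.symm e.target := by
    intro w hw
    have hz := e.map_target hw
    obtain ⟨L, hL⟩ := (hWsub (hes _ hz)).2
    have hFz := hFs _ (hWsub (hes _ hz)).1
    have heF' : (e : EuclideanSpace ℝ (Fin D) → EuclideanSpace ℝ (Fin D)) = F := funext heF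
    refine (e.contDiffAt_symm (f₀' := L) hw ?_ ?_).contDiffWithinAt
    · rw [heF', hL]; exact (hFz.differentiableAt (by simp)).hasFDerivAt
    · rw [heF']; exact hFz
  have hxs : x ∈ (φ₀.trans e).source := by
    refine ⟨hx₀, ?_⟩
    have : z₀ ∈ e.source := by rw [he]; exact ⟨he₀s, hzW⟩
    rw [hz₀] at this
    exact this
  refine ⟨φ₀.trans e, ℓ, ⟨hφ₀.trans hsm hsm', hℓ0, fun y hy => ?_⟩, hxs, ?_⟩
  · have hyU : y ∈ U := by
      have := (hWsub (hes _ hy.2)).1.2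
      have h2 : φ₀.symm (φ₀ y) ∈ U := this
      rwa [φ₀.left_inv hy.1] at h2
    have h1 : ℓ ((φ₀.trans e) y) = u y := by
      rw [OpenPartialHomeomorph.coe_trans, Function.comp, heF, hℓF, hf]
      simp only [φ₀.left_inv hy.1]
    rw [h1]
    constructor
    · intro hyE
      have : y ∈ {y ∈ U | 0 < u y} := hEU ▸ ⟨hyE, hyU⟩
      exact this.2
    · intro hpos
      have : y ∈ E ∩ U := by rw [hEU]; exact ⟨hyU, hpos⟩
      exact this.1
  · rw [OpenPartialHomeomorph.coe_trans, Function.comp, heF, ← hz₀, hF]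
    simp [hf, hsymm, hux]

end FlatChart

/-! ### Isometric coordinates for the isotropy representation -/

section Orthonormalization

/-- A positive definite form is the standard one in suitable linear coordinates. -/
theorem exists_basis_of_posDef {V : Type*} [AddCommGroup V] [Module ℝ V] [FiniteDimensional ℝ V]
    (b : V → V → ℝ) (hsymm : ∀ u v, b u v = b v u) (hadd : ∀ u v w, b (u + v) w = b u w + b v w)
    (hsmul : ∀ (c : ℝ) u v, b (c • u) v = c * b u v) (hpos : ∀ u, u ≠ 0 → 0 < b u u) :
    ∃ B : Module.Basis (Fin (Module.finrank ℝ V)) ℝ V,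
      ∀ u v, b u v = ∑ i, B.repr u i * B.repr v i := by
  let c : InnerProductSpace.Core ℝ V :=
    { inner := b
      conj_inner_symm := fun u v => by simp [hsymm u v]
      re_inner_nonneg := fun u => by
        by_cases h : u = 0
        · have h1 := hsmul 0 u u
          rw [zero_smul, zero_mul] at h1
          change 0 ≤ b u u
          rw [h] at h1 ⊢
          exact h1.ge
        · exact (hpos u h).le
      add_left := hadd
      smul_left := fun u v r => by simp [hsmul]
      definite := fun u h => by
        by_contra h0
        exact (hpos u h0).ne' h }
  let _ : NormedAddCommGroup V := c.toNormedAddCommGroup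
  let _ : InnerProductSpace ℝ V := InnerProductSpace.ofCore c.toCore
  refine ⟨(stdOrthonormalBasis ℝ V).toBasis, fun u v => ?_⟩
  have h1 : b u v = inner ℝ u v := rfl
  rw [h1, ← (stdOrthonormalBasis ℝ V).sum_inner_mul_inner u v]
  refine Finset.sum_congr rfl fun i _ => ?_
  rw [OrthonormalBasis.coe_toBasis_repr_apply, OrthonormalBasis.coe_toBasis_repr_apply,
    OrthonormalBasis.repr_apply_apply, OrthonormalBasis.repr_apply_apply, real_inner_comm]

theorem exists_equiv_of_posDef {D : ℕ}
    (b : EuclideanSpace ℝ (Fin D) → EuclideanSpace ℝ (Fin D) → ℝ) (hsymm : ∀ u v, b u v = b v u)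
    (hadd : ∀ u v w, b (u + v) w = b u w + b v w)
    (hsmul : ∀ (c : ℝ) u v, b (c • u) v = c * b u v) (hpos : ∀ u, u ≠ 0 → 0 < b u u) :
    ∃ S : EuclideanSpace ℝ (Fin D) ≃L[ℝ] EuclideanSpace ℝ (Fin D),
      ∀ u, b u u = ‖S u‖ ^ 2 := by
  obtain ⟨B, hB⟩ := exists_basis_of_posDef b hsymm hadd hsmul hpos
  have hfin : Module.finrank ℝ (EuclideanSpace ℝ (Fin D)) = D := by simp
  let B' := B.reindex (finCongr hfin)
  refine ⟨(B'.equivFun.trans (WithLp.linearEquiv 2 ℝ (Fin D → ℝ)).symm).toContinuousLinearEquiv,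
    fun u => ?_⟩
  rw [hB, EuclideanSpace.norm_sq_eq, ← Equiv.sum_comp (finCongr hfin)]
  refine Finset.sum_congr rfl fun i _ => ?_
  simp [B', sq]

end Orthonormalization

/-! ### The isotropy representation -/

namespace IsometricAction

variable {D m : ℕ} {M : Type*} [TopologicalSpace M]
  [ChartedSpace (EuclideanSpace ℝ (Fin D)) M] [IsManifold (𝓡 D) ∞ M]
  {g : LorentzMetric D M} {Φ : IsometricAction g m}
  {φ : OpenPartialHomeomorph M (EuclideanSpace ℝ (Fin D))} {x : M}

theorem mem_coordFlowDomain_of_stabilizer (hx : x ∈ φ.source) {s : Fin (m + 1) → ℝ}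
    (hs : s ∈ Φ.stabilizer x) : (s, φ x) ∈ Φ.coordFlowDomain φ := by
  refine ⟨φ.map_source hx, ?_⟩
  rw [φ.left_inv hx, mem_stabilizer.1 hs]
  exact hx

theorem coordFlow_of_stabilizer (hx : x ∈ φ.source) {s : Fin (m + 1) → ℝ}
    (hs : s ∈ Φ.stabilizer x) : Φ.coordFlow φ s (φ x) = φ x := by
  rw [coordFlow, φ.left_inv hx, mem_stabilizer.1 hs]

theorem coordFlowDeriv_periodic (s : Fin (m + 1) → ℝ) {l : Fin (m + 1) → ℝ}
    (hl : l ∈ periodLattice m) (z : EuclideanSpace ℝ (Fin D)) :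
    Φ.coordFlowDeriv φ (s + l) z = Φ.coordFlowDeriv φ s z := by
  have : (fun w => Φ.coordFlow φ (s + l) w) = fun w => Φ.coordFlow φ s w := by
    funext w
    rw [coordFlow, Φ.flow_add, Φ.flow_lattice hl.1 hl.2, coordFlow]
  rw [coordFlowDeriv, this, coordFlowDeriv]

theorem coordFlowDeriv_add_of_stabilizer (hφ : IsSmoothChart φ) (hx : x ∈ φ.source)
    {s t : Fin (m + 1) → ℝ} (hs : s ∈ Φ.stabilizer x) (ht : t ∈ Φ.stabilizer x)
    (v : EuclideanSpace ℝ (Fin D)) :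
    Φ.coordFlowDeriv φ (s + t) (φ x) v
      = Φ.coordFlowDeriv φ s (φ x) (Φ.coordFlowDeriv φ t (φ x) v) := by
  rw [Φ.coordFlowDeriv_add hφ (mem_coordFlowDomain_of_stabilizer hx ht)
    (mem_coordFlowDomain_of_stabilizer hx (add_mem hs ht)), coordFlow_of_stabilizer hx ht]
  rfl

theorem coordFlowDeriv_neg_apply (hφ : IsSmoothChart φ) (hx : x ∈ φ.source)
    {s : Fin (m + 1) → ℝ} (hs : s ∈ Φ.stabilizer x) (v : EuclideanSpace ℝ (Fin D)) :
    Φ.coordFlowDeriv φ (-s) (φ x) (Φ.coordFlowDeriv φ s (φ x) v) = v := by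
  rw [← coordFlowDeriv_add_of_stabilizer hφ hx (neg_mem hs) hs, neg_add_cancel,
    Φ.coordFlowDeriv_zero (φ.map_source hx)]
  rfl

theorem continuousOn_coordFlowDeriv (hφ : IsSmoothChart φ) (hx : x ∈ φ.source) :
    ContinuousOn (fun s => Φ.coordFlowDeriv φ s (φ x)) (Φ.stabilizer x) := by
  intro s hs
  have h1 := (Φ.contDiffAt_coordFlowDeriv hφ
    (mem_coordFlowDomain_of_stabilizer hx hs)).continuousAt
  exact (ContinuousAt.comp (f := fun s => (s, φ x)) h1 (by fun_prop)).continuousWithinAt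

variable [T2Space M]

/-- The isotropy representation is orthogonal in suitable linear coordinates. -/
theorem exists_equiv_norm_coordFlowDeriv (hH : ∀ s ∈ Φ.stabilizer x, s 0 = 0)
    (hφ : IsSmoothChart φ) (hx : x ∈ φ.source) :
    ∃ S : EuclideanSpace ℝ (Fin D) ≃L[ℝ] EuclideanSpace ℝ (Fin D), ∀ s ∈ Φ.stabilizer x,
      ∀ u, ‖S (Φ.coordFlowDeriv φ s (φ x) u)‖ = ‖S u‖ := by
  obtain ⟨Q, _, μ, σ, hμ, hσ, hmean⟩ := exists_invariant_mean (isClosed_stabilizer (Φ := Φ) x) hH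
    (periodLattice_le_stabilizer x)
  obtain ⟨ρ, hρ⟩ : ∃ ρ, ρ = fun s => Φ.coordFlowDeriv φ s (φ x) := ⟨_, rfl⟩
  have hρc : ContinuousOn ρ (Φ.stabilizer x) := hρ ▸ continuousOn_coordFlowDeriv hφ hx
  have hm : ∀ u v : EuclideanSpace ℝ (Fin D),
      MeasureTheory.Integrable (fun q => (inner ℝ (ρ (σ q) u) (ρ (σ q) v) : ℝ)) μ ∧
      ∀ t ∈ Φ.stabilizer x, ∫ q, (inner ℝ (ρ (t + σ q) u) (ρ (t + σ q) v) : ℝ) ∂μ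
        = ∫ q, (inner ℝ (ρ (σ q) u) (ρ (σ q) v) : ℝ) ∂μ := by
    intro u v
    refine hmean ℝ (fun s => inner ℝ (ρ s u) (ρ s v)) ?_ fun s _ l hl => ?_
    · exact (hρc.clm_apply continuousOn_const).inner (hρc.clm_apply continuousOn_const)
    · simp only [hρ, coordFlowDeriv_periodic s hl]
  obtain ⟨b, hb⟩ : ∃ b : EuclideanSpace ℝ (Fin D) → EuclideanSpace ℝ (Fin D) → ℝ,
    b = fun u v => ∫ q, (inner ℝ (ρ (σ q) u) (ρ (σ q) v) : ℝ) ∂μ := ⟨_, rfl⟩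
  have hpos : ∀ u, u ≠ 0 → 0 < b u u := by
    intro u hu
    rw [hb]
    refine (MeasureTheory.integral_pos_iff_support_of_nonneg
      (fun q => real_inner_self_nonneg) (hm u u).1).2 ?_
    have : Function.support (fun q => (inner ℝ (ρ (σ q) u) (ρ (σ q) u) : ℝ)) = univ := by
      refine eq_univ_of_forall fun q => ?_
      rw [Function.mem_support, Ne, inner_self_eq_zero]
      intro h0
      have h1 := coordFlowDeriv_neg_apply hφ hx (hσ q) u
      rw [hρ] at h0
      simp only at h0
      rw [h0, map_zero] at h1
      exact hu h1.symm
    rw [this]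
    simp
  obtain ⟨S, hS⟩ := exists_equiv_of_posDef b (fun u v => by simp only [hb, real_inner_comm])
    (fun u v w => by
      simp only [hb, map_add, inner_add_left]
      exact MeasureTheory.integral_add (hm u w).1 (hm v w).1)
    (fun c u v => by
      simp only [hb, map_smul, real_inner_smul_left]
      exact MeasureTheory.integral_const_mul _ _) hpos
  refine ⟨S, fun s hs u => ?_⟩
  have h1 : b (ρ s u) (ρ s u) = b u u := by
    rw [hb]
    simp only
    rw [← (hm u u).2 s hs]
    refine MeasureTheory.integral_congr_ae (Eventually.of_forall fun q => ?_)
    simp only [hρ]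
    rw [add_comm s, coordFlowDeriv_add_of_stabilizer hφ hx (hσ q) hs]
  rw [hS, hS, hρ] at h1
  exact (sq_eq_sq₀ (norm_nonneg _) (norm_nonneg _)).1 h1

variable (Φ) in
/-- Coordinates centred at `x` in which `E` is the whole space or a half space, and in which the
isotropy representation is orthogonal. -/
structure IsAdaptedChart (E : Set M) (x : M)
    (φ : OpenPartialHomeomorph M (EuclideanSpace ℝ (Fin D)))
    (ℓ : EuclideanSpace ℝ (Fin D) →L[ℝ] ℝ) : Prop where
  smoothChart : IsSmoothChart φ
  mem_source : x ∈ φ.source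
  apply_eq_zero : φ x = 0
  flat : (ℓ = 0 ∧ φ.source ⊆ E) ∨ IsFlatChart φ ℓ E
  norm_coordFlowDeriv : ∀ s ∈ Φ.stabilizer x, ∀ u, ‖Φ.coordFlowDeriv φ s 0 u‖ = ‖u‖

/-- The linear map `S`, which comes from an averaged inner product, makes the isotropy
representation orthogonal; the conormal is transported along. -/
theorem exists_isAdaptedChart_of_chart {E : Set M} {ℓ : EuclideanSpace ℝ (Fin D) →L[ℝ] ℝ}
    (hH : ∀ s ∈ Φ.stabilizer x, s 0 = 0) (hφ : IsSmoothChart φ) (hx : x ∈ φ.source)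
    (h0 : φ x = 0) (hflat : (ℓ = 0 ∧ φ.source ⊆ E) ∨ IsFlatChart φ ℓ E) :
    ∃ φ ℓ, Φ.IsAdaptedChart E x φ ℓ := by
  obtain ⟨S, hS⟩ := exists_equiv_norm_coordFlowDeriv (Φ := Φ) hH hφ hx
  obtain ⟨e, he⟩ : ∃ e, e = S.toHomeomorph.toOpenPartialHomeomorph := ⟨_, rfl⟩
  have hes : ∀ z, e z = S z := fun z => by rw [he]; rfl
  have hsm : IsSmoothChart (φ.trans e) := by
    refine hφ.trans ?_ ?_
    · rw [he]; exact S.contDiff.contDiffOn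
    · rw [he]; exact S.symm.contDiff.contDiffOn
  have hsrc : ∀ y, y ∈ (φ.trans e).source ↔ y ∈ φ.source := by
    intro y; rw [he]; simp
  have hap : ∀ y, (φ.trans e) y = S (φ y) := fun y => hes _
  refine ⟨φ.trans e, ℓ.comp (S.symm : EuclideanSpace ℝ (Fin D) →L[ℝ] EuclideanSpace ℝ (Fin D)),
    hsm, (hsrc x).2 hx, by rw [hap, h0, map_zero], ?_, fun s hs u => ?_⟩
  · rcases hflat with ⟨h, hsub⟩ | h
    · left
      exact ⟨by rw [h, ContinuousLinearMap.zero_comp], fun y hy => hsub ((hsrc y).1 hy)⟩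
    · right
      refine ⟨hsm, fun h1 => h.ne_zero ?_, fun y hy => ?_⟩
      · ext v
        have := DFunLike.congr_fun h1 (S v)
        simpa using this
      · rw [h.mem_iff y ((hsrc y).1 hy), hap]
        simp
  · have h1 : (fun w => Φ.coordFlow (φ.trans e) s w)
        = S ∘ (fun w => Φ.coordFlow φ s w) ∘ S.symm := by
      funext w
      rw [coordFlow, hap, he]
      rfl
    have h2 : Φ.coordFlowDeriv (φ.trans e) s 0 u
        = S (Φ.coordFlowDeriv φ s (φ x) (S.symm u)) := by
      rw [coordFlowDeriv, h1, S.comp_fderiv, S.symm.comp_right_fderiv, map_zero, h0]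
      rfl
    rw [h2, hS s hs, S.apply_symm_apply]

/-- Interior points are encoded by `ℓ = 0` and a chart inside `E`, so that `E` and its boundary can
be treated together. -/
theorem IsExterior.exists_isAdaptedChart {E : Set M} (hE : Φ.IsExterior E)
    (hproper : Φ.IsProper E) (hb : HasSmoothBoundary (D := D) E) (hx : x ∈ closure E) :
    ∃ φ ℓ, Φ.IsAdaptedChart E x φ ℓ := by
  have hH : ∀ s ∈ Φ.stabilizer x, s 0 = 0 := fun s hs => hproper.apply_zero_eq_zero_of_flow hx hs
  rcases hE.mem_or_mem_frontier hx with h | h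
  · obtain ⟨φ, hφ, hxφ⟩ := exists_isSmoothChart (D := D) x
    obtain ⟨φ₁, hφ₁⟩ : ∃ φ₁, φ₁ = φ.restrOpen E hE.isOpen := ⟨_, rfl⟩
    have hsm₁ : IsSmoothChart φ₁ := by
      constructor
      · rw [hφ₁]; exact hφ.smooth.mono fun y hy => hy.1
      · rw [hφ₁]; exact hφ.smooth_symm.mono fun y hy => hy.1
    obtain ⟨e, he⟩ : ∃ e, e =
      (Homeomorph.addRight (-(φ₁ x))).toOpenPartialHomeomorph := ⟨_, rfl⟩
    have hsm : IsSmoothChart (φ₁.trans e) := by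
      refine hsm₁.trans ?_ ?_
      · rw [he]
        exact (contDiff_id.add contDiff_const).contDiffOn
      · rw [he]
        exact (contDiff_id.add contDiff_const).contDiffOn
    refine exists_isAdaptedChart_of_chart (ℓ := 0) hH hsm ?_ ?_ (Or.inl ⟨rfl, ?_⟩)
    · rw [he, hφ₁]; exact ⟨⟨hxφ, h⟩, mem_univ _⟩
    · rw [he]; exact add_neg_cancel (φ₁ x)
    · intro y hy
      rw [hφ₁] at hy
      exact hy.1.2
  · obtain ⟨φ, ℓ, hflat, hxφ, h0⟩ := hb.exists_isFlatChart hE.isOpen h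
    exact exists_isAdaptedChart_of_chart hH hflat.smoothChart hxφ h0 (Or.inr hflat)

end IsometricAction

end DomainStructure

namespace DomainStructure

namespace IsometricAction

variable {D m : ℕ} {M : Type*} [TopologicalSpace M]
  [ChartedSpace (EuclideanSpace ℝ (Fin D)) M] [IsManifold (𝓡 D) ∞ M]
  {g : LorentzMetric D M} {Φ : IsometricAction g m}
  {φ : OpenPartialHomeomorph M (EuclideanSpace ℝ (Fin D))} {x : M}

/-! ### The infinitesimal isotropy representation -/

variable (Φ φ) in
/-- The infinitesimal isotropy representation in local coordinates. -/
noncomputable def isotropyRep (z : EuclideanSpace ℝ (Fin D)) : (Fin (m + 1) → ℝ) →L[ℝ]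
    EuclideanSpace ℝ (Fin D) →L[ℝ] EuclideanSpace ℝ (Fin D) :=
  fderiv ℝ (fun s => Φ.coordFlowDeriv φ s z) 0

section

variable (hφ : IsSmoothChart φ) (hx : x ∈ φ.source)
include hφ hx

theorem hasDerivAt_coordFlowDeriv_zero (a : Fin (m + 1) → ℝ) (v : EuclideanSpace ℝ (Fin D)) :
    HasDerivAt (fun t : ℝ => Φ.coordFlowDeriv φ (t • a) (φ x) v)
      (Φ.isotropyRep φ (φ x) a v) 0 := by
  have h1 := (Φ.contDiffAt_coordFlowDeriv hφ
    (Φ.mem_coordFlowDomain_zero (φ.map_source hx))).differentiableAt (by simp)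
  have h2 : HasFDerivAt (fun s => Φ.coordFlowDeriv φ s (φ x)) (Φ.isotropyRep φ (φ x))
      ((0 : ℝ) • a) := by
    rw [zero_smul]
    exact (DifferentiableAt.comp (f := fun s => (s, φ x)) (0 : Fin (m + 1) → ℝ) h1
      (by fun_prop)).hasFDerivAt
  have h3 : HasDerivAt (fun t : ℝ => t • a) a 0 := by
    simpa using (hasDerivAt_id (0 : ℝ)).smul_const a
  have h4 := h2.comp_hasDerivAt (0 : ℝ) h3
  exact (ContinuousLinearMap.apply ℝ (EuclideanSpace ℝ (Fin D)) v).hasFDerivAt.comp_hasDerivAt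
    (0 : ℝ) h4

variable [T2Space M]

theorem hasDerivAt_coordFlowDeriv {a : Fin (m + 1) → ℝ} (ha : a ∈ Φ.isotropy x)
    (v : EuclideanSpace ℝ (Fin D)) (t : ℝ) :
    HasDerivAt (fun t : ℝ => Φ.coordFlowDeriv φ (t • a) (φ x) v)
      (Φ.coordFlowDeriv φ (t • a) (φ x) (Φ.isotropyRep φ (φ x) a v)) t := by
  have hst : ∀ t : ℝ, t • a ∈ Φ.stabilizer x := fun t =>
    isotropy_le_stabilizer ((Φ.isotropy x).smul_mem t ha)
  have h1 : (fun τ : ℝ => Φ.coordFlowDeriv φ (τ • a) (φ x) v) = fun τ : ℝ =>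
      Φ.coordFlowDeriv φ (t • a) (φ x) (Φ.coordFlowDeriv φ ((τ - t) • a) (φ x) v) := by
    funext τ
    rw [← coordFlowDeriv_add_of_stabilizer hφ hx (hst _) (hst _), ← add_smul, add_sub_cancel]
  have h2 : HasDerivAt (fun τ : ℝ => Φ.coordFlowDeriv φ ((τ - t) • a) (φ x) v)
      (Φ.isotropyRep φ (φ x) a v) t := by
    have h3 := hasDerivAt_coordFlowDeriv_zero (Φ := Φ) hφ hx a v
    rw [← sub_self t] at h3
    exact h3.comp_sub_const t t
  rw [h1]
  exact (Φ.coordFlowDeriv φ (t • a) (φ x)).hasFDerivAt.comp_hasDerivAt t h2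

theorem coordFlowDeriv_smul_apply_eq {a : Fin (m + 1) → ℝ} (ha : a ∈ Φ.isotropy x)
    {v : EuclideanSpace ℝ (Fin D)} (h0 : Φ.isotropyRep φ (φ x) a v = 0) (t : ℝ) :
    Φ.coordFlowDeriv φ (t • a) (φ x) v = v := by
  have h1 := is_const_of_deriv_eq_zero
    (fun t => (hasDerivAt_coordFlowDeriv (Φ := Φ) hφ hx ha v t).differentiableAt)
    (fun t => by rw [(hasDerivAt_coordFlowDeriv (Φ := Φ) hφ hx ha v t).deriv, h0, map_zero]) t 0
  rw [h1, zero_smul, Φ.coordFlowDeriv_zero (φ.map_source hx)]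
  rfl

omit [T2Space M] in
theorem isotropyRep_apply_eq_zero {a : Fin (m + 1) → ℝ} {v : EuclideanSpace ℝ (Fin D)}
    (h : ∀ᶠ t : ℝ in 𝓝 0, Φ.coordFlowDeriv φ (t • a) (φ x) v = v) :
    Φ.isotropyRep φ (φ x) a v = 0 :=
  ((hasDerivAt_coordFlowDeriv_zero (Φ := Φ) hφ hx a v).congr_of_eventuallyEq
    (h.mono fun _ ht => ht.symm)).unique (hasDerivAt_const _ _)

theorem isotropyRep_coordFlowDeriv {a : Fin (m + 1) → ℝ} (ha : a ∈ Φ.isotropy x)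
    {s : Fin (m + 1) → ℝ} (hs : s ∈ Φ.stabilizer x) (v : EuclideanSpace ℝ (Fin D)) :
    Φ.isotropyRep φ (φ x) a (Φ.coordFlowDeriv φ s (φ x) v)
      = Φ.coordFlowDeriv φ s (φ x) (Φ.isotropyRep φ (φ x) a v) := by
  have hst : ∀ t : ℝ, t • a ∈ Φ.stabilizer x := fun t =>
    isotropy_le_stabilizer ((Φ.isotropy x).smul_mem t ha)
  have h1 := hasDerivAt_coordFlowDeriv_zero (Φ := Φ) hφ hx a (Φ.coordFlowDeriv φ s (φ x) v)
  have h2 := (Φ.coordFlowDeriv φ s (φ x)).hasFDerivAt.comp_hasDerivAt (0 : ℝ)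
    (hasDerivAt_coordFlowDeriv_zero (Φ := Φ) hφ hx a v)
  refine h1.unique (h2.congr_of_eventuallyEq (Eventually.of_forall fun t => ?_))
  simp only [Function.comp]
  rw [← coordFlowDeriv_add_of_stabilizer hφ hx (hst _) hs, add_comm,
    coordFlowDeriv_add_of_stabilizer hφ hx hs (hst _)]

theorem isotropyRep_comm {a b : Fin (m + 1) → ℝ} (ha : a ∈ Φ.isotropy x)
    (hb : b ∈ Φ.isotropy x) (v : EuclideanSpace ℝ (Fin D)) :
    Φ.isotropyRep φ (φ x) a (Φ.isotropyRep φ (φ x) b v)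
      = Φ.isotropyRep φ (φ x) b (Φ.isotropyRep φ (φ x) a v) := by
  have hst : ∀ t : ℝ, t • b ∈ Φ.stabilizer x := fun t =>
    isotropy_le_stabilizer ((Φ.isotropy x).smul_mem t hb)
  have h1 := hasDerivAt_coordFlowDeriv_zero (Φ := Φ) hφ hx b (Φ.isotropyRep φ (φ x) a v)
  have h2 := (Φ.isotropyRep φ (φ x) a).hasFDerivAt.comp_hasDerivAt (0 : ℝ)
    (hasDerivAt_coordFlowDeriv_zero (Φ := Φ) hφ hx b v)
  refine h2.unique (h1.congr_of_eventuallyEq (Eventually.of_forall fun t => ?_))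
  exact isotropyRep_coordFlowDeriv hφ hx ha (hst t) v

omit [T2Space M] in
theorem coordMetric_coordFlowDeriv {s : Fin (m + 1) → ℝ} (hs : s ∈ Φ.stabilizer x)
    (u v : EuclideanSpace ℝ (Fin D)) :
    coordMetric g φ (φ x) (Φ.coordFlowDeriv φ s (φ x) u) (Φ.coordFlowDeriv φ s (φ x) v)
      = coordMetric g φ (φ x) u v := by
  have := Φ.coordMetric_coordFlow hφ (mem_coordFlowDomain_of_stabilizer hx hs) u v
  rwa [coordFlow_of_stabilizer hx hs] at this

/-- The isotropy representation is skew for the forms that it preserves. -/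
theorem isotropyRep_skew {a : Fin (m + 1) → ℝ} (ha : a ∈ Φ.isotropy x)
    (B : EuclideanSpace ℝ (Fin D) →L[ℝ] EuclideanSpace ℝ (Fin D) →L[ℝ] ℝ)
    (hB : ∀ s ∈ Φ.stabilizer x, ∀ u v, B (Φ.coordFlowDeriv φ s (φ x) u)
      (Φ.coordFlowDeriv φ s (φ x) v) = B u v) (u v : EuclideanSpace ℝ (Fin D)) :
    B (Φ.isotropyRep φ (φ x) a u) v = -B u (Φ.isotropyRep φ (φ x) a v) := by
  have hst : ∀ t : ℝ, t • a ∈ Φ.stabilizer x := fun t =>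
    isotropy_le_stabilizer ((Φ.isotropy x).smul_mem t ha)
  have h1 := (B.hasFDerivAt.comp_hasDerivAt (0 : ℝ)
    (hasDerivAt_coordFlowDeriv_zero (Φ := Φ) hφ hx a u)).clm_apply
    (hasDerivAt_coordFlowDeriv_zero (Φ := Φ) hφ hx a v)
  have h2 := (h1.congr_of_eventuallyEq (Eventually.of_forall fun t => (hB _ (hst t) u v).symm)).unique
    (hasDerivAt_const _ _)
  simp only [Function.comp, zero_smul, Φ.coordFlowDeriv_zero (φ.map_source hx),
    ContinuousLinearMap.coe_id', id] at h2
  linarith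

/-- The stabilizer fixes the tangent vectors of the orbit because the group is abelian. -/
theorem isotropyRep_coordKilling {a : Fin (m + 1) → ℝ} (ha : a ∈ Φ.isotropy x)
    (b : Fin (m + 1) → ℝ) :
    Φ.isotropyRep φ (φ x) a (Φ.coordKilling φ (φ x) b) = 0 := by
  refine isotropyRep_apply_eq_zero hφ hx (Eventually.of_forall fun t => ?_)
  have hst : t • a ∈ Φ.stabilizer x := isotropy_le_stabilizer ((Φ.isotropy x).smul_mem t ha)
  have := Φ.coordKilling_coordFlow hφ (mem_coordFlowDomain_of_stabilizer hx hst) b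
  rw [coordFlow_of_stabilizer hx hst] at this
  exact this.symm

end

end IsometricAction

/-- A Lorentzian form has a time-like vector that is annihilated by every operator that is skew
both for this form and for the inner product. -/
theorem IsLorentz.exists_timelike_of_skew {V : Type*} [NormedAddCommGroup V]
    [InnerProductSpace ℝ V] [FiniteDimensional ℝ V] {B : V →L[ℝ] V →L[ℝ] ℝ} (hB : IsLorentz B) :
    ∃ ν, B ν ν < 0 ∧ ∀ A : V →ₗ[ℝ] V, (∀ u v, inner ℝ (A u) v = -inner ℝ u (A v)) →
      (∀ u v, B (A u) v = -B u (A v)) → A ν = 0 := by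
  obtain ⟨β, hβ⟩ : ∃ β : V →ₗ[ℝ] V, ∀ u v, inner ℝ (β u) v = B u v := by
    refine ⟨⟨⟨fun u => (InnerProductSpace.toDual ℝ V).symm (B u), fun u v => by simp⟩,
      fun c u => by simp⟩, fun u v => ?_⟩
    simp
  have hsymm : β.IsSymmetric := fun u v => by
    rw [hβ, real_inner_comm, hβ, hB.symm]
  obtain ⟨T, hT, -⟩ := hB.signature
  obtain ⟨e, he⟩ : ∃ e, e = hsymm.eigenvectorBasis rfl := ⟨_, rfl⟩
  obtain ⟨lam, hlam⟩ : ∃ lam, lam = hsymm.eigenvalues rfl := ⟨_, rfl⟩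
  have heig : ∀ i, β (e i) = lam i • e i := fun i => by
    rw [he, hlam]; exact hsymm.apply_eigenvectorBasis rfl i
  have hneg : ∃ i, lam i < 0 := by
    by_contra! hnn
    have h1 : B T T = ∑ i, lam i * inner ℝ (e i) T ^ 2 := by
      rw [← hβ, ← e.sum_inner_mul_inner]
      refine Finset.sum_congr rfl fun i _ => ?_
      rw [hsymm, heig, inner_smul_right, real_inner_comm]
      ring
    rw [h1] at hT
    exact absurd hT (not_lt.2 (Finset.sum_nonneg fun i _ => mul_nonneg (hnn i) (sq_nonneg _)))
  obtain ⟨i, hi⟩ := hneg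
  have hν : B (e i) (e i) < 0 := by
    rw [← hβ, heig, inner_smul_left, real_inner_self_eq_norm_sq, e.norm_eq_one]
    simpa using hi
  refine ⟨e i, hν, fun A hA hAB => ?_⟩
  by_contra h0
  -- `A` commutes with `β`, so `A (e i)` would be a second eigenvector with the same negative
  -- eigenvalue, orthogonal to `e i`. The signature has no room for it.
  have hort : inner ℝ (e i) (A (e i)) = (0 : ℝ) := by
    have h1 := hA (e i) (e i)
    rw [real_inner_comm] at h1
    linarith
  have h1 : B (e i) (A (e i)) = 0 := by
    rw [← hβ, heig, inner_smul_left, hort, mul_zero]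
  have h2 := hB.pos_of_orthogonal hν h1 h0
  have h3 : β (A (e i)) = lam i • A (e i) := by
    refine ext_inner_right ℝ fun v => ?_
    rw [hβ, hAB, ← hβ, heig, inner_smul_left, inner_smul_left, hA]
    simp
  rw [← hβ, h3, inner_smul_left, real_inner_self_eq_norm_sq] at h2
  simp only [conj_trivial] at h2
  have : 0 < ‖A (e i)‖ ^ 2 := by positivity
  nlinarith

namespace IsometricAction

variable {D m : ℕ} {M : Type*} [TopologicalSpace M] [T2Space M]
  [ChartedSpace (EuclideanSpace ℝ (Fin D)) M] [IsManifold (𝓡 D) ∞ M]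
  {g : LorentzMetric D M} {Φ : IsometricAction g m} {E : Set M} {x : M}
  {φ : OpenPartialHomeomorph M (EuclideanSpace ℝ (Fin D))}
  {ℓ : EuclideanSpace ℝ (Fin D) →L[ℝ] ℝ}

/-! ### Linearization of the action near a point -/

variable (Φ) in
/-- A chart in which the isotropy group acts linearly. -/
structure IsLinearModel (E : Set M) (x : M)
    (φ : OpenPartialHomeomorph M (EuclideanSpace ℝ (Fin D)))
    (ℓ : EuclideanSpace ℝ (Fin D) →L[ℝ] ℝ)
    (A : Φ.isotropy x →ₗ[ℝ] EuclideanSpace ℝ (Fin D) →ₗ[ℝ] EuclideanSpace ℝ (Fin D))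
    (X : OpenPartialHomeomorph M (EuclideanSpace ℝ (Fin D))) : Prop where
  adapted : Φ.IsAdaptedChart E x φ ℓ
  isSkewFamily : IsSkewFamily A
  target_eq : ∃ r > 0, X.target = Metric.ball 0 r
  mem_source : x ∈ X.source
  apply_eq_zero : X x = 0
  killing_iff : ∀ y ∈ X.source, ∀ a, Φ.killing a y = 0 ↔
    ∃ h : a ∈ Φ.isotropy x, A ⟨a, h⟩ (X y) = 0
  normal_apply : ∀ a v, ℓ (A a v) = 0
  mem_closure_iff : ∀ y ∈ X.source, y ∈ closure E ↔ 0 ≤ ℓ (X y)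
  mem_frontier_iff : ∀ y ∈ X.source, y ∈ frontier E ↔ ℓ ≠ 0 ∧ ℓ (X y) = 0
  -- `X` is not required to be smooth. This comparison, uniform in `a` and relative to the size of
  -- the field, replaces its derivative.
  approx : ∀ ε > 0, ∀ᶠ y in 𝓝 x, ∀ a : Φ.isotropy x,
    ‖Φ.coordKilling φ (φ y) a - A a (X y)‖ ≤ ε * ‖Φ.coordKilling φ (φ y) a‖
  metric_skew : ∀ a u v, coordMetric g φ 0 (A a u) v = -coordMetric g φ 0 u (A a v)
  apply_coordKilling : ∀ a b, A a (Φ.coordKilling φ 0 b) = 0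
  exists_timelike : ∃ ν, coordMetric g φ 0 ν ν < 0 ∧ ∀ a, A a ν = 0

/-- Uniformity over the stabilizer of properties near the origin. -/
theorem eventually_forall_stabilizer_coord (hH : ∀ s ∈ Φ.stabilizer x, s 0 = 0)
    {P : (Fin (m + 1) → ℝ) → EuclideanSpace ℝ (Fin D) → Prop} {z₀ : EuclideanSpace ℝ (Fin D)}
    (hper : ∀ s, ∀ l ∈ periodLattice m, ∀ z, P s z → P (s + l) z)
    (hP : ∀ s ∈ Φ.stabilizer x, ∀ᶠ p : (Fin (m + 1) → ℝ) × EuclideanSpace ℝ (Fin D) in 𝓝 (s, z₀),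
      P p.1 p.2) : ∀ᶠ z in 𝓝 z₀, ∀ s ∈ Φ.stabilizer x, P s z := by
  have hK : IsCompact ((Φ.stabilizer x : Set (Fin (m + 1) → ℝ)) ∩
      Metric.closedBall 0 (2 * Real.pi)) :=
    (isCompact_closedBall _ _).inter_left (isClosed_stabilizer x)
  have h2 := hK.eventually_forall_of_forall_eventually (x₀ := z₀) (P := fun z s => P s z)
    fun s hs => by
      have := hP s hs.1
      have hsw : Tendsto Prod.swap (𝓝 (z₀, s)) (𝓝 (s, z₀)) := continuous_swap.tendsto _
      exact hsw.eventually this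
  filter_upwards [h2] with z hz s hs
  obtain ⟨l, hl, hsl⟩ := exists_periodLattice_sub_norm_le (hH s hs)
  have h3 := hz (s - l) ⟨(Φ.stabilizer x).sub_mem hs (periodLattice_le_stabilizer x hl),
    by simpa using hsl⟩
  simpa using hper _ l hl z h3

/-- The estimate behind the linearization: near a fixed point, the flow differs from its
derivative by a small Lipschitz term, uniformly over the stabilizer. -/
theorem eventually_norm_coordFlow_sub_le (hH : ∀ s ∈ Φ.stabilizer x, s 0 = 0)
    (hφ : IsSmoothChart φ) (hx : x ∈ φ.source) (h0 : φ x = 0) {ε : ℝ} (hε : 0 < ε) :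
    ∃ δ > 0, ∀ s ∈ Φ.stabilizer x, ∀ z ∈ Metric.ball 0 δ, ∀ w ∈ Metric.ball 0 δ,
      (s, z) ∈ Φ.coordFlowDomain φ ∧
      ‖Φ.coordFlow φ s z - Φ.coordFlow φ s w - Φ.coordFlowDeriv φ s 0 (z - w)‖ ≤ ε * ‖z - w‖ := by
  have key : ∀ᶠ z in 𝓝 (0 : EuclideanSpace ℝ (Fin D)), ∀ s ∈ Φ.stabilizer x,
      (s, z) ∈ Φ.coordFlowDomain φ ∧ ‖Φ.coordFlowDeriv φ s z - Φ.coordFlowDeriv φ s 0‖ < ε := by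
    refine eventually_forall_stabilizer_coord hH (P := fun s z => (s, z) ∈ Φ.coordFlowDomain φ ∧
      ‖Φ.coordFlowDeriv φ s z - Φ.coordFlowDeriv φ s 0‖ < ε) ?_ fun s hs => ?_
    · rintro s l hl z ⟨h1, h2⟩
      refine ⟨⟨h1.1, ?_⟩, ?_⟩
      · rw [Φ.flow_add, Φ.flow_lattice hl.1 hl.2]; exact h1.2
      · rwa [coordFlowDeriv_periodic s hl, coordFlowDeriv_periodic s hl]
    · have hd := mem_coordFlowDomain_of_stabilizer hx hs
      rw [h0] at hd
      have hc := (Φ.contDiffAt_coordFlowDeriv hφ hd).continuousAt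
      have hc0 : ContinuousAt (fun p : (Fin (m + 1) → ℝ) × EuclideanSpace ℝ (Fin D) =>
          Φ.coordFlowDeriv φ p.1 0) (s, 0) :=
        ContinuousAt.comp (f := fun p : (Fin (m + 1) → ℝ) × EuclideanSpace ℝ (Fin D) =>
          (p.1, (0 : EuclideanSpace ℝ (Fin D)))) (x := (s, (0 : EuclideanSpace ℝ (Fin D)))) hc
          (by fun_prop)
      have hn := (hc.sub hc0).norm
      have hlt : ∀ᶠ p : (Fin (m + 1) → ℝ) × EuclideanSpace ℝ (Fin D) in 𝓝 (s, 0),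
          ‖Φ.coordFlowDeriv φ p.1 p.2 - Φ.coordFlowDeriv φ p.1 0‖ < ε :=
        hn.eventually (gt_mem_nhds (by simpa using hε))
      filter_upwards [hlt, Φ.isOpen_coordFlowDomain.mem_nhds hd] with p hp hpd using ⟨hpd, hp⟩
  obtain ⟨δ, hδ, hball⟩ := Metric.eventually_nhds_iff_ball.1 key
  refine ⟨δ, hδ, fun s hs z hz w hw => ⟨(hball z hz s hs).1, ?_⟩⟩
  have h1 : ∀ y ∈ Metric.ball (0 : EuclideanSpace ℝ (Fin D)) δ,
      HasFDerivWithinAt (fun w => Φ.coordFlow φ s w) (Φ.coordFlowDeriv φ s y)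
        (Metric.ball 0 δ) y := fun y hy =>
    (Φ.hasFDerivAt_coordFlow hφ (hball y hy s hs).1).hasFDerivWithinAt
  exact (convex_ball 0 δ).norm_image_sub_le_of_norm_hasFDerivWithin_le' h1
    (fun y hy => (hball y hy s hs).2.le) hw hz

end IsometricAction

end DomainStructure

/-! ### Averaged coordinates in which the stabilizer acts linearly -/

namespace DomainStructure

namespace IsometricAction

variable {D m : ℕ} {M : Type*} [TopologicalSpace M] [T2Space M]
  [ChartedSpace (EuclideanSpace ℝ (Fin D)) M] [IsManifold (𝓡 D) ∞ M]
  {g : LorentzMetric D M} {Φ : IsometricAction g m} {E : Set M} {x : M}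
  {φ : OpenPartialHomeomorph M (EuclideanSpace ℝ (Fin D))}
  {ℓ : EuclideanSpace ℝ (Fin D) →L[ℝ] ℝ}

namespace IsAdaptedChart

variable (h : Φ.IsAdaptedChart E x φ ℓ)
include h

omit [T2Space M] in
theorem coordFlowDeriv_add' {s t : Fin (m + 1) → ℝ} (hs : s ∈ Φ.stabilizer x)
    (ht : t ∈ Φ.stabilizer x) (v : EuclideanSpace ℝ (Fin D)) :
    Φ.coordFlowDeriv φ (s + t) 0 v = Φ.coordFlowDeriv φ s 0 (Φ.coordFlowDeriv φ t 0 v) := by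
  have := coordFlowDeriv_add_of_stabilizer h.smoothChart h.mem_source hs ht v
  rwa [h.apply_eq_zero] at this

omit [T2Space M] in
theorem coordFlowDeriv_neg_apply' {s : Fin (m + 1) → ℝ} (hs : s ∈ Φ.stabilizer x)
    (v : EuclideanSpace ℝ (Fin D)) :
    Φ.coordFlowDeriv φ (-s) 0 (Φ.coordFlowDeriv φ s 0 v) = v := by
  have := coordFlowDeriv_neg_apply h.smoothChart h.mem_source hs v
  rwa [h.apply_eq_zero] at this

omit [T2Space M] in
theorem zero_mem_target : (0 : EuclideanSpace ℝ (Fin D)) ∈ φ.target := by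
  have := φ.map_source h.mem_source
  rwa [h.apply_eq_zero] at this

omit [T2Space M] in
-- The flow preserves `E`, so its derivative cannot turn an inward vector outward; the sign is that
-- of a limit of difference quotients.
theorem normal_coordFlowDeriv_nonneg (hE : Φ.IsExterior E) (hflat : IsFlatChart φ ℓ E)
    {s : Fin (m + 1) → ℝ} (hs : s ∈ Φ.stabilizer x) {v : EuclideanSpace ℝ (Fin D)}
    (hv : 0 < ℓ v) : 0 ≤ ℓ (Φ.coordFlowDeriv φ s 0 v) := by
  have hd := mem_coordFlowDomain_of_stabilizer h.mem_source hs
  rw [h.apply_eq_zero] at hd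
  have hΓ0 : Φ.coordFlow φ s 0 = 0 := by
    have := coordFlow_of_stabilizer h.mem_source hs
    rwa [h.apply_eq_zero] at this
  have h1 : HasDerivAt (fun t : ℝ => Φ.coordFlow φ s (t • v)) (Φ.coordFlowDeriv φ s 0 v) 0 := by
    have h2 := Φ.hasFDerivAt_coordFlow h.smoothChart hd
    rw [← zero_smul ℝ v] at h2
    have h3 : HasDerivAt (fun t : ℝ => t • v) v 0 := by
      simpa using (hasDerivAt_id (0 : ℝ)).smul_const v
    have h4 := h2.comp_hasDerivAt (0 : ℝ) h3
    rwa [zero_smul] at h4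
  have h2 := (ℓ.hasFDerivAt.comp_hasDerivAt (0 : ℝ) h1).tendsto_slope_zero_right
  refine ge_of_tendsto h2 ?_
  have htend : Tendsto (fun t : ℝ => t • v) (𝓝[>] 0) (𝓝 0) :=
    (Continuous.tendsto' (by fun_prop) _ _ (by simp) : Tendsto (fun t : ℝ => t • v) (𝓝 0) _).mono_left
      nhdsWithin_le_nhds
  filter_upwards [htend.eventually (Φ.eventually_mem_coordFlowDomain hd), self_mem_nhdsWithin]
    with t ht ht0
  have ht0 : 0 < t := ht0
  have hmem : φ.symm (t • v) ∈ E := by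
    rw [hflat.mem_iff _ (φ.map_target ht.1), φ.right_inv ht.1, map_smul, smul_eq_mul]
    positivity
  have h3 := (hflat.mem_iff _ ht.2).1 (hE.flow_mem hmem s)
  simp only [Function.comp, zero_add, zero_smul, hΓ0, map_zero, sub_zero, smul_eq_mul]
  exact mul_nonneg (inv_nonneg.2 ht0.le) h3.le

omit [T2Space M] in
/-- The isotropy representation preserves the conormal of the boundary. -/
theorem normal_coordFlowDeriv (hE : Φ.IsExterior E) {s : Fin (m + 1) → ℝ}
    (hs : s ∈ Φ.stabilizer x) (v : EuclideanSpace ℝ (Fin D)) :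
    ℓ (Φ.coordFlowDeriv φ s 0 v) = ℓ v := by
  rcases h.flat with ⟨h0, -⟩ | hflat
  · simp [h0]
  obtain ⟨n, hn⟩ : ∃ n, ℓ n = 1 := by
    obtain ⟨v, hv⟩ := DFunLike.ne_iff.1 hflat.ne_zero
    exact ⟨(ℓ v)⁻¹ • v, by rw [map_smul, smul_eq_mul]; exact inv_mul_cancel₀ hv⟩
  -- The hyperplane `ℓ = 0` is preserved, so `ℓ` is only rescaled, by a factor of at most one since
  -- the representation is isometric. The same holds for the inverse, and the two factors have
  -- product one.
  have main : ∀ s ∈ Φ.stabilizer x, ∃ κ : ℝ, 0 ≤ κ ∧ κ ≤ 1 ∧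
      ∀ v, ℓ (Φ.coordFlowDeriv φ s 0 v) = κ * ℓ v := by
    intro s hs
    have hker : ∀ u, ℓ u = 0 → ℓ (Φ.coordFlowDeriv φ s 0 u) = 0 := by
      intro u hu
      have h1 : ∀ c : ℝ, 0 ≤ ℓ (Φ.coordFlowDeriv φ s 0 n)
          + c * ℓ (Φ.coordFlowDeriv φ s 0 u) := by
        intro c
        have := h.normal_coordFlowDeriv_nonneg hE hflat hs (v := n + c • u) (by simp [hn, hu])
        simpa using this
      by_contra hne
      have h2 := h1 (-(ℓ (Φ.coordFlowDeriv φ s 0 n) + 1) / ℓ (Φ.coordFlowDeriv φ s 0 u))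
      rw [div_mul_cancel₀ _ hne] at h2
      linarith
    have hκ : ∀ v, ℓ (Φ.coordFlowDeriv φ s 0 v) = ℓ (Φ.coordFlowDeriv φ s 0 n) * ℓ v := by
      intro v
      have h1 := hker (v - ℓ v • n) (by simp [hn])
      simp only [map_sub, map_smul, smul_eq_mul] at h1
      linarith
    have hκ0 := h.normal_coordFlowDeriv_nonneg hE hflat hs (v := n) (by simp [hn])
    refine ⟨_, hκ0, ?_, hκ⟩
    have h2 : ‖ℓ (Φ.coordFlowDeriv φ s 0 n) • ℓ‖ ≤ ‖ℓ‖ := by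
      refine ContinuousLinearMap.opNorm_le_bound _ (norm_nonneg _) fun v => ?_
      rw [smul_apply, smul_eq_mul, ← hκ]
      refine (ℓ.le_opNorm _).trans ?_
      rw [h.norm_coordFlowDeriv s hs]
    rw [norm_smul, Real.norm_eq_abs, abs_of_nonneg hκ0] at h2
    have h3 : 0 < ‖ℓ‖ := norm_pos_iff.2 hflat.ne_zero
    nlinarith
  obtain ⟨κ, hκ0, hκ1, hκ⟩ := main s hs
  obtain ⟨κ', hκ0', hκ1', hκ'⟩ := main (-s) (neg_mem hs)
  have h1 : κ' * κ = 1 := by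
    have := hκ' (Φ.coordFlowDeriv φ s 0 n)
    rw [h.coordFlowDeriv_neg_apply' hs, hκ, hn] at this
    linarith
  have : κ = 1 := le_antisymm hκ1 (by nlinarith)
  rw [hκ, this, one_mul]

/-- The averaged coordinates in which the action of the stabilizer is linear. -/
theorem exists_equivariant (hE : Φ.IsExterior E) (hH : ∀ s ∈ Φ.stabilizer x, s 0 = 0) :
    ∃ χ : M → EuclideanSpace ℝ (Fin D),
      HasStrictFDerivAt (fun z => χ (φ.symm z)) (ContinuousLinearMap.id ℝ _) 0 ∧ χ x = 0 ∧
      ∀ y, (∀ s ∈ Φ.stabilizer x, Φ.flow s y ∈ φ.source) →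
        (∀ t ∈ Φ.stabilizer x, χ (Φ.flow t y) = Φ.coordFlowDeriv φ t 0 (χ y)) ∧
        (y ∈ closure E ↔ 0 ≤ ℓ (χ y)) ∧ (y ∈ frontier E ↔ ℓ ≠ 0 ∧ ℓ (χ y) = 0) := by
  obtain ⟨Q, _, μ, σ, hμ, hσ, hmean⟩ := exists_invariant_mean (isClosed_stabilizer (Φ := Φ) x) hH
    (periodLattice_le_stabilizer x)
  obtain ⟨ρ, hρ⟩ : ∃ ρ, ρ = fun s => Φ.coordFlowDeriv φ s 0 := ⟨_, rfl⟩
  have hρc : ContinuousOn ρ (Φ.stabilizer x) := by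
    have := continuousOn_coordFlowDeriv (Φ := Φ) h.smoothChart h.mem_source
    rw [h.apply_eq_zero] at this
    rwa [hρ]
  have hρnc : ContinuousOn (fun s => ρ (-s)) (Φ.stabilizer x) :=
    hρc.comp continuous_neg.continuousOn fun s hs => neg_mem hs
  -- Moving a point by `s`, reading off its coordinates and undoing `s` linearly: the mean over the
  -- stabilizer is equivariant. The integrand differs from the coordinates by a small Lipschitz
  -- term, uniformly in `s`, so the mean has the identity as strict derivative.
  obtain ⟨f, hf⟩ : ∃ f : M → (Fin (m + 1) → ℝ) → EuclideanSpace ℝ (Fin D),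
    f = fun y s => ρ (-s) (φ (Φ.flow s y)) := ⟨_, rfl⟩
  have hm : ∀ y, (∀ s ∈ Φ.stabilizer x, Φ.flow s y ∈ φ.source) →
      MeasureTheory.Integrable (fun q => f y (σ q)) μ ∧
      ∀ t ∈ Φ.stabilizer x, ∫ q, f y (t + σ q) ∂μ = ∫ q, f y (σ q) ∂μ := by
    intro y hy
    refine hmean _ (f y) ?_ fun s _ l hl => ?_
    · have h1 : ContinuousOn (fun s => φ (Φ.flow s y)) (Φ.stabilizer x) :=
        φ.continuousOn.comp (Φ.contMDiff_orbit y).continuous.continuousOn fun s hs => hy s hs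
      rw [hf]
      exact hρnc.clm_apply h1
    · simp only [hf, hρ]
      rw [neg_add, coordFlowDeriv_periodic _ (neg_mem hl), Φ.flow_add, Φ.flow_lattice hl.1 hl.2]
  obtain ⟨χ, hχ⟩ : ∃ χ : M → EuclideanSpace ℝ (Fin D), χ = fun y => ∫ q, f y (σ q) ∂μ :=
    ⟨_, rfl⟩
  have hiso : ∀ s ∈ Φ.stabilizer x, ∀ v, ‖ρ (-s) v‖ = ‖v‖ := fun s hs v => by
    rw [hρ]; exact h.norm_coordFlowDeriv _ (neg_mem hs) v
  refine ⟨χ, ?_, ?_, fun y hy => ⟨fun t ht => ?_, ?_⟩⟩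
  · rw [hasStrictFDerivAt_iff_isLittleO, Asymptotics.isLittleO_iff]
    intro ε hε
    obtain ⟨δ, hδ, hest⟩ := eventually_norm_coordFlow_sub_le hH h.smoothChart h.mem_source
      h.apply_eq_zero hε
    have hnb : Metric.ball (0 : EuclideanSpace ℝ (Fin D)) δ ×ˢ Metric.ball 0 δ ∈
        𝓝 ((0, 0) : EuclideanSpace ℝ (Fin D) × EuclideanSpace ℝ (Fin D)) :=
      prod_mem_nhds (Metric.ball_mem_nhds _ hδ) (Metric.ball_mem_nhds _ hδ)
    filter_upwards [hnb] with p hp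
    have hdom : ∀ z ∈ Metric.ball (0 : EuclideanSpace ℝ (Fin D)) δ,
        ∀ s ∈ Φ.stabilizer x, Φ.flow s (φ.symm z) ∈ φ.source := fun z hz s hs =>
      ((hest s hs z hz z hz).1).2
    have h1 := (hm _ (hdom _ hp.1)).1
    have h2 := (hm _ (hdom _ hp.2)).1
    have h3 : χ (φ.symm p.1) - χ (φ.symm p.2) - ContinuousLinearMap.id ℝ _ (p.1 - p.2)
        = ∫ q, (f (φ.symm p.1) (σ q) - f (φ.symm p.2) (σ q) - (p.1 - p.2)) ∂μ := by
      have h12 : MeasureTheory.Integrable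
          (fun q => f (φ.symm p.1) (σ q) - f (φ.symm p.2) (σ q)) μ := h1.sub h2
      rw [MeasureTheory.integral_sub h12 (MeasureTheory.integrable_const _),
        MeasureTheory.integral_sub h1 h2, hχ]
      simp
    rw [h3]
    refine (MeasureTheory.norm_integral_le_of_norm_le_const (C := ε * ‖p.1 - p.2‖)
      (Eventually.of_forall fun q => ?_)).trans (by simp)
    have h4 := (hest _ (hσ q) p.1 hp.1 p.2 hp.2).2
    rw [← hiso _ (hσ q)] at h4
    have e : f (φ.symm p.1) (σ q) - f (φ.symm p.2) (σ q) - (p.1 - p.2)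
        = ρ (-σ q) (Φ.coordFlow φ (σ q) p.1 - Φ.coordFlow φ (σ q) p.2
          - Φ.coordFlowDeriv φ (σ q) 0 (p.1 - p.2)) := by
      rw [map_sub, map_sub, hf, hρ]
      simp only
      rw [h.coordFlowDeriv_neg_apply' (hσ q)]
      rfl
    rw [e]
    exact h4
  · have : ∀ q, f x (σ q) = 0 := fun q => by
      simp only [hf]
      rw [mem_stabilizer.1 (hσ q), h.apply_eq_zero, map_zero]
    simp [hχ, this]
  · have h1 : ∀ q, f (Φ.flow t y) (σ q) = ρ t (f y (t + σ q)) := by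
      intro q
      simp only [hf, hρ]
      rw [← h.coordFlowDeriv_add' ht (neg_mem (add_mem ht (hσ q))), ← Φ.flow_add, add_comm (σ q)]
      congr 2
      abel_nf
    have h2 : MeasureTheory.Integrable (fun q => f y (t + σ q)) μ := by
      have hy' : ∀ s ∈ Φ.stabilizer x, Φ.flow s (Φ.flow t y) ∈ φ.source := fun s hs => by
        rw [← Φ.flow_add]; exact hy _ (add_mem hs ht)
      have h3 := (hm _ hy').1
      simp only [h1] at h3
      have h4 := (ρ (-t)).integrable_comp h3
      refine h4.congr (Eventually.of_forall fun q => ?_)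
      simp only [hρ]
      exact h.coordFlowDeriv_neg_apply' ht _
    rw [hχ]
    simp only [h1]
    rw [(ρ t).integral_comp_comm h2, (hm y hy).2 t ht, hρ]
  · rcases h.flat with ⟨h0, hsub⟩ | hflat
    · have hyE : y ∈ E := by
        have := hy 0 (Φ.stabilizer x).zero_mem
        rw [Φ.flow_zero] at this
        exact hsub this
      refine ⟨by simp [h0, subset_closure hyE], ?_⟩
      simp only [h0, ne_eq, not_true, false_and, iff_false]
      intro hfr
      exact (hE.mem_frontier_iff.1 hfr).2 hyE
    -- The conormal is invariant, so `ℓ (χ y)` is the mean of `ℓ` over the translates of `y` by the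
    -- stabilizer. These values all have the same sign, since the flow preserves `E`, its closure
    -- and its boundary.
    have hint : MeasureTheory.Integrable (fun q => ℓ (φ (Φ.flow (σ q) y))) μ ∧
        ℓ (χ y) = ∫ q, ℓ (φ (Φ.flow (σ q) y)) ∂μ := by
      have h1 : ∀ q, ℓ (f y (σ q)) = ℓ (φ (Φ.flow (σ q) y)) := fun q => by
        simp only [hf, hρ]
        exact h.normal_coordFlowDeriv hE (neg_mem (hσ q)) _
      have h2 := ℓ.integrable_comp (hm y hy).1
      simp only [h1] at h2
      refine ⟨h2, ?_⟩
      rw [hχ]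
      simp only
      rw [← ℓ.integral_comp_comm (hm y hy).1]
      simp only [h1]
    have hcl : y ∈ closure E → 0 ≤ ℓ (χ y) := by
      intro hyc
      rw [hint.2]
      exact MeasureTheory.integral_nonneg fun q =>
        (hflat.mem_closure_iff (hy _ (hσ q))).1 (hE.flow_mem_closure hyc _)
    have hpos : y ∈ E → 0 < ℓ (χ y) := by
      intro hyE
      rw [hint.2]
      have hall : ∀ q, 0 < ℓ (φ (Φ.flow (σ q) y)) := fun q =>
        (hflat.mem_iff _ (hy _ (hσ q))).1 (hE.flow_mem hyE _)
      refine (MeasureTheory.integral_pos_iff_support_of_nonneg (fun q => (hall q).le) hint.1).2 ?_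
      rw [show Function.support (fun q => ℓ (φ (Φ.flow (σ q) y))) = univ from
        eq_univ_of_forall fun q => (hall q).ne']
      simp
    have hneg : y ∉ closure E → ℓ (χ y) < 0 := by
      intro hyc
      have hall : ∀ q, 0 < -ℓ (φ (Φ.flow (σ q) y)) := fun q => by
        have h1 : ¬ 0 ≤ ℓ (φ (Φ.flow (σ q) y)) := fun h1 =>
          hyc ((hE.flow_mem_closure_iff _).1 ((hflat.mem_closure_iff (hy _ (hσ q))).2 h1))
        linarith
      have h2 := (MeasureTheory.integral_pos_iff_support_of_nonneg (fun q => (hall q).le)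
        hint.1.neg).2 (by
          rw [show Function.support (fun q => -ℓ (φ (Φ.flow (σ q) y))) = univ from
            eq_univ_of_forall fun q => (hall q).ne']
          simp)
      rw [MeasureTheory.integral_neg] at h2
      rw [hint.2]
      linarith
    refine ⟨⟨hcl, fun hnn => ?_⟩, ⟨fun hfr => ⟨hflat.ne_zero, ?_⟩, fun h0 => ?_⟩⟩
    · by_contra hyc
      linarith [hneg hyc]
    · rw [hint.2]
      have : ∀ q, ℓ (φ (Φ.flow (σ q) y)) = 0 := fun q =>
        (hflat.mem_frontier_iff hE.isOpen (hy _ (hσ q))).1 ((hE.flow_mem_frontier_iff _).2 hfr)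
      simp [this]
    · refine hE.mem_frontier_iff.2 ⟨?_, fun hyE => ?_⟩
      · by_contra hyc
        linarith [hneg hyc, h0.2]
      · linarith [hpos hyE, h0.2]

/-- Linearization of the action near a point of the exterior or its boundary. -/
theorem exists_isLinearModel (hE : Φ.IsExterior E) (hH : ∀ s ∈ Φ.stabilizer x, s 0 = 0) :
    ∃ A X, Φ.IsLinearModel E x φ ℓ A X := by
  obtain ⟨χ, hstrict, hχ0, hχ⟩ := h.exists_equivariant hE hH
  have hx := h.mem_source
  have hφ := h.smoothChart
  have hst : ∀ a : Φ.isotropy x, ∀ t : ℝ, t • (a : Fin (m + 1) → ℝ) ∈ Φ.stabilizer x := fun a t =>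
    isotropy_le_stabilizer ((Φ.isotropy x).smul_mem t a.2)
  let R := Φ.isotropyRep φ (φ x)
  let A : Φ.isotropy x →ₗ[ℝ] EuclideanSpace ℝ (Fin D) →ₗ[ℝ] EuclideanSpace ℝ (Fin D) :=
    { toFun := fun a => (R a : EuclideanSpace ℝ (Fin D) →ₗ[ℝ] EuclideanSpace ℝ (Fin D))
      map_add' := fun a b => by ext1 v; simp
      map_smul' := fun c a => by ext1 v; simp }
  have hA : ∀ a v, A a v = Φ.isotropyRep φ (φ x) a v := fun _ _ => rfl
  have hinner : ∀ s ∈ Φ.stabilizer x, ∀ u v : EuclideanSpace ℝ (Fin D),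
      innerSL ℝ (Φ.coordFlowDeriv φ s (φ x) u) (Φ.coordFlowDeriv φ s (φ x) v)
        = innerSL ℝ u v := by
    intro s hs u v
    rw [h.apply_eq_zero]
    exact LinearIsometry.inner_map_map
      (⟨(Φ.coordFlowDeriv φ s 0 : EuclideanSpace ℝ (Fin D) →ₗ[ℝ] EuclideanSpace ℝ (Fin D)),
        h.norm_coordFlowDeriv s hs⟩ : EuclideanSpace ℝ (Fin D) →ₗᵢ[ℝ] EuclideanSpace ℝ (Fin D)) u v
  have hskew : IsSkewFamily A := by
    refine ⟨fun a u v => ?_, fun a b v => isotropyRep_comm hφ hx a.2 b.2 v⟩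
    exact isotropyRep_skew hφ hx a.2 (innerSL ℝ) hinner u v
  have hmskew : ∀ a u v, coordMetric g φ 0 (A a u) v = -coordMetric g φ 0 u (A a v) := by
    intro a u v
    have := isotropyRep_skew hφ hx a.2 (coordMetric g φ (φ x))
      (fun s hs u v => coordMetric_coordFlowDeriv hφ hx hs u v) u v
    rw [h.apply_eq_zero] at this
    rw [hA, hA, h.apply_eq_zero]
    exact this
  have hstrict' : HasStrictFDerivAt (fun z => χ (φ.symm z))
      (ContinuousLinearEquiv.refl ℝ (EuclideanSpace ℝ (Fin D)) :
        EuclideanSpace ℝ (Fin D) →L[ℝ] EuclideanSpace ℝ (Fin D)) 0 := hstrict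
  obtain ⟨e₁, he₁⟩ : ∃ e₁, e₁ = HasStrictFDerivAt.toOpenPartialHomeomorph
      (fun z => χ (φ.symm z)) hstrict' := ⟨_, rfl⟩
  have he₁χ : ∀ z, e₁ z = χ (φ.symm z) := fun z => by
    rw [he₁]; rfl
  have he₁0 : (0 : EuclideanSpace ℝ (Fin D)) ∈ e₁.source := by
    rw [he₁]; exact HasStrictFDerivAt.mem_toOpenPartialHomeomorph_source hstrict'
  obtain ⟨X₀, hX₀⟩ : ∃ X₀, X₀ = φ.trans e₁ := ⟨_, rfl⟩
  have hX₀χ : ∀ y ∈ φ.source, X₀ y = χ y := fun y hy => by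
    rw [hX₀, OpenPartialHomeomorph.coe_trans, Function.comp, he₁χ, φ.left_inv hy]
  have hxX₀ : x ∈ X₀.source := by
    rw [hX₀]
    refine ⟨hx, ?_⟩
    have : φ x ∈ e₁.source := by rw [h.apply_eq_zero]; exact he₁0
    exact this
  have hX₀0 : X₀ x = 0 := by rw [hX₀χ x hx, hχ0]
  -- The chart is cut down to points whose translates by the stabilizer stay in the source of `φ`
  -- and whose isotropy algebra is contained in that of `x`, with a ball as target, so that radial
  -- segments stay inside.
  obtain ⟨N, hN⟩ : ∃ N : Set M, N = {y | (∀ s ∈ Φ.stabilizer x, Φ.flow s y ∈ φ.source) ∧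
      Φ.isotropy y ≤ Φ.isotropy x} := ⟨_, rfl⟩
  have hNx : N ∈ 𝓝 x := by
    rw [hN]
    exact (eventually_forall_stabilizer hH (φ.open_source.mem_nhds hx)).and
      (eventually_isotropy_le hH)
  have hc : ContinuousAt X₀.symm 0 := by
    have := X₀.continuousAt_symm (X₀.map_source hxX₀)
    rwa [hX₀0] at this
  have htar : (0 : EuclideanSpace ℝ (Fin D)) ∈ X₀.target := by
    have := X₀.map_source hxX₀
    rwa [hX₀0] at this
  have hX₀s0 : X₀.symm 0 = x := by rw [← hX₀0, X₀.left_inv hxX₀]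
  obtain ⟨r, hr, hball⟩ := Metric.mem_nhds_iff.1 (inter_mem (X₀.open_target.mem_nhds htar)
    (hc.preimage_mem_nhds (by rw [hX₀s0]; exact hNx)))
  obtain ⟨X, hX⟩ : ∃ X, X = (X₀.symm.restrOpen (Metric.ball 0 r) Metric.isOpen_ball).symm :=
    ⟨_, rfl⟩
  have hXX₀ : ∀ y, X y = X₀ y := fun y => by rw [hX]; rfl
  have hXt : X.target = Metric.ball 0 r := by
    rw [hX]
    exact inter_eq_right.2 fun z hz => (hball hz).1
  have hXs : ∀ y ∈ X.source, y ∈ X₀.source ∧ y ∈ φ.source ∧ y ∈ N ∧ X y = χ y := by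
    intro y hy
    have h1 : y ∈ X₀.source := by
      have h2 := X.map_source hy
      rw [hXt] at h2
      have h3 := X₀.map_target (hball h2).1
      have h4 : X₀.symm (X y) = y := by
        have := X.left_inv hy
        rw [hX] at this ⊢
        exact this
      rwa [h4] at h3
    have h2 : y ∈ N := by
      have h2 := X.map_source hy
      rw [hXt] at h2
      have h3 : X₀.symm (X y) ∈ N := (hball h2).2
      rwa [hXX₀, X₀.left_inv h1] at h3
    have h3 : y ∈ φ.source := by rw [hX₀] at h1; exact h1.1
    exact ⟨h1, h3, h2, by rw [hXX₀, hX₀χ y h3]⟩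
  have hxX : x ∈ X.source := by
    have h1 : X.symm 0 ∈ X.source := X.map_target (by rw [hXt]; exact Metric.mem_ball_self hr)
    have h2 : X.symm 0 = X₀.symm 0 := by rw [hX]; rfl
    rwa [h2, hX₀s0] at h1
  have hfix : ∀ y ∈ X.source, ∀ a : Φ.isotropy x, ∀ t : ℝ,
      χ (Φ.flow (t • (a : Fin (m + 1) → ℝ)) y)
        = Φ.coordFlowDeriv φ (t • (a : Fin (m + 1) → ℝ)) (φ x) (X y) := by
    intro y hy a t
    obtain ⟨-, -, hyN, hyχ⟩ := hXs y hy
    rw [hN] at hyN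
    rw [(hχ y hyN.1).1 _ (hst a t), hyχ, h.apply_eq_zero]
  refine ⟨A, X, h, hskew, ⟨r, hr, hXt⟩, hxX, ?_, ?_, ?_, ?_, ?_, ?_, hmskew, ?_, ?_⟩
  · rw [(hXs x hxX).2.2.2, hχ0]
  · intro y hy a
    obtain ⟨-, hys, hyN, hyχ⟩ := hXs y hy
    rw [hN] at hyN
    constructor
    · intro hk
      refine ⟨hyN.2 (mem_isotropy.2 hk), ?_⟩
      rw [hA]
      refine isotropyRep_apply_eq_zero hφ hx (Eventually.of_forall fun t => ?_)
      rw [← hfix y hy ⟨a, hyN.2 (mem_isotropy.2 hk)⟩ t,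
        Φ.flow_smul_eq_of_killing_eq_zero hk, hyχ]
    · rintro ⟨ha, hAa⟩
      refine Φ.killing_eq_zero_of_flow_eventually ?_
      have hcf : ∀ᶠ t : ℝ in 𝓝 0, Φ.flow (t • a) y ∈ X.source := by
        have : ContinuousAt (fun t : ℝ => Φ.flow (t • a) y) 0 :=
          (Φ.continuous_flow.comp (by fun_prop : Continuous fun t : ℝ => (t • a, y))).continuousAt
        refine this.preimage_mem_nhds (X.open_source.mem_nhds ?_)
        rwa [zero_smul, Φ.flow_zero]
      filter_upwards [hcf] with t ht
      refine X.injOn ht hy ?_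
      rw [(hXs _ ht).2.2.2, hfix y hy ⟨a, ha⟩ t,
        coordFlowDeriv_smul_apply_eq hφ hx ha hAa t]
  · intro a v
    have h1 := ℓ.hasFDerivAt.comp_hasDerivAt (0 : ℝ)
      (hasDerivAt_coordFlowDeriv_zero (Φ := Φ) hφ hx a v)
    refine h1.unique ((hasDerivAt_const (0 : ℝ) (ℓ v)).congr_of_eventuallyEq
      (Eventually.of_forall fun t => ?_))
    simp only [Function.comp]
    rw [h.apply_eq_zero, h.normal_coordFlowDeriv hE (hst a t)]
  · intro y hy
    obtain ⟨-, -, hyN, hyχ⟩ := hXs y hy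
    rw [hN] at hyN
    rw [hyχ, (hχ y hyN.1).2.1]
  · intro y hy
    obtain ⟨-, -, hyN, hyχ⟩ := hXs y hy
    rw [hN] at hyN
    rw [hyχ, (hχ y hyN.1).2.2]
  · intro ε hε
    have h1 := hstrict.isLittleO.def hε
    -- The strict estimate will be applied to a point and its image under a short flow, and divided
    -- by the time. This requires it near the diagonal.
    have h2 : ∀ᶠ z in 𝓝 (0 : EuclideanSpace ℝ (Fin D)), ∀ᶠ p in 𝓝 (z, z),
        ‖χ (φ.symm p.1) - χ (φ.symm p.2) - ContinuousLinearMap.id ℝ _ (p.1 - p.2)‖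
          ≤ ε * ‖p.1 - p.2‖ := by
      have h3 : ∀ᶠ p : EuclideanSpace ℝ (Fin D) × EuclideanSpace ℝ (Fin D) in 𝓝 (0, 0),
        ∀ᶠ p in 𝓝 p,
        ‖χ (φ.symm p.1) - χ (φ.symm p.2) - ContinuousLinearMap.id ℝ _ (p.1 - p.2)‖
          ≤ ε * ‖p.1 - p.2‖ := h1.eventually_nhds
      have h4 : Tendsto (fun z : EuclideanSpace ℝ (Fin D) => (z, z)) (𝓝 0) (𝓝 (0, 0)) :=
        Continuous.tendsto' (by fun_prop) _ _ rfl
      exact h4.eventually h3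
    have h3 : Tendsto φ (𝓝 x) (𝓝 0) := by
      have := φ.continuousAt hx
      rwa [ContinuousAt, h.apply_eq_zero] at this
    filter_upwards [h3.eventually h2, X.open_source.mem_nhds hxX] with y hy hyX a
    obtain ⟨-, hys, -, hyχ⟩ := hXs y hyX
    have hz : φ y ∈ φ.target := φ.map_source hys
    have hΓ : HasDerivAt (fun t : ℝ => Φ.coordFlow φ (t • (a : Fin (m + 1) → ℝ)) (φ y))
        (Φ.coordKilling φ (φ y) a) 0 := by
      have := Φ.hasDerivAt_coordFlow_smul (a := (a : Fin (m + 1) → ℝ)) (t := 0) hφ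
        (by simpa using Φ.mem_coordFlowDomain_zero hz)
      rwa [zero_smul, Φ.coordFlow_zero hz] at this
    have hρ := hasDerivAt_coordFlowDeriv_zero (Φ := Φ) hφ hx a (X y)
    have hΓ0 : Φ.coordFlow φ ((0 : ℝ) • (a : Fin (m + 1) → ℝ)) (φ y) = φ y := by
      rw [zero_smul, Φ.coordFlow_zero hz]
    have hρ0 : Φ.coordFlowDeriv φ ((0 : ℝ) • (a : Fin (m + 1) → ℝ)) (φ x) (X y) = X y := by
      rw [zero_smul, Φ.coordFlowDeriv_zero (φ.map_source hx)]; rfl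
    have hlhs := (hΓ.sub hρ).tendsto_slope_zero_right.norm
    have hrhs := hΓ.tendsto_slope_zero_right.norm.const_mul ε
    refine le_of_tendsto_of_tendsto hlhs hrhs ?_
    have hcd : ∀ᶠ t : ℝ in 𝓝 0, (t • (a : Fin (m + 1) → ℝ), φ y) ∈ Φ.coordFlowDomain φ := by
      refine ContinuousAt.preimage_mem_nhds
        (f := fun t : ℝ => (t • (a : Fin (m + 1) → ℝ), φ y)) (by fun_prop) ?_
      simpa using Φ.isOpen_coordFlowDomain.mem_nhds (Φ.mem_coordFlowDomain_zero hz)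
    have hpair : Tendsto (fun t : ℝ => (Φ.coordFlow φ (t • (a : Fin (m + 1) → ℝ)) (φ y), φ y))
        (𝓝 0) (𝓝 (φ y, φ y)) := by
      have := hΓ.continuousAt.tendsto.prodMk_nhds (tendsto_const_nhds (x := φ y))
      rwa [hΓ0] at this
    filter_upwards [nhdsWithin_le_nhds (hpair.eventually hy), nhdsWithin_le_nhds hcd,
      self_mem_nhdsWithin] with t ht htd ht0
    have ht0 : 0 < t := ht0
    simp only [ContinuousLinearMap.id_apply, Φ.symm_coordFlow htd, φ.left_inv hys,
      hfix y hyX a t, ← hyχ] at ht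
    simp only [zero_add, Pi.sub_apply, hΓ0, hρ0]
    rw [norm_smul, norm_smul, mul_left_comm]
    refine mul_le_mul_of_nonneg_left ?_ (norm_nonneg _)
    rw [← norm_neg]
    refine le_trans (le_of_eq ?_) ht
    congr 1
    abel
  · intro a b
    have := isotropyRep_coordKilling (Φ := Φ) hφ hx a.2 b
    rw [hA]
    rw [h.apply_eq_zero] at this ⊢
    exact this
  · obtain ⟨ν, hν, hAν⟩ :=
      (hφ.isLorentz_coordMetric (g := g) h.zero_mem_target).exists_timelike_of_skew
    exact ⟨ν, hν, fun a => hAν (A a) (hskew.skew a) (hmskew a)⟩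

end IsAdaptedChart

end IsometricAction

end DomainStructure

/-! ### Causal character of the Killing vector fields near their zeros -/

namespace DomainStructure

/-- A Lorentzian form is uniformly positive on the complement of a time-like vector. -/
theorem IsLorentz.exists_mul_norm_sq_le {V : Type*} [NormedAddCommGroup V] [NormedSpace ℝ V]
    [FiniteDimensional ℝ V] {B : V →L[ℝ] V →L[ℝ] ℝ} (hB : IsLorentz B) {ν : V} (hν : B ν ν < 0) :
    ∃ c > 0, ∀ u, B ν u = 0 → c * ‖u‖ ^ 2 ≤ B u u := by
  have hcomp : IsCompact (Metric.sphere (0 : V) 1 ∩ {u | B ν u = 0}) :=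
    (isCompact_sphere _ _).inter_right (isClosed_eq (B ν).continuous continuous_const)
  by_cases hne : (Metric.sphere (0 : V) 1 ∩ {u | B ν u = 0}).Nonempty
  · obtain ⟨u₀, ⟨hu₀, hort⟩, hmin⟩ := hcomp.exists_isMinOn hne (f := fun u => B u u)
      (by fun_prop)
    have hu₀' : u₀ ≠ 0 := by rintro rfl; simp at hu₀
    refine ⟨B u₀ u₀, hB.pos_of_orthogonal hν hort hu₀', fun u hu => ?_⟩
    by_cases hu0 : u = 0
    · simp [hu0]
    have hn : 0 < ‖u‖ := norm_pos_iff.2 hu0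
    have h1 : B u₀ u₀ ≤ B (‖u‖⁻¹ • u) (‖u‖⁻¹ • u) :=
      hmin ⟨by simp [norm_smul, hu0], by simp [hu]⟩
    simp only [map_smul, smul_apply, smul_eq_mul] at h1
    calc B u₀ u₀ * ‖u‖ ^ 2 ≤ (‖u‖⁻¹ * (‖u‖⁻¹ * B u u)) * ‖u‖ ^ 2 := by gcongr
      _ = B u u := by field_simp
  · refine ⟨1, one_pos, fun u hu => ?_⟩
    by_cases hu0 : u = 0
    · simp [hu0]
    · exact absurd ⟨‖u‖⁻¹ • u, by simp [norm_smul, hu0], by simp [hu]⟩ hne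

namespace IsometricAction

variable {D m : ℕ} {M : Type*} [TopologicalSpace M] [T2Space M]
  [ChartedSpace (EuclideanSpace ℝ (Fin D)) M] [IsManifold (𝓡 D) ∞ M]
  {g : LorentzMetric D M} {Φ : IsometricAction g m} {E : Set M} {x : M}
  {φ : OpenPartialHomeomorph M (EuclideanSpace ℝ (Fin D))}
  {ℓ : EuclideanSpace ℝ (Fin D) →L[ℝ] ℝ}

namespace IsAdaptedChart

variable (h : Φ.IsAdaptedChart E x φ ℓ)
include h

omit [T2Space M] in
theorem tendsto : Tendsto φ (𝓝 x) (𝓝 0) := by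
  have := φ.continuousAt h.mem_source
  rwa [ContinuousAt, h.apply_eq_zero] at this

omit [T2Space M] in
theorem eventually_coordMetric {ε : ℝ} (hε : 0 < ε) :
    ∀ᶠ y in 𝓝 x, ‖coordMetric g φ (φ y) - coordMetric g φ 0‖ < ε := by
  have h1 := (h.smoothChart.contDiffAt_coordMetric (g := g) h.zero_mem_target).continuousAt
  have h2 := Metric.continuousAt_iff'.1 h1 ε hε
  simpa only [dist_eq_norm] using h.tendsto.eventually h2

omit [T2Space M] in
theorem eventually_coordKilling {ε : ℝ} (hε : 0 < ε) :
    ∀ᶠ y in 𝓝 x, ‖Φ.coordKilling φ (φ y) - Φ.coordKilling φ 0‖ < ε := by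
  have h1 := (Φ.contDiffAt_coordKilling h.smoothChart h.zero_mem_target).continuousAt
  have h2 := Metric.continuousAt_iff'.1 h1 ε hε
  simpa only [dist_eq_norm] using h.tendsto.eventually h2

end IsAdaptedChart

variable {A : Φ.isotropy x →ₗ[ℝ] EuclideanSpace ℝ (Fin D) →ₗ[ℝ] EuclideanSpace ℝ (Fin D)}
  {X : OpenPartialHomeomorph M (EuclideanSpace ℝ (Fin D))}

theorem abs_bilin_le {V : Type*} [NormedAddCommGroup V] [NormedSpace ℝ V]
    (B : V →L[ℝ] V →L[ℝ] ℝ) (u v : V) : |B u v| ≤ ‖B‖ * ‖u‖ * ‖v‖ := B.le_opNorm₂ u v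

namespace IsLinearModel

variable (hL : Φ.IsLinearModel E x φ ℓ A X)
include hL

omit [T2Space M] in
/-- Near a point, the Killing vector fields that vanish there are uniformly space-like. -/
theorem exists_mul_norm_sq_le : ∃ c > 0, ∀ᶠ y in 𝓝 x, ∀ a : Φ.isotropy x,
    c * ‖Φ.coordKilling φ (φ y) a‖ ^ 2 ≤
      coordMetric g φ (φ y) (Φ.coordKilling φ (φ y) a) (Φ.coordKilling φ (φ y) a) := by
  have h := hL.adapted
  have hB := h.smoothChart.isLorentz_coordMetric (g := g) h.zero_mem_target
  obtain ⟨ν, hν, hAν⟩ := hL.exists_timelike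
  obtain ⟨c₀, hc₀, hlow⟩ := hB.exists_mul_norm_sq_le hν
  obtain ⟨G, hG⟩ : ∃ G, G = ‖coordMetric g φ 0‖ := ⟨_, rfl⟩
  have hG0 : 0 ≤ G := hG ▸ ContinuousLinearMap.opNorm_nonneg _
  obtain ⟨ε, hε⟩ : ∃ ε, ε = min (1 / 2) (c₀ / (8 * (5 * G + 1))) := ⟨_, rfl⟩
  have hε0 : 0 < ε := by rw [hε]; positivity
  have hε1 : ε ≤ 1 / 2 := hε ▸ min_le_left _ _
  have hε2 : ε * (5 * G + 1) ≤ c₀ / 8 := by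
    have : ε ≤ c₀ / (8 * (5 * G + 1)) := hε ▸ min_le_right _ _
    rw [le_div_iff₀ (by positivity)] at this
    linarith
  refine ⟨c₀ / 8, by positivity, ?_⟩
  filter_upwards [hL.approx ε hε0, h.eventually_coordMetric hε0] with y happ hmet a
  obtain ⟨k, hk⟩ : ∃ k, k = Φ.coordKilling φ (φ y) a := ⟨_, rfl⟩
  obtain ⟨u, hu⟩ : ∃ u, u = A a (X y) := ⟨_, rfl⟩
  have hku : ‖k - u‖ ≤ ε * ‖k‖ := by rw [hk, hu]; exact happ a
  rw [← hk]
  -- The operators annihilate `ν` and are skew for the metric, so the linear field is orthogonal to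
  -- the time-like `ν`, where the form is uniformly positive. The true field differs from it by a
  -- small fraction of its own norm.
  have hu0 : coordMetric g φ 0 ν u = 0 := by
    have := hL.metric_skew a ν (X y)
    rw [hAν, map_zero] at this
    simp only [zero_apply] at this
    rw [hu]; linarith
  have h1 := hlow u hu0
  have h2 : ‖k‖ ≤ 2 * ‖u‖ := by
    have := norm_sub_norm_le k u
    nlinarith [norm_nonneg k]
  have h3 : ‖u‖ ≤ 2 * ‖k‖ := by
    have := norm_sub_norm_le u k
    rw [norm_sub_rev] at this
    nlinarith [norm_nonneg k]
  have h4 := abs_le.1 (abs_bilin_le (coordMetric g φ (φ y) - coordMetric g φ 0) k k)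
  have h5 := abs_le.1 (abs_bilin_le (coordMetric g φ 0) u (k - u))
  have h6 := abs_le.1 (abs_bilin_le (coordMetric g φ 0) (k - u) (k - u))
  rw [← hG] at h5 h6
  simp only [sub_apply] at h4
  have e1 : coordMetric g φ 0 k k = coordMetric g φ 0 u u + 2 * coordMetric g φ 0 u (k - u)
      + coordMetric g φ 0 (k - u) (k - u) := by
    have := hB.symm u k
    simp only [map_sub, sub_apply]
    linarith
  have n0 := norm_nonneg k
  have b4 : ‖coordMetric g φ (φ y) - coordMetric g φ 0‖ * ‖k‖ * ‖k‖ ≤ ε * ‖k‖ * ‖k‖ := by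
    gcongr
  have b5 : G * ‖u‖ * ‖k - u‖ ≤ G * (2 * ‖k‖) * (ε * ‖k‖) := by gcongr
  have b6 : G * ‖k - u‖ * ‖k - u‖ ≤ G * (ε * ‖k‖) * (1 * ‖k‖) := by
    gcongr
    nlinarith
  have b1 : c₀ * (‖k‖ / 2) ^ 2 ≤ c₀ * ‖u‖ ^ 2 := by
    gcongr
    linarith
  have b7 : ε * (5 * G + 1) * (‖k‖ * ‖k‖) ≤ c₀ / 8 * (‖k‖ * ‖k‖) := by gcongr
  nlinarith only [h1, h4.1, h5.1, h6.1, e1, b4, b5, b6, b1, b7]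

omit [T2Space M] in
/-- Near a point, the Killing vector fields that vanish there are almost orthogonal to the
orbits. -/
theorem eventually_abs_le {ε : ℝ} (hε : 0 < ε) :
    ∀ᶠ y in 𝓝 x, ∀ a : Φ.isotropy x, ∀ b,
    |coordMetric g φ (φ y) (Φ.coordKilling φ (φ y) a) (Φ.coordKilling φ (φ y) b)| ≤
      ε * ‖Φ.coordKilling φ (φ y) a‖ * ‖b‖ := by
  have h := hL.adapted
  obtain ⟨G, hG⟩ : ∃ G, G = ‖coordMetric g φ 0‖ := ⟨_, rfl⟩
  have hG0 : 0 ≤ G := hG ▸ ContinuousLinearMap.opNorm_nonneg _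
  obtain ⟨K, hK⟩ : ∃ K, K = ‖Φ.coordKilling φ 0‖ := ⟨_, rfl⟩
  have hK0 : 0 ≤ K := hK ▸ ContinuousLinearMap.opNorm_nonneg _
  obtain ⟨δ, hδ⟩ : ∃ δ, δ = min 1 (ε / (K + 1 + G + G * K)) := ⟨_, rfl⟩
  have hδ0 : 0 < δ := by rw [hδ]; positivity
  have hδ1 : δ ≤ 1 := hδ ▸ min_le_left _ _
  have hδ2 : δ * (K + 1 + G + G * K) ≤ ε := by
    have : δ ≤ ε / (K + 1 + G + G * K) := hδ ▸ min_le_right _ _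
    rwa [le_div_iff₀ (by positivity)] at this
  filter_upwards [hL.approx δ hδ0, h.eventually_coordMetric hδ0, h.eventually_coordKilling hδ0]
    with y happ hmet hkil a b
  obtain ⟨k, hk⟩ : ∃ k, k = Φ.coordKilling φ (φ y) a := ⟨_, rfl⟩
  obtain ⟨u, hu⟩ : ∃ u, u = A a (X y) := ⟨_, rfl⟩
  obtain ⟨p, hp⟩ : ∃ p, p = Φ.coordKilling φ (φ y) b := ⟨_, rfl⟩
  obtain ⟨p₀, hp₀⟩ : ∃ p₀, p₀ = Φ.coordKilling φ 0 b := ⟨_, rfl⟩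
  have hku : ‖k - u‖ ≤ δ * ‖k‖ := by rw [hk, hu]; exact happ a
  have hpp : ‖p - p₀‖ ≤ δ * ‖b‖ := by
    rw [hp, hp₀]
    exact ((Φ.coordKilling φ (φ y) - Φ.coordKilling φ 0).le_opNorm b).trans (by gcongr)
  have hp₀n : ‖p₀‖ ≤ K * ‖b‖ := by rw [hp₀, hK]; exact (Φ.coordKilling φ 0).le_opNorm b
  have hpn : ‖p‖ ≤ (K + 1) * ‖b‖ := by
    have := norm_sub_norm_le p p₀
    nlinarith [norm_nonneg b]
  rw [← hk, ← hp]
  -- At the base point the linear field is exactly orthogonal to the orbit, because the operators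
  -- are skew for the metric and annihilate the tangent vectors of the orbit.
  have hup : coordMetric g φ 0 u p₀ = 0 := by
    rw [hu, hp₀, hL.metric_skew, hL.apply_coordKilling, map_zero, neg_zero]
  have h1 := abs_bilin_le (coordMetric g φ (φ y) - coordMetric g φ 0) k p
  have h2 := abs_bilin_le (coordMetric g φ 0) k (p - p₀)
  have h3 := abs_bilin_le (coordMetric g φ 0) (k - u) p₀
  rw [← hG] at h2 h3
  have e1 : coordMetric g φ (φ y) k p = (coordMetric g φ (φ y) - coordMetric g φ 0) k p
      + coordMetric g φ 0 k (p - p₀) + coordMetric g φ 0 (k - u) p₀ := by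
    simp only [map_sub, sub_apply, hup]
    ring
  have n0 := norm_nonneg k
  have n1 := norm_nonneg b
  have b1 : ‖coordMetric g φ (φ y) - coordMetric g φ 0‖ * ‖k‖ * ‖p‖
      ≤ δ * ‖k‖ * ((K + 1) * ‖b‖) := by gcongr
  have b2 : G * ‖k‖ * ‖p - p₀‖ ≤ G * ‖k‖ * (δ * ‖b‖) := by gcongr
  have b3 : G * ‖k - u‖ * ‖p₀‖ ≤ G * (δ * ‖k‖) * (K * ‖b‖) := by gcongr
  have b4 : δ * (K + 1 + G + G * K) * (‖k‖ * ‖b‖) ≤ ε * (‖k‖ * ‖b‖) := by gcongr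
  rw [e1]
  refine (abs_add_three _ _ _).trans ?_
  nlinarith only [h1, h2, h3, b1, b2, b3, b4]

omit [T2Space M] in
/-- Near a point, the Killing vector fields that vanish there are space-like or zero. -/
theorem eventually_pos : ∀ᶠ y in 𝓝 x, ∀ a ∈ Φ.isotropy x, Φ.killing a y ≠ 0 →
    0 < a ⬝ᵥ (Φ.G y *ᵥ a) := by
  obtain ⟨c, hc, hev⟩ := hL.exists_mul_norm_sq_le
  filter_upwards [hev, φ.open_source.mem_nhds hL.adapted.mem_source] with y hy hys a ha hk
  have hz := φ.map_source hys
  have h1 := Φ.dotProduct_G_coord hL.adapted.smoothChart hz a a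
  have h2 := Φ.coordKilling_eq_zero_iff hL.adapted.smoothChart hz a
  rw [φ.left_inv hys] at h1 h2
  rw [h1]
  have h3 : 0 < ‖Φ.coordKilling φ (φ y) a‖ := norm_pos_iff.2 fun h0 => hk (h2.1 h0)
  have h4 := hy ⟨a, ha⟩
  have : 0 < c * ‖Φ.coordKilling φ (φ y) a‖ ^ 2 := by positivity
  exact this.trans_le h4

omit [T2Space M] in
/-- At the boundary of the exterior, some null linear combination of the Killing vector fields is
nonzero. -/
theorem exists_mulVec_eq_zero (hE : Φ.IsExterior E) (hx : x ∈ frontier E) :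
    ∃ w, Φ.G x *ᵥ w = 0 ∧ Φ.killing w x ≠ 0 := by
  -- Otherwise `G x` is positive on a complement of the isotropy algebra. The fields of the isotropy
  -- algebra are uniformly space-like near `x` and almost orthogonal to that complement, so `G` is
  -- positive semidefinite near `x`, against the time-like combinations in `E`.
  by_contra! hcon
  obtain ⟨C, hC⟩ := (Φ.isotropy x).exists_isCompl
  obtain ⟨S, hS⟩ : ∃ S : Set (Fin (m + 1) → ℝ), S = Metric.sphere 0 1 ∩ C := ⟨_, rfl⟩
  have hScomp : IsCompact S := by
    rw [hS]
    exact (isCompact_sphere _ _).inter_right C.closed_of_finiteDimensional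
  have hpos : ∀ a ∈ S, 0 < a ⬝ᵥ (Φ.G x *ᵥ a) := by
    intro a ha
    rw [hS] at ha
    refine (hE.dotProduct_G_nonneg hx a).lt_of_ne fun h0 => ?_
    have h2 := (hE.posSemidef_G hx).dotProduct_mulVec_zero_iff a
    simp only [star_trivial] at h2
    have h3 : a ∈ Φ.isotropy x := mem_isotropy.2 (hcon a (h2.1 h0.symm))
    have h4 := hC.disjoint.le_bot ⟨h3, ha.2⟩
    rw [Submodule.mem_bot] at h4
    have h5 := ha.1
    rw [h4] at h5
    simp at h5
  have hlow : ∃ c > 0, ∀ᶠ y in 𝓝 x, ∀ a ∈ S, c ≤ a ⬝ᵥ (Φ.G y *ᵥ a) := by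
    by_cases hne : S.Nonempty
    · obtain ⟨a₀, ha₀, hmin⟩ := hScomp.exists_isMinOn hne
        (f := fun a => a ⬝ᵥ (Φ.G x *ᵥ a)) (Φ.continuous_dotProduct_G.comp
          (by fun_prop : Continuous fun a : Fin (m + 1) → ℝ => (a, x))).continuousOn
      refine ⟨(a₀ ⬝ᵥ (Φ.G x *ᵥ a₀)) / 2, by linarith [hpos a₀ ha₀], ?_⟩
      refine (hScomp.eventually_forall_of_forall_eventually (x₀ := x)
        (P := fun y a => (a₀ ⬝ᵥ (Φ.G x *ᵥ a₀)) / 2 < a ⬝ᵥ (Φ.G y *ᵥ a)) fun a ha => ?_).mono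
        fun y hy a ha => (hy a ha).le
      have hc : ContinuousAt (fun p : M × (Fin (m + 1) → ℝ) => p.2 ⬝ᵥ (Φ.G p.1 *ᵥ p.2)) (x, a) :=
        (Φ.continuous_dotProduct_G.comp continuous_swap).continuousAt
      refine hc.eventually (lt_mem_nhds ?_)
      have : a₀ ⬝ᵥ (Φ.G x *ᵥ a₀) ≤ a ⬝ᵥ (Φ.G x *ᵥ a) := hmin ha
      linarith [hpos a₀ ha₀]
    · exact ⟨1, one_pos, Eventually.of_forall fun y a ha => absurd ⟨a, ha⟩ hne⟩
  obtain ⟨c₁, hc₁, hev₁⟩ := hlow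
  obtain ⟨c₀, hc₀, hev₀⟩ := hL.exists_mul_norm_sq_le
  -- With this `ε` the mixed terms are absorbed by `ε * (k - ‖c‖) ^ 2 ≥ 0`.
  obtain ⟨ε, hε⟩ : ∃ ε, ε = min c₀ c₁ := ⟨_, rfl⟩
  have hε0 : 0 < ε := by rw [hε]; positivity
  have hε1 : ε ≤ c₀ := hε ▸ min_le_left _ _
  have hε2 : ε ≤ c₁ := hε ▸ min_le_right _ _
  obtain ⟨y, ⟨hy1, hy0, hyc, hys⟩, hyE⟩ := mem_closure_iff_nhds.1 (hE.mem_frontier_iff.1 hx).1 _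
    (hev₁.and (hev₀.and ((hL.eventually_abs_le hε0).and
      (φ.open_source.mem_nhds hL.adapted.mem_source))))
  obtain ⟨b, hb⟩ := hE.subset hyE
  refine absurd hb (not_lt.2 ?_)
  obtain ⟨a, ha, c, hc, rfl⟩ := Submodule.mem_sup.1 (hC.sup_eq_top ▸ Submodule.mem_top (x := b))
  have hz := φ.map_source hys
  have hd := fun u v => Φ.dotProduct_G_coord hL.adapted.smoothChart hz u v
  rw [φ.left_inv hys] at hd
  have hcc : c₁ * ‖c‖ ^ 2 ≤ c ⬝ᵥ (Φ.G y *ᵥ c) := by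
    by_cases hc0 : c = 0
    · simp [hc0]
    have hn : 0 < ‖c‖ := norm_pos_iff.2 hc0
    have h1 := hy1 (‖c‖⁻¹ • c) (by rw [hS]; exact ⟨by simp [norm_smul, hc0], C.smul_mem _ hc⟩)
    rw [Matrix.mulVec_smul, dotProduct_smul, smul_dotProduct, smul_smul, smul_eq_mul] at h1
    calc c₁ * ‖c‖ ^ 2 ≤ (‖c‖⁻¹ * ‖c‖⁻¹ * (c ⬝ᵥ (Φ.G y *ᵥ c))) * ‖c‖ ^ 2 := by gcongr
      _ = c ⬝ᵥ (Φ.G y *ᵥ c) := by field_simp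
  rw [hd] at hcc ⊢
  have haa := hy0 ⟨a, ha⟩
  have hac := (abs_le.1 (hyc ⟨a, ha⟩ c)).1
  have hsymm := (hL.adapted.smoothChart.isLorentz_coordMetric (g := g) hz).symm
    (Φ.coordKilling φ (φ y) a) (Φ.coordKilling φ (φ y) c)
  simp only [map_add, add_apply]
  simp only at haa hac
  obtain ⟨k, hk⟩ : ∃ k, k = ‖Φ.coordKilling φ (φ y) a‖ := ⟨_, rfl⟩
  rw [← hk] at haa hac
  have b0 : ε * k ^ 2 ≤ c₀ * k ^ 2 := by gcongr
  have b1 : ε * ‖c‖ ^ 2 ≤ c₁ * ‖c‖ ^ 2 := by gcongr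
  have b2 : 0 ≤ ε * (k - ‖c‖) ^ 2 := by positivity
  nlinarith only [haa, hac, hcc, hsymm, b0, b1, b2]

end IsLinearModel

end IsometricAction

end DomainStructure

/-! ### Faithfulness of the isotropy representation -/

namespace DomainStructure

namespace IsometricAction

variable {D m : ℕ} {M : Type*} [TopologicalSpace M] [T2Space M]
  [ChartedSpace (EuclideanSpace ℝ (Fin D)) M] [IsManifold (𝓡 D) ∞ M]
  {g : LorentzMetric D M} {Φ : IsometricAction g m} {E : Set M} {x : M}

theorem IsExterior.exists_isLinearModel (hE : Φ.IsExterior E) (hproper : Φ.IsProper E)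
    (hb : HasSmoothBoundary (D := D) E) (hx : x ∈ closure E) :
    ∃ φ ℓ A X, Φ.IsLinearModel E x φ ℓ A X := by
  obtain ⟨φ, ℓ, h⟩ := hE.exists_isAdaptedChart hproper hb hx
  exact ⟨φ, ℓ, h.exists_isLinearModel hE fun s hs => hproper.apply_zero_eq_zero_of_flow hx hs⟩

/-- In an effective action, a nonzero combination of the Killing vector fields does not vanish on
an open set. -/
theorem IsExterior.eq_zero_of_killing_eventually (hE : Φ.IsExterior E) (hproper : Φ.IsProper E)
    (hb : HasSmoothBoundary (D := D) E) (heff : Φ.IsEffective E) (hx : x ∈ E)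
    {a : Fin (m + 1) → ℝ} (h : ∀ᶠ y in 𝓝 x, Φ.killing a y = 0) : a = 0 := by
  have hopen : IsOpen {y | ∀ᶠ z in 𝓝 y, Φ.killing a z = 0} :=
    isOpen_setOfPred_eventually_nhds
  have hsub : E ⊆ {y | ∀ᶠ z in 𝓝 y, Φ.killing a z = 0} := by
    refine hE.isConnected.isPreconnected.subset_of_closure_inter_subset hopen ⟨x, hx, h⟩ ?_
    rintro y ⟨hy, hyE⟩
    obtain ⟨φ, ℓ, A, X, hL⟩ := hE.exists_isLinearModel hproper hb (subset_closure hyE)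
    obtain ⟨z, hzX, hz⟩ := mem_closure_iff_nhds.1 hy _ (X.open_source.mem_nhds hL.mem_source)
    have hz' : ∀ᶠ w in 𝓝 z, Φ.killing a w = 0 := hz
    obtain ⟨ha, -⟩ := (hL.killing_iff z hzX a).1 hz'.self_of_nhds
    have hker : ∀ᶠ v in 𝓝 (X z), A ⟨a, ha⟩ v = 0 := by
      have h1 := (X.tendsto_symm hzX).eventually hz'
      filter_upwards [h1, X.open_target.mem_nhds (X.map_source hzX)] with v hv hvt
      obtain ⟨_, h2⟩ := (hL.killing_iff _ (X.map_target hvt) a).1 hv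
      rwa [X.right_inv hvt] at h2
    -- In the linear model the zeros of the field form a linear subspace; having an interior point,
    -- it is the whole space. So the set of interior zeros is closed in `E` as well as open.
    have hA : ∀ v, A ⟨a, ha⟩ v = 0 := by
      intro v
      have h1 : Tendsto (fun t : ℝ => X z + t • v) (𝓝 0) (𝓝 (X z)) := by
        have : Continuous fun t : ℝ => X z + t • v := by fun_prop
        simpa using this.tendsto 0
      obtain ⟨t, ht, ht0⟩ := ((((h1.eventually hker).filter_mono
        (nhdsWithin_le_nhds (s := {0}ᶜ))).and self_mem_nhdsWithin)).exists
      have h2 := hker.self_of_nhds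
      simp only [map_add, map_smul, h2, zero_add] at ht
      exact (smul_eq_zero.1 ht).resolve_left ht0
    filter_upwards [X.open_source.mem_nhds hL.mem_source] with w hw
    exact (hL.killing_iff w hw a).2 ⟨ha, hA _⟩
  have hfix : ∀ t : ℝ, ∀ y ∈ E, Φ.flow (t • a) y = y := fun t y hy =>
    Φ.flow_smul_eq_of_killing_eq_zero (hsub hy : ∀ᶠ z in 𝓝 y, Φ.killing a z = 0).self_of_nhds t
  funext i
  refine Fin.cases ?_ (fun i => ?_) i
  · simpa using (heff _ (hfix 1)).1
  · by_contra h0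
    simp only [Pi.zero_apply] at h0
    -- At this time the component is `π`, which is not a multiple of `2π`.
    obtain ⟨k, hk⟩ := (heff _ (hfix (Real.pi / a i.succ))).2 i
    simp only [Pi.smul_apply, smul_eq_mul] at hk
    rw [div_mul_cancel₀ _ h0] at hk
    have h1 : (2 * k : ℝ) = 1 := by
      have := Real.pi_pos
      apply mul_left_cancel₀ this.ne'
      linarith
    have h2 : (2 * k : ℤ) = 1 := by exact_mod_cast h1
    omega

/-- The infinitesimal isotropy representation of an effective action is faithful. -/
theorem IsLinearModel.faithful {φ : OpenPartialHomeomorph M (EuclideanSpace ℝ (Fin D))}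
    {ℓ : EuclideanSpace ℝ (Fin D) →L[ℝ] ℝ}
    {A : Φ.isotropy x →ₗ[ℝ] EuclideanSpace ℝ (Fin D) →ₗ[ℝ] EuclideanSpace ℝ (Fin D)}
    {X : OpenPartialHomeomorph M (EuclideanSpace ℝ (Fin D))}
    (hL : Φ.IsLinearModel E x φ ℓ A X) (hE : Φ.IsExterior E) (hproper : Φ.IsProper E)
    (hb : HasSmoothBoundary (D := D) E) (heff : Φ.IsEffective E) (hx : x ∈ closure E)
    (a : Φ.isotropy x) (ha : A a = 0) : a = 0 := by
  obtain ⟨y, hyX, hyE⟩ := mem_closure_iff_nhds.1 hx _ (X.open_source.mem_nhds hL.mem_source)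
  refine Subtype.ext (hE.eq_zero_of_killing_eventually hproper hb heff hyE ?_)
  filter_upwards [X.open_source.mem_nhds hyX] with z hz
  exact (hL.killing_iff z hz a).2 ⟨a.2, by simp [ha]⟩

end IsometricAction

end DomainStructure

namespace DomainStructure

/-! ### Matrices with one negative eigenvalue -/

section Matrices

variable {ι : Type*} [Fintype ι] [DecidableEq ι]

omit [DecidableEq ι] in
theorem dotProduct_vecMulVec_mulVec (w a b : ι → ℝ) :
    a ⬝ᵥ (Matrix.vecMulVec w w *ᵥ b) = (w ⬝ᵥ a) * (w ⬝ᵥ b) := by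
  rw [Matrix.vecMulVec_mulVec, dotProduct_smul, dotProduct_comm a w]
  simp

theorem det_add_vecMulVec_of_det_ne_zero {A : Matrix ι ι ℝ} (hA : A.det ≠ 0) (u v : ι → ℝ) :
    (A + Matrix.vecMulVec u v).det = A.det + v ⬝ᵥ (A.adjugate *ᵥ u) := by
  have h := Matrix.det_add_replicateCol_mul_replicateRow (ι := Unit) (A := A)
    (isUnit_iff_ne_zero.2 hA) u v
  have e : Matrix.replicateCol Unit u * Matrix.replicateRow Unit v = Matrix.vecMulVec u v := by
    ext i j; simp [Matrix.mul_apply, Matrix.vecMulVec_apply]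
  have e2 : (Matrix.replicateRow Unit v * A⁻¹ * Matrix.replicateCol Unit u) =
      Matrix.of fun _ _ => A.det⁻¹ * (v ⬝ᵥ (A.adjugate *ᵥ u)) := by
    rw [Matrix.inv_def, Matrix.mul_smul, Matrix.smul_mul, Ring.inverse_eq_inv', Matrix.mul_assoc]
    ext i j
    simp [Matrix.mul_apply, dotProduct, Matrix.mulVec]
  rw [e, e2] at h
  rw [h, Matrix.det_unique (n := Unit), Matrix.add_apply, Matrix.one_apply_eq, Matrix.of_apply]
  field_simp

/-- Both sides are continuous in `A`, so the identity for the positive definite matrices `A + t • 1`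
with `t > 0` passes to the limit. The form with the adjugate survives the degeneration of `A`. -/
theorem det_add_vecMulVec_of_posSemidef {A : Matrix ι ι ℝ} (hA : A.PosSemidef) (u v : ι → ℝ) :
    (A + Matrix.vecMulVec u v).det = A.det + v ⬝ᵥ (A.adjugate *ᵥ u) := by
  have h1 : Continuous fun t : ℝ => (A + t • (1 : Matrix ι ι ℝ) + Matrix.vecMulVec u v).det := by
    fun_prop
  have h2 : Continuous fun t : ℝ => (A + t • (1 : Matrix ι ι ℝ)).det
      + v ⬝ᵥ ((A + t • (1 : Matrix ι ι ℝ)).adjugate *ᵥ u) := by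
    have hc : Continuous fun t : ℝ => A + t • (1 : Matrix ι ι ℝ) := by fun_prop
    exact hc.matrix_det.add (continuous_const.dotProduct (hc.matrix_adjugate.matrix_mulVec
      continuous_const))
  have h3 := (h1.tendsto 0).mono_left (nhdsWithin_le_nhds (s := Ioi 0))
  have h4 := (h2.tendsto 0).mono_left (nhdsWithin_le_nhds (s := Ioi 0))
  have h5 := tendsto_nhds_unique (h3.congr' ?_) h4
  · simpa using h5
  · filter_upwards [self_mem_nhdsWithin] with t ht
    have hpd : (A + t • (1 : Matrix ι ι ℝ)).PosDef :=
      Matrix.PosDef.posSemidef_add hA (Matrix.PosDef.one.smul ht)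
    exact det_add_vecMulVec_of_det_ne_zero hpd.det_pos.ne' u v

/-- If `A` is positive definite up to a rank-one term and has a negative direction, then `det A`
is negative. -/
theorem det_neg_of_posDef_add {A : Matrix ι ι ℝ} {w a : ι → ℝ}
    (hP : (A + Matrix.vecMulVec w w).PosDef) (ha : a ⬝ᵥ (A *ᵥ a) < 0) : A.det < 0 := by
  obtain ⟨P, hPe⟩ : ∃ P, P = A + Matrix.vecMulVec w w := ⟨_, rfl⟩
  rw [← hPe] at hP
  have hdet := hP.det_pos
  have hA : A = P + Matrix.vecMulVec (-w) w := by
    rw [hPe, Matrix.neg_vecMulVec]; simp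
  obtain ⟨u, hu⟩ : ∃ u, P *ᵥ u = w := ⟨P⁻¹ *ᵥ w, by
    rw [Matrix.mulVec_mulVec, Matrix.mul_nonsing_inv _ (isUnit_iff_ne_zero.2 hdet.ne'),
      Matrix.one_mulVec]⟩
  have hadj : P.adjugate *ᵥ w = P.det • u := by
    rw [← hu, Matrix.mulVec_mulVec, Matrix.adjugate_mul, Matrix.smul_mulVec, Matrix.one_mulVec]
  have hsymm : ∀ b c : ι → ℝ, b ⬝ᵥ (P *ᵥ c) = c ⬝ᵥ (P *ᵥ b) := fun b c => by
    have hT : Pᵀ = P := by simpa using hP.isHermitian.eq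
    rw [Matrix.dotProduct_mulVec, ← Matrix.mulVec_transpose, hT, dotProduct_comm]
  have hnn : ∀ b : ι → ℝ, 0 ≤ b ⬝ᵥ (P *ᵥ b) := fun b => by
    simpa using hP.posSemidef.dotProduct_mulVec_nonneg b
  have haA : a ⬝ᵥ (P *ᵥ a) < (w ⬝ᵥ a) ^ 2 := by
    rw [hPe, Matrix.add_mulVec, dotProduct_add, dotProduct_vecMulVec_mulVec]
    nlinarith
  have hwa : w ⬝ᵥ a = u ⬝ᵥ (P *ᵥ a) := by rw [hsymm, hu, dotProduct_comm]
  have huu : u ⬝ᵥ (P *ᵥ u) = w ⬝ᵥ u := by rw [hu, dotProduct_comm]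
  -- The determinant is `det P * (1 - w ⬝ᵥ u)` with `P *ᵥ u = w`. The negative direction satisfies
  -- `a ⬝ᵥ (P *ᵥ a) < (w ⬝ᵥ a) ^ 2`, and Cauchy-Schwarz for `P` makes the bracket negative.
  have hcs : 1 < w ⬝ᵥ u := by
    obtain ⟨s, hs⟩ : ∃ s, s = w ⬝ᵥ a := ⟨_, rfl⟩
    have hq := hnn (s • u - a)
    have hs0 : 0 < s ^ 2 := by rw [hs]; linarith [hnn a]
    simp only [Matrix.mulVec_sub, Matrix.mulVec_smul, dotProduct_sub, sub_dotProduct,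
      smul_dotProduct, dotProduct_smul, smul_eq_mul, huu, ← hwa, hsymm a u, ← hs] at hq
    rw [← hs] at haA
    nlinarith
  rw [hA, det_add_vecMulVec_of_det_ne_zero hdet.ne', Matrix.mulVec_neg, dotProduct_neg, hadj,
    dotProduct_smul, smul_eq_mul]
  nlinarith

omit [DecidableEq ι] in
-- Compactness of the unit sphere makes positivity on it persist, and homogeneity extends it to all
-- vectors.
theorem eventually_forall_pos {X : Type*} [TopologicalSpace X] {F : X → Matrix ι ι ℝ} {x : X}
    (hF : ContinuousAt F x) (hpos : ∀ a : ι → ℝ, a ≠ 0 → 0 < a ⬝ᵥ (F x *ᵥ a)) :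
    ∀ᶠ y in 𝓝 x, ∀ a : ι → ℝ, a ≠ 0 → 0 < a ⬝ᵥ (F y *ᵥ a) := by
  have hK : IsCompact (Metric.sphere (0 : ι → ℝ) 1) := isCompact_sphere _ _
  have h := hK.eventually_forall_of_forall_eventually (x₀ := x)
    (P := fun y a => 0 < a ⬝ᵥ (F y *ᵥ a)) fun a ha => by
      have h1 : ContinuousAt (fun p : X × (ι → ℝ) => F p.1) (x, a) :=
        ContinuousAt.comp (f := Prod.fst) hF continuousAt_fst
      have h2 : Continuous fun q : Matrix ι ι ℝ × (ι → ℝ) => q.2 ⬝ᵥ (q.1 *ᵥ q.2) :=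
        continuous_snd.dotProduct (continuous_fst.matrix_mulVec continuous_snd)
      have h3 : ContinuousAt (fun p : X × (ι → ℝ) => p.2 ⬝ᵥ (F p.1 *ᵥ p.2)) (x, a) :=
        ContinuousAt.comp (f := fun p : X × (ι → ℝ) => (F p.1, p.2)) h2.continuousAt
          (h1.prodMk continuousAt_snd)
      refine h3.eventually (lt_mem_nhds (hpos a ?_))
      rintro rfl
      simp at ha
  filter_upwards [h] with y hy a ha
  have hn : ‖a‖ ≠ 0 := norm_ne_zero_iff.2 ha
  have h1 := hy (‖a‖⁻¹ • a) (by simp [norm_smul, hn])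
  rw [Matrix.mulVec_smul, dotProduct_smul, smul_dotProduct, smul_smul, smul_eq_mul] at h1
  have h2 : 0 < ‖a‖⁻¹ * ‖a‖⁻¹ := by positivity
  exact pos_of_mul_pos_right h1 h2.le

end Matrices

/-! ### The decomposition of a Lorentzian form along a subspace -/

section Gram

variable {ι : Type*} [Fintype ι] [DecidableEq ι]
  {V : Type*} [NormedAddCommGroup V] [NormedSpace ℝ V]

/-- The Gram matrix of a bilinear form on the range of `K`. -/
noncomputable def gram (B : V →L[ℝ] V →L[ℝ] ℝ) (K : (ι → ℝ) →L[ℝ] V) : Matrix ι ι ℝ :=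
  Matrix.of fun i j => B (K (Pi.single i 1)) (K (Pi.single j 1))

/-- The components of a vector relative to the range of `K`. -/
noncomputable def gramVec (B : V →L[ℝ] V →L[ℝ] ℝ) (K : (ι → ℝ) →L[ℝ] V) (v : V) : ι → ℝ :=
  fun i => B (K (Pi.single i 1)) v

/-- The value of the form on the orthogonal projection to the complement of the range of `K`. -/
noncomputable def gramTilde (B : V →L[ℝ] V →L[ℝ] ℝ) (K : (ι → ℝ) →L[ℝ] V) (v : V) : ℝ :=
  B v v - ((gram B K)⁻¹ *ᵥ gramVec B K v) ⬝ᵥ (gram B K *ᵥ ((gram B K)⁻¹ *ᵥ gramVec B K v))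

variable {B : V →L[ℝ] V →L[ℝ] ℝ} {K : (ι → ℝ) →L[ℝ] V}

theorem apply_eq_sum_single (K : (ι → ℝ) →L[ℝ] V) (a : ι → ℝ) :
    K a = ∑ i, a i • K (Pi.single i 1) := by
  conv_lhs => rw [pi_eq_sum_univ' a]
  simp [map_sum]

theorem dotProduct_gramVec (a : ι → ℝ) (v : V) : a ⬝ᵥ gramVec B K v = B (K a) v := by
  rw [apply_eq_sum_single K a]
  simp [dotProduct, gramVec, map_sum]

theorem gram_mulVec (b : ι → ℝ) : gram B K *ᵥ b = gramVec B K (K b) := by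
  funext i
  rw [apply_eq_sum_single K b]
  simp [gram, gramVec, Matrix.mulVec, dotProduct, map_sum, mul_comm]

theorem dotProduct_gram (a b : ι → ℝ) : a ⬝ᵥ (gram B K *ᵥ b) = B (K a) (K b) := by
  rw [gram_mulVec, dotProduct_gramVec]

omit [Fintype ι] in
theorem gram_transpose (hB : IsLorentz B) : (gram B K)ᵀ = gram B K := by
  ext i j; exact hB.symm _ _

theorem gram_mulVec_eq_zero_iff {b : ι → ℝ} :
    gram B K *ᵥ b = 0 ↔ ∀ a, B (K a) (K b) = 0 := by
  constructor
  · intro h a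
    rw [← dotProduct_gram, h, dotProduct_zero]
  · intro h
    funext i
    rw [gram_mulVec]
    exact h _

variable (hB : IsLorentz B) (hdet : (gram B K).det < 0)
include hB hdet

omit hB in
theorem orthogonal_sub_gram (a : ι → ℝ) (v : V) :
    B (K a) (v - K ((gram B K)⁻¹ *ᵥ gramVec B K v)) = 0 := by
  rw [map_sub, ← dotProduct_gram, Matrix.mulVec_mulVec,
    Matrix.mul_nonsing_inv _ (isUnit_iff_ne_zero.2 hdet.ne), Matrix.one_mulVec,
    dotProduct_gramVec, sub_self]

theorem gramTilde_eq (v : V) : gramTilde B K v =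
    B (v - K ((gram B K)⁻¹ *ᵥ gramVec B K v)) (v - K ((gram B K)⁻¹ *ᵥ gramVec B K v)) := by
  obtain ⟨t, ht⟩ : ∃ t, t = (gram B K)⁻¹ *ᵥ gramVec B K v := ⟨_, rfl⟩
  have h1 := orthogonal_sub_gram hdet t v
  rw [gramTilde, dotProduct_gram, ← ht]
  rw [← ht] at h1
  have h2 := hB.symm v (K t)
  simp only [map_sub, sub_apply] at h1 ⊢
  linarith

omit hB hdet in
/-- The vector `K (adj G w)` is time-like. -/
theorem gram_adjugate_timelike {w : ι → ℝ} :
    B (K ((gram B K).adjugate *ᵥ w)) (K ((gram B K).adjugate *ᵥ w))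
      = (gram B K).det * (w ⬝ᵥ ((gram B K).adjugate *ᵥ w)) := by
  rw [← dotProduct_gram, Matrix.mulVec_mulVec, Matrix.mul_adjugate, Matrix.smul_mulVec,
    Matrix.one_mulVec, dotProduct_smul, smul_eq_mul, dotProduct_comm]

variable {w : ι → ℝ} (hw : 0 < w ⬝ᵥ ((gram B K).adjugate *ᵥ w))
include hw

/-- The vector `K (adj G w)` is time-like and tangent to the orbits, so what is orthogonal to the
orbits has nonnegative norm. -/
theorem gramTilde_nonneg (v : V) : 0 ≤ gramTilde B K v := by
  rw [gramTilde_eq hB hdet]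
  refine hB.nonneg_of_orthogonal ?_ (orthogonal_sub_gram hdet ((gram B K).adjugate *ᵥ w) v)
  rw [gram_adjugate_timelike]
  exact mul_neg_of_neg_of_pos hdet hw

/-- The part of `v` along the orbits may be time-like; the reverse Cauchy-Schwarz inequality against
the single vector `K (adj G w)` bounds its contribution. This vector stays bounded as `det G → 0`,
so only one factor `1 / det G` is lost. -/
theorem gramTilde_le (v : V) : gramTilde B K v ≤ B v v +
    B (K ((gram B K).adjugate *ᵥ w)) v ^ 2 /
      (-(gram B K).det * (w ⬝ᵥ ((gram B K).adjugate *ᵥ w))) := by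
  have hT := gram_adjugate_timelike (B := B) (K := K) (w := w)
  have hTneg : B (K ((gram B K).adjugate *ᵥ w)) (K ((gram B K).adjugate *ᵥ w)) < 0 := by
    rw [hT]; exact mul_neg_of_neg_of_pos hdet hw
  obtain ⟨t, ht⟩ : ∃ t, t = (gram B K)⁻¹ *ᵥ gramVec B K v := ⟨_, rfl⟩
  have h1 := orthogonal_sub_gram hdet ((gram B K).adjugate *ᵥ w) v
  have h2 := hB.reverse_cauchy_schwarz hTneg (K t)
  rw [map_sub, ← ht, sub_eq_zero] at h1
  rw [← h1, hT] at h2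
  rw [gramTilde, dotProduct_gram, ← ht]
  have h3 : 0 < -(gram B K).det * (w ⬝ᵥ ((gram B K).adjugate *ᵥ w)) :=
    mul_pos (by linarith) hw
  have h4 : -B (K t) (K t) ≤ B (K ((gram B K).adjugate *ᵥ w)) v ^ 2 /
      (-(gram B K).det * (w ⬝ᵥ ((gram B K).adjugate *ᵥ w))) := by
    rw [le_div_iff₀ h3]
    linarith
  linarith

/-- Meant for the gradient `p` of an invariant function. It pairs only with the projection of `v` to
the complement of the orbits, where Cauchy-Schwarz holds. -/
theorem sq_le_mul_gramTilde {p : V} (hp : ∀ a, B p (K a) = 0) (v : V) :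
    B p v ^ 2 ≤ B p p * gramTilde B K v := by
  have hTneg : B (K ((gram B K).adjugate *ᵥ w)) (K ((gram B K).adjugate *ᵥ w)) < 0 := by
    rw [gram_adjugate_timelike]; exact mul_neg_of_neg_of_pos hdet hw
  have h1 := hB.cauchy_schwarz_of_orthogonal hTneg (by rw [hB.symm]; exact hp _)
    (orthogonal_sub_gram hdet ((gram B K).adjugate *ᵥ w) v)
  rw [← gramTilde_eq hB hdet, map_sub, hp, sub_zero] at h1
  exact h1

end Gram

end DomainStructure

/-! ### Calculus of determinants, and uniform bounds along segments -/

namespace DomainStructure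

section Calculus

variable {V : Type*} [NormedAddCommGroup V] [NormedSpace ℝ V]

theorem contDiffAt_det {ι : Type*} [Fintype ι] [DecidableEq ι] {F : V → Matrix ι ι ℝ} {z : V}
    {n : WithTop ℕ∞} (h : ∀ i j, ContDiffAt ℝ n (fun y => F y i j) z) :
    ContDiffAt ℝ n (fun y => (F y).det) z := by
  simp only [Matrix.det_apply]
  refine ContDiffAt.sum fun σ _ => ContDiffAt.const_smul _ ?_
  exact contDiffAt_prod fun i _ => h _ _

theorem contDiffAt_adjugate_mulVec {ι : Type*} [Fintype ι] [DecidableEq ι] {F : V → Matrix ι ι ℝ}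
    {z : V} {n : WithTop ℕ∞} (h : ∀ i j, ContDiffAt ℝ n (fun y => F y i j) z) (a : ι → ℝ) :
    ContDiffAt ℝ n (fun y => (F y).adjugate *ᵥ a) z := by
  refine contDiffAt_pi.2 fun i => ?_
  simp only [Matrix.mulVec, dotProduct]
  refine ContDiffAt.sum fun j _ => ContDiffAt.mul ?_ contDiffAt_const
  simp only [Matrix.adjugate_apply]
  refine contDiffAt_det fun k l => ?_
  by_cases hk : k = j
  · simp only [hk, Matrix.updateRow_self]
    exact contDiffAt_const
  · simp only [Matrix.updateRow_ne hk]
    exact h k l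

/-- A `C²` function of one variable that vanishes to first order is of second order. -/
theorem exists_abs_le_sq {h : ℝ → ℝ} (hh : ContDiffAt ℝ 2 h 0) (h0 : h 0 = 0)
    (h1 : deriv h 0 = 0) : ∃ C, 0 ≤ C ∧ ∀ᶠ t in 𝓝 (0 : ℝ), |h t| ≤ C * t ^ 2 := by
  have hd : ContDiffAt ℝ 1 (fderiv ℝ h) 0 := hh.fderiv_right (by norm_num)
  obtain ⟨C, hC, hev⟩ := exists_norm_le_of_eq_zero_on_hyperplane
    (ℓ := ContinuousLinearMap.id ℝ ℝ) (z₀ := (0 : ℝ)) (F := fderiv ℝ h)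
    (fun h => one_ne_zero (DFunLike.congr_fun h (1 : ℝ))) rfl hd
    (Eventually.of_forall fun t ht => by
      have : t = 0 := ht
      subst this
      ext
      simpa using h1)
  have hdiff : ∀ᶠ t in 𝓝 (0 : ℝ), DifferentiableAt ℝ h t :=
    (hh.eventually (by simp)).mono fun t ht => ht.differentiableAt (by simp)
  obtain ⟨δ, hδ, hball⟩ := Metric.eventually_nhds_iff_ball.1 (hev.and hdiff)
  refine ⟨C, hC, Metric.eventually_nhds_iff_ball.2 ⟨δ, hδ, fun t ht => ?_⟩⟩
  have ht' : |t| < δ := by simpa using ht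
  have h2 := (convex_Icc (-|t|) |t|).norm_image_sub_le_of_norm_hasFDerivWithin_le (f := h)
    (f' := fderiv ℝ h) (C := C * |t|) (x := 0) (y := t)
    (fun s hs => (hball s (by simpa using (abs_le.2 hs).trans_lt ht')).2.hasFDerivAt.hasFDerivWithinAt)
    (fun s hs => ((hball s (by simpa using (abs_le.2 hs).trans_lt ht')).1).trans (by
      have : |s| ≤ |t| := abs_le.2 hs
      simp only [ContinuousLinearMap.coe_id', id]
      gcongr)) ⟨by simp, by simp⟩ ⟨neg_abs_le t, le_abs_self t⟩
  rw [h0, sub_zero, sub_zero, Real.norm_eq_abs, Real.norm_eq_abs, mul_assoc, abs_mul_abs_self] at h2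
  rwa [sq]

/-- Local bounds near the points of a segment hold uniformly in a strip along it. -/
theorem exists_uniform_strip {P : ℝ → V → Prop} (hmono : ∀ C C' z, C ≤ C' → P C z → P C' z)
    {p d n : V} (h : ∀ s ∈ Icc (0 : ℝ) 1, ∃ C, ∀ᶠ z in 𝓝 (p + s • d), P C z) :
    ∃ C, ∀ᶠ t in 𝓝 (0 : ℝ), ∀ s ∈ Icc (0 : ℝ) 1, P C (p + t • n + s • d) := by
  refine isCompact_Icc.induction_on (p := fun S => ∃ C, ∀ᶠ t in 𝓝 (0 : ℝ), ∀ s ∈ S,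
    P C (p + t • n + s • d)) ⟨0, by simp⟩ ?_ ?_ ?_
  · rintro S T hST ⟨C, hC⟩
    exact ⟨C, hC.mono fun t ht s hs => ht s (hST hs)⟩
  · rintro S T ⟨C, hC⟩ ⟨C', hC'⟩
    refine ⟨max C C', ?_⟩
    filter_upwards [hC, hC'] with t h1 h2 s hs
    rcases hs with hs | hs
    · exact hmono _ _ _ (le_max_left _ _) (h1 s hs)
    · exact hmono _ _ _ (le_max_right _ _) (h2 s hs)
  · intro s hs
    obtain ⟨C, hC⟩ := h s hs
    have hc : Tendsto (fun q : ℝ × ℝ => p + q.1 • n + q.2 • d) (𝓝 (0, s)) (𝓝 (p + s • d)) :=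
      Continuous.tendsto' (by fun_prop) _ _ (by simp)
    have h1 := hc.eventually hC
    rw [nhds_prod_eq, eventually_prod_iff] at h1
    obtain ⟨pa, hpa, pb, hpb, hab⟩ := h1
    exact ⟨{s | pb s}, mem_nhdsWithin_of_mem_nhds hpb, C, hpa.mono fun t ht s hs => hab ht hs⟩

end Calculus

/-! ### A Lorentzian metric with Killing vector fields near a horizon -/

section Horizon

variable {ι : Type*} [Fintype ι] [DecidableEq ι]
  {V : Type*} [NormedAddCommGroup V] [InnerProductSpace ℝ V] [FiniteDimensional ℝ V]

/-- Local data near a hyperplane on which the Gram matrix of the vector fields `K z a`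
degenerates, while its canonical form is regular on the side `0 < ℓ`. -/
structure IsHorizonModel (U : Set V) (ℓ : V →L[ℝ] ℝ) (B : V → V →L[ℝ] V →L[ℝ] ℝ)
    (K : V → (ι → ℝ) →L[ℝ] V) (w : ι → ℝ) (X : ι → V → ℝ) : Prop where
  isOpen : IsOpen U
  convex : Convex ℝ U
  normal_ne_zero : ℓ ≠ 0
  contDiffAt_metric : ∀ z ∈ U, ContDiffAt ℝ ∞ B z
  contDiffAt_killing : ∀ z ∈ U, ContDiffAt ℝ ∞ K z
  isLorentz : ∀ z ∈ U, IsLorentz (B z)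
  killing_injective : ∀ z ∈ U, ∀ a, K z a = 0 → a = 0
  det_eq_zero : ∀ z ∈ U, ℓ z = 0 → (gram (B z) (K z)).det = 0
  det_neg : ∀ z ∈ U, 0 < ℓ z → (gram (B z) (K z)).det < 0
  adjugate_pos : ∀ z ∈ U, 0 < w ⬝ᵥ ((gram (B z) (K z)).adjugate *ᵥ w)
  gauge : ∃ C, 0 ≤ C ∧ ∀ z ∈ U, 0 < ℓ z → ∀ i, DifferentiableAt ℝ (X i) z ∧
    ∀ v, (((gram (B z) (K z))⁻¹ *ᵥ gramVec (B z) (K z) v) i - fderiv ℝ (X i) z v) ^ 2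
      ≤ C * gramTilde (B z) (K z) v
  radial : ∃ C, ∀ z ∈ U, 0 < ℓ z →
    ∃ v, fderiv ℝ (fun y => √(-(gram (B y) (K y)).det)) z v = 1 ∧ gramTilde (B z) (K z) v ≤ C
  invariant : ∀ z ∈ U, 0 < ℓ z → ∀ a,
    fderiv ℝ (fun y => √(-(gram (B y) (K y)).det)) z (K z a) = 0

namespace IsHorizonModel

set_option linter.unusedSectionVars false

variable {U : Set V} {ℓ : V →L[ℝ] ℝ} {B : V → V →L[ℝ] V →L[ℝ] ℝ}
  {K : V → (ι → ℝ) →L[ℝ] V} {w : ι → ℝ} {X : ι → V → ℝ}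
  (h : IsHorizonModel U ℓ B K w X) {z₀ : V} (hz₀ : z₀ ∈ U)
include h hz₀

theorem contDiffAt_gram (i j : ι) : ContDiffAt ℝ ∞ (fun z => gram (B z) (K z) i j) z₀ := by
  have h1 := h.contDiffAt_metric z₀ hz₀
  have h2 := h.contDiffAt_killing z₀ hz₀
  exact (h1.clm_apply (h2.clm_apply contDiffAt_const)).clm_apply (h2.clm_apply contDiffAt_const)

theorem contDiffAt_neg_det : ContDiffAt ℝ ∞ (fun z => -(gram (B z) (K z)).det) z₀ :=
  (contDiffAt_det (h.contDiffAt_gram hz₀)).neg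

theorem contDiffAt_adjugate (a : ι → ℝ) :
    ContDiffAt ℝ ∞ (fun z => (gram (B z) (K z)).adjugate *ᵥ a) z₀ :=
  contDiffAt_adjugate_mulVec (h.contDiffAt_gram hz₀) a

theorem contDiffAt_form (a : ι → ℝ) :
    ContDiffAt ℝ ∞ (fun z => B z (K z ((gram (B z) (K z)).adjugate *ᵥ a))) z₀ :=
  (h.contDiffAt_metric z₀ hz₀).clm_apply
    ((h.contDiffAt_killing z₀ hz₀).clm_apply (h.contDiffAt_adjugate hz₀ a))

theorem continuousAt_adjugate_dotProduct :
    ContinuousAt (fun z => w ⬝ᵥ ((gram (B z) (K z)).adjugate *ᵥ w)) z₀ :=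
  ContinuousAt.comp (f := fun z => (gram (B z) (K z)).adjugate *ᵥ w)
    (continuous_const.dotProduct continuous_id).continuousAt
    (h.contDiffAt_adjugate hz₀ w).continuousAt

theorem form_apply (a : ι → ℝ) (v : V) :
    B z₀ (K z₀ ((gram (B z₀) (K z₀)).adjugate *ᵥ a)) v
      = a ⬝ᵥ ((gram (B z₀) (K z₀)).adjugate *ᵥ gramVec (B z₀) (K z₀) v) := by
  have hT : (gram (B z₀) (K z₀)).adjugateᵀ = (gram (B z₀) (K z₀)).adjugate := by
    rw [Matrix.adjugate_transpose, gram_transpose (h.isLorentz z₀ hz₀)]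
  rw [← dotProduct_gramVec, Matrix.dotProduct_mulVec, ← Matrix.mulVec_transpose, hT]

/-- The asymptotics of the functions conjugate to the Killing vector fields. -/
theorem exists_abs_fderiv_add_le (a : ι → ℝ) : ∃ C, 0 ≤ C ∧ ∀ᶠ z in 𝓝 z₀, 0 < ℓ z →
    DifferentiableAt ℝ (fun z => ∑ i, a i * X i z) z ∧
    ∀ v, |fderiv ℝ (fun z => ∑ i, a i * X i z) z v
        + B z (K z ((gram (B z) (K z)).adjugate *ᵥ a)) v / -(gram (B z) (K z)).det|
      ≤ C * (‖v‖ + |B z (K z ((gram (B z) (K z)).adjugate *ᵥ w)) v| /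
        √(-(gram (B z) (K z)).det)) := by
  obtain ⟨C, hC, hgauge⟩ := h.gauge
  obtain ⟨β, hβ⟩ : ∃ β, β = ‖B z₀‖ + 1 := ⟨_, rfl⟩
  obtain ⟨μ, hμ⟩ : ∃ μ, μ = (w ⬝ᵥ ((gram (B z₀) (K z₀)).adjugate *ᵥ w)) / 2 := ⟨_, rfl⟩
  have hpos := h.adjugate_pos z₀ hz₀
  have hμ0 : 0 < μ := by rw [hμ]; linarith
  have hβ0 : 0 < β := by
    have := ContinuousLinearMap.opNorm_nonneg (B z₀)
    rw [hβ]; linarith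
  have e1 : ∀ᶠ z in 𝓝 z₀, ‖B z‖ < β := by
    filter_upwards [Metric.continuousAt_iff'.1 (h.contDiffAt_metric z₀ hz₀).continuousAt 1 one_pos]
      with z hz
    rw [dist_eq_norm] at hz
    have := ContinuousLinearMap.opNorm_add_le (f := B z - B z₀) (g := B z₀)
    rw [sub_add_cancel] at this
    rw [hβ]
    exact this.trans_lt (by linarith)
  have e2 : ∀ᶠ z in 𝓝 z₀, μ < w ⬝ᵥ ((gram (B z) (K z)).adjugate *ᵥ w) :=
    (h.continuousAt_adjugate_dotProduct hz₀).eventually (lt_mem_nhds (by rw [hμ]; linarith))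
  obtain ⟨γ, hγ⟩ : ∃ γ, γ = max β μ⁻¹ := ⟨_, rfl⟩
  have hγ0 : 0 < γ := hγ ▸ lt_max_of_lt_left hβ0
  refine ⟨(∑ i, |a i|) * √(C * γ), by positivity, ?_⟩
  filter_upwards [h.isOpen.mem_nhds hz₀, e1, e2] with z hz hz1 hz2 hzℓ
  have hX := hgauge z hz hzℓ
  have hder : HasFDerivAt (fun z => ∑ i, a i * X i z) (∑ i, a i • fderiv ℝ (X i) z) z :=
    HasFDerivAt.fun_sum fun i _ => (hX i).1.hasFDerivAt.const_mul (a i)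
  refine ⟨hder.differentiableAt, fun v => ?_⟩
  have hdet := h.det_neg z hz hzℓ
  obtain ⟨f, hf⟩ : ∃ f, f = -(gram (B z) (K z)).det := ⟨_, rfl⟩
  have hf0 : 0 < f := by rw [hf]; linarith
  obtain ⟨ϑ, hϑ⟩ : ∃ ϑ, ϑ = B z (K z ((gram (B z) (K z)).adjugate *ᵥ w)) v := ⟨_, rfl⟩
  have hT := gramTilde_le (h.isLorentz z hz) hdet (h.adjugate_pos z hz) v
  rw [← hf, ← hϑ] at hT
  have hBv : B z v v ≤ γ * ‖v‖ ^ 2 := by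
    have h1 := (le_abs_self _).trans ((B z).le_opNorm₂ v v)
    have h2 : ‖B z‖ * ‖v‖ * ‖v‖ ≤ γ * ‖v‖ * ‖v‖ := by
      have : ‖B z‖ ≤ γ := hz1.le.trans (hγ ▸ le_max_left _ _)
      gcongr
    nlinarith
  have hθ : ϑ ^ 2 / (f * (w ⬝ᵥ ((gram (B z) (K z)).adjugate *ᵥ w))) ≤ γ * (|ϑ| / √f) ^ 2 := by
    have h1 : (w ⬝ᵥ ((gram (B z) (K z)).adjugate *ᵥ w))⁻¹ ≤ γ :=
      (inv_anti₀ hμ0 hz2.le).trans (hγ ▸ le_max_right _ _)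
    have h2 : ϑ ^ 2 / (f * (w ⬝ᵥ ((gram (B z) (K z)).adjugate *ᵥ w)))
        = (w ⬝ᵥ ((gram (B z) (K z)).adjugate *ᵥ w))⁻¹ * (ϑ ^ 2 / f) := by
      field_simp
    rw [h2, div_pow, sq_abs, Real.sq_sqrt hf0.le]
    gcongr
  have hq : gramTilde (B z) (K z) v ≤ γ * (‖v‖ + |ϑ| / √f) ^ 2 := by
    have : 0 ≤ γ * (2 * ‖v‖ * (|ϑ| / √f)) := by positivity
    nlinarith
  -- Writing `G⁻¹ = adj G / det G` identifies `∑ i, a i * θ^i` with `-B (K (adj G a)) / f`, where `f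
  -- = -det G`. What remains is a combination of the gauge fields, bounded through `gramTilde_le`.
  have hsum : fderiv ℝ (fun z => ∑ i, a i * X i z) z v
      + B z (K z ((gram (B z) (K z)).adjugate *ᵥ a)) v / f
      = -∑ i, a i * (((gram (B z) (K z))⁻¹ *ᵥ gramVec (B z) (K z) v) i - fderiv ℝ (X i) z v) := by
    have h1 : B z (K z ((gram (B z) (K z)).adjugate *ᵥ a)) v / f
        = -(a ⬝ᵥ ((gram (B z) (K z))⁻¹ *ᵥ gramVec (B z) (K z) v)) := by
      rw [h.form_apply hz, Matrix.inv_def, Ring.inverse_eq_inv', Matrix.smul_mulVec,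
        dotProduct_smul, smul_eq_mul, hf]
      field_simp
    rw [h1, hder.fderiv, dotProduct]
    simp only [sum_apply, smul_apply, smul_eq_mul, mul_sub, Finset.sum_sub_distrib]
    ring
  rw [← hf, ← hϑ, hsum, abs_neg, Finset.sum_mul, Finset.sum_mul]
  refine (Finset.abs_sum_le_sum_abs _ _).trans (Finset.sum_le_sum fun i _ => ?_)
  rw [abs_mul, mul_assoc]
  refine mul_le_mul_of_nonneg_left ?_ (abs_nonneg _)
  refine abs_le_of_sq_le_sq ?_ (by positivity)
  rw [mul_pow, Real.sq_sqrt (by positivity), mul_assoc]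
  exact ((hX i).2 v).trans (mul_le_mul_of_nonneg_left hq hC)

variable (hℓ : ℓ z₀ = 0)
include hℓ

theorem mulVec_adjugate (a : ι → ℝ) :
    gram (B z₀) (K z₀) *ᵥ ((gram (B z₀) (K z₀)).adjugate *ᵥ a) = 0 := by
  rw [Matrix.mulVec_mulVec, Matrix.mul_adjugate, h.det_eq_zero z₀ hz₀ hℓ, zero_smul,
    Matrix.zero_mulVec]

omit hℓ in
theorem adjugate_ne_zero : (gram (B z₀) (K z₀)).adjugate *ᵥ w ≠ 0 := by
  intro h0
  have := h.adjugate_pos z₀ hz₀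
  rw [h0, dotProduct_zero] at this
  exact lt_irrefl _ this

/-- The kernel of the Gram matrix on the horizon is one-dimensional. -/
theorem exists_smul_eq {b : ι → ℝ} (hb : gram (B z₀) (K z₀) *ᵥ b = 0) :
    ∃ c : ℝ, b = c • ((gram (B z₀) (K z₀)).adjugate *ᵥ w) := by
  have h1 := gram_mulVec_eq_zero_iff.1 hb
  have h2 := gram_mulVec_eq_zero_iff.1 (h.mulVec_adjugate hz₀ hℓ w)
  obtain ⟨α, β, hαβ, h0⟩ := (h.isLorentz z₀ hz₀).dependent_of_null (h1 b) (h2 _) (h2 b)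
  rw [← map_smul, ← map_smul, ← map_add] at h0
  have h3 := h.killing_injective z₀ hz₀ _ h0
  have hα : α ≠ 0 := by
    rintro rfl
    rw [zero_smul, zero_add, smul_eq_zero] at h3
    exact h3.elim (fun hβ => hαβ.elim (fun h => h rfl) fun h => h hβ) (h.adjugate_ne_zero hz₀)
  refine ⟨-(α⁻¹ * β), ?_⟩
  rw [neg_smul, ← smul_smul, eq_neg_iff_add_eq_zero]
  have := congrArg (α⁻¹ • ·) h3
  simpa [smul_smul, hα] using this

omit hℓ in
theorem eventually_neg_det_eq_zero : ∀ᶠ z in 𝓝 z₀, ℓ z = 0 → -(gram (B z) (K z)).det = 0 := by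
  filter_upwards [h.isOpen.mem_nhds hz₀] with z hz hzℓ
  rw [h.det_eq_zero z hz hzℓ, neg_zero]

/-- The null directions in the horizon are normal to it. -/
theorem form_eq_zero {v : V} (hv : ℓ v = 0) (a : ι → ℝ) :
    B z₀ (K z₀ ((gram (B z₀) (K z₀)).adjugate *ᵥ a)) v = 0 := by
  obtain ⟨n, hn⟩ : ∃ n, ℓ n = 1 := by
    obtain ⟨v, hv⟩ := DFunLike.ne_iff.1 h.normal_ne_zero
    exact ⟨(ℓ v)⁻¹ • v, by rw [map_smul, smul_eq_mul]; exact inv_mul_cancel₀ hv⟩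
  have key : B z₀ (K z₀ ((gram (B z₀) (K z₀)).adjugate *ᵥ w)) v = 0 := by
    obtain ⟨C, hC, hev⟩ := h.exists_abs_fderiv_add_le hz₀ w
    obtain ⟨Cf, hCf, hevf⟩ := exists_norm_le_of_eq_zero_on_hyperplane h.normal_ne_zero hℓ
      ((h.contDiffAt_neg_det hz₀).of_le (by simp)) (h.eventually_neg_det_eq_zero hz₀)
    refine eq_zero_of_fderiv_asymptotic (f := fun z => -(gram (B z) (K z)).det)
      (Y := fun z => -∑ i, w i * X i z)
      (ϑ := fun z => B z (K z ((gram (B z) (K z)).adjugate *ᵥ w))) (C := C) (Cf := Cf) hℓ hC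
      (h.contDiffAt_form hz₀ w).continuousAt ?_ ?_ hv n hn
    · filter_upwards [hevf, h.isOpen.mem_nhds hz₀] with z hz hzU hzℓ
      refine ⟨by linarith [h.det_neg z hzU hzℓ], ?_⟩
      rw [abs_of_pos hzℓ] at hz
      exact (le_abs_self _).trans hz
    · filter_upwards [hev] with z hz hzℓ
      obtain ⟨h1, h2⟩ := hz hzℓ
      refine ⟨h1.neg, fun v => ?_⟩
      have h3 := h2 v
      rw [← abs_neg] at h3
      rw [fderiv_fun_neg, neg_apply]
      convert! h3 using 2
      ring
  obtain ⟨c, hc⟩ := h.exists_smul_eq hz₀ hℓ (h.mulVec_adjugate hz₀ hℓ a)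
  rw [hc, map_smul, map_smul, smul_apply, key, smul_zero]

end IsHorizonModel

end Horizon

end DomainStructure

/-! ### Nondegeneracy and constancy of the horizon generator -/

namespace DomainStructure

section Inverse

variable {V : Type*} [NormedAddCommGroup V] [InnerProductSpace ℝ V] [FiniteDimensional ℝ V]

/-- A Lorentzian form identifies the space with its dual. -/
theorem IsLorentz.exists_equiv {B : V →L[ℝ] V →L[ℝ] ℝ} (hB : IsLorentz B) :
    ∃ e : V ≃L[ℝ] (V →L[ℝ] ℝ), (e : V →L[ℝ] V →L[ℝ] ℝ) = B := by
  have hinj : Function.Injective (B : V →ₗ[ℝ] V →L[ℝ] ℝ) := by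
    refine (injective_iff_map_eq_zero (B : V →ₗ[ℝ] V →L[ℝ] ℝ)).2 fun u hu => hB.nondegenerate fun w => ?_
    have : B u = 0 := hu
    rw [this, zero_apply]
  have hdim : Module.finrank ℝ V = Module.finrank ℝ (V →L[ℝ] ℝ) :=
    (InnerProductSpace.toDual ℝ V).toLinearEquiv.finrank_eq
  refine ⟨(LinearEquiv.ofInjectiveOfFinrankEq (B : V →ₗ[ℝ] V →L[ℝ] ℝ) hinj hdim).toContinuousLinearEquiv, ?_⟩
  ext u v
  rfl

end Inverse

section Horizon

variable {ι : Type*} [Fintype ι] [DecidableEq ι]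
  {V : Type*} [NormedAddCommGroup V] [InnerProductSpace ℝ V] [FiniteDimensional ℝ V]

namespace IsHorizonModel

set_option linter.unusedSectionVars false

variable {U : Set V} {ℓ : V →L[ℝ] ℝ} {B : V → V →L[ℝ] V →L[ℝ] ℝ}
  {K : V → (ι → ℝ) →L[ℝ] V} {w : ι → ℝ} {X : ι → V → ℝ}
  (h : IsHorizonModel U ℓ B K w X) {z₀ : V} (hz₀ : z₀ ∈ U) (hℓ : ℓ z₀ = 0)
include h hz₀ hℓ

theorem form_self (a : ι → ℝ) (b : ι → ℝ) :
    B z₀ (K z₀ ((gram (B z₀) (K z₀)).adjugate *ᵥ a)) (K z₀ b) = 0 := by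
  rw [(h.isLorentz z₀ hz₀).symm, ← dotProduct_gram, h.mulVec_adjugate hz₀ hℓ, dotProduct_zero]

theorem form_eq_smul {n : V} (hn : ℓ n = 1) :
    B z₀ (K z₀ ((gram (B z₀) (K z₀)).adjugate *ᵥ w))
      = B z₀ (K z₀ ((gram (B z₀) (K z₀)).adjugate *ᵥ w)) n • ℓ := by
  ext v
  have h1 := h.form_eq_zero hz₀ hℓ (v := v - ℓ v • n) (by simp [hn]) w
  rw [map_sub, map_smul, sub_eq_zero] at h1
  rw [h1, smul_apply, smul_eq_mul, smul_eq_mul, mul_comm]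

/-- The form of the null generator is a multiple of `ℓ`; with factor zero, the nonzero vector `K
(adj G w)` would be orthogonal to everything. -/
theorem form_normal_ne_zero {n : V} (hn : ℓ n = 1) :
    B z₀ (K z₀ ((gram (B z₀) (K z₀)).adjugate *ᵥ w)) n ≠ 0 := by
  intro h0
  have h1 := h.form_eq_smul hz₀ hℓ hn
  rw [h0, zero_smul] at h1
  refine h.adjugate_ne_zero hz₀ (h.killing_injective z₀ hz₀ _
    ((h.isLorentz z₀ hz₀).nondegenerate fun v => ?_))
  rw [h1, zero_apply]

/-- The horizon is not degenerate. -/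
theorem fderiv_neg_det_pos {n : V} (hn : ℓ n = 1) :
    0 < fderiv ℝ (fun z => -(gram (B z) (K z)).det) z₀ n := by
  have hne : fderiv ℝ (fun z => -(gram (B z) (K z)).det) z₀ n ≠ 0 := by
    obtain ⟨e, he⟩ := (h.isLorentz z₀ hz₀).exists_equiv
    have hq : ContDiffAt ℝ ∞ (fun z => (B z).inverse) z₀ := by
      have h1 : ContDiffAt ℝ ∞ ContinuousLinearMap.inverse (B z₀) := by
        rw [← he]; exact contDiffAt_map_inverse e
      exact ContDiffAt.comp z₀ h1 (h.contDiffAt_metric z₀ hz₀)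
    have hqe : ∀ z ∈ U, ∀ α, B z ((B z).inverse α) = α := by
      intro z hz α
      obtain ⟨e, he⟩ := (h.isLorentz z hz).exists_equiv
      rw [← he, ContinuousLinearMap.inverse_equiv]
      exact e.apply_symm_apply α
    -- On the horizon the metric identifies `ℓ` with a multiple of the null generator, which is
    -- tangent to the horizon. So the inverse metric gives `ℓ` norm zero there, and a norm of order
    -- `ℓ z` nearby.
    obtain ⟨C₁, hC₁, hev₁⟩ := exists_norm_le_of_eq_zero_on_hyperplane h.normal_ne_zero hℓ
      (F := fun z => ℓ ((B z).inverse ℓ))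
      ((contDiffAt_const.clm_apply (hq.clm_apply contDiffAt_const)).of_le (by simp)) (by
        filter_upwards [h.isOpen.mem_nhds hz₀] with z hz hzℓ
        obtain ⟨c, hc⟩ : ∃ c, c = B z (K z ((gram (B z) (K z)).adjugate *ᵥ w)) n := ⟨_, rfl⟩
        have h1 := h.form_eq_smul hz hzℓ hn
        have h2 := h.form_normal_ne_zero hz hzℓ hn
        rw [← hc] at h1 h2
        have h3 : ∀ α, B z α = ℓ → ℓ α = 0 := by
          intro α hα
          have h4 : c • α = K z ((gram (B z) (K z)).adjugate *ᵥ w) := by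
            refine sub_eq_zero.1 ((h.isLorentz z hz).nondegenerate fun v => ?_)
            rw [map_sub, map_smul, hα, h1, sub_self, zero_apply]
          have h5 : ℓ (K z ((gram (B z) (K z)).adjugate *ᵥ w)) = 0 := by
            have h6 := h.form_self hz hzℓ w ((gram (B z) (K z)).adjugate *ᵥ w)
            rw [h1, smul_apply, smul_eq_mul] at h6
            exact (mul_eq_zero.1 h6).resolve_left h2
          rw [← h4, map_smul, smul_eq_mul] at h5
          exact (mul_eq_zero.1 h5).resolve_left h2
        exact h3 _ (hqe z hz ℓ))
    obtain ⟨Cr, hCr⟩ := h.radial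
    obtain ⟨β, hβ⟩ : ∃ β, β = ‖(B z₀).inverse‖ + 1 := ⟨_, rfl⟩
    refine fderiv_normal_ne_zero (f := fun z => -(gram (B z) (K z)).det)
      (q := fun z => (B z).inverse) (C := max β C₁) (c₀ := 1 / max Cr 1) hℓ hn
      ((h.contDiffAt_neg_det hz₀).of_le (by norm_cast)) (h.eventually_neg_det_eq_zero hz₀) ?_
      (by positivity) ?_
    · filter_upwards [h.isOpen.mem_nhds hz₀] with z hz hzℓ
      linarith [h.det_neg z hz hzℓ]
    · filter_upwards [h.isOpen.mem_nhds hz₀, hev₁,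
        Metric.continuousAt_iff'.1 hq.continuousAt 1 one_pos] with z hz h1 h2 hzℓ
      refine ⟨?_, ?_, ?_⟩
      · rw [dist_eq_norm] at h2
        have := ContinuousLinearMap.opNorm_add_le (f := (B z).inverse - (B z₀).inverse)
          (g := (B z₀).inverse)
        rw [sub_add_cancel] at this
        exact (this.trans (by linarith)).trans (le_max_left _ _)
      · rw [abs_of_pos hzℓ] at h1
        exact ((le_abs_self _).trans h1).trans
          (mul_le_mul_of_nonneg_right (le_max_right _ _) hzℓ.le)
      · obtain ⟨v, hv1, hv2⟩ := hCr z hz hzℓ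
        obtain ⟨dr, hdr⟩ : ∃ dr, dr = fderiv ℝ (fun y => √(-(gram (B y) (K y)).det)) z := ⟨_, rfl⟩
        rw [← hdr] at hv1 ⊢
        obtain ⟨p, hp⟩ : ∃ p, p = (B z).inverse dr := ⟨_, rfl⟩
        have hBp : B z p = dr := hp ▸ hqe z hz dr
        have hdet := h.det_neg z hz hzℓ
        have hB := h.isLorentz z hz
        -- `p` is the gradient of `r`, orthogonal to the orbits by invariance. Cauchy-Schwarz with a
        -- vector on which `dr` is one turns the upper bound on `g_rr` into a lower bound on the
        -- norm of `dr`.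
        have h3 := sq_le_mul_gramTilde hB hdet (h.adjugate_pos z hz) (p := p)
          (fun a => by rw [hBp, hdr]; exact h.invariant z hz hzℓ a) v
        have h4 := gramTilde_nonneg hB hdet (h.adjugate_pos z hz) v
        rw [hBp, hv1] at h3
        rw [← hp, div_le_iff₀ (by positivity)]
        have h5 : gramTilde (B z) (K z) v ≤ max Cr 1 := hv2.trans (le_max_left _ _)
        have h6 : 0 ≤ dr p := by
          by_contra! hneg
          nlinarith
        nlinarith
  refine lt_of_le_of_ne ?_ hne.symm
  have hd := ((h.contDiffAt_neg_det hz₀).differentiableAt (by simp)).hasFDerivAt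
  have h1 : HasDerivAt (fun t : ℝ => z₀ + t • n) n 0 := by
    simpa using ((hasDerivAt_id (0 : ℝ)).smul_const n).const_add z₀
  have h2 : HasFDerivAt (fun z => -(gram (B z) (K z)).det)
      (fderiv ℝ (fun z => -(gram (B z) (K z)).det) z₀) (z₀ + (0 : ℝ) • n) := by
    rw [zero_smul, add_zero]; exact hd
  have h3 := h2.comp_hasDerivAt (0 : ℝ) h1
  have h4 := h3.tendsto_slope_zero_right
  refine ge_of_tendsto h4 ?_
  have hc : Tendsto (fun t : ℝ => z₀ + (0 + t) • n) (𝓝[>] 0) (𝓝 z₀) :=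
    (Continuous.tendsto' (by fun_prop) _ _ (by simp)).mono_left nhdsWithin_le_nhds
  filter_upwards [hc.eventually (h.isOpen.mem_nhds hz₀), self_mem_nhdsWithin] with t ht ht0
  have ht0' : 0 < t := ht0
  have h5 := h.det_neg _ ht (by rw [map_add, hℓ, map_smul, hn]; simpa using ht0')
  simp only [Function.comp, zero_smul, add_zero, h.det_eq_zero z₀ hz₀ hℓ, neg_zero, sub_zero,
    smul_eq_mul]
  have : 0 < t⁻¹ := inv_pos.2 ht0'
  nlinarith

/-- The depth of the horizon is comparable to `-det G`. -/
theorem exists_mul_le_neg_det : ∃ c > 0, ∀ᶠ z in 𝓝 z₀, 0 ≤ ℓ z →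
    c * ℓ z ≤ -(gram (B z) (K z)).det := by
  obtain ⟨n, hn⟩ : ∃ n, ℓ n = 1 := by
    obtain ⟨v, hv⟩ := DFunLike.ne_iff.1 h.normal_ne_zero
    exact ⟨(ℓ v)⁻¹ • v, by rw [map_smul, smul_eq_mul]; exact inv_mul_cancel₀ hv⟩
  have hpos := h.fderiv_neg_det_pos hz₀ hℓ hn
  have hfd : ContinuousAt (fun z => fderiv ℝ (fun z => -(gram (B z) (K z)).det) z n) z₀ :=
    (((h.contDiffAt_neg_det hz₀).fderiv_right (m := 0) (by simp)).clm_apply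
      contDiffAt_const).continuousAt
  have e1 := hfd.eventually (lt_mem_nhds (half_lt_self hpos))
  obtain ⟨δ, hδ, hball⟩ := Metric.eventually_nhds_iff_ball.1 (e1.and (h.isOpen.mem_nhds hz₀))
  have hproj : Tendsto (fun z => z - ℓ z • n) (𝓝 z₀) (𝓝 z₀) := by
    have : ContinuousAt (fun z => z - ℓ z • n) z₀ := by fun_prop
    simpa [ContinuousAt, hℓ] using this
  refine ⟨_, half_pos hpos, ?_⟩
  filter_upwards [Metric.ball_mem_nhds z₀ hδ, hproj (Metric.ball_mem_nhds z₀ hδ)] with z hz hz' hzℓ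
  have hseg : ∀ s ∈ Icc 0 (ℓ z), (z - ℓ z • n) + s • n ∈ Metric.ball z₀ δ := by
    intro s hs
    rcases hzℓ.eq_or_lt with h0 | h0
    · have : s = 0 := le_antisymm (h0 ▸ hs.2) hs.1
      simpa [this] using hz'
    · have h1 := (convex_ball z₀ δ) hz' hz (a := 1 - s / ℓ z) (b := s / ℓ z)
        (by rw [sub_nonneg, div_le_one h0]; exact hs.2) (div_nonneg hs.1 h0.le) (by ring)
      convert! h1 using 1
      rw [sub_smul, one_smul, smul_sub, smul_smul, div_mul_cancel₀ _ h0.ne']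
      module
  have h1 := mul_le_sub_of_le_fderiv (Y := fun z => -(gram (B z) (K z)).det)
    (p := z - ℓ z • n) (e := n) hzℓ
    (fun s hs => (h.contDiffAt_neg_det (hball _ (hseg s hs)).2).differentiableAt (by simp))
    (fun s hs => (hball _ (hseg s hs)).1.le)
  rw [zero_smul, add_zero, sub_add_cancel, sub_zero,
    h.det_eq_zero (z - ℓ z • n) (hball _ hz').2 (by simp [hn])] at h1
  linarith

omit hℓ in
theorem contDiffAt_line {F : V → ℝ} (hF : ContDiffAt ℝ ∞ F z₀) (n : V) :
    ContDiffAt ℝ ∞ (fun t : ℝ => F (z₀ + t • n)) 0 := by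
  have h1 : ContDiffAt ℝ ∞ F (z₀ + (0 : ℝ) • n) := by rwa [zero_smul, add_zero]
  exact ContDiffAt.comp (f := fun t : ℝ => z₀ + t • n) (0 : ℝ) h1 (by fun_prop)

/-- With `k` the quotient of `θ 0` by the derivative of `f`, the numerator `t * θ t - k * f t`
vanishes to second order at `0`. The denominator `t * f t` is at least of order `t ^ 2` because the
horizon is not degenerate. -/
theorem exists_normal_asymptotic {n : V} (hn : ℓ n = 1) (a : ι → ℝ) :
    ∃ C, ∀ᶠ t in 𝓝[>] (0 : ℝ),
      |B (z₀ + t • n) (K (z₀ + t • n)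
          ((gram (B (z₀ + t • n)) (K (z₀ + t • n))).adjugate *ᵥ a)) n /
          -(gram (B (z₀ + t • n)) (K (z₀ + t • n))).det -
        B z₀ (K z₀ ((gram (B z₀) (K z₀)).adjugate *ᵥ a)) n /
          fderiv ℝ (fun z => -(gram (B z) (K z)).det) z₀ n / t| ≤ C := by
  obtain ⟨θ, hθ⟩ : ∃ θ, θ = fun t : ℝ => B (z₀ + t • n) (K (z₀ + t • n)
    ((gram (B (z₀ + t • n)) (K (z₀ + t • n))).adjugate *ᵥ a)) n := ⟨_, rfl⟩
  obtain ⟨f, hf⟩ : ∃ f, f = fun t : ℝ => -(gram (B (z₀ + t • n)) (K (z₀ + t • n))).det := ⟨_, rfl⟩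
  obtain ⟨f', hf'⟩ : ∃ f', f' = fderiv ℝ (fun z => -(gram (B z) (K z)).det) z₀ n := ⟨_, rfl⟩
  have hθs : ContDiffAt ℝ ∞ θ 0 := by
    rw [hθ]
    exact h.contDiffAt_line hz₀ ((h.contDiffAt_form hz₀ a).clm_apply contDiffAt_const) n
  have hfs : ContDiffAt ℝ ∞ f 0 := by
    rw [hf]
    exact h.contDiffAt_line hz₀ (h.contDiffAt_neg_det hz₀) n
  have hθ0 : θ 0 = B z₀ (K z₀ ((gram (B z₀) (K z₀)).adjugate *ᵥ a)) n := by simp [hθ]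
  have hf0 : f 0 = 0 := by simp [hf, h.det_eq_zero z₀ hz₀ hℓ]
  have hf'0 : 0 < f' := hf' ▸ h.fderiv_neg_det_pos hz₀ hℓ hn
  have hfd : HasDerivAt f f' 0 := by
    have h1 : HasDerivAt (fun t : ℝ => z₀ + t • n) n 0 := by
      simpa using ((hasDerivAt_id (0 : ℝ)).smul_const n).const_add z₀
    have h2 : HasFDerivAt (fun z => -(gram (B z) (K z)).det)
        (fderiv ℝ (fun z => -(gram (B z) (K z)).det) z₀) (z₀ + (0 : ℝ) • n) := by
      rw [zero_smul, add_zero]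
      exact ((h.contDiffAt_neg_det hz₀).differentiableAt (by simp)).hasFDerivAt
    rw [hf, hf']
    exact h2.comp_hasDerivAt (0 : ℝ) h1
  obtain ⟨k, hk⟩ : ∃ k, k = θ 0 / f' := ⟨_, rfl⟩
  obtain ⟨C, hC, hev⟩ := exists_abs_le_sq (h := fun t => t * θ t - k * f t)
    (((contDiffAt_id.mul hθs).sub (contDiffAt_const.mul hfs)).of_le (by norm_cast))
    (by simp [hf0]) (by
      have h1 := ((hasDerivAt_id (0 : ℝ)).mul (hθs.differentiableAt (by simp)).hasDerivAt).sub
        (hfd.const_mul k)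
      refine h1.deriv.trans ?_
      simp only [id, one_mul, zero_mul, add_zero, hk]
      field_simp
      ring)
  obtain ⟨c, hc, hlow⟩ := h.exists_mul_le_neg_det hz₀ hℓ
  have hline : Tendsto (fun t : ℝ => z₀ + t • n) (𝓝 0) (𝓝 z₀) :=
    Continuous.tendsto' (by fun_prop) _ _ (by simp)
  refine ⟨C / c, ?_⟩
  filter_upwards [nhdsWithin_le_nhds hev, nhdsWithin_le_nhds (hline.eventually hlow),
    self_mem_nhdsWithin] with t h1 h2 ht
  have ht0 : 0 < t := ht
  have e1 : ℓ (z₀ + t • n) = t := by rw [map_add, hℓ, map_smul, hn]; simp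
  rw [e1] at h2
  have h3 : c * t ≤ f t := by rw [hf]; exact h2 ht0.le
  have hft : 0 < f t := lt_of_lt_of_le (by positivity) h3
  have e2 : θ t / f t - k / t = (t * θ t - k * f t) / (t * f t) := by field_simp
  have e3 : |θ t / f t - k / t| ≤ C / c := by
    rw [e2, abs_div, abs_of_pos (mul_pos ht0 hft), div_le_div_iff₀ (mul_pos ht0 hft) hc]
    have h4 : C * (c * t) ≤ C * f t := mul_le_mul_of_nonneg_left h3 hC
    nlinarith
  rw [hk, hθ0] at e3
  rw [← hf']
  simpa only [hθ, hf] using e3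

omit hz₀ hℓ in
/-- The surface gravity is constant: on a connected horizon, the normal null Killing vector
fields are proportional to one another. -/
theorem form_div_eq {z₁ : V} (hz₀ : z₀ ∈ U) (hℓ : ℓ z₀ = 0) (hz₁ : z₁ ∈ U) (hℓ₁ : ℓ z₁ = 0)
    {n : V} (hn : ℓ n = 1) (a : ι → ℝ) :
    B z₀ (K z₀ ((gram (B z₀) (K z₀)).adjugate *ᵥ a)) n /
        fderiv ℝ (fun z => -(gram (B z) (K z)).det) z₀ n =
      B z₁ (K z₁ ((gram (B z₁) (K z₁)).adjugate *ᵥ a)) n /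
        fderiv ℝ (fun z => -(gram (B z) (K z)).det) z₁ n := by
  obtain ⟨d, hd⟩ : ∃ d, d = z₁ - z₀ := ⟨_, rfl⟩
  have hℓd : ℓ d = 0 := by rw [hd, map_sub, hℓ, hℓ₁, sub_zero]
  have hℓs : ∀ t s : ℝ, ℓ (z₀ + t • n + s • d) = t := fun t s => by
    simp [hℓ, hn, hℓd]
  have hseg : ∀ s ∈ Icc (0 : ℝ) 1, z₀ + s • d ∈ U ∧ ℓ (z₀ + s • d) = 0 := by
    intro s hs
    refine ⟨?_, by simp [hℓ, hℓd]⟩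
    have h1 := h.convex hz₀ hz₁ (a := 1 - s) (b := s) (by linarith [hs.2]) hs.1 (by ring)
    rw [hd]
    convert! h1 using 1
    module
  have htan : ∀ b : ι → ℝ, ∀ z ∈ U, ℓ z = 0 → ∃ C, 0 ≤ C ∧ ∀ᶠ y in 𝓝 z,
      ‖B y (K y ((gram (B y) (K y)).adjugate *ᵥ b)) d‖ ≤ C * |ℓ y| := fun b z hz hzℓ =>
    exists_norm_le_of_eq_zero_on_hyperplane h.normal_ne_zero hzℓ
      (((h.contDiffAt_form hz b).clm_apply contDiffAt_const).of_le (by simp)) (by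
        filter_upwards [h.isOpen.mem_nhds hz] with y hy hyℓ
        exact h.form_eq_zero hy hyℓ hℓd b)
  -- The estimates for the logarithmic comparison, with one constant for a whole strip along the
  -- segment from `z₀` to `z₁`.
  obtain ⟨C₁, hC₁⟩ := exists_uniform_strip (p := z₀) (d := d) (n := n)
    (P := fun C z => 0 < C ∧ (0 < ℓ z → (DifferentiableAt ℝ (fun z => ∑ i, a i * X i z) z ∧
      ∀ v, |fderiv ℝ (fun z => ∑ i, a i * X i z) z v
          + B z (K z ((gram (B z) (K z)).adjugate *ᵥ a)) v / -(gram (B z) (K z)).det|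
        ≤ C * (‖v‖ + |B z (K z ((gram (B z) (K z)).adjugate *ᵥ w)) v| /
          √(-(gram (B z) (K z)).det))) ∧
      |B z (K z ((gram (B z) (K z)).adjugate *ᵥ a)) d| ≤ C * ℓ z ∧
      |B z (K z ((gram (B z) (K z)).adjugate *ᵥ w)) d| ≤ C * ℓ z ∧
      ℓ z ≤ C * -(gram (B z) (K z)).det)) (by
    rintro C C' z hCC ⟨h0, h1⟩
    refine ⟨h0.trans_le hCC, fun hz => ?_⟩
    obtain ⟨⟨h2, h3⟩, h4, h5, h6⟩ := h1 hz
    have hf : 0 < -(gram (B z) (K z)).det := pos_of_mul_pos_right (hz.trans_le h6) h0.le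
    refine ⟨⟨h2, fun v => (h3 v).trans ?_⟩, h4.trans ?_, h5.trans ?_, h6.trans ?_⟩
    all_goals exact mul_le_mul_of_nonneg_right hCC (by positivity)) (by
    intro s hs
    obtain ⟨hU, hsℓ⟩ := hseg s hs
    obtain ⟨A₁, hA₁, ev₁⟩ := h.exists_abs_fderiv_add_le hU a
    obtain ⟨A₂, hA₂, ev₂⟩ := htan a _ hU hsℓ
    obtain ⟨A₃, hA₃, ev₃⟩ := htan w _ hU hsℓ
    obtain ⟨c, hc, ev₄⟩ := h.exists_mul_le_neg_det hU hsℓ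
    have hci : 0 < c⁻¹ := inv_pos.2 hc
    refine ⟨A₁ + A₂ + A₃ + c⁻¹, ?_⟩
    filter_upwards [ev₁, ev₂, ev₃, ev₄] with z h1 h2 h3 h4
    refine ⟨by positivity, fun hz => ?_⟩
    rw [abs_of_pos hz] at h2 h3
    have h5 := h4 hz.le
    have hf : 0 < -(gram (B z) (K z)).det := lt_of_lt_of_le (by positivity) h5
    refine ⟨⟨(h1 hz).1, fun v => ((h1 hz).2 v).trans ?_⟩, h2.trans ?_, h3.trans ?_, ?_⟩
    · exact mul_le_mul_of_nonneg_right (by linarith) (by positivity)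
    · exact mul_le_mul_of_nonneg_right (by linarith) (by positivity)
    · exact mul_le_mul_of_nonneg_right (by linarith) (by positivity)
    · have h6 : ℓ z ≤ c⁻¹ * -(gram (B z) (K z)).det := by
        rw [inv_mul_eq_div, le_div_iff₀ hc]; linarith
      exact h6.trans (mul_le_mul_of_nonneg_right (by linarith) hf.le))
  have hbd : ∀ z ∈ U, ∃ C, ∀ᶠ t in 𝓝[>] (0 : ℝ), |B (z + t • n) (K (z + t • n)
      ((gram (B (z + t • n)) (K (z + t • n))).adjugate *ᵥ w)) n| ≤ C := by
    intro z hz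
    have h1 := (h.contDiffAt_line hz ((h.contDiffAt_form hz w).clm_apply
      (contDiffAt_const (c := n))) n).continuousAt.abs
    exact ⟨_, ((h1.eventually (gt_mem_nhds (lt_add_one _))).filter_mono nhdsWithin_le_nhds).mono
      fun t ht => ht.le⟩
  obtain ⟨C₂, hC₂⟩ := hbd z₀ hz₀
  obtain ⟨C₃, hC₃⟩ := hbd z₁ hz₁
  obtain ⟨C₄, hC₄⟩ := h.exists_normal_asymptotic hz₀ hℓ hn a
  obtain ⟨C₅, hC₅⟩ := h.exists_normal_asymptotic hz₁ hℓ₁ hn a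
  have hall := (hC₁.filter_mono (nhdsWithin_le_nhds (s := Ioi 0))).and
    (hC₂.and (hC₃.and (hC₄.and hC₅)))
  obtain ⟨ε, hε, hsub⟩ := mem_nhdsGT_iff_exists_Ioc_subset.1 hall
  have hε0 : 0 < ε := hε
  have hC₁0 : 0 < C₁ := ((hsub ⟨hε0, le_rfl⟩).1 0 ⟨le_rfl, zero_le_one⟩).1
  obtain ⟨C, hCe⟩ : ∃ C, C = max C₁ (max (max C₂ C₃) (max C₄ C₅)) := ⟨_, rfl⟩
  have g1 : C₁ ≤ C := hCe ▸ le_max_left _ _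
  have g2 : C₂ ≤ C := hCe ▸ (le_max_left _ _).trans ((le_max_left _ _).trans (le_max_right _ _))
  have g3 : C₃ ≤ C := hCe ▸ (le_max_right _ _).trans ((le_max_left _ _).trans (le_max_right _ _))
  have g4 : C₄ ≤ C := hCe ▸ (le_max_left _ _).trans ((le_max_right _ _).trans (le_max_right _ _))
  have g5 : C₅ ≤ C := hCe ▸ (le_max_right _ _).trans ((le_max_right _ _).trans (le_max_right _ _))
  have hstrip : ∀ t ∈ Ioc 0 ε, ∀ s ∈ Icc (0 : ℝ) 1, _ := fun t ht s hs =>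
    ((hsub ht).1 s hs).2 (by rw [hℓs]; exact ht.1)
  have hC0 : 0 ≤ C := hC₁0.le.trans g1
  refine eq_of_fderiv_log_asymptotic (z₀ := z₀) (z₁ := z₁) (n := n)
    (f := fun z => -(gram (B z) (K z)).det) (X := fun z => ∑ i, a i * X i z)
    (Θ := fun z => B z (K z ((gram (B z) (K z)).adjugate *ᵥ a)))
    (ϑ := fun z => B z (K z ((gram (B z) (K z)).adjugate *ᵥ w)))
    (C := C) (c := C₁⁻¹) (ε := ε) hC0 (inv_pos.2 hC₁0) hε0 ?_ ?_ ?_ ?_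
  · intro t ht s hs
    have := (hstrip t ht s hs).2.2.2
    rw [hℓs] at this
    rw [← hd, inv_mul_eq_div, div_le_iff₀ hC₁0]
    linarith
  · intro t ht s hs
    obtain ⟨⟨h1, h2⟩, -⟩ := hstrip t ht s hs
    rw [← hd]
    exact ⟨h1, fun v => (h2 v).trans (mul_le_mul_of_nonneg_right g1 (by positivity))⟩
  · intro t ht s hs
    obtain ⟨-, h1, h2, -⟩ := hstrip t ht s hs
    rw [hℓs] at h1 h2
    rw [← hd]
    exact ⟨h1.trans (mul_le_mul_of_nonneg_right g1 ht.1.le),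
      h2.trans (mul_le_mul_of_nonneg_right g1 ht.1.le)⟩
  · intro t ht
    obtain ⟨-, h2, h3, h4, h5⟩ := hsub ht
    exact ⟨h2.trans g2, h3.trans g3, h4.trans g4, h5.trans g5⟩

omit hz₀ hℓ in
/-- The kernel of the Gram matrix is constant on the horizon. -/
theorem gram_mulVec_eq_zero_of_eq_zero {z₁ : V} (hz₀ : z₀ ∈ U) (hℓ : ℓ z₀ = 0) (hz₁ : z₁ ∈ U)
    (hℓ₁ : ℓ z₁ = 0) {b : ι → ℝ} (hb : gram (B z₀) (K z₀) *ᵥ b = 0) :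
    gram (B z₁) (K z₁) *ᵥ b = 0 := by
  obtain ⟨n, hn⟩ : ∃ n, ℓ n = 1 := by
    obtain ⟨v, hv⟩ := DFunLike.ne_iff.1 h.normal_ne_zero
    exact ⟨(ℓ v)⁻¹ • v, by rw [map_smul, smul_eq_mul]; exact inv_mul_cancel₀ hv⟩
  -- The vector whose pairings with all `a` are the quotients in `form_div_eq`, hence the same at
  -- both points. It is a nonzero element of the kernel, which is one-dimensional, so the kernels
  -- agree.
  obtain ⟨κ, hκ⟩ : ∃ κ : V → ι → ℝ, κ = fun z =>
    (fderiv ℝ (fun z => -(gram (B z) (K z)).det) z n)⁻¹ •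
      ((gram (B z) (K z)).adjugate *ᵥ gramVec (B z) (K z) n) := ⟨_, rfl⟩
  have hdot : ∀ z ∈ U, ∀ a, a ⬝ᵥ κ z = B z (K z ((gram (B z) (K z)).adjugate *ᵥ a)) n /
      fderiv ℝ (fun z => -(gram (B z) (K z)).det) z n := fun z hz a => by
    rw [h.form_apply hz, hκ]
    simp only [dotProduct_smul, smul_eq_mul]
    rw [inv_mul_eq_div]
  have heq : κ z₀ = κ z₁ := by
    funext i
    have h1 := h.form_div_eq hz₀ hℓ hz₁ hℓ₁ hn (Pi.single i 1)
    rw [← hdot z₀ hz₀, ← hdot z₁ hz₁] at h1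
    simpa using h1
  have hker : ∀ z ∈ U, ℓ z = 0 → gram (B z) (K z) *ᵥ κ z = 0 := fun z hz hzℓ => by
    rw [hκ]
    simp only [Matrix.mulVec_smul, h.mulVec_adjugate hz hzℓ, smul_zero]
  obtain ⟨c, hc⟩ := h.exists_smul_eq hz₀ hℓ hb
  obtain ⟨c', hc'⟩ := h.exists_smul_eq hz₀ hℓ (hker z₀ hz₀ hℓ)
  have hc'0 : c' ≠ 0 := by
    rintro rfl
    have h1 := hdot z₀ hz₀ w
    rw [hc', zero_smul, dotProduct_zero] at h1
    exact div_ne_zero (h.form_normal_ne_zero hz₀ hℓ hn) (h.fderiv_neg_det_pos hz₀ hℓ hn).ne' h1.symm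
  have hb' : b = (c * c'⁻¹) • κ z₁ := by
    rw [← heq, hc', hc, smul_smul, inv_mul_cancel_right₀ hc'0]
  rw [hb', Matrix.mulVec_smul, hker z₁ hz₁ hℓ₁, smul_zero]

/-- The normal Killing vector field of the horizon is time-like on the regular side. -/
theorem eventually_timelike (hw : gram (B z₀) (K z₀) *ᵥ w = 0) :
    ∀ᶠ z in 𝓝 z₀, 0 < ℓ z → w ⬝ᵥ (gram (B z) (K z) *ᵥ w) < 0 := by
  have hwz : ∀ z ∈ U, ℓ z = 0 → gram (B z) (K z) *ᵥ w = 0 := fun z hz hzℓ =>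
    h.gram_mulVec_eq_zero_of_eq_zero hz₀ hℓ hz hzℓ hw
  have hw0 : w ≠ 0 := by
    rintro rfl
    have := h.adjugate_pos z₀ hz₀
    rw [zero_dotProduct] at this
    exact lt_irrefl _ this
  have hww : 0 < w ⬝ᵥ w := by
    obtain ⟨i, hi⟩ := Function.ne_iff.1 hw0
    exact Finset.sum_pos' (fun j _ => mul_self_nonneg _) ⟨i, Finset.mem_univ _, mul_self_pos.2 hi⟩
  -- On the horizon `adj G w` is a multiple of `w`, with coefficient `lam`; nearby, both the
  -- remainder `e` and `y = G w` are `O(ℓ)`. In the identity `lam * (w ⬝ᵥ y) = det G * (w ⬝ᵥ w) - e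
  -- ⬝ᵥ y` the determinant, at most `-c * ℓ`, beats the quadratic error.
  obtain ⟨lam, hlam⟩ : ∃ lam : V → ℝ, lam = fun z =>
    (w ⬝ᵥ w)⁻¹ * (w ⬝ᵥ ((gram (B z) (K z)).adjugate *ᵥ w)) := ⟨_, rfl⟩
  have hdots : ∀ {F : V → ι → ℝ}, ContDiffAt ℝ ∞ F z₀ → ContDiffAt ℝ ∞ (fun z => w ⬝ᵥ F z) z₀ :=
    fun hF => ContDiffAt.sum fun i _ => contDiffAt_const.mul (contDiffAt_pi.1 hF i)
  have hadj := h.contDiffAt_adjugate hz₀ w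
  obtain ⟨C₁, hC₁, ev₁⟩ := exists_norm_le_of_eq_zero_on_hyperplane h.normal_ne_zero hℓ
    (F := fun z => (gram (B z) (K z)).adjugate *ᵥ w - lam z • w)
    (by
      rw [hlam]
      exact (hadj.sub ((contDiffAt_const.mul (hdots hadj)).smul contDiffAt_const)).of_le (by simp))
    (by
      filter_upwards [h.isOpen.mem_nhds hz₀] with z hz hzℓ
      obtain ⟨c, hc⟩ := h.exists_smul_eq hz hzℓ (hwz z hz hzℓ)
      have hc0 : c ≠ 0 := by
        rintro rfl
        rw [zero_smul] at hc
        exact hw0 hc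
      have h1 : (gram (B z) (K z)).adjugate *ᵥ w = c⁻¹ • w := by
        conv_rhs => rw [hc]
        rw [smul_smul, inv_mul_cancel₀ hc0, one_smul]
      simp only [hlam, h1, dotProduct_smul, smul_eq_mul]
      rw [mul_left_comm, inv_mul_cancel₀ hww.ne', mul_one, sub_self])
  obtain ⟨C₂, hC₂, ev₂⟩ := exists_norm_le_of_eq_zero_on_hyperplane h.normal_ne_zero hℓ
    (F := fun z => gram (B z) (K z) *ᵥ w)
    (by
      refine ContDiffAt.of_le (contDiffAt_pi.2 fun i => ?_) (by simp : (1 : WithTop ℕ∞) ≤ ∞)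
      exact ContDiffAt.sum fun j _ => (h.contDiffAt_gram hz₀ i j).mul contDiffAt_const)
    (by
      filter_upwards [h.isOpen.mem_nhds hz₀] with z hz hzℓ using hwz z hz hzℓ)
  obtain ⟨c, hc, ev₃⟩ := h.exists_mul_le_neg_det hz₀ hℓ
  obtain ⟨C, hC⟩ : ∃ C, C = Fintype.card ι * (C₁ * C₂) := ⟨_, rfl⟩
  have hC0 : 0 ≤ C := by rw [hC]; positivity
  have ev₄ : ∀ᶠ z in 𝓝 z₀, C * ℓ z < c * (w ⬝ᵥ w) := by
    have h1 : ContinuousAt (fun z => C * ℓ z) z₀ := by fun_prop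
    exact h1.eventually (gt_mem_nhds (by simp only [hℓ, mul_zero]; positivity))
  filter_upwards [h.isOpen.mem_nhds hz₀, ev₁, ev₂, ev₃, ev₄] with z hz h1 h2 h3 h4 hzℓ
  rw [abs_of_pos hzℓ] at h1 h2
  obtain ⟨e, he⟩ : ∃ e, e = (gram (B z) (K z)).adjugate *ᵥ w - lam z • w := ⟨_, rfl⟩
  obtain ⟨y, hy⟩ : ∃ y, y = gram (B z) (K z) *ᵥ w := ⟨_, rfl⟩
  rw [← he] at h1
  rw [← hy] at h2 ⊢
  have hey : |e ⬝ᵥ y| ≤ C * ℓ z ^ 2 := by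
    refine (Finset.abs_sum_le_sum_abs _ _).trans ((Finset.sum_le_card_nsmul _ _
      (C₁ * ℓ z * (C₂ * ℓ z)) fun i _ => ?_).trans (le_of_eq ?_))
    · rw [abs_mul]
      exact mul_le_mul ((norm_le_pi_norm e i).trans h1) ((norm_le_pi_norm y i).trans h2)
        (abs_nonneg _) (by positivity)
    · rw [nsmul_eq_mul, Finset.card_univ, hC]; ring
  have hid : lam z * (w ⬝ᵥ y) = (gram (B z) (K z)).det * (w ⬝ᵥ w) - e ⬝ᵥ y := by
    have h5 : w ⬝ᵥ (gram (B z) (K z) *ᵥ ((gram (B z) (K z)).adjugate *ᵥ w))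
        = (gram (B z) (K z)).det * (w ⬝ᵥ w) := by
      rw [Matrix.mulVec_mulVec, Matrix.mul_adjugate, Matrix.smul_mulVec, Matrix.one_mulVec,
        dotProduct_smul, smul_eq_mul]
    have h6 : e ⬝ᵥ y = w ⬝ᵥ (gram (B z) (K z) *ᵥ e) := by
      rw [hy, Matrix.dotProduct_mulVec, ← Matrix.mulVec_transpose,
        gram_transpose (h.isLorentz z hz), dotProduct_comm]
    rw [← h5, h6, he, Matrix.mulVec_sub, Matrix.mulVec_smul, dotProduct_sub, dotProduct_smul, hy,
      smul_eq_mul]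
    ring
  have hlam0 : 0 < lam z := by
    rw [hlam]
    exact mul_pos (inv_pos.2 hww) (h.adjugate_pos z hz)
  have h7 := (abs_le.1 hey).1
  have h8 := h3 hzℓ.le
  have h9 : lam z * (w ⬝ᵥ y) < 0 := by
    rw [hid]
    have h10 : c * ℓ z * (w ⬝ᵥ w) ≤ -(gram (B z) (K z)).det * (w ⬝ᵥ w) :=
      mul_le_mul_of_nonneg_right h8 hww.le
    have h11 := mul_lt_mul_of_pos_right h4 hzℓ
    nlinarith only [h7, h10, h11]
  by_contra! hcon
  exact absurd h9 (not_lt.2 (mul_nonneg hlam0.le hcon))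

end IsHorizonModel

end Horizon

end DomainStructure

/-! ### The horizon model at a generic boundary point -/

namespace DomainStructure

section Chart

variable {D : ℕ} {M : Type*} [TopologicalSpace M]
  [ChartedSpace (EuclideanSpace ℝ (Fin D)) M] [IsManifold (𝓡 D) ∞ M]
  {φ : OpenPartialHomeomorph M (EuclideanSpace ℝ (Fin D))}

theorem IsSmoothChart.mfderiv_eq (hφ : IsSmoothChart φ) {y : M} (hy : y ∈ φ.source) {u : M → ℝ}
    (hu : DifferentiableAt ℝ (fun z => u (φ.symm z)) (φ y)) (v : TangentSpace (𝓡 D) y) :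
    (show ℝ from mfderiv (𝓡 D) 𝓘(ℝ, ℝ) u y v)
      = fderiv ℝ (fun z => u (φ.symm z)) (φ y) (coordDeriv φ y v) := by
  have h1 : u =ᶠ[𝓝 y] (fun z => u (φ.symm z)) ∘ φ := by
    filter_upwards [φ.open_source.mem_nhds hy] with x hx
    simp [φ.left_inv hx]
  have h2 := (hu.hasFDerivAt.hasMFDerivAt.comp y
    (hφ.mdifferentiableAt hy).hasMFDerivAt).congr_of_eventuallyEq h1
  rw [h2.mfderiv]
  rfl

theorem IsSmoothChart.differentiableAt_comp_symm (hφ : IsSmoothChart φ)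
    {z : EuclideanSpace ℝ (Fin D)} (hz : z ∈ φ.target) {u : M → ℝ}
    (hu : MDifferentiableAt (𝓡 D) 𝓘(ℝ, ℝ) u (φ.symm z)) :
    DifferentiableAt ℝ (fun z => u (φ.symm z)) z := by
  rw [← mdifferentiableAt_iff_differentiableAt]
  exact hu.comp z (hφ.mdifferentiableAt_symm hz)

end Chart

namespace IsometricAction

variable {D m : ℕ} {M : Type*} [TopologicalSpace M]
  [ChartedSpace (EuclideanSpace ℝ (Fin D)) M] [IsManifold (𝓡 D) ∞ M]
  {g : LorentzMetric D M} {Φ : IsometricAction g m} {E : Set M} {x : M}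
  {φ : OpenPartialHomeomorph M (EuclideanSpace ℝ (Fin D))}

section

variable (hφ : IsSmoothChart φ) {z : EuclideanSpace ℝ (Fin D)} (hz : z ∈ φ.target)
include hφ hz

theorem gram_coord : gram (coordMetric g φ z) (Φ.coordKilling φ z) = Φ.G (φ.symm z) := by
  ext i j
  rw [G_apply, Φ.dotProduct_G_coord hφ hz]
  rfl

theorem gramVec_coord (v : EuclideanSpace ℝ (Fin D)) (j : Fin (m + 1)) :
    gramVec (coordMetric g φ z) (Φ.coordKilling φ z) v j
      = g.val (φ.symm z) (Φ.V j (φ.symm z)) (coordFrame φ z v) := by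
  rw [V, ← Φ.coordFrame_coordKilling hφ hz]
  rfl

theorem theta_coord (v : EuclideanSpace ℝ (Fin D)) (i : Fin (m + 1)) :
    Φ.theta i (φ.symm z) (coordFrame φ z v) =
      ((gram (coordMetric g φ z) (Φ.coordKilling φ z))⁻¹ *ᵥ
        gramVec (coordMetric g φ z) (Φ.coordKilling φ z) v) i := by
  simp only [theta, Matrix.mulVec, dotProduct, gram_coord hφ hz, gramVec_coord hφ hz]

theorem gTilde_coord (v : EuclideanSpace ℝ (Fin D)) :
    Φ.gTilde (φ.symm z) (coordFrame φ z v)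
      = gramTilde (coordMetric g φ z) (Φ.coordKilling φ z) v := by
  have h0 : Φ.gTilde (φ.symm z) (coordFrame φ z v) = coordMetric g φ z v v -
      ∑ i, ∑ j, Φ.G (φ.symm z) i j * Φ.theta i (φ.symm z) (coordFrame φ z v) *
        Φ.theta j (φ.symm z) (coordFrame φ z v) := rfl
  rw [h0, gramTilde]
  simp only [theta_coord hφ hz]
  generalize (gram (coordMetric g φ z) (Φ.coordKilling φ z))⁻¹ *ᵥ
    gramVec (coordMetric g φ z) (Φ.coordKilling φ z) v = t
  congr 1
  rw [gram_coord hφ hz]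
  simp only [dotProduct, Matrix.mulVec, Finset.mul_sum]
  refine Finset.sum_congr rfl fun i _ => Finset.sum_congr rfl fun j _ => ?_
  ring

theorem contDiffAt_det_coord :
    ContDiffAt ℝ ∞ (fun w => (gram (coordMetric g φ w) (Φ.coordKilling φ w)).det) z := by
  have h1 := hφ.contDiffAt_coordMetric (g := g) hz
  have h2 := Φ.contDiffAt_coordKilling hφ hz
  exact contDiffAt_det fun i j =>
    (h1.clm_apply (h2.clm_apply contDiffAt_const)).clm_apply (h2.clm_apply contDiffAt_const)

theorem fderiv_sqrt_det_coordKilling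
    (hdet : (gram (coordMetric g φ z) (Φ.coordKilling φ z)).det < 0) (a : Fin (m + 1) → ℝ) :
    fderiv ℝ (fun w => √(-(gram (coordMetric g φ w) (Φ.coordKilling φ w)).det)) z
      (Φ.coordKilling φ z a) = 0 := by
  have h1 : DifferentiableAt ℝ
      (fun w => √(-(gram (coordMetric g φ w) (Φ.coordKilling φ w)).det)) z :=
    (((contDiffAt_det_coord hφ hz).differentiableAt (by simp)).neg).sqrt (neg_ne_zero.2 hdet.ne)
  have h2 := Φ.hasFDerivAt_coordFlow_time hφ hz
  have h3 : HasFDerivAt (fun w => √(-(gram (coordMetric g φ w) (Φ.coordKilling φ w)).det))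
      (fderiv ℝ (fun w => √(-(gram (coordMetric g φ w) (Φ.coordKilling φ w)).det)) z)
      (Φ.coordFlow φ 0 z) := by
    rw [Φ.coordFlow_zero hz]; exact h1.hasFDerivAt
  have h4 := h3.comp (0 : Fin (m + 1) → ℝ) h2
  have h5 : ((fun w => √(-(gram (coordMetric g φ w) (Φ.coordKilling φ w)).det)) ∘
      fun s => Φ.coordFlow φ s z) =ᶠ[𝓝 0]
      fun _ => √(-(gram (coordMetric g φ z) (Φ.coordKilling φ z)).det) := by
    have hc : Tendsto (fun s : Fin (m + 1) → ℝ => (s, z)) (𝓝 0) (𝓝 (0, z)) :=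
      Continuous.tendsto' (by fun_prop) _ _ rfl
    filter_upwards [hc.eventually (Φ.isOpen_coordFlowDomain.mem_nhds
      (Φ.mem_coordFlowDomain_zero hz))] with s hs
    simp only [Function.comp]
    rw [gram_coord hφ (Φ.coordFlow_mem_target hs), gram_coord hφ hz, Φ.symm_coordFlow hs, Φ.G_flow]
  have h6 := h4.unique ((hasFDerivAt_const _ _).congr_of_eventuallyEq h5)
  exact DFunLike.congr_fun h6 a

end

variable [T2Space M]

/-- The isotropy groups near the generic points of the boundary are discrete. -/
theorem IsExterior.isotropy_eq_bot (hE : Φ.IsExterior E) (hproper : Φ.IsProper E)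
    (hb : HasSmoothBoundary (D := D) E) (hx : x ∈ frontier E)
    (hdim : Module.finrank ℝ (LinearMap.ker (Φ.G x).mulVecLin) < 2) :
    Φ.isotropy x = ⊥ ∧ ∃ w, Φ.G x *ᵥ w = 0 ∧ w ≠ 0 ∧ ∀ b, Φ.G x *ᵥ b = 0 → ∃ c : ℝ, b = c • w := by
  obtain ⟨φ, ℓ, A, X, hL⟩ := hE.exists_isLinearModel hproper hb (frontier_subset_closure hx)
  obtain ⟨w, hw, hkw⟩ := hL.exists_mulVec_eq_zero hE hx
  have hw0 : w ≠ 0 := by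
    rintro rfl
    apply hkw
    rw [← killingₗ_apply, map_zero]
  have hspan : ∀ b, Φ.G x *ᵥ b = 0 → ∃ c : ℝ, b = c • w := by
    intro b hb
    have h1 : Module.finrank ℝ (LinearMap.ker (Φ.G x).mulVecLin) = 1 := by
      refine le_antisymm (by omega) (Nat.one_le_iff_ne_zero.2 fun h0 => ?_)
      rw [Submodule.finrank_eq_zero] at h0
      have h2 : w ∈ LinearMap.ker (Φ.G x).mulVecLin := hw
      rw [h0] at h2
      exact hw0 ((Submodule.mem_bot ℝ).1 h2)
    obtain ⟨c, hc⟩ := (finrank_eq_one_iff_of_nonzero'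
      (⟨w, hw⟩ : LinearMap.ker (Φ.G x).mulVecLin) (by
        intro h; exact hw0 (congrArg Subtype.val h))).1 h1 ⟨b, hb⟩
    exact ⟨c, (congrArg Subtype.val hc).symm⟩
  refine ⟨(Submodule.eq_bot_iff _).2 fun a ha => ?_, w, hw, hw0, hspan⟩
  have ha' : Φ.killing a x = 0 := mem_isotropy.1 ha
  obtain ⟨c, rfl⟩ := hspan a (Φ.G_mulVec_eq_zero_of_killing ha')
  rw [Φ.killing_smul] at ha'
  rw [(smul_eq_zero.1 ha').resolve_right hkw, zero_smul]

/-- With `w` spanning the kernel at `x`, the sum of `G` and `w wᵀ` is positive definite near `x`. So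
`G` has at most one negative direction, and as it has one in `E`, its determinant is negative there.
The gauge and radial bounds are the regularity assumption read in coordinates. -/
theorem IsExterior.exists_isHorizonModel (hE : Φ.IsExterior E) (hproper : Φ.IsProper E)
    (hb : HasSmoothBoundary (D := D) E) (hreg : Φ.RegularAtBoundary E) (hx : x ∈ frontier E)
    (hdim : Module.finrank ℝ (LinearMap.ker (Φ.G x).mulVecLin) < 2)
    {ℓ : EuclideanSpace ℝ (Fin D) →L[ℝ] ℝ} (hφ : IsFlatChart φ ℓ E) (hxφ : x ∈ φ.source) :
    ∃ U w X, IsHorizonModel U ℓ (coordMetric g φ) (Φ.coordKilling φ) w X ∧ φ x ∈ U ∧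
      U ⊆ φ.target ∧ Φ.G x *ᵥ w = 0 := by
  obtain ⟨hiso, w, hw, hw0, hspan⟩ := hE.isotropy_eq_bot hproper hb hx hdim
  obtain ⟨O, hO, hxO, ⟨X, ⟨hX, -⟩, C, hC⟩, cr, Cr, hcr, hr⟩ := hreg x hx hdim
  have hH : ∀ s ∈ Φ.stabilizer x, s 0 = 0 := fun s hs =>
    hproper.apply_zero_eq_zero_of_flow (frontier_subset_closure hx) hs
  have hPx : ∀ a : Fin (m + 1) → ℝ, a ≠ 0 →
      0 < a ⬝ᵥ ((Φ.G x + Matrix.vecMulVec w w) *ᵥ a) := by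
    intro a ha
    have h1 := hE.dotProduct_G_nonneg hx a
    rw [Matrix.add_mulVec, dotProduct_add, dotProduct_vecMulVec_mulVec]
    by_contra! hcon
    have h2 := mul_self_nonneg (w ⬝ᵥ a)
    have h3 := (hE.posSemidef_G hx).dotProduct_mulVec_zero_iff a
    simp only [star_trivial] at h3
    obtain ⟨c, rfl⟩ := hspan a (h3.1 (by linarith))
    have h4 : w ⬝ᵥ (c • w) = 0 := mul_self_eq_zero.1 (by linarith)
    rw [dotProduct_smul, smul_eq_mul] at h4
    rcases mul_eq_zero.1 h4 with h5 | h5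
    · exact ha (by rw [h5, zero_smul])
    · exact hw0 (dotProduct_self_eq_zero.1 h5)
  have hPsymm : ∀ y, (Φ.G y + Matrix.vecMulVec w w).IsHermitian := fun y => by
    rw [Matrix.IsHermitian, Matrix.conjTranspose_eq_transpose_of_trivial, Matrix.transpose_add,
      Φ.G_transpose, Matrix.transpose_vecMulVec]
  have hPD : ∀ y, (∀ a : Fin (m + 1) → ℝ, a ≠ 0 →
      0 < a ⬝ᵥ ((Φ.G y + Matrix.vecMulVec w w) *ᵥ a)) →
      (Φ.G y + Matrix.vecMulVec w w).PosDef := fun y h =>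
    Matrix.PosDef.of_dotProduct_mulVec_pos (hPsymm y) fun a ha => by simpa using h a ha
  have ev₁ := eventually_forall_pos (F := fun y => Φ.G y + Matrix.vecMulVec w w)
    (Φ.continuous_G.add continuous_const).continuousAt hPx
  -- As `det G = 0` at `x`, the matrix determinant lemma identifies this number with the determinant
  -- of the positive definite matrix.
  have hadj : 0 < w ⬝ᵥ ((Φ.G x).adjugate *ᵥ w) := by
    have h1 := det_add_vecMulVec_of_posSemidef (hE.posSemidef_G hx) w w
    rw [hE.det_G_eq_zero_of_mem_frontier hx, zero_add] at h1
    rw [← h1]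
    exact (hPD x hPx).det_pos
  have ev₂ : ∀ᶠ y in 𝓝 x, 0 < w ⬝ᵥ ((Φ.G y).adjugate *ᵥ w) :=
    (continuous_const.dotProduct (Φ.continuous_G.matrix_adjugate.matrix_mulVec
      continuous_const)).continuousAt.eventually (lt_mem_nhds hadj)
  have ev₃ := eventually_isotropy_le hH
  have hev := (φ.tendsto_symm hxφ).eventually (ev₁.and (ev₂.and (ev₃.and (hO.mem_nhds hxO))))
  obtain ⟨δ, hδ, hball⟩ := Metric.eventually_nhds_iff_ball.1
    (hev.and (φ.open_target.mem_nhds (φ.map_source hxφ)))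
  have hsm := hφ.smoothChart
  have ht : ∀ z ∈ Metric.ball (φ x) δ, z ∈ φ.target := fun z hz => (hball z hz).2
  have hEiff : ∀ z ∈ Metric.ball (φ x) δ, 0 < ℓ z → φ.symm z ∈ E := fun z hz hzℓ => by
    rw [hφ.mem_iff _ (φ.map_target (ht z hz)), φ.right_inv (ht z hz)]; exact hzℓ
  have hneg : ∀ z ∈ Metric.ball (φ x) δ, 0 < ℓ z →
      (gram (coordMetric g φ z) (Φ.coordKilling φ z)).det < 0 := fun z hz hzℓ => by
    rw [gram_coord hsm (ht z hz)]
    obtain ⟨a, ha⟩ := hE.subset (hEiff z hz hzℓ)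
    exact det_neg_of_posDef_add (hPD _ (hball z hz).1.1) ha
  have hadjz : ∀ z ∈ Metric.ball (φ x) δ,
      0 < w ⬝ᵥ ((gram (coordMetric g φ z) (Φ.coordKilling φ z)).adjugate *ᵥ w) := fun z hz => by
    rw [gram_coord hsm (ht z hz)]
    exact (hball z hz).1.2.1
  have hreg' : ∀ z ∈ Metric.ball (φ x) δ, 0 < ℓ z →
      φ.symm z ∈ O ∩ E ∧ (Φ.G (φ.symm z)).det ≠ 0 := fun z hz hzℓ => by
    refine ⟨⟨(hball z hz).1.2.2.2, hEiff z hz hzℓ⟩, ?_⟩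
    rw [← gram_coord hsm (ht z hz)]
    exact (hneg z hz hzℓ).ne
  refine ⟨Metric.ball (φ x) δ, w, fun i z => X i (φ.symm z), ?_, Metric.mem_ball_self hδ, ht, hw⟩
  constructor
  · exact Metric.isOpen_ball
  · exact convex_ball _ _
  · exact hφ.ne_zero
  · exact fun z hz => hsm.contDiffAt_coordMetric (ht z hz)
  · exact fun z hz => Φ.contDiffAt_coordKilling hsm (ht z hz)
  · exact fun z hz => hsm.isLorentz_coordMetric (ht z hz)
  · intro z hz a ha
    have h1 : a ∈ Φ.isotropy (φ.symm z) :=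
      mem_isotropy.2 ((Φ.coordKilling_eq_zero_iff hsm (ht z hz) a).1 ha)
    have h2 := (hball z hz).1.2.2.1 h1
    rw [hiso] at h2
    exact (Submodule.mem_bot ℝ).1 h2
  · intro z hz hzℓ
    rw [gram_coord hsm (ht z hz)]
    refine hE.det_G_eq_zero_of_mem_frontier
      ((hφ.mem_frontier_iff hE.isOpen (φ.map_target (ht z hz))).2 ?_)
    rw [φ.right_inv (ht z hz)]
    exact hzℓ
  · exact hneg
  · exact hadjz
  · refine ⟨max C 0, le_max_right _ _, fun z hz hzℓ i => ?_⟩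
    have hopen : IsOpen {y ∈ O ∩ E | (Φ.G y).det ≠ 0} := by
      have h1 : IsOpen {y | (Φ.G y).det ≠ 0} :=
        isOpen_ne_fun Φ.continuous_G.matrix_det continuous_const
      exact (hO.inter hE.isOpen).inter h1
    have hXd : DifferentiableAt ℝ (fun z => X i (φ.symm z)) z :=
      hsm.differentiableAt_comp_symm (ht z hz) (((hX i _ (hreg' z hz hzℓ)).contMDiffAt
        (hopen.mem_nhds (hreg' z hz hzℓ))).mdifferentiableAt (by simp))
    refine ⟨hXd, fun v => ?_⟩
    have h1 := hC _ (hreg' z hz hzℓ).1 (hreg' z hz hzℓ).2 i (coordFrame φ z v)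
    have h2 := hsm.mfderiv_eq (φ.map_target (ht z hz)) (u := X i)
      (by rw [φ.right_inv (ht z hz)]; exact hXd) (coordFrame φ z v)
    rw [φ.right_inv (ht z hz), hsm.coordDeriv_coordFrame (ht z hz)] at h2
    have h3 : Φ.gaugeField X i (φ.symm z) (coordFrame φ z v) =
        Φ.theta i (φ.symm z) (coordFrame φ z v) -
          (show ℝ from mfderiv (𝓡 D) 𝓘(ℝ, ℝ) (X i) (φ.symm z) (coordFrame φ z v)) := rfl
    rw [h3, h2, theta_coord hsm (ht z hz), gTilde_coord hsm (ht z hz)] at h1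
    refine h1.trans (mul_le_mul_of_nonneg_right (le_max_left _ _) ?_)
    exact gramTilde_nonneg (hsm.isLorentz_coordMetric (ht z hz)) (hneg z hz hzℓ) (hadjz z hz) v
  · refine ⟨Cr + 1, fun z hz hzℓ => ?_⟩
    obtain ⟨h1, h2⟩ := hr _ (hreg' z hz hzℓ).1 (hreg' z hz hzℓ).2
    have hne : {c | ∃ v : TangentSpace (𝓡 D) (φ.symm z),
        mfderiv (𝓡 D) 𝓘(ℝ, ℝ) Φ.r (φ.symm z) v = 1 ∧ c = Φ.gTilde (φ.symm z) v}.Nonempty := by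
      -- The infimum of the empty set is `0` by convention; the positive lower bound on `g_rr` rules
      -- this case out.
      by_contra hemp
      rw [not_nonempty_iff_eq_empty] at hemp
      rw [g_rr, hemp, Real.sInf_empty] at h1
      linarith
    obtain ⟨_, ⟨v, hv, rfl⟩, hlt⟩ := exists_lt_of_csInf_lt hne (lt_of_le_of_lt h2 (lt_add_one Cr))
    have hev : (fun y => √(-(gram (coordMetric g φ y) (Φ.coordKilling φ y)).det))
        =ᶠ[𝓝 z] fun y => Φ.r (φ.symm y) := by
      have hlt0 := (contDiffAt_det_coord (Φ := Φ) hsm (ht z hz)).continuousAt.eventually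
        (gt_mem_nhds (hneg z hz hzℓ))
      filter_upwards [hlt0, φ.open_target.mem_nhds (ht z hz)] with y hy hyt
      rw [r, ← gram_coord hsm hyt, abs_of_neg hy]
    have hd : DifferentiableAt ℝ
        (fun w => √(-(gram (coordMetric g φ w) (Φ.coordKilling φ w)).det)) z :=
      (((contDiffAt_det_coord hsm (ht z hz)).differentiableAt (by simp)).neg).sqrt
        (neg_ne_zero.2 (hneg z hz hzℓ).ne)
    have h3 := hsm.mfderiv_eq (φ.map_target (ht z hz)) (u := Φ.r)
      (by rw [φ.right_inv (ht z hz)]; exact hev.differentiableAt_iff.1 hd) v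
    rw [φ.right_inv (ht z hz), ← hev.fderiv_eq] at h3
    refine ⟨coordDeriv φ (φ.symm z) v, h3.symm.trans hv, ?_⟩
    have e : coordFrame φ z (coordDeriv φ (φ.symm z) v) = v :=
      hsm.coordFrame_coordDeriv' (ht z hz) v
    rw [← gTilde_coord hsm (ht z hz)]
    exact (congrArg (fun u => Φ.gTilde (φ.symm z) u) e).le.trans hlt.le
  · exact fun z hz hzℓ a => fderiv_sqrt_det_coordKilling hsm (ht z hz) (hneg z hz hzℓ) a

/-- Near a generic point of the boundary of the exterior, the kernel of `G` is constant on the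
boundary and normal to it, and it is time-like in the exterior. -/
theorem IsExterior.exists_horizon_generator (hE : Φ.IsExterior E) (hproper : Φ.IsProper E)
    (hb : HasSmoothBoundary (D := D) E) (hreg : Φ.RegularAtBoundary E)
    (hrot : Φ.RotationsNotTimelike E) (hx : x ∈ frontier E)
    (hdim : Module.finrank ℝ (LinearMap.ker (Φ.G x).mulVecLin) < 2) :
    ∃ w : Fin (m + 1) → ℝ, w 0 = 1 ∧ (∀ᶠ y in 𝓝 x, (y ∈ frontier E → Φ.G y *ᵥ w = 0) ∧
      (y ∈ E → w ⬝ᵥ (Φ.G y *ᵥ w) < 0)) ∧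
      ∀ φ ℓ, IsFlatChart (D := D) φ ℓ E → x ∈ φ.source → ∀ v, ℓ v = 0 →
        coordMetric g φ (φ x) (Φ.coordKilling φ (φ x) w) v = 0 := by
  obtain ⟨-, w₀, hw₀, -, hspan⟩ := hE.isotropy_eq_bot hproper hb hx hdim
  obtain ⟨φ, ℓ, hφ, hxφ, -⟩ := hb.exists_isFlatChart hE.isOpen hx
  obtain ⟨U, w, X, hM, hxU, hUt, hw⟩ := hE.exists_isHorizonModel hproper hb hreg hx hdim hφ hxφ
  have hsm := hφ.smoothChart
  have hxℓ : ℓ (φ x) = 0 := (hφ.mem_frontier_iff hE.isOpen hxφ).1 hx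
  have hgw : gram (coordMetric g φ (φ x)) (Φ.coordKilling φ (φ x)) *ᵥ w = 0 := by
    rw [gram_coord hsm (hUt hxU), φ.left_inv hxφ]; exact hw
  have hev : ∀ᶠ y in 𝓝 x, (y ∈ frontier E → Φ.G y *ᵥ w = 0) ∧
      (y ∈ E → w ⬝ᵥ (Φ.G y *ᵥ w) < 0) := by
    have ht : Tendsto φ (𝓝 x) (𝓝 (φ x)) := φ.continuousAt hxφ
    filter_upwards [φ.open_source.mem_nhds hxφ, ht.eventually (hM.isOpen.mem_nhds hxU),
      ht.eventually (hM.eventually_timelike hxU hxℓ hgw)] with y hy hyU h1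
    have hG := gram_coord (Φ := Φ) hsm (hUt hyU)
    rw [φ.left_inv hy] at hG
    rw [hG] at h1
    refine ⟨fun hyF => ?_, fun hyE => h1 ((hφ.mem_iff y hy).1 hyE)⟩
    rw [← hG]
    exact hM.gram_mulVec_eq_zero_of_eq_zero hxU hxℓ hyU ((hφ.mem_frontier_iff hE.isOpen hy).1 hyF)
      hgw
  -- Without a `V_(0)` component the generator would be a combination of rotations that is time-like
  -- at points of `E`.
  have hw0 : w 0 ≠ 0 := by
    obtain ⟨y, hy, hyE⟩ := mem_closure_iff_nhds.1 (frontier_subset_closure hx) _ hev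
    intro h0
    exact absurd (hrot y hyE w h0) (not_le.2 (hy.2 hyE))
  refine ⟨(w 0)⁻¹ • w, by simp [hw0], ?_, ?_⟩
  · filter_upwards [hev] with y hy
    refine ⟨fun h => by rw [Matrix.mulVec_smul, hy.1 h, smul_zero], fun h => ?_⟩
    have h1 := hy.2 h
    rw [Matrix.mulVec_smul, dotProduct_smul, smul_dotProduct, smul_smul, smul_eq_mul]
    have : 0 < (w 0)⁻¹ * (w 0)⁻¹ := mul_self_pos.2 (inv_ne_zero hw0)
    nlinarith
  · intro φ ℓ hφ hxφ v hv
    -- Another flat chart has its own horizon model, but the kernel at `x` is one-dimensional, so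
    -- its null generator is the same up to a factor.
    obtain ⟨U, w', X, hM, hxU, hUt, hw'⟩ := hE.exists_isHorizonModel hproper hb hreg hx hdim hφ hxφ
    have hxℓ : ℓ (φ x) = 0 := (hφ.mem_frontier_iff hE.isOpen hxφ).1 hx
    have h1 : gram (coordMetric g φ (φ x)) (Φ.coordKilling φ (φ x)) *ᵥ w = 0 := by
      rw [gram_coord hφ.smoothChart (hUt hxU), φ.left_inv hxφ]; exact hw
    obtain ⟨c, hc⟩ := hM.exists_smul_eq hxU hxℓ h1
    rw [map_smul, map_smul, smul_apply, hc, map_smul, map_smul, smul_apply,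
      hM.form_eq_zero hxU hxℓ hv, smul_zero, smul_zero]

end IsometricAction

end DomainStructure

/-! ### The null generator along the whole boundary -/

namespace DomainStructure

/-- A locally constant property holds everywhere on a preconnected set or nowhere. -/
theorem forall_of_eventually_iff {Y : Type*} [TopologicalSpace Y] {T : Set Y}
    (hT : IsPreconnected T) {p : Y → Prop} (h : ∀ x ∈ T, ∀ᶠ y in 𝓝[T] x, (p y ↔ p x)) {x y : Y}
    (hx : x ∈ T) (hy : y ∈ T) (px : p x) : p y := by
  classical
  have hc : ContinuousOn (fun x => decide (p x)) T := by
    intro x hx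
    refine tendsto_const_nhds.congr' ?_
    filter_upwards [h x hx] with y hy
    simp [hy]
  simpa [px] using hT.constant hc hx hy

namespace IsometricAction

variable {D m : ℕ} {M : Type*} [TopologicalSpace M]
  [ChartedSpace (EuclideanSpace ℝ (Fin D)) M] [IsManifold (𝓡 D) ∞ M]
  {g : LorentzMetric D M} {Φ : IsometricAction g m} {E : Set M} {x : M}

variable (Φ E) in
/-- The Killing vector field `w` is null and normal to the boundary of `E` near `x`, and it is
normalized. -/
structure IsGenerator (x : M) (w : Fin (m + 1) → ℝ) : Prop where
  apply_zero : w 0 = 1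
  eventually_mulVec_eq_zero : ∀ᶠ y in 𝓝 x, y ∈ frontier E → Φ.G y *ᵥ w = 0
  eventually_normal : ∀ᶠ y in 𝓝 x, y ∈ frontier E → ∀ φ ℓ, IsFlatChart (D := D) φ ℓ E →
    y ∈ φ.source → ∀ v, ℓ v = 0 → coordMetric g φ (φ y) (Φ.coordKilling φ (φ y) w) v = 0

namespace IsGenerator

variable {w w' : Fin (m + 1) → ℝ} (h : Φ.IsGenerator E x w)
include h

theorem eventually : ∀ᶠ y in 𝓝 x, Φ.IsGenerator E y w := by
  filter_upwards [h.eventually_mulVec_eq_zero.eventually_nhds,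
    h.eventually_normal.eventually_nhds] with y h1 h2 using ⟨h.apply_zero, h1, h2⟩

theorem mulVec_eq_zero (hx : x ∈ frontier E) : Φ.G x *ᵥ w = 0 :=
  h.eventually_mulVec_eq_zero.self_of_nhds hx

end IsGenerator

theorem eq_smul_of_finrank_lt_two {w b : Fin (m + 1) → ℝ}
    (hdim : Module.finrank ℝ (LinearMap.ker (Φ.G x).mulVecLin) < 2)
    (hw : Φ.G x *ᵥ w = 0) (hw0 : w 0 = 1) (hb : Φ.G x *ᵥ b = 0) : b = b 0 • w := by
  have hne : w ≠ 0 := by rintro rfl; simp at hw0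
  have h1 : Module.finrank ℝ (LinearMap.ker (Φ.G x).mulVecLin) = 1 := by
    refine le_antisymm (by omega) (Nat.one_le_iff_ne_zero.2 fun h0 => ?_)
    rw [Submodule.finrank_eq_zero] at h0
    have h2 : w ∈ LinearMap.ker (Φ.G x).mulVecLin := hw
    rw [h0] at h2
    exact hne ((Submodule.mem_bot ℝ).1 h2)
  obtain ⟨c, hc⟩ := (finrank_eq_one_iff_of_nonzero'
    (⟨w, hw⟩ : LinearMap.ker (Φ.G x).mulVecLin) (by
      intro h; exact hne (congrArg Subtype.val h))).1 h1 ⟨b, hb⟩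
  have hc' : c • w = b := congrArg Subtype.val hc
  rw [← hc']
  simp [hw0]

variable [T2Space M]

/-- Orthogonal null vectors are dependent in Lorentzian signature. Without isotropy, this dependence
holds for the coefficient vectors too. -/
theorem IsExterior.finrank_ker_lt_two (hE : Φ.IsExterior E) (hproper : Φ.IsProper E)
    (hb : HasSmoothBoundary (D := D) E) (hx : x ∈ frontier E) (hiso : Φ.isotropy x = ⊥) :
    Module.finrank ℝ (LinearMap.ker (Φ.G x).mulVecLin) < 2 := by
  obtain ⟨φ, ℓ, A, X, hL⟩ := hE.exists_isLinearModel hproper hb (frontier_subset_closure hx)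
  obtain ⟨w, hw, hkw⟩ := hL.exists_mulVec_eq_zero hE hx
  refine Nat.lt_succ_of_le (finrank_le_one (⟨w, hw⟩ : LinearMap.ker (Φ.G x).mulVecLin) ?_)
  rintro ⟨b, hb⟩
  obtain ⟨α, β, hαβ, h0⟩ := dependent_of_G_mulVec Φ hb hw
  have h1 : α • b + β • w = 0 := by
    have h2 : α • b + β • w ∈ Φ.isotropy x := mem_isotropy.2 h0
    rw [hiso] at h2
    exact (Submodule.mem_bot ℝ).1 h2
  have hw0 : w ≠ 0 := by
    rintro rfl
    apply hkw
    rw [← killingₗ_apply, map_zero]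
  have hα : α ≠ 0 := by
    rintro rfl
    rw [zero_smul, zero_add, smul_eq_zero] at h1
    exact h1.elim (fun hβ => hαβ.elim (fun h => h rfl) fun h => h hβ) hw0
  refine ⟨-(α⁻¹ * β), Subtype.ext ?_⟩
  have h3 := congrArg (α⁻¹ • ·) h1
  simp only [smul_add, smul_smul, inv_mul_cancel₀ hα, one_smul, smul_zero] at h3
  change -(α⁻¹ * β) • w = b
  rw [neg_smul]
  exact (eq_neg_of_add_eq_zero_left h3).symm

variable {φ : OpenPartialHomeomorph M (EuclideanSpace ℝ (Fin D))}
  {ℓ : EuclideanSpace ℝ (Fin D) →L[ℝ] ℝ}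
  {A : Φ.isotropy x →ₗ[ℝ] EuclideanSpace ℝ (Fin D) →ₗ[ℝ] EuclideanSpace ℝ (Fin D)}
  {X : OpenPartialHomeomorph M (EuclideanSpace ℝ (Fin D))}

omit [T2Space M] in
theorem IsLinearModel.isotropy_eq_bot (hL : Φ.IsLinearModel E x φ ℓ A X) {y : M}
    (hy : y ∈ X.source) (h : annihilator A (X y) = ⊥) : Φ.isotropy y = ⊥ := by
  refine (Submodule.eq_bot_iff _).2 fun a ha => ?_
  obtain ⟨ha', h1⟩ := (hL.killing_iff y hy a).1 (mem_isotropy.1 ha)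
  have h2 : (⟨a, ha'⟩ : Φ.isotropy x) ∈ annihilator A (X y) := mem_annihilator.2 h1
  rw [h, Submodule.mem_bot] at h2
  exact congrArg Subtype.val h2

section Generator

variable (hE : Φ.IsExterior E) (hproper : Φ.IsProper E)
  (hb : HasSmoothBoundary (D := D) E) (heff : Φ.IsEffective E)
include hE hproper hb heff

/-- The points with discrete isotropy group are dense in the boundary. -/
theorem IsExterior.frequently_isotropy_eq_bot (hx : x ∈ frontier E) :
    ∃ᶠ y in 𝓝 x, y ∈ frontier E ∧ Φ.isotropy y = ⊥ := by
  obtain ⟨φ, ℓ, A, X, hL⟩ := hE.exists_isLinearModel hproper hb (frontier_subset_closure hx)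
  have hA := hL.isSkewFamily
  obtain ⟨u, huℓ, hu⟩ := hA.exists_mem_ker_annihilator_eq_bot
    (hL.faithful hE hproper hb heff (frontier_subset_closure hx)) hL.normal_apply
  have hxs := hL.mem_source
  have hxℓ := (hL.mem_frontier_iff x hxs).1 hx
  have hc : Tendsto (fun t : ℝ => t • u) (𝓝[≠] 0) (𝓝 (X x)) := by
    rw [hL.apply_eq_zero]
    exact (Continuous.tendsto' (by fun_prop) _ _ (by simp)).mono_left nhdsWithin_le_nhds
  have hcs : Tendsto (fun t : ℝ => X.symm (t • u)) (𝓝[≠] 0) (𝓝 x) :=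
    (X.tendsto_symm hxs).comp hc
  refine hcs.frequently (Eventually.frequently ?_)
  filter_upwards [hc.eventually (X.open_target.mem_nhds (X.map_source hxs)), self_mem_nhdsWithin]
    with t ht ht0
  have hs := X.map_target ht
  refine ⟨(hL.mem_frontier_iff _ hs).2 ⟨hxℓ.1, ?_⟩, hL.isotropy_eq_bot hs ?_⟩
  · rw [X.right_inv ht, map_smul, huℓ, smul_zero]
  · rw [X.right_inv ht]
    refine (Submodule.eq_bot_iff _).2 fun a ha => ?_
    rw [mem_annihilator, map_smul] at ha
    have : a ∈ annihilator A u := mem_annihilator.2 ((smul_eq_zero.1 ha).resolve_left ht0)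
    rw [hu] at this
    exact (Submodule.mem_bot ℝ).1 this

variable (hreg : Φ.RegularAtBoundary E) (hrot : Φ.RotationsNotTimelike E)
include hreg hrot

omit heff in
theorem IsGenerator.eventually_timelike {w : Fin (m + 1) → ℝ} (h : Φ.IsGenerator E x w)
    (hx : x ∈ frontier E) (hdim : Module.finrank ℝ (LinearMap.ker (Φ.G x).mulVecLin) < 2) :
    ∀ᶠ y in 𝓝 x, y ∈ E → w ⬝ᵥ (Φ.G y *ᵥ w) < 0 := by
  obtain ⟨w', hw', hev, -⟩ := hE.exists_horizon_generator hproper hb hreg hrot hx hdim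
  have := eq_smul_of_finrank_lt_two hdim (hev.self_of_nhds.1 hx) hw' (h.mulVec_eq_zero hx)
  rw [h.apply_zero, one_smul] at this
  rw [this]
  exact hev.mono fun y hy => hy.2

omit heff in
/-- The null direction is locally constant along the generic part of the boundary. -/
theorem IsExterior.eventually_mulVec_iff (hx : x ∈ frontier E) (hiso : Φ.isotropy x = ⊥)
    {w : Fin (m + 1) → ℝ} (hw : w 0 = 1) : ∀ᶠ y in 𝓝 x, y ∈ frontier E → Φ.isotropy y = ⊥ →
      (Φ.G y *ᵥ w = 0 ↔ Φ.G x *ᵥ w = 0) := by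
  have hdim := hE.finrank_ker_lt_two hproper hb hx hiso
  obtain ⟨w', hw', hev, -⟩ := hE.exists_horizon_generator hproper hb hreg hrot hx hdim
  have key : ∀ y ∈ frontier E, Φ.isotropy y = ⊥ → Φ.G y *ᵥ w' = 0 →
      (Φ.G y *ᵥ w = 0 ↔ w = w') := by
    intro y hy hyi hyw'
    refine ⟨fun h => ?_, fun h => h ▸ hyw'⟩
    have := eq_smul_of_finrank_lt_two (hE.finrank_ker_lt_two hproper hb hy hyi) hyw' hw' h
    rwa [hw, one_smul] at this
  filter_upwards [hev] with y hy hyF hyi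
  rw [key y hyF hyi (hy.1 hyF), key x hx hiso (hev.self_of_nhds.1 hx)]

/-- Near every point of the boundary of the exterior, the boundary is a Killing horizon of a single
Killing vector field. -/
theorem IsExterior.exists_isGenerator (hx : x ∈ frontier E) : ∃ w, Φ.IsGenerator E x w := by
  obtain ⟨φ, ℓ, A, X, hL⟩ := hE.exists_isLinearModel hproper hb (frontier_subset_closure hx)
  have hA := hL.isSkewFamily
  have hinj := hL.faithful hE hproper hb heff (frontier_subset_closure hx)
  have hxs := hL.mem_source
  have hxℓ := (hL.mem_frontier_iff x hxs).1 hx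
  obtain ⟨r, hr, htarget⟩ := hL.target_eq
  obtain ⟨u₀, hu₀ℓ, hu₀⟩ := hA.exists_mem_ker_annihilator_eq_bot hinj hL.normal_apply
  have hgen : ∀ v ∈ X.target, ℓ v = 0 → annihilator A v = ⊥ →
      X.symm v ∈ frontier E ∧ Φ.isotropy (X.symm v) = ⊥ := by
    intro v hv hvℓ hva
    have hs := X.map_target hv
    refine ⟨(hL.mem_frontier_iff _ hs).2 ⟨hxℓ.1, by rwa [X.right_inv hv]⟩,
      hL.isotropy_eq_bot hs (by rwa [X.right_inv hv])⟩
  have hsmul : ∀ (c : ℝ) v, c ≠ 0 → annihilator A v = ⊥ → annihilator A (c • v) = ⊥ := by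
    intro c v hc hv
    refine (Submodule.eq_bot_iff _).2 fun a ha => ?_
    rw [mem_annihilator, map_smul] at ha
    have : a ∈ annihilator A v := mem_annihilator.2 ((smul_eq_zero.1 ha).resolve_left hc)
    rw [hv] at this
    exact (Submodule.mem_bot ℝ).1 this
  have hshrink : ∀ v : EuclideanSpace ℝ (Fin D), ∃ c : ℝ, c ≠ 0 ∧ c • v ∈ X.target := by
    intro v
    have hc : Tendsto (fun t : ℝ => t • v) (𝓝[≠] 0) (𝓝 0) :=
      (Continuous.tendsto' (by fun_prop) _ _ (by simp)).mono_left nhdsWithin_le_nhds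
    have h0 : X.target ∈ 𝓝 (0 : EuclideanSpace ℝ (Fin D)) := by
      rw [htarget]; exact Metric.ball_mem_nhds _ hr
    obtain ⟨c, hc1, hc2⟩ := ((hc.eventually h0).and self_mem_nhdsWithin).exists
    exact ⟨c, hc2, hc1⟩
  have hconv : Convex ℝ X.target := by rw [htarget]; exact convex_ball _ _
  -- propagation of the null direction along segments of generic points
  have hsegment : ∀ v₀ ∈ X.target, ∀ v₁ ∈ X.target, ℓ v₀ = 0 → ℓ v₁ = 0 →
      (∀ s ∈ Icc (0 : ℝ) 1, annihilator A ((1 - s) • v₀ + s • v₁) = ⊥) →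
      ∀ w : Fin (m + 1) → ℝ, w 0 = 1 → Φ.G (X.symm v₀) *ᵥ w = 0 → Φ.G (X.symm v₁) *ᵥ w = 0 := by
    intro v₀ hv₀ v₁ hv₁ h₀ h₁ hann w hw0 hw
    obtain ⟨γ, hγ⟩ : ∃ γ : ℝ → M, γ = fun s => X.symm ((1 - s) • v₀ + s • v₁) := ⟨_, rfl⟩
    have hmem : ∀ s ∈ Icc (0 : ℝ) 1, (1 - s) • v₀ + s • v₁ ∈ X.target := fun s hs =>
      hconv hv₀ hv₁ (by linarith [hs.2]) hs.1 (by ring)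
    have hγc : ContinuousOn γ (Icc 0 1) := by
      rw [hγ]
      exact X.continuousOn_symm.comp (by fun_prop) hmem
    have hγg : ∀ s ∈ Icc (0 : ℝ) 1, γ s ∈ frontier E ∧ Φ.isotropy (γ s) = ⊥ := fun s hs => by
      rw [hγ]
      exact hgen _ (hmem s hs) (by simp [h₀, h₁]) (hann s hs)
    have h2 := forall_of_eventually_iff isPreconnected_Icc
      (p := fun s => Φ.G (γ s) *ᵥ w = 0) (fun s hs => by
        have h3 := hE.eventually_mulVec_iff hproper hb hreg hrot (hγg s hs).1 (hγg s hs).2 hw0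
        filter_upwards [(hγc s hs).eventually h3, self_mem_nhdsWithin] with t ht hts
        exact ht (hγg t hts).1 (hγg t hts).2)
      (left_mem_Icc.2 zero_le_one) (right_mem_Icc.2 zero_le_one) (by simpa [hγ] using hw)
    simpa [hγ] using h2
  -- the null direction at one generic point
  obtain ⟨c₀, hc₀, hc₀t⟩ := hshrink u₀
  obtain ⟨v₀, hv₀e⟩ : ∃ v, v = c₀ • u₀ := ⟨_, rfl⟩
  rw [← hv₀e] at hc₀t
  have hv₀ℓ : ℓ v₀ = 0 := by rw [hv₀e, map_smul, hu₀ℓ, smul_zero]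
  have hv₀ : annihilator A v₀ = ⊥ := hv₀e ▸ hsmul _ _ hc₀ hu₀
  obtain ⟨hF₀, hI₀⟩ := hgen v₀ hc₀t hv₀ℓ hv₀
  obtain ⟨w, hw0, hwev, -⟩ := hE.exists_horizon_generator hproper hb hreg hrot hF₀
    (hE.finrank_ker_lt_two hproper hb hF₀ hI₀)
  have hgeneric : ∀ v ∈ X.target, ℓ v = 0 → annihilator A v = ⊥ → Φ.G (X.symm v) *ᵥ w = 0 := by
    intro v hv hvℓ hva
    -- The nongeneric vectors do not separate the hyperplane: the broken line from `v₀` over `c • u`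
    -- to `v` consists of generic vectors and carries the null direction along.
    obtain ⟨u, huℓ, hu⟩ := hA.exists_generic_vertex hL.normal_apply hv₀ hva hv₀ℓ hvℓ
    obtain ⟨c, hc, hct⟩ := hshrink u
    have hcℓ : ℓ (c • u) = 0 := by rw [map_smul, huℓ, smul_zero]
    have hne : ∀ s : ℝ, 1 - s ≠ 0 ∨ s * c ≠ 0 := fun s => by
      by_cases hs : s = 0
      · left; simp [hs]
      · right; exact mul_ne_zero hs hc
    have h1 := hsegment v₀ hc₀t (c • u) hct hv₀ℓ hcℓ (fun s _ => by
      rw [smul_smul]; exact (hu _ _ (hne s)).1) w hw0 (hwev.self_of_nhds.1 hF₀)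
    refine hsegment (c • u) hct v hv hcℓ hvℓ (fun s _ => ?_) w hw0 h1
    have h2 := (hu s ((1 - s) * c) ((hne (1 - s)).imp (by simp) id)).2
    rw [smul_smul]
    exact (congrArg (annihilator A) (add_comm _ _)).trans h2
  -- generic points are dense
  have hdense : ∀ y ∈ X.source, y ∈ frontier E → ∃ᶠ y' in 𝓝 y, y' ∈ frontier E ∧
      Φ.isotropy y' = ⊥ ∧ Φ.G y' *ᵥ w = 0 := by
    intro y hy hyF
    refine ((hE.frequently_isotropy_eq_bot hproper hb heff hyF).and_eventually
      (X.open_source.mem_nhds hy)).mono ?_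
    rintro z ⟨⟨hzF, hz⟩, hzs⟩
    refine ⟨hzF, hz, ?_⟩
    have := hgeneric (X z) (X.map_source hzs) ((hL.mem_frontier_iff z hzs).1 hzF).2
      ((Submodule.eq_bot_iff _).2 fun a ha => ?_)
    · rwa [X.left_inv hzs] at this
    · have h1 : (a : Fin (m + 1) → ℝ) ∈ Φ.isotropy z :=
        mem_isotropy.2 ((hL.killing_iff z hzs a).2 ⟨a.2, mem_annihilator.1 ha⟩)
      rw [hz] at h1
      exact Subtype.ext ((Submodule.mem_bot ℝ).1 h1)
  refine ⟨w, hw0, ?_, ?_⟩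
  · filter_upwards [X.open_source.mem_nhds hxs] with y hy hyF
    have hcl : IsClosed {y | Φ.G y *ᵥ w = 0} :=
      isClosed_eq (Φ.continuous_G.matrix_mulVec continuous_const) continuous_const
    refine hcl.closure_subset (mem_closure_iff_frequently.2 ?_)
    exact (hdense y hy hyF).mono fun z hz => hz.2.2
  · filter_upwards [X.open_source.mem_nhds hxs] with y hy hyF φ ℓ hφ hyφ v hv
    have hsm := hφ.smoothChart
    have hyt := φ.map_source hyφ
    have hc : ContinuousAt (fun z => coordMetric g φ (φ z) (Φ.coordKilling φ (φ z) w) v) y := by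
      have h1 : ContinuousAt (fun z => coordMetric g φ z (Φ.coordKilling φ z w) v) (φ y) :=
        (((hsm.contDiffAt_coordMetric hyt).clm_apply ((Φ.contDiffAt_coordKilling hsm hyt).clm_apply
          contDiffAt_const)).clm_apply contDiffAt_const).continuousAt
      exact ContinuousAt.comp h1 (φ.continuousAt hyφ)
    -- Normality is a closed condition and holds at the generic points, which are dense in the
    -- boundary.
    by_contra hne
    obtain ⟨z, ⟨hzF, hzi, hzw⟩, hzne, hzφ⟩ := ((hdense y hy hyF).and_eventually
      ((hc.eventually_ne hne).and (φ.open_source.mem_nhds hyφ))).exists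
    have hdim := hE.finrank_ker_lt_two hproper hb hzF hzi
    obtain ⟨w', hw', hev, hnor⟩ := hE.exists_horizon_generator hproper hb hreg hrot hzF hdim
    have := eq_smul_of_finrank_lt_two hdim (hev.self_of_nhds.1 hzF) hw' hzw
    rw [hw0, one_smul] at this
    rw [this] at hzne
    exact hzne (hnor φ ℓ hφ hzφ v hv)

end Generator

end IsometricAction

end DomainStructure

/-! ### The orbit space and the connected components that form the domains -/

namespace DomainStructure

namespace IsometricAction

variable {D m : ℕ} {M : Type*} [TopologicalSpace M]
  [ChartedSpace (EuclideanSpace ℝ (Fin D)) M] [IsManifold (𝓡 D) ∞ M]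
  {g : LorentzMetric D M} {Φ : IsometricAction g m} {E : Set M} {x : M}

variable (Φ) in
/-- The orbit of a point of the space-time. -/
def orbit {x : M} (hx : x ∈ closure E) : Φ.OrbitSpace E :=
  Quotient.mk (Φ.orbitSetoid E) ⟨x, hx⟩

variable (Φ E) in
/-- The orbits on which all elements of `S` belong to `ker G`. -/
def kerSet (S : Set (Fin (m + 1) → ℝ)) : Set (Φ.OrbitSpace E) := {q | ∀ a ∈ S, Φ.InKer a q}

theorem exists_orbit_eq (q : Φ.OrbitSpace E) : ∃ x, ∃ hx : x ∈ closure E, Φ.orbit hx = q := by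
  obtain ⟨⟨x, hx⟩, rfl⟩ := Quotient.exists_rep q
  exact ⟨x, hx, rfl⟩

theorem inKer_orbit {a : Fin (m + 1) → ℝ} (hx : x ∈ closure E) :
    Φ.InKer a (Φ.orbit hx) ↔ Φ.G x *ᵥ a = 0 := Iff.rfl

theorem mem_B_orbit (hx : x ∈ closure E) : Φ.orbit hx ∈ Φ.B E ↔ (Φ.G x).det = 0 := Iff.rfl

theorem kerSet_singleton {a : Fin (m + 1) → ℝ} {q : Φ.OrbitSpace E} :
    q ∈ Φ.kerSet E {a} ↔ Φ.InKer a q := by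
  simp [kerSet]

theorem kerSet_span (a : Fin (m + 1) → ℝ) :
    Φ.kerSet E (ℝ ∙ a : Submodule ℝ (Fin (m + 1) → ℝ)) = Φ.kerSet E {a} := by
  ext q
  rw [kerSet_singleton]
  refine ⟨fun h => h a (Submodule.mem_span_singleton_self a), fun h b hb => ?_⟩
  obtain ⟨c, rfl⟩ := Submodule.mem_span_singleton.1 hb
  rw [InKer, Matrix.mulVec_smul, h, smul_zero]

theorem kerSet_smul {c : ℝ} (hc : c ≠ 0) (a : Fin (m + 1) → ℝ) :
    Φ.kerSet E {c • a} = Φ.kerSet E {a} := by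
  ext q
  rw [kerSet_singleton, kerSet_singleton, InKer, InKer, Matrix.mulVec_smul, smul_eq_zero]
  simp [hc]

theorem kerSet_singleton_subset_B {a : Fin (m + 1) → ℝ} (ha : a ≠ 0) : Φ.kerSet E {a} ⊆ Φ.B E := by
  intro q hq
  obtain ⟨x, hx, rfl⟩ := exists_orbit_eq q
  exact (mem_B_orbit hx).2 ((Φ.det_G_eq_zero_iff x).2 ⟨a, ha, kerSet_singleton.1 hq⟩)

/-- For `a ≠ 0` the condition of lying in `B` is automatic, and a maximal connected set through a
point is a connected component. -/
theorem isDomain_iff {S : Set (Φ.OrbitSpace E)} : Φ.IsDomain S ↔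
    ∃ x, ∃ hx : x ∈ closure E, Module.finrank ℝ (LinearMap.ker (Φ.G x).mulVecLin) < 2 ∧
      ∃ a : Fin (m + 1) → ℝ, a ≠ 0 ∧ Φ.G x *ᵥ a = 0 ∧
        S = connectedComponentIn (Φ.kerSet E {a}) (Φ.orbit hx) := by
  have key : ∀ (q : Φ.OrbitSpace E) (a : Fin (m + 1) → ℝ), a ≠ 0 → Φ.InKer a q →
      Maximal (fun T : Set (Φ.OrbitSpace E) =>
        IsConnected T ∧ q ∈ T ∧ T ⊆ Φ.B E ∧ ∀ q' ∈ T, Φ.InKer a q')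
        (connectedComponentIn (Φ.kerSet E {a}) q) := by
    intro q a ha hq
    have hq' : q ∈ Φ.kerSet E {a} := kerSet_singleton.2 hq
    have hsub := connectedComponentIn_subset (Φ.kerSet E {a}) q
    refine ⟨⟨isConnected_connectedComponentIn_iff.2 hq', mem_connectedComponentIn hq',
      hsub.trans (kerSet_singleton_subset_B ha), fun q' h => kerSet_singleton.1 (hsub h)⟩, ?_⟩
    rintro T ⟨hT, hqT, -, hTa⟩ -
    exact hT.isPreconnected.subset_connectedComponentIn hqT
      fun q' hq' => kerSet_singleton.2 (hTa q' hq')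
  constructor
  · rintro ⟨q, ⟨-, hq2⟩, a, ha, hq, hmax⟩
    obtain ⟨x, hx, rfl⟩ := exists_orbit_eq q
    refine ⟨x, hx, not_le.1 hq2, a, ha, hq, ?_⟩
    have h := key _ a ha hq
    exact subset_antisymm (hmax.prop.1.isPreconnected.subset_connectedComponentIn hmax.prop.2.1
      fun q' hq' => kerSet_singleton.2 (hmax.prop.2.2.2 q' hq'))
      (hmax.le_of_ge h.prop (hmax.prop.1.isPreconnected.subset_connectedComponentIn hmax.prop.2.1
      fun q' hq' => kerSet_singleton.2 (hmax.prop.2.2.2 q' hq')))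
  · rintro ⟨x, hx, hdim, a, ha, hxa, rfl⟩
    exact ⟨Φ.orbit hx, ⟨kerSet_singleton_subset_B ha (kerSet_singleton.2 hxa), not_le.2 hdim⟩, a, ha,
      hxa, key _ a ha hxa⟩

theorem continuous_orbit : Continuous fun y : closure E => Φ.orbit y.2 := continuous_quotient_mk'

theorem orbit_flow (hE : Φ.IsExterior E) (hx : x ∈ closure E) (s : Fin (m + 1) → ℝ) :
    Φ.orbit (hE.flow_mem_closure hx s) = Φ.orbit hx :=
  Quotient.sound (s := Φ.orbitSetoid E) ⟨-s, Φ.flow_neg_flow s x⟩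

/-- The saturation of an open set is the union of its translates under the group. -/
theorem isOpenMap_orbit (hE : Φ.IsExterior E) :
    IsOpenMap fun y : closure E => Φ.orbit y.2 := by
  intro U hU
  refine isQuotientMap_quotient_mk'.isOpen_preimage.1 ?_
  have h1 : (Quotient.mk (Φ.orbitSetoid E)) ⁻¹' ((fun y : closure E => Φ.orbit y.2) '' U)
      = ⋃ s, {y : closure E | (⟨Φ.flow s y, hE.flow_mem_closure y.2 s⟩ : closure E) ∈ U} := by
    ext y
    simp only [mem_preimage, mem_image, mem_iUnion, mem_ofPred_eq]
    constructor
    · rintro ⟨z, hz, hzy⟩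
      obtain ⟨s, hs⟩ := Quotient.exact (s := Φ.orbitSetoid E) hzy.symm
      refine ⟨s, ?_⟩
      convert! hz
    · rintro ⟨s, hs⟩
      exact ⟨_, hs, orbit_flow hE y.2 s⟩
  exact h1 ▸ isOpen_iUnion fun s => hU.preimage
    (((Φ.continuous_flow_right s).comp continuous_subtype_val).subtype_mk _)

theorem eventually_nhds_orbit (hE : Φ.IsExterior E) (hx : x ∈ closure E)
    {P : Φ.OrbitSpace E → Prop} :
    (∀ᶠ q in 𝓝 (Φ.orbit hx), P q) ↔ ∀ᶠ y in 𝓝 x, ∀ hy : y ∈ closure E, P (Φ.orbit hy) := by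
  have h1 : map (fun y : closure E => Φ.orbit y.2) (𝓝 ⟨x, hx⟩) = 𝓝 (Φ.orbit hx) :=
    le_antisymm continuous_orbit.continuousAt ((isOpenMap_orbit hE).nhds_le _)
  rw [← h1, eventually_map, nhds_subtype_eq_comap, eventually_comap]
  refine eventually_congr (Eventually.of_forall fun y => ?_)
  exact ⟨fun h hy => h ⟨y, hy⟩ rfl, fun h z hz => by subst hz; exact h z.2⟩

/-- Domains are compared by joining representatives of orbits within the space-time, where charts
are available. -/
theorem connectedComponentIn_orbit_eq {F : Set (Φ.OrbitSpace E)} {T : Set M}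
    (hT : IsPreconnected T) (hsub : T ⊆ closure E)
    (hF : ∀ y, ∀ hy : y ∈ closure E, y ∈ T → Φ.orbit hy ∈ F) {y : M} (hx : x ∈ T) (hy : y ∈ T) :
    connectedComponentIn F (Φ.orbit (hsub hx)) = connectedComponentIn F (Φ.orbit (hsub hy)) := by
  have h1 : IsPreconnected (Subtype.val ⁻¹' T : Set (closure E)) := by
    rw [← Topology.IsInducing.subtypeVal.isPreconnected_image, Subtype.image_preimage_coe,
      inter_eq_right.2 hsub]
    exact hT
  have h2 := h1.image _ (continuous_orbit (Φ := Φ)).continuousOn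
  refine connectedComponentIn_eq (h2.subset_connectedComponentIn (F := F)
    ⟨⟨x, hsub hx⟩, hx, rfl⟩ ?_ ⟨⟨y, hsub hy⟩, hy, rfl⟩)
  rintro _ ⟨z, hz, rfl⟩
  exact hF z z.2 hz

variable [T2Space M]

/-- A neighbourhood of a point of the space-time is star-shaped. -/
theorem IsExterior.eventually_exists_segment (hE : Φ.IsExterior E) (hproper : Φ.IsProper E)
    (hb : HasSmoothBoundary (D := D) E) (hx : x ∈ closure E) {P : M → Prop}
    (hP : ∀ᶠ y in 𝓝 x, P y) : ∀ᶠ y in 𝓝 x, y ∈ closure E → ∃ T ⊆ closure E,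
      IsPreconnected T ∧ x ∈ T ∧ y ∈ T ∧ (∀ a, Φ.killing a y = 0 → ∀ z ∈ T, Φ.killing a z = 0) ∧
      (y ∈ frontier E → T ⊆ frontier E) ∧ ∀ z ∈ T, P z := by
  obtain ⟨φ, ℓ, A, X, hL⟩ := hE.exists_isLinearModel hproper hb hx
  have hxs := hL.mem_source
  have h1 := (X.tendsto_symm hxs).eventually hP
  rw [hL.apply_eq_zero] at h1
  obtain ⟨δ, hδ, h2⟩ := Metric.eventually_nhds_iff_ball.1 h1
  obtain ⟨r, hr, htarget⟩ := hL.target_eq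
  have hball : ∀ᶠ y in 𝓝 x, X y ∈ Metric.ball 0 δ := by
    refine (X.continuousAt hxs).eventually (Metric.isOpen_ball.mem_nhds ?_)
    rw [hL.apply_eq_zero]
    exact Metric.mem_ball_self hδ
  filter_upwards [hball, X.open_source.mem_nhds hxs] with y hy hys hycl
  have hyt := X.map_source hys
  rw [htarget] at hyt
  have hmul : ∀ t ∈ Icc (0 : ℝ) 1, ∀ ρ, X y ∈ Metric.ball 0 ρ → t • X y ∈ Metric.ball 0 ρ := by
    intro t ht ρ hρ
    rw [mem_ball_zero_iff] at hρ ⊢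
    rw [norm_smul, Real.norm_of_nonneg ht.1]
    exact (mul_le_of_le_one_left (norm_nonneg _) ht.2).trans_lt hρ
  have hmem : ∀ t ∈ Icc (0 : ℝ) 1, t • X y ∈ X.target := fun t ht => by
    rw [htarget]; exact hmul t ht r hyt
  have hℓ : ∀ t : ℝ, ℓ (t • X y) = t * ℓ (X y) := fun t => by rw [map_smul, smul_eq_mul]
  -- The radial segment in the linear model: what annihilates `X y` annihilates its multiples, and
  -- these stay in the half space or hyperplane of `X y`.
  refine ⟨(fun t : ℝ => X.symm (t • X y)) '' Icc 0 1, ?_, ?_, ⟨0, by simp, ?_⟩, ⟨1, by simp, ?_⟩,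
    ?_, ?_, ?_⟩
  · rintro _ ⟨t, ht, rfl⟩
    rw [hL.mem_closure_iff _ (X.map_target (hmem t ht)), X.right_inv (hmem t ht), hℓ]
    exact mul_nonneg ht.1 ((hL.mem_closure_iff y hys).1 hycl)
  · exact isPreconnected_Icc.image _ (X.continuousOn_symm.comp (by fun_prop) hmem)
  · have := X.left_inv hxs
    rw [hL.apply_eq_zero] at this
    simpa using this
  · simpa using X.left_inv hys
  · rintro a ha _ ⟨t, ht, rfl⟩
    obtain ⟨h, hA⟩ := (hL.killing_iff y hys a).1 ha
    refine (hL.killing_iff _ (X.map_target (hmem t ht)) a).2 ⟨h, ?_⟩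
    rw [X.right_inv (hmem t ht), map_smul, hA, smul_zero]
  · rintro hyF _ ⟨t, ht, rfl⟩
    obtain ⟨h, hy0⟩ := (hL.mem_frontier_iff y hys).1 hyF
    refine (hL.mem_frontier_iff _ (X.map_target (hmem t ht))).2 ⟨h, ?_⟩
    rw [X.right_inv (hmem t ht), hℓ, hy0, mul_zero]
  · rintro _ ⟨t, ht, rfl⟩
    exact h2 _ (hmul t ht δ hy)

section

variable (hE : Φ.IsExterior E) (hproper : Φ.IsProper E)
  (hb : HasSmoothBoundary (D := D) E) (heff : Φ.IsEffective E)
include hE hproper hb heff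

/-- The principal orbits are dense in `E`. -/
theorem IsExterior.frequently_det_ne_zero (hx : x ∈ closure E) :
    ∃ᶠ y in 𝓝 x, y ∈ E ∧ (Φ.G y).det ≠ 0 := by
  have key : ∀ x ∈ E, ∃ᶠ y in 𝓝 x, y ∈ E ∧ (Φ.G y).det ≠ 0 := by
    intro x hxE
    obtain ⟨φ, ℓ, A, X, hL⟩ := hE.exists_isLinearModel hproper hb (subset_closure hxE)
    obtain ⟨u, hu⟩ := hL.isSkewFamily.exists_annihilator_eq_bot
      (hL.faithful hE hproper hb heff (subset_closure hxE))
    have hxs := hL.mem_source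
    have hc : Tendsto (fun t : ℝ => t • u) (𝓝[≠] 0) (𝓝 (X x)) := by
      rw [hL.apply_eq_zero]
      exact (Continuous.tendsto' (by fun_prop) 0 0 (zero_smul ℝ u)).mono_left nhdsWithin_le_nhds
    have hc2 : Tendsto (fun t : ℝ => X.symm (t • u)) (𝓝[≠] 0) (𝓝 x) := (X.tendsto_symm hxs).comp hc
    refine hc2.frequently (Eventually.frequently ?_)
    filter_upwards [hc.eventually (X.open_target.mem_nhds (X.map_source hxs)),
      hc2.eventually (hE.isOpen.mem_nhds hxE), self_mem_nhdsWithin] with t ht htE ht0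
    refine ⟨htE, fun hdet => ?_⟩
    obtain ⟨a, ha, hGa⟩ := (Φ.det_G_eq_zero_iff _).1 hdet
    refine ha ((Submodule.mem_bot ℝ).1 ?_)
    rw [← hL.isotropy_eq_bot (X.map_target ht) ?_]
    · exact mem_isotropy.2 (hE.killing_eq_zero_of_G htE hGa)
    · rw [X.right_inv ht, Submodule.eq_bot_iff]
      intro b hb'
      rw [mem_annihilator, map_smul, smul_eq_zero] at hb'
      have : b ∈ annihilator A u := mem_annihilator.2 (hb'.resolve_left ht0)
      rw [hu] at this
      exact (Submodule.mem_bot ℝ).1 this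
  intro h
  obtain ⟨y, hy, hyE⟩ := (mem_closure_iff_frequently.1 hx).and_eventually h.eventually_nhds |>.exists
  exact key y hy hyE

end

end IsometricAction

end DomainStructure

/-! ### Local finiteness of the domains, and the covering of `B` -/

namespace DomainStructure

theorem annihilator_smul {V J : Type*} [NormedAddCommGroup V] [InnerProductSpace ℝ V]
    [FiniteDimensional ℝ V] [AddCommGroup J] [Module ℝ J] (A : J →ₗ[ℝ] V →ₗ[ℝ] V) {c : ℝ}
    (hc : c ≠ 0) (v : V) : annihilator A (c • v) = annihilator A v := by
  ext a
  rw [mem_annihilator, mem_annihilator, map_smul, smul_eq_zero]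
  simp [hc]

namespace IsometricAction

variable {D m : ℕ} {M : Type*} [TopologicalSpace M]
  [ChartedSpace (EuclideanSpace ℝ (Fin D)) M] [IsManifold (𝓡 D) ∞ M]
  {g : LorentzMetric D M} {Φ : IsometricAction g m} {E : Set M} {x : M}

theorem finrank_ker_lt_two_of_subset_span {b : Fin (m + 1) → ℝ}
    (h : ∀ a, Φ.G x *ᵥ a = 0 → a ∈ (ℝ ∙ b : Submodule ℝ (Fin (m + 1) → ℝ))) :
    Module.finrank ℝ (LinearMap.ker (Φ.G x).mulVecLin) < 2 :=
  Nat.lt_succ_of_le ((Submodule.finrank_mono (t := ℝ ∙ b) fun a ha => h a ha).trans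
    ((finrank_span_le_card ({b} : Set (Fin (m + 1) → ℝ))).trans (by simp)))

theorem mem_span_of_finrank_lt_two {a b : Fin (m + 1) → ℝ}
    (hdim : Module.finrank ℝ (LinearMap.ker (Φ.G x).mulVecLin) < 2) (ha0 : a ≠ 0)
    (ha : Φ.G x *ᵥ a = 0) (hb : Φ.G x *ᵥ b = 0) :
    b ∈ (ℝ ∙ a : Submodule ℝ (Fin (m + 1) → ℝ)) := by
  have h1 : (ℝ ∙ a : Submodule ℝ (Fin (m + 1) → ℝ)) ≤ LinearMap.ker (Φ.G x).mulVecLin :=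
    (Submodule.span_singleton_le_iff_mem _ _).2 ha
  have h2 := Submodule.eq_of_le_of_finrank_le h1
    (by rw [finrank_span_singleton ha0]; omega)
  exact h2.ge hb

theorem IsExterior.isotropy_eq_span (hE : Φ.IsExterior E) (hx : x ∈ E) {a : Fin (m + 1) → ℝ}
    (hdim : Module.finrank ℝ (LinearMap.ker (Φ.G x).mulVecLin) < 2) (ha0 : a ≠ 0)
    (ha : Φ.G x *ᵥ a = 0) : Φ.isotropy x = ℝ ∙ a := by
  refine le_antisymm (fun b hb => ?_) ?_
  · exact mem_span_of_finrank_lt_two hdim ha0 ha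
      ((hE.G_mulVec_eq_zero_iff_killing hx).2 (mem_isotropy.1 hb))
  · rw [Submodule.span_singleton_le_iff_mem, mem_isotropy]
    exact hE.killing_eq_zero_of_G hx ha

theorem IsLinearModel.isotropy_eq_map {φ : OpenPartialHomeomorph M (EuclideanSpace ℝ (Fin D))}
    {ℓ : EuclideanSpace ℝ (Fin D) →L[ℝ] ℝ}
    {A : Φ.isotropy x →ₗ[ℝ] EuclideanSpace ℝ (Fin D) →ₗ[ℝ] EuclideanSpace ℝ (Fin D)}
    {X : OpenPartialHomeomorph M (EuclideanSpace ℝ (Fin D))} (hL : Φ.IsLinearModel E x φ ℓ A X)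
    {y : M} (hy : y ∈ X.source) :
    Φ.isotropy y = (annihilator A (X y)).map (Φ.isotropy x).subtype := by
  ext a
  rw [mem_isotropy, hL.killing_iff y hy a, Submodule.mem_map]
  constructor
  · rintro ⟨h, hA⟩
    exact ⟨⟨a, h⟩, mem_annihilator.2 hA, rfl⟩
  · rintro ⟨b, hb, rfl⟩
    exact ⟨b.2, mem_annihilator.1 hb⟩

section

variable [T2Space M] (hE : Φ.IsExterior E) (hproper : Φ.IsProper E)
  (hb : HasSmoothBoundary (D := D) E) (heff : Φ.IsEffective E)
  (hreg : Φ.RegularAtBoundary E) (hrot : Φ.RotationsNotTimelike E)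
include hE hproper hb heff hreg hrot

/-- The domains are locally finite. -/
theorem IsExterior.exists_finite_eventually_domain_mem (hx : x ∈ closure E) :
    ∃ 𝓕 : Set (Set (Φ.OrbitSpace E)), 𝓕.Finite ∧ ∀ᶠ y in 𝓝 x, ∀ hy : y ∈ closure E,
      Module.finrank ℝ (LinearMap.ker (Φ.G y).mulVecLin) < 2 → ∀ a : Fin (m + 1) → ℝ, a ≠ 0 →
        Φ.G y *ᵥ a = 0 → connectedComponentIn (Φ.kerSet E {a}) (Φ.orbit hy) ∈ 𝓕 := by
  obtain ⟨φ, ℓ, A, X, hL⟩ := hE.exists_isLinearModel hproper hb hx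
  obtain ⟨w, hw⟩ : ∃ w, x ∈ frontier E → Φ.IsGenerator E x w := by
    by_cases hxF : x ∈ frontier E
    · obtain ⟨w, hw⟩ := hE.exists_isGenerator hproper hb heff hreg hrot hxF
      exact ⟨w, fun _ => hw⟩
    · exact ⟨0, fun h => absurd h hxF⟩
  -- The candidates are components through the orbit of `x`: one for each of the finitely many
  -- isotropy algebras nearby, and one for the null generator if `x` is a boundary point. A segment
  -- from `y` to `x` shows that the domain given by `y` is among them.
  refine ⟨(fun S : Submodule ℝ (Φ.isotropy x) => connectedComponentIn
      (Φ.kerSet E (S.map (Φ.isotropy x).subtype : Submodule ℝ (Fin (m + 1) → ℝ)))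
      (Φ.orbit hx)) '' range (annihilator A) ∪
    {connectedComponentIn (Φ.kerSet E {w}) (Φ.orbit hx)},
    (hL.isSkewFamily.finite_range_annihilator.image _).union (finite_singleton _), ?_⟩
  have hP : ∀ᶠ y in 𝓝 x, y ∈ frontier E → x ∈ frontier E → Φ.G y *ᵥ w = 0 := by
    by_cases hxF : x ∈ frontier E
    · exact (hw hxF).eventually_mulVec_eq_zero.mono fun y h hy _ => h hy
    · exact Eventually.of_forall fun y _ h => absurd h hxF
  filter_upwards [hE.eventually_exists_segment hproper hb hx hP,
    X.open_source.mem_nhds hL.mem_source] with y hseg hys hy hdim a ha0 ha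
  obtain ⟨T, hTcl, hT, hxT, hyT, hTkill, hTF, hTP⟩ := hseg hy
  rcases hE.mem_or_mem_frontier hy with hyE | hyF
  · refine Or.inl ⟨_, ⟨X y, rfl⟩, ?_⟩
    have h1 : Φ.kerSet E {a} = Φ.kerSet E ((annihilator A (X y)).map (Φ.isotropy x).subtype :
        Submodule ℝ (Fin (m + 1) → ℝ)) := by
      rw [← kerSet_span, ← hE.isotropy_eq_span hyE hdim ha0 ha, hL.isotropy_eq_map hys]
    rw [h1]
    refine connectedComponentIn_orbit_eq hT hTcl (fun z hz hzT => ?_) hxT hyT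
    rw [← h1, kerSet_singleton]
    exact Φ.G_mulVec_eq_zero_of_killing (hTkill a (hE.killing_eq_zero_of_G hyE ha) z hzT)
  · refine Or.inr ?_
    have hTF := hTF hyF
    have hw := hw (hTF hxT)
    have hTw : ∀ z ∈ T, Φ.G z *ᵥ w = 0 := fun z hz => hTP z hz (hTF hz) (hTF hxT)
    have h1 := eq_smul_of_finrank_lt_two hdim (hTw y hyT) hw.apply_zero ha
    have h2 : a 0 ≠ 0 := fun h => ha0 (by rw [h1, h, zero_smul])
    rw [h1, kerSet_smul h2]
    exact (connectedComponentIn_orbit_eq hT hTcl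
      (fun z hz hzT => kerSet_singleton.2 (hTw z hzT)) hxT hyT).symm

/-- The domains cover the set `det G = 0`. -/
theorem IsExterior.exists_isDomain_mem (hx : x ∈ closure E) (hdet : (Φ.G x).det = 0) :
    ∃ S, Φ.IsDomain S ∧ Φ.orbit hx ∈ S := by
  -- It suffices to reach a point where the kernel is a line, through a connected set on which this
  -- line stays in the kernel.
  have finish : ∀ (T : Set M) (hTcl : T ⊆ closure E), IsPreconnected T → x ∈ T → ∀ y ∈ T,
      Module.finrank ℝ (LinearMap.ker (Φ.G y).mulVecLin) < 2 → ∀ a : Fin (m + 1) → ℝ, a ≠ 0 →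
      (∀ z ∈ T, Φ.G z *ᵥ a = 0) → ∃ S, Φ.IsDomain S ∧ Φ.orbit hx ∈ S := by
    intro T hTcl hT hxT y hyT hdim a ha0 ha
    refine ⟨_, isDomain_iff.2 ⟨y, hTcl hyT, hdim, a, ha0, ha y hyT, rfl⟩, ?_⟩
    rw [← connectedComponentIn_orbit_eq hT hTcl
      (fun z hz hzT => kerSet_singleton.2 (ha z hzT)) hxT hyT]
    exact mem_connectedComponentIn (kerSet_singleton.2 (ha x hxT))
  rcases hE.mem_or_mem_frontier hx with hxE | hxF
  · obtain ⟨φ, ℓ, A, X, hL⟩ := hE.exists_isLinearModel hproper hb hx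
    obtain ⟨a, ha0, ha⟩ := (Φ.det_G_eq_zero_iff x).1 hdet
    have : Nontrivial (Φ.isotropy x) :=
      ⟨⟨a, hE.killing_eq_zero_of_G hxE ha⟩, 0, fun h => ha0 (congrArg Subtype.val h)⟩
    -- In the direction of `v` the isotropy algebra shrinks to a line.
    obtain ⟨v, b, hb0, hv⟩ := hL.isSkewFamily.exists_annihilator_eq_span
      (hL.faithful hE hproper hb heff hx)
    have hxs := hL.mem_source
    have hc : Tendsto (fun t : ℝ => t • v) (𝓝[≠] 0) (𝓝 (X x)) := by
      rw [hL.apply_eq_zero]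
      exact (Continuous.tendsto' (by fun_prop) 0 0 (zero_smul ℝ v)).mono_left nhdsWithin_le_nhds
    have hc2 : Tendsto (fun t : ℝ => X.symm (t • v)) (𝓝[≠] 0) (𝓝 x) := (X.tendsto_symm hxs).comp hc
    obtain ⟨t, ht, htE, hseg, ht0⟩ := ((hc.eventually (X.open_target.mem_nhds
      (X.map_source hxs))).and ((hc2.eventually (hE.isOpen.mem_nhds hxE)).and
      ((hc2.eventually (hE.eventually_exists_segment hproper hb hx
        (P := fun _ => True) (Eventually.of_forall fun _ => trivial))).and
        self_mem_nhdsWithin))).exists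
    obtain ⟨T, hTcl, hT, hxT, hyT, hTkill, -⟩ := hseg (subset_closure htE)
    have hiso : Φ.isotropy (X.symm (t • v)) = ℝ ∙ (b : Fin (m + 1) → ℝ) := by
      rw [hL.isotropy_eq_map (X.map_target ht), X.right_inv ht, annihilator_smul A ht0, hv,
        Submodule.map_span, image_singleton]
      rfl
    refine finish T hTcl hT hxT _ hyT (finrank_ker_lt_two_of_subset_span (b := b) fun c hcG => ?_) b
      (fun h => hb0 (Subtype.ext h)) fun z hz => ?_
    · rw [← hiso]
      exact hE.killing_eq_zero_of_G htE hcG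
    · refine Φ.G_mulVec_eq_zero_of_killing (hTkill b ?_ z hz)
      rw [← mem_isotropy, hiso]
      exact Submodule.mem_span_singleton_self _
  · obtain ⟨w, hw⟩ := hE.exists_isGenerator hproper hb heff hreg hrot hxF
    obtain ⟨y, ⟨hyF, hy⟩, hseg⟩ := ((hE.frequently_isotropy_eq_bot hproper hb heff
      hxF).and_eventually (hE.eventually_exists_segment hproper hb hx
        hw.eventually_mulVec_eq_zero)).exists
    obtain ⟨T, hTcl, hT, hxT, hyT, -, hTF, hTP⟩ := hseg (frontier_subset_closure hyF)
    refine finish T hTcl hT hxT y hyT (hE.finrank_ker_lt_two hproper hb hyF hy) w ?_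
      fun z hz => hTP z hz (hTF hyF hz)
    rintro rfl
    simpa using hw.apply_zero

end

end IsometricAction

end DomainStructure

/-! ### The asymptotic region and the finiteness of the set of domains -/

namespace DomainStructure

variable {D m d k : ℕ} {M : Type*} [TopologicalSpace M]
  [ChartedSpace (EuclideanSpace ℝ (Fin D)) M] [IsManifold (𝓡 D) ∞ M]
  {g : LorentzMetric D M} {Φ : IsometricAction g m} {E : Set M}

namespace AsymptoticEnd

variable (h : AsymptoticEnd Φ E d k)

/-- No homomorphism property of `rot` is assumed; this case follows from `flow_zero` because a point
determines its coordinate `y`. -/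
theorem rot_zero {y : EuclideanSpace ℝ (Fin d)} (hy : h.R < ‖y‖) : h.rot 0 y = y := by
  have h1 := h.flow_eq 0 (0, y, 0) hy
  have h2 : h.R < ‖h.rot 0 y‖ := by rwa [LinearIsometryEquiv.norm_map]
  have h3 : (fun i : Fin m => (0 : Fin (m + 1) → ℝ) i.succ) = 0 := rfl
  rw [Φ.flow_zero, h3] at h1
  exact ((h.eq_iff (0, y, 0) (0 + (0 : Fin (m + 1) → ℝ) 0, h.rot 0 y, 0 + h.shift 0) hy h2).1
    h1).2.1.symm

theorem flow_time (t : ℝ) {z : KKCover d k} (hz : h.R < ‖z.2.1‖) :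
    Φ.flow (Pi.single 0 t) (h.Ψ z) = h.Ψ (z.1 + t, z.2) := by
  rw [h.flow_eq _ _ hz]
  have h1 : (fun i : Fin m => (Pi.single 0 t : Fin (m + 1) → ℝ) i.succ) = 0 := by
    funext i
    simp
  rw [h1, h.rot_zero hz, map_zero, add_zero]
  simp

theorem exists_angle_mem_Icc {z : KKCover d k} (hz : h.R < ‖z.2.1‖) :
    ∃ θ ∈ Icc (0 : Fin k → ℝ) (fun _ => 2 * Real.pi), h.Ψ z = h.Ψ (z.1, z.2.1, θ) := by
  have hpi := Real.pi_pos
  refine ⟨fun a => z.2.2 a - 2 * Real.pi * ⌊z.2.2 a / (2 * Real.pi)⌋,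
    ⟨fun a => ?_, fun a => ?_⟩, ?_⟩
  · have h1 := Int.floor_le (z.2.2 a / (2 * Real.pi))
    rw [le_div_iff₀ (by positivity)] at h1
    simp only [Pi.zero_apply]
    linarith
  · have h1 := Int.lt_floor_add_one (z.2.2 a / (2 * Real.pi))
    rw [div_lt_iff₀ (by positivity)] at h1
    simp only
    linarith
  · exact (h.eq_iff z (z.1, z.2.1, fun a => z.2.2 a - 2 * Real.pi * ⌊z.2.2 a / (2 * Real.pi)⌋)
      hz hz).2 ⟨rfl, rfl, fun a => ⟨_, sub_sub_cancel _ _⟩⟩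

theorem flow_eq_self_iff {z : KKCover d k} (hz : h.R < ‖z.2.1‖) (s : Fin (m + 1) → ℝ) :
    Φ.flow s (h.Ψ z) = h.Ψ z ↔ s 0 = 0 ∧ h.rot (fun i => s i.succ) z.2.1 = z.2.1 ∧
      ∀ a, ∃ n : ℤ, h.shift (fun i => s i.succ) a = 2 * Real.pi * n := by
  rw [h.flow_eq _ _ hz, h.eq_iff _ _ (by simpa using hz) hz]
  simp

theorem mem (z : KKCover d k) (hz : h.R < ‖z.2.1‖) : h.Ψ z ∈ E := h.subset ⟨z, hz, rfl⟩

theorem continuousOn_Ψ : ContinuousOn h.Ψ {z | h.R < ‖z.2.1‖} :=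
  h.isLocalDiffeo.contMDiffOn.continuousOn

variable [T2Space M]

/-- The isotropy algebras are constant along the rays of the asymptotic region. -/
theorem killing_smul_eq_zero_iff {z : KKCover d k} (hz : h.R < ‖z.2.1‖) {c : ℝ} (hc0 : c ≠ 0)
    (hc : h.R < ‖c • z.2.1‖) (a : Fin (m + 1) → ℝ) :
    Φ.killing a (h.Ψ (z.1, c • z.2.1, z.2.2)) = 0 ↔ Φ.killing a (h.Ψ z) = 0 := by
  rw [Φ.killing_eq_zero_iff_flow, Φ.killing_eq_zero_iff_flow]
  refine forall_congr' fun t => ?_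
  rw [h.flow_eq_self_iff hz, h.flow_eq_self_iff (z := (z.1, c • z.2.1, z.2.2)) hc]
  simp only [map_smul, smul_right_inj hc0]

end AsymptoticEnd

namespace IsometricAction

variable [T2Space M]

/-- All domains meet a compact part of the space-time. -/
theorem IsExterior.exists_isCompact (hE : Φ.IsExterior E) (h : AsymptoticEnd Φ E d k) :
    ∃ K ⊆ closure E, IsCompact K ∧ ∀ S, Φ.IsDomain S → ∃ x ∈ K, ∃ hx : x ∈ closure E,
      Module.finrank ℝ (LinearMap.ker (Φ.G x).mulVecLin) < 2 ∧
      ∃ a : Fin (m + 1) → ℝ, a ≠ 0 ∧ Φ.G x *ᵥ a = 0 ∧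
        S = connectedComponentIn (Φ.kerSet E {a}) (Φ.orbit hx) := by
  obtain ⟨K, hK, hcover⟩ := h.compact_rest
  obtain ⟨ρ, hρ⟩ : ∃ ρ, ρ = max h.R 0 + 1 := ⟨_, rfl⟩
  have hρR : h.R < ρ := by have := le_max_left h.R 0; linarith
  have hρ0 : 0 < ρ := by have := le_max_right h.R 0; linarith
  -- Every ray from the origin meets the sphere of radius `ρ > R`. The origin itself, which is in
  -- the coordinate domain only if `R < 0`, cannot be rescaled and is included separately.
  obtain ⟨C, hC⟩ : ∃ C : Set (EuclideanSpace ℝ (Fin d)),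
    C = Metric.sphere 0 ρ ∪ {0} ∩ {y | h.R < ‖y‖} := ⟨_, rfl⟩
  have hCc : IsCompact C := hC ▸ (isCompact_sphere _ _).union
    ((finite_singleton _).inter_of_left _).isCompact
  have hCR : ∀ y ∈ C, h.R < ‖y‖ := by
    rw [hC]
    rintro y (hy | hy)
    · rw [mem_sphere_zero_iff_norm] at hy; rwa [hy]
    · exact hy.2
  obtain ⟨L, hL⟩ : ∃ L : Set (KKCover d k),
    L = {0} ×ˢ C ×ˢ Icc (0 : Fin k → ℝ) (fun _ => 2 * Real.pi) := ⟨_, rfl⟩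
  have hLR : ∀ z ∈ L, h.R < ‖z.2.1‖ := by
    rw [hL]; exact fun z hz => hCR _ hz.2.1
  have hLc : IsCompact (h.Ψ '' L) :=
    (hL ▸ isCompact_singleton.prod (hCc.prod isCompact_Icc) : IsCompact L).image_of_continuousOn
      (h.continuousOn_Ψ.mono hLR)
  refine ⟨K ∩ closure E ∪ h.Ψ '' L, union_subset inter_subset_right ?_,
    (hK.inter_right isClosed_closure).union hLc, fun S hS => ?_⟩
  · rintro _ ⟨z, hz, rfl⟩
    exact subset_closure (h.mem z (hLR z hz))
  obtain ⟨x, hx, hdim, a, ha0, ha, rfl⟩ := isDomain_iff.1 hS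
  rcases hcover hx with ⟨z, hz, rfl⟩ | hxK
  · replace hz : h.R < ‖z.2.1‖ := hz
    -- move along the ray
    obtain ⟨c, hc0, hcC, hseg⟩ : ∃ c : ℝ, c ≠ 0 ∧ c • z.2.1 ∈ C ∧
        ∀ s ∈ uIcc 1 c, s ≠ 0 ∧ h.R < ‖s • z.2.1‖ := by
      by_cases hz0 : z.2.1 = 0
      · refine ⟨1, one_ne_zero, ?_, ?_⟩
        · rw [hC, one_smul]
          exact Or.inr ⟨hz0, hz⟩
        · rw [uIcc_self]
          rintro s rfl
          rw [one_smul]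
          exact ⟨one_ne_zero, hz⟩
      · have hn : 0 < ‖z.2.1‖ := norm_pos_iff.2 hz0
        have hnorm : ∀ s : ℝ, 0 < s → ‖s • z.2.1‖ = s * ‖z.2.1‖ := fun s hs => by
          rw [norm_smul, Real.norm_of_nonneg hs.le]
        have hc : 0 < ρ / ‖z.2.1‖ := by positivity
        refine ⟨ρ / ‖z.2.1‖, hc.ne', ?_, fun s hs => ?_⟩
        · rw [hC]
          left
          rw [mem_sphere_zero_iff_norm, hnorm _ hc, div_mul_cancel₀ _ hn.ne']
        · have hs0 : 0 < s := (lt_min one_pos hc).trans_le hs.1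
          refine ⟨hs0.ne', ?_⟩
          rw [hnorm _ hs0]
          rcases min_le_iff.1 hs.1 with h1 | h1
          · nlinarith
          · rw [div_le_iff₀ hn] at h1
            linarith
    obtain ⟨T, hT⟩ : ∃ T : Set M, T = (fun s : ℝ => h.Ψ (z.1, s • z.2.1, z.2.2)) '' uIcc 1 c :=
      ⟨_, rfl⟩
    have hTE : T ⊆ E := by
      rw [hT]
      rintro _ ⟨s, hs, rfl⟩
      exact h.mem _ (hseg s hs).2
    have hTp : IsPreconnected T := hT ▸ isPreconnected_uIcc.image _
      (h.continuousOn_Ψ.comp (by fun_prop) fun s hs => (hseg s hs).2)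
    -- Rotations are linear in `y`, so the isotropy algebra is the same along the segment; in `E` it
    -- is the kernel of `G`.
    have hTG : ∀ y ∈ T, ∀ b, Φ.G y *ᵥ b = 0 ↔ Φ.G (h.Ψ z) *ᵥ b = 0 := by
      intro y hy b
      rw [hE.G_mulVec_eq_zero_iff_killing (hTE hy), hE.G_mulVec_eq_zero_iff_killing (h.mem z hz)]
      rw [hT] at hy
      obtain ⟨s, hs, rfl⟩ := hy
      exact h.killing_smul_eq_zero_iff hz (hseg s hs).1 (hseg s hs).2 b
    obtain ⟨p, hp⟩ : ∃ p : KKCover d k, p = (z.1, c • z.2.1, z.2.2) := ⟨_, rfl⟩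
    have hpR : h.R < ‖p.2.1‖ := by rw [hp]; exact hCR _ hcC
    have hpT : h.Ψ p ∈ T := by rw [hT, hp]; exact ⟨c, right_mem_uIcc, rfl⟩
    have hzT : h.Ψ z ∈ T := by rw [hT]; exact ⟨1, left_mem_uIcc, by simp⟩
    have hcomp := connectedComponentIn_orbit_eq (Φ := Φ) (F := Φ.kerSet E {a}) hTp
      (hTE.trans subset_closure)
      (fun y hy hyT => kerSet_singleton.2 ((hTG y hyT a).2 ha)) hzT hpT
    -- move to the initial time and to the fundamental domain of the torus
    obtain ⟨θ, hθ, hpθ⟩ := h.exists_angle_mem_Icc hpR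
    have hflow : Φ.flow (Pi.single 0 (-p.1)) (h.Ψ p) = h.Ψ (0, p.2.1, θ) := by
      rw [hpθ]
      refine (h.flow_time (-p.1) (z := (p.1, p.2.1, θ)) hpR).trans ?_
      simp only [add_neg_cancel]
    have hp' : h.Ψ p ∈ closure E := subset_closure (h.mem p hpR)
    have hGp : Φ.G (h.Ψ (0, p.2.1, θ)) = Φ.G (h.Ψ p) := by rw [← hflow, Φ.G_flow]
    refine ⟨h.Ψ (0, p.2.1, θ), Or.inr ⟨_, ?_, rfl⟩, ?_, ?_, a, ha0, ?_, ?_⟩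
    · rw [hL, hp]
      exact ⟨rfl, hcC, hθ⟩
    · exact hflow ▸ hE.flow_mem_closure hp' _
    · have : LinearMap.ker (Φ.G (h.Ψ p)).mulVecLin = LinearMap.ker (Φ.G (h.Ψ z)).mulVecLin := by
        ext b
        exact hTG _ hpT b
      rwa [hGp, this]
    · rw [hGp]
      exact (hTG _ hpT a).2 ha
    · refine hcomp.trans (congrArg _ ?_)
      rw [← orbit_flow hE hp' (Pi.single 0 (-p.1))]
      congr 1
  · obtain ⟨s, y, hy, rfl⟩ := mem_iUnion.1 hxK
    have hycl := (hE.flow_mem_closure_iff s).1 hx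
    rw [Φ.G_flow] at hdim ha
    exact ⟨y, Or.inl ⟨hy, hycl⟩, hycl, hdim, a, ha0, ha, by rw [← orbit_flow hE hycl s]⟩

/-- There are only finitely many domains. -/
theorem IsExterior.finite_isDomain (hE : Φ.IsExterior E) (hproper : Φ.IsProper E)
    (hb : HasSmoothBoundary (D := D) E) (heff : Φ.IsEffective E)
    (hreg : Φ.RegularAtBoundary E) (hrot : Φ.RotationsNotTimelike E)
    (h : AsymptoticEnd Φ E d k) : {S : Set (Φ.OrbitSpace E) | Φ.IsDomain S}.Finite := by
  obtain ⟨K, hKE, hK, hcover⟩ := hE.exists_isCompact h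
  have h1 := fun x (hx : x ∈ K) =>
    hE.exists_finite_eventually_domain_mem hproper hb heff hreg hrot (hKE hx)
  choose! 𝓕 hfin hev using h1
  obtain ⟨t, htK, ht⟩ := hK.elim_nhds_subcover _ hev
  refine (t.finite_toSet.biUnion fun x hx => hfin x (htK x hx)).subset fun S hS => ?_
  obtain ⟨x, hxK, hx, hdim, a, ha0, ha, rfl⟩ := hcover S hS
  obtain ⟨y, hyt, hy⟩ := mem_iUnion₂.1 (ht hxK)
  exact mem_iUnion₂.2 ⟨y, hyt, hy hx hdim a ha0 ha⟩

end IsometricAction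

end DomainStructure

/-! ### The direction of a domain -/

namespace DomainStructure

namespace IsometricAction

variable {D m : ℕ} {M : Type*} [TopologicalSpace M]
  [ChartedSpace (EuclideanSpace ℝ (Fin D)) M] [IsManifold (𝓡 D) ∞ M]
  {g : LorentzMetric D M} {Φ : IsometricAction g m} {E : Set M} {x : M}

/-- A combination of the rotational Killing vector fields with relatively prime coefficients
generates an effective `U(1)` action. -/
theorem IsEffective.flow_smul_eq_iff (heff : Φ.IsEffective E) {W : Fin (m + 1) → ℝ}
    (hW : W 0 = 0) {n : Fin m → ℤ} (hn : Finset.univ.gcd n = 1) (hWn : ∀ i, W (Fin.succ i) = n i)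
    (s : ℝ) : (∀ x ∈ closure E, Φ.flow (s • W) x = x) ↔ ∃ j : ℤ, s = 2 * Real.pi * j := by
  constructor
  · intro h
    obtain ⟨-, h1⟩ := heff (s • W) fun x hx => h x (subset_closure hx)
    choose l hl using h1
    -- Bézout coefficients combine the conditions on all `s * n i` into one on `s`.
    obtain ⟨c, hc⟩ := Finset.gcd_eq_sum_mul Finset.univ n
    rw [hn] at hc
    refine ⟨∑ i, l i * c i, ?_⟩
    have hc' : (1 : ℝ) = ∑ i, (n i : ℝ) * c i := by exact_mod_cast hc
    calc s = s * ∑ i, (n i : ℝ) * c i := by rw [← hc', mul_one]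
      _ = ∑ i, (2 * Real.pi * l i) * c i := by
        rw [Finset.mul_sum]
        refine Finset.sum_congr rfl fun i _ => ?_
        rw [← hl i, Pi.smul_apply, smul_eq_mul, hWn, mul_assoc]
      _ = 2 * Real.pi * ((∑ i, l i * c i : ℤ) : ℝ) := by
        push_cast
        rw [Finset.mul_sum]
        exact Finset.sum_congr rfl fun i _ => mul_assoc _ _ _
  · rintro ⟨j, rfl⟩ x -
    refine Φ.flow_lattice (by simp [hW]) (fun i => ⟨j * n i, ?_⟩) x
    rw [Pi.smul_apply, smul_eq_mul, hWn]
    push_cast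
    ring

variable [T2Space M]

section

variable (hE : Φ.IsExterior E) (hproper : Φ.IsProper E)
  (hb : HasSmoothBoundary (D := D) E) (heff : Φ.IsEffective E)
include hE hproper hb heff

/-- Both conditions concern only points off `B`. These are dense, so neither is vacuous, and the two
cases of the theorem exclude each other. -/
theorem IsExterior.not_spacelikeNear_and_timelikeNear (q : Φ.OrbitSpace E)
    (a : Fin (m + 1) → ℝ) : ¬(Φ.SpacelikeNear a q ∧ Φ.TimelikeNear a q) := by
  rintro ⟨⟨O, hO, h1⟩, O', hO', h2⟩
  obtain ⟨x, hx, rfl⟩ := exists_orbit_eq q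
  obtain ⟨y, ⟨hyE, hdet⟩, hy⟩ := ((hE.frequently_det_ne_zero hproper hb heff hx).and_eventually
    ((eventually_nhds_orbit hE hx).1 (inter_mem hO hO'))).exists
  have hyO := hy (subset_closure hyE)
  have hyB : Φ.orbit (subset_closure hyE) ∉ Φ.B E := hdet
  exact lt_asymm (h1 _ ⟨hyO.1, hyB⟩) (h2 _ ⟨hyO.2, hyB⟩)

variable (hreg : Φ.RegularAtBoundary E) (hrot : Φ.RotationsNotTimelike E)
include hreg hrot

/-- At a boundary point off `Q_2` the kernel is spanned by a generator with time component one, so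
`W 0 = 0` places the point in `E`. There `W` vanishes, and near its zeros it is space-like or zero.
-/
theorem IsExterior.isSpacelikeDirection (S : Set (Φ.OrbitSpace E))
    {W : Fin (m + 1) → ℝ} (hW : W ≠ 0) (hW0 : W 0 = 0) (hS : ∀ q ∈ S, Φ.InKer W q) :
    Φ.IsSpacelikeDirection S W := by
  rintro q ⟨hqS, hq2⟩
  obtain ⟨x, hx, rfl⟩ := exists_orbit_eq q
  have hdim : Module.finrank ℝ (LinearMap.ker (Φ.G x).mulVecLin) < 2 := not_le.1 hq2
  have hGx : Φ.G x *ᵥ W = 0 := hS _ hqS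
  have hxE : x ∈ E := by
    refine (hE.mem_or_mem_frontier hx).resolve_right fun hxF => hW ?_
    obtain ⟨w, hw⟩ := hE.exists_isGenerator hproper hb heff hreg hrot hxF
    rw [eq_smul_of_finrank_lt_two hdim (hw.mulVec_eq_zero hxF) hw.apply_zero hGx, hW0, zero_smul]
  obtain ⟨φ, ℓ, A, X, hL⟩ := hE.exists_isLinearModel hproper hb hx
  have key : ∀ᶠ q' in 𝓝 (Φ.orbit hx), q' ∉ Φ.B E → 0 < W ⬝ᵥ (Φ.orbitG q' *ᵥ W) := by
    refine (eventually_nhds_orbit hE hx).2 ?_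
    filter_upwards [hL.eventually_pos] with y hy hycl hyB
    refine hy W (mem_isotropy.2 (hE.killing_eq_zero_of_G hxE hGx)) fun hk => hyB ?_
    exact kerSet_singleton_subset_B hW (kerSet_singleton.2 (Φ.G_mulVec_eq_zero_of_killing hk))
  exact ⟨_, key, fun q' hq' => hq'.1 hq'.2⟩

omit hreg hrot in
/-- The null generator of the boundary is constant along connected sets on which it belongs to
the kernel. -/
theorem IsGenerator.of_isPreconnected {S : Set (Φ.OrbitSpace E)} (hS : IsPreconnected S)
    {W : Fin (m + 1) → ℝ} (hgen : ∀ y, ∀ hy : y ∈ closure E, Φ.orbit hy ∈ S →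
      y ∈ frontier E ∧ ∃ w, Φ.IsGenerator E y w) {hx : x ∈ closure E} (hxS : Φ.orbit hx ∈ S)
    (hxW : Φ.IsGenerator E x W) {y : M} {hy : y ∈ closure E} (hyS : Φ.orbit hy ∈ S) :
    Φ.IsGenerator E y W := by
  let F : Set (Φ.OrbitSpace E) := {q | ∃ z, ∃ hz : z ∈ closure E, z ∈ frontier E ∧ Φ.orbit hz = q}
  have hF : ∀ z, ∀ hz : z ∈ closure E, Φ.orbit hz ∈ F ↔ z ∈ frontier E := by
    refine fun z hz => ⟨?_, fun h => ⟨z, hz, h, rfl⟩⟩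
    rintro ⟨z', hz', hF, h⟩
    obtain ⟨s, rfl⟩ := Quotient.exact (s := Φ.orbitSetoid E) h
    exact (hE.flow_mem_frontier_iff s).2 hF
  -- Membership of `W` in the kernel on a boundary neighbourhood determines the generator, because
  -- points with one-dimensional kernel are dense in the boundary. So `p` is locally constant along
  -- `S`.
  let p : Φ.OrbitSpace E → Prop := fun q => ∀ᶠ q' in 𝓝 q, q' ∈ F → Φ.InKer W q'
  have hp : ∀ z, ∀ hz : z ∈ closure E, z ∈ frontier E → ∀ w, Φ.IsGenerator E z w →
      (p (Φ.orbit hz) ↔ w = W) := by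
    intro z hz hzF w hw
    have h1 : p (Φ.orbit hz) ↔ ∀ᶠ y in 𝓝 z, y ∈ frontier E → Φ.G y *ᵥ W = 0 := by
      refine (eventually_nhds_orbit hE hz).trans (eventually_congr (Eventually.of_forall fun y => ?_))
      refine ⟨fun h hyF => ?_, fun h hy hyF => h ((hF y hy).1 hyF)⟩
      exact h (frontier_subset_closure hyF) ((hF y _).2 hyF)
    rw [h1]
    refine ⟨fun h => ?_, fun h => h ▸ hw.eventually_mulVec_eq_zero⟩
    obtain ⟨y, ⟨hyF, hy⟩, h2, h3⟩ := ((hE.frequently_isotropy_eq_bot hproper hb heff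
      hzF).and_eventually (h.and hw.eventually_mulVec_eq_zero)).exists
    have h4 := eq_smul_of_finrank_lt_two (hE.finrank_ker_lt_two hproper hb hyF hy) (h3 hyF)
      hw.apply_zero (h2 hyF)
    rw [h4, hxW.apply_zero, one_smul]
  have hloc : ∀ q ∈ S, ∀ᶠ q' in 𝓝[S] q, (p q' ↔ p q) := by
    intro q hq
    obtain ⟨z, hz, rfl⟩ := exists_orbit_eq q
    obtain ⟨hzF, w, hw⟩ := hgen z hz hq
    have h1 : ∀ᶠ q' in 𝓝 (Φ.orbit hz), q' ∈ F → (p q' ↔ p (Φ.orbit hz)) := by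
      refine (eventually_nhds_orbit hE hz).2 ?_
      filter_upwards [hw.eventually] with y hyw hy hyF
      rw [hp y hy ((hF y hy).1 hyF) w hyw, hp z hz hzF w hw]
    filter_upwards [h1.filter_mono nhdsWithin_le_nhds, self_mem_nhdsWithin] with q' h hq'
    obtain ⟨y, hy, rfl⟩ := exists_orbit_eq q'
    exact h ((hF y hy).2 (hgen y hy hq').1)
  have h1 := forall_of_eventually_iff hS hloc hxS hyS
    ((hp x hx (hgen x hx hxS).1 W hxW).2 rfl)
  obtain ⟨hyF, w, hw⟩ := hgen y hy hyS
  rwa [(hp y hy hyF w hw).1 h1] at hw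

omit heff hreg hrot in
/-- The set of orbits of the boundary with a common generator is a Killing horizon. -/
theorem IsExterior.isKillingHorizon {S : Set (Φ.OrbitSpace E)} {W : Fin (m + 1) → ℝ}
    (hgen : ∀ y, ∀ hy : y ∈ closure E, Φ.orbit hy ∈ S → y ∈ frontier E ∧ Φ.IsGenerator E y W)
    (hS : ∀ q ∈ S, S = connectedComponentIn (Φ.kerSet E {W}) q) :
    Φ.IsKillingHorizon (Φ.preimage S) W := by
  rintro x ⟨hx, hxS⟩
  obtain ⟨hxF, hw⟩ := hgen x hx hxS
  obtain ⟨φ, ℓ, hφ, hxφ, -⟩ := hb.exists_isFlatChart hE.isOpen hxF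
  -- Boundary points near `x` are joined to `x` within the boundary while `W` stays in the kernel,
  -- so they all belong to the domain of `x`.
  have hev : ∀ᶠ y in 𝓝 x, y ∈ frontier E → y ∈ Φ.preimage S := by
    filter_upwards [hE.eventually_exists_segment hproper hb hx hw.eventually_mulVec_eq_zero]
      with y hseg hyF
    obtain ⟨T, hTcl, hT, hxT, hyT, -, hTF, hTP⟩ := hseg (frontier_subset_closure hyF)
    refine ⟨frontier_subset_closure hyF, ?_⟩
    have hTW : ∀ z, ∀ hz : z ∈ closure E, z ∈ T → Φ.orbit hz ∈ Φ.kerSet E {W} :=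
      fun z hz hzT => kerSet_singleton.2 (hTP z hzT (hTF hyF hzT))
    rw [hS _ hxS]
    refine (connectedComponentIn_orbit_eq hT hTcl hTW hxT hyT).ge ?_
    exact mem_connectedComponentIn (hTW y _ hyT)
  obtain ⟨U, hU, hUo, hxU⟩ := eventually_nhds_iff.1 hev
  have hkx : Φ.killing W x ≠ 0 := fun h => by
    have := hproper.apply_zero_eq_zero hx h
    rw [hw.apply_zero] at this
    exact one_ne_zero this
  have hGx := hw.mulVec_eq_zero hxF
  have hzt := φ.map_source hxφ
  have hd : (fun z => ℓ (φ (φ.symm z))) =ᶠ[𝓝 (φ x)] ℓ := by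
    filter_upwards [φ.open_target.mem_nhds hzt] with z hz
    rw [φ.right_inv hz]
  have hderiv : ∀ v : TangentSpace (𝓡 D) x,
      (show ℝ from mfderiv (𝓡 D) 𝓘(ℝ, ℝ) (fun y => ℓ (φ y)) x v) = ℓ (coordDeriv φ x v) := by
    intro v
    rw [hφ.smoothChart.mfderiv_eq hxφ (u := fun y => ℓ (φ y))
      (ℓ.differentiableAt.congr_of_eventuallyEq hd) v, hd.fderiv_eq, ℓ.fderiv]
  refine ⟨U ∩ φ.source, hUo.inter φ.open_source, ⟨hxU, hxφ⟩, fun y => ℓ (φ y), ?_, ?_, ?_, hkx,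
    ?_, ?_⟩
  · exact ℓ.contMDiff.comp_contMDiffOn (hφ.smoothChart.smooth.mono inter_subset_right)
  · ext y
    constructor
    · rintro ⟨⟨hy, hyS⟩, hyU⟩
      exact ⟨hyU, (hφ.mem_frontier_iff hE.isOpen hyU.2).1 (hgen y hy hyS).1⟩
    · rintro ⟨hyU, hy0⟩
      exact ⟨hU y hyU.1 ((hφ.mem_frontier_iff hE.isOpen hyU.2).2 hy0), hyU⟩
  · intro h0
    refine hφ.ne_zero (ContinuousLinearMap.ext fun v => ?_)
    have h1 := hderiv (coordFrame φ (φ x) v)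
    have h2 := hφ.smoothChart.coordDeriv_coordFrame hzt v
    rw [φ.left_inv hxφ] at h2
    rw [h2] at h1
    rw [← h1, h0]
    rfl
  · rw [← Φ.dotProduct_G, hGx, dotProduct_zero]
  · intro v hv
    have h1 := hw.eventually_normal.self_of_nhds hxF φ ℓ hφ hxφ (coordDeriv φ x v)
      ((hderiv v).symm.trans hv)
    have h2 := Φ.coordFrame_coordKilling hφ.smoothChart hzt W
    have h3 := hφ.smoothChart.coordFrame_coordDeriv hxφ v
    rw [φ.left_inv hxφ] at h2
    have h4 : coordMetric g φ (φ x) (Φ.coordKilling φ (φ x) W) (coordDeriv φ x v) =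
        g.val (φ.symm (φ x)) (coordFrame φ (φ x) (Φ.coordKilling φ (φ x) W))
          (coordFrame φ (φ x) (coordDeriv φ x v)) := rfl
    rw [h4, h2, h3, φ.left_inv hxφ] at h1
    exact h1

omit heff in
theorem IsExterior.isTimelikeDirection {S : Set (Φ.OrbitSpace E)} {W : Fin (m + 1) → ℝ}
    (hgen : ∀ y, ∀ hy : y ∈ closure E, Φ.orbit hy ∈ S → y ∈ frontier E ∧ Φ.IsGenerator E y W) :
    Φ.IsTimelikeDirection S W := by
  rintro q ⟨hqS, hq2⟩
  obtain ⟨x, hx, rfl⟩ := exists_orbit_eq q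
  obtain ⟨hxF, hw⟩ := hgen x hx hqS
  have key : ∀ᶠ q' in 𝓝 (Φ.orbit hx), q' ∉ Φ.B E → W ⬝ᵥ (Φ.orbitG q' *ᵥ W) < 0 := by
    refine (eventually_nhds_orbit hE hx).2 ?_
    filter_upwards [hw.eventually_timelike hE hproper hb hreg hrot hxF (not_le.1 hq2)]
      with y hy hycl hyB
    exact hy ((hE.mem_or_mem_frontier hycl).resolve_right
      fun hyF => hyB (hE.det_G_eq_zero_of_mem_frontier hyF))
  exact ⟨_, key, fun q' hq' => hq'.1 hq'.2⟩

/-- The direction of a domain is a `U(1)` generator, or it generates a Killing horizon. -/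
theorem IsExterior.exists_direction {S : Set (Φ.OrbitSpace E)} (hS : Φ.IsDomain S) :
    ∃ W : Fin (m + 1) → ℝ, W ≠ 0 ∧ (∀ q ∈ S, Φ.InKer W q) ∧
      (Φ.IsSpacelikeDirection S W ∨ Φ.IsTimelikeDirection S W) ∧
      (Φ.IsSpacelikeDirection S W →
        W 0 = 0 ∧
        (∃ n : Fin m → ℤ, Finset.univ.gcd n = 1 ∧ ∀ i, W (Fin.succ i) = n i) ∧
        ∀ s : ℝ, (∀ x ∈ closure E, Φ.flow (s • W) x = x) ↔ ∃ j : ℤ, s = 2 * Real.pi * j) ∧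
      (Φ.IsTimelikeDirection S W →
        W 0 = 1 ∧ Φ.IsKillingHorizon (Φ.preimage S) W) := by
  obtain ⟨x, hx, hdim, a, ha0, ha, hSeq⟩ := isDomain_iff.1 hS
  obtain ⟨W, c, hc, hWa, hW⟩ : ∃ W : Fin (m + 1) → ℝ, ∃ c : ℝ, c ≠ 0 ∧ W = c • a ∧
      ((x ∈ E ∧ ∃ n : Fin m → ℤ, Finset.univ.gcd n = 1 ∧ W = Fin.cons 0 fun i => (n i : ℝ)) ∨
        x ∈ frontier E ∧ Φ.IsGenerator E x W) := by
    rcases hE.mem_or_mem_frontier hx with hxE | hxF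
    · obtain ⟨n, hn, c, hc, hnc⟩ := exists_primitive_of_isotropy_eq_span (Φ := Φ) (x := x)
        (fun s hs => hproper.apply_zero_eq_zero_of_flow hx (mem_stabilizer.1 hs)) ha0
        (hE.isotropy_eq_span hxE hdim ha0 ha)
      exact ⟨_, c, hc, hnc, Or.inl ⟨hxE, n, hn, rfl⟩⟩
    · obtain ⟨w, hw⟩ := hE.exists_isGenerator hproper hb heff hreg hrot hxF
      have h1 := eq_smul_of_finrank_lt_two hdim (hw.mulVec_eq_zero hxF) hw.apply_zero ha
      have h2 : a 0 ≠ 0 := fun h => ha0 (by rw [h1, h, zero_smul])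
      refine ⟨w, (a 0)⁻¹, inv_ne_zero h2, ?_, Or.inr ⟨hxF, hw⟩⟩
      rw [h1, Pi.smul_apply, smul_smul, hw.apply_zero, smul_eq_mul, mul_one, inv_mul_cancel₀ h2,
        one_smul]
  have hW0 : W ≠ 0 := hWa ▸ smul_ne_zero hc ha0
  rw [← kerSet_smul hc a, ← hWa] at hSeq
  have hxW : Φ.orbit hx ∈ Φ.kerSet E {W} :=
    kerSet_singleton.2 (by rw [inKer_orbit, hWa, Matrix.mulVec_smul, ha, smul_zero])
  have hxS : Φ.orbit hx ∈ S := hSeq ▸ mem_connectedComponentIn hxW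
  have hxS2 : Φ.orbit hx ∈ S \ Φ.Q E 2 := ⟨hxS, not_le.2 hdim⟩
  have hker : ∀ q ∈ S, Φ.InKer W q := fun q hq =>
    kerSet_singleton.1 (connectedComponentIn_subset _ _ (hSeq ▸ hq))
  have hnot := hE.not_spacelikeNear_and_timelikeNear hproper hb heff (Φ.orbit hx) W
  refine ⟨W, hW0, hker, ?_⟩
  rcases hW with ⟨hxE, n, hn, hWn⟩ | ⟨hxF, hw⟩
  · have h0 : W 0 = 0 := by rw [hWn]; rfl
    have hn' : ∀ i, W (Fin.succ i) = n i := fun i => by rw [hWn]; rfl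
    have hsp := hE.isSpacelikeDirection hproper hb heff hreg hrot S hW0 h0 hker
    exact ⟨Or.inl hsp, fun _ => ⟨h0, ⟨n, hn, hn'⟩, heff.flow_smul_eq_iff h0 hn hn'⟩,
      fun htl => absurd ⟨hsp _ hxS2, htl _ hxS2⟩ hnot⟩
  · have hSF : ∀ y, ∀ hy : y ∈ closure E, Φ.orbit hy ∈ S → y ∈ frontier E := by
      refine fun y hy hyS => (hE.mem_or_mem_frontier hy).resolve_left fun hyE => ?_
      have h1 := hproper.apply_zero_eq_zero hy (hE.killing_eq_zero_of_G hyE (hker _ hyS))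
      rw [hw.apply_zero] at h1
      exact one_ne_zero h1
    have hSc : IsPreconnected S := hSeq ▸ isPreconnected_connectedComponentIn
    have hgen : ∀ y, ∀ hy : y ∈ closure E, Φ.orbit hy ∈ S →
        y ∈ frontier E ∧ Φ.IsGenerator E y W := fun y hy hyS =>
      ⟨hSF y hy hyS, IsGenerator.of_isPreconnected hE hproper hb heff hSc (fun z hz hzS =>
        ⟨hSF z hz hzS, hE.exists_isGenerator hproper hb heff hreg hrot (hSF z hz hzS)⟩)
        hxS hw hyS⟩
    have htl := hE.isTimelikeDirection hproper hb hreg hrot hgen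
    refine ⟨Or.inr htl, fun hsp => absurd ⟨hsp _ hxS2, htl _ hxS2⟩ hnot, fun _ =>
      ⟨hw.apply_zero, hE.isKillingHorizon hproper hb hgen fun q hq => ?_⟩⟩
    rw [hSeq] at hq ⊢
    exact connectedComponentIn_eq hq

end

end IsometricAction

end DomainStructure

theorem theorem2 {D m d k : ℕ} {M : Type*} [TopologicalSpace M] [T2Space M]
    [SecondCountableTopology M] [ChartedSpace (EuclideanSpace ℝ (Fin D)) M]
    [IsManifold (𝓡 D) ∞ M]
    (g : DomainStructure.LorentzMetric D M) (Φ : DomainStructure.IsometricAction g m)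
    (E : Set M) (hE : Φ.IsExterior E)
    (hrot : Φ.RotationsNotTimelike E) (heff : Φ.IsEffective E) (hproper : Φ.IsProper E)
    (hboundary : DomainStructure.HasSmoothBoundary (D := D) E)
    (hregular : Φ.RegularAtBoundary E)
    (hasym : DomainStructure.AsymptoticEnd Φ E d k) :
    {S : Set (Φ.OrbitSpace E) | Φ.IsDomain S}.Finite ∧
    Φ.B E = ⋃₀ {S : Set (Φ.OrbitSpace E) | Φ.IsDomain S} ∧
    ∀ S : Set (Φ.OrbitSpace E), Φ.IsDomain S →
      ∃ W : Fin (m + 1) → ℝ, W ≠ 0 ∧ (∀ q ∈ S, Φ.InKer W q) ∧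
        (Φ.IsSpacelikeDirection S W ∨ Φ.IsTimelikeDirection S W) ∧
        (Φ.IsSpacelikeDirection S W →
          W 0 = 0 ∧
          (∃ n : Fin m → ℤ, Finset.univ.gcd n = 1 ∧ ∀ i, W (Fin.succ i) = n i) ∧
          ∀ s : ℝ, (∀ x ∈ closure E, Φ.flow (s • W) x = x) ↔ ∃ j : ℤ, s = 2 * Real.pi * j) ∧
        (Φ.IsTimelikeDirection S W →
          W 0 = 1 ∧ Φ.IsKillingHorizon (Φ.preimage S) W) := by
  refine ⟨hE.finite_isDomain hproper hboundary heff hregular hrot hasym, ?_,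
    fun S hS => hE.exists_direction hproper hboundary heff hregular hrot hS⟩
  ext q
  constructor
  · intro hq
    obtain ⟨x, hx, rfl⟩ := DomainStructure.IsometricAction.exists_orbit_eq q
    exact hE.exists_isDomain_mem hproper hboundary heff hregular hrot hx hq
  · rintro ⟨S, hS, hqS⟩
    obtain ⟨x, hx, -, a, ha0, ha, rfl⟩ := DomainStructure.IsometricAction.isDomain_iff.1 hS
    exact DomainStructure.IsometricAction.kerSet_singleton_subset_B ha0
      (connectedComponentIn_subset _ _ hqS)
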